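/- Let $p$ be a prime, $F$ a non-archimedean local field with residue characteristic $p$, ring of integers $\mathcal O_F$ and uniformizer $p_F$, and let $e\ge 1$. In $G={\rm GL}_2(F)$ write $(a,b)$ for the matrix $\begin{pmatrix}a&b\\0&1\end{pmatrix}$ and put $N=\{(1,b): b\in F\}$, $T=\{(a,0): a\in F^\times\}$, $T_\star=\{(a,0): 0\ne a\in\mathcal O_F\}$, $N_0^{(i)}=\{(1,b): b\in p_F^{i-1}\mathcal O_F\}$ for $i\ge 1$, and $t=(p_F,0)$. Let $X$ be the Bruhat–Tits tree of ${\rm PGL}_2(F)$ with vertex set $X^0=G/Z\,{\rm GL}_2(\mathcal O_F)$ ($Z$ the center of $G$), edge set $X^1$ and distance $d$; let $x_+$ be the vertex with stabilizer $Z\,{\rm GL}_2(\mathcal O_F)$, $x_-=t^{-1}x_+$, $\sigma=\{x_+,x_-\}\in X^1$. For $z\in X^0$ let $[\alpha_0,z]$ be the infinite path without backtracking which starts at $z$ and passes through almost all $t^{-m}x_+$ ($m\ge 0$), and put $Z_+^{(i)}(x)=\{z\in X^0: d(x,z)\le i,\ x\in[\alpha_0,z]\}$. For $\mu\in X^1$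 let $x_+^\mu$ be the vertex of $\mu$ such that the other vertex of $\mu$ lies on $[\alpha_0,x_+^\mu]$. Let $N_x^{(e)}$ be the group of all $g\in N$ fixing $Z_+^{(e-1)}(x)$ pointwise. Let $\widehat N_0^{(e)}$ be the group of all $g\in{\rm Aut}(X)$ such that for every $x\in X^0$ there is $g'\in N_0^{(e)}$ with $g=g'$ on $Z_+^{(e)}(x)$; let $\widehat N^{(e)}=\bigcup_m t^{-m}\widehat N_0^{(e)}t^m$, let $\widehat P^{(e)}=\widehat N^{(e)}\rtimes T\subset{\rm Aut}(X)$, let $\widehat P_\star^{(e)}$ be the monoid generated by $\widehat N_0^{(e)}$ and $T_\star$, and let $\widetilde P_\star^{(e)}\subset\widehat P^{(e)}$ be the monoid generated by $\widehat P_\star^{(e)}$ and $N_0^{(1)}$ (so $\widetilde P_\star^{(1)}=\widehat P_\star^{(1)}$). Let $X_+^0=\{(a,b)x_+: 0\ne a\in\mathcal O_F,\ b\in\mathcal O_F\}$, let $X_+$ and $X_-$ be the full closed subcomplexes of $X$ with vertex sets $X_+^0$ and $X^0\setminus X_+^0$, and let $\widehat N_{0,1}^{(e)}$ be the profinite group of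 permutations of $X_+^0$ induced by $\widehat N_0^{(e)}$. Let $\mathfrak o$ be the ring of integers of a finite extension $L$ of $\mathbb Q_p$, with uniformizer $p_L$ and residue field $k$, and let $\Lambda$ be an Artinian local quotient of $\mathfrak o$. A homological coefficient system $\mathcal F$ in $\Lambda$-modules on $X$ consists of $\Lambda$-modules $\mathcal F(x)$, $\mathcal F(\eta)$ for $x\in X^0$, $\eta\in X^1$ and $\Lambda$-linear transition maps $r^\eta_x:\mathcal F(\eta)\to\mathcal F(x)$ for $x\in\eta$; it is $NT$-equivariant if there are given $\Lambda$-linear maps $\mathcal F(\tau)\to\mathcal F(g\tau)$ for $g\in NT$, multiplicative in $g$ and compatible with the transition maps. For a full closed subcomplex $Y$, $H_0(Y,\mathcal F)$ is the cokernel of $\bigoplus_{\eta\subset Y}\mathcal F(\eta)\to\bigoplus_{x\in Y}\mathcal F(x)$, $f\mapsto\sum_{x\in\eta}r^\eta_x(f)$ for $f\in\mathcal F(\eta)$. Let $\mathcal F$ be an $NT$-equivariant homological coefficient system in $\Lambda$-modules on $X$ such that (Hyp 1) all transition maps are injective; (Hyp 2) for every $\mu\in X^1$, $\mathcal F(x_+^\mu)=\sum_{\eta}{\rm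 im}(r^\eta_{x_+^\mu})$, the sum over all $\eta\in X^1$ with $\mu\cap\eta=\{x_+^\mu\}$; (Hyp 3) for every $\mu\in X^1$, the image of $\mathcal F(\mu)\to\mathcal F(x_+^\mu)$ is $\mathcal F(x_+^\mu)^{N^{(e)}_{x_+^\mu}}$. The group $\widehat P^{(e)}$ acts on $\mathcal F$: an element $s\in\widehat N^{(e)}\tau$ with $\tau\in T$ acts on $\mathcal F(x)$ like any $g\in N\tau$ which coincides with $s$ on $Z_+^{(e)}(x)$. Put $$D(\mathcal F)={\rm Hom}_{\mathfrak o}(H_0(X_+,\mathcal F),L/\mathfrak o),\qquad D'(\mathcal F)={\rm Hom}_{\mathfrak o}(H_0(X_+,\mathcal F)/\mathcal F(\sigma),L/\mathfrak o),$$ where $\mathcal F(\sigma)$ is mapped to $H_0(X_+,\mathcal F)$ through $\mathcal F(x_+)$. Let $(\widetilde P_\star^{(e)})^{-1}$ act on $D(\mathcal F)$ dually to the action of $\widetilde P_\star^{(e)}$ on $H_0(X_+,\mathcal F)$, and let $\widetilde P_\star^{(e)}$ act on $D'(\mathcal F)$ dually to the action of $(\widetilde P_\star^{(e)})^{-1}$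 on $H_0(X,\mathcal F)/H_0(X_-,\mathcal F)\cong H_0(X_+,\mathcal F)/\mathcal F(\sigma)$. Write $\mathcal L(H)=\mathfrak o[[H]]$ for the completed group ring of a profinite group $H$, and let $\mathcal O_{\mathcal E}^{(e)}$ be the $p$-adic completion of the localization of $\mathcal L(N_0^{(e)})$ with respect to the complement of $p_L\mathcal L(N_0^{(e)})$ (i.e. all elements of this complement are inverted). **Theorem.** Suppose that the $k$-vector space of all $N_0^{(e)}$-invariant elements of $\mathcal F(x_+)$ killed by $p_L$ has finite dimension $n$. Then the $\widehat N_{0,1}^{(e)}$-actions on $D(\mathcal F)$ and $D'(\mathcal F)$ extend to $\mathfrak o$-linear $\mathcal L(\widehat N_{0,1}^{(e)})$-module structures, continuous for pointwise convergence, and with the above actions the map $\partial:D'(\mathcal F)\to D(\mathcal F)$ dual to the projection is an étale $((\widehat P_\star^{(e)})^{-1},\widehat P_\star^{(e)})$-pair over $\mathcal L(\widehat N_{0,1}^{(e)})$. That is: $\partial$ is injective, $\mathcal L(\widehat N_{0,1}^{(e)})$-linear and commutes with $N_0^{(1)}$; the monoid actions extend the actions of $\widehat N_0^{(e)}$ through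 $\widehat N_{0,1}^{(e)}$; and, with $\psi_{t^m}$ the action of $t^{-m}$ on $D(\mathcal F)$ and $\varphi_{t^m}$ the action of $t^m$ on $D'(\mathcal F)$, (a) $\psi_{t^m}\,\partial\,\varphi_{t^m}=\partial$ for all $m\ge 0$; (b) the cokernel of $\partial$ is finite, and $\partial$ induces an isomorphism $\mathcal O_{\mathcal E}^{(e)}\otimes_{\mathcal L(N_0^{(e)})}D'(\mathcal F)\cong\mathcal O_{\mathcal E}^{(e)}\otimes_{\mathcal L(N_0^{(e)})}D(\mathcal F)$; identify both with one module ${\bf D}$; (c) for every $m\ge 0$, conjugation by $t^m$ on $\mathcal L(N_0^{(e)})$ extends to a ring endomorphism $\varphi$ of $\mathcal O_{\mathcal E}^{(e)}$, there are additive endomorphisms $\varphi_{t^m}$, $\psi_{t^m}$ and $n$ (for $n\in N_0^{(1)}$) of ${\bf D}$ with $\varphi_{t^m}(a\otimes d')=\varphi(a)\otimes\varphi_{t^m}(d')$, $\psi_{t^m}(\varphi(a)\otimes d)=a\otimes\psi_{t^m}(d)$, $n(a\otimes d)=a\otimes nd$ for $a\in\mathcal O_{\mathcal E}^{(e)}$,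 $d'\in D'(\mathcal F)$, $d\in D(\mathcal F)$, and $$\sum_{n\in N_0^{(1)}/t^mN_0^{(1)}t^{-m}}n\,\varphi_{t^m}\,\psi_{t^m}\,n^{-1}={\rm id}_{\bf D}.$$ Moreover $D(\mathcal F)$ can be generated by $n$ elements as an $\mathcal L(\widehat N_{0,1}^{(e)})$-module. -/

import Mathlib

open scoped ValuativeRel Pointwise DirectSum TensorProduct

noncomputable section

/-! ### Iwasawa algebras -/

/-- The subalgebra of compatible families in `∏ U, o[H/U]`, with `U` running through the open
normal subgroups of `H`. -/
def iwasawaSubalgebra (o H : Type*) [CommRing o] [Group H] [TopologicalSpace H] :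
    Subalgebra o (∀ U : OpenNormalSubgroup H, MonoidAlgebra o (H ⧸ U.toSubgroup)) where
  carrier := {x | ∀ (U V : OpenNormalSubgroup H) (h : U.toSubgroup ≤ V.toSubgroup),
    MonoidAlgebra.mapDomainAlgHom o o
      (QuotientGroup.map U.toSubgroup V.toSubgroup (MonoidHom.id H) h) (x U) = x V}
  mul_mem' := fun hx hy U V h => by simp [map_mul, hx U V h, hy U V h]
  add_mem' := fun hx hy U V h => by simp [map_add, hx U V h, hy U V h]
  algebraMap_mem' := fun r U V h => by
    simp only [Pi.algebraMap_apply]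
    exact AlgHom.commutes _ r

/-- The completed group ring `o[[H]] = lim_U o[H/U]` of a (profinite) group `H`. -/
def IwasawaAlgebra (o H : Type*) [CommRing o] [Group H] [TopologicalSpace H] : Type _ :=
  ↥(iwasawaSubalgebra o H)

namespace IwasawaAlgebra

instance (o H : Type*) [CommRing o] [Group H] [TopologicalSpace H] : Ring (IwasawaAlgebra o H) :=
  inferInstanceAs (Ring ↥(iwasawaSubalgebra o H))

instance (o H : Type*) [CommRing o] [Group H] [TopologicalSpace H] :
    Algebra o (IwasawaAlgebra o H) :=
  inferInstanceAs (Algebra o ↥(iwasawaSubalgebra o H))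

variable (o : Type*) {H H' : Type*} [CommRing o] [Group H] [TopologicalSpace H]
  [Group H'] [TopologicalSpace H']

lemma mul_comm_of_comm (hH : ∀ a b : H, a * b = b * a) (x y : IwasawaAlgebra o H) :
    x * y = y * x := by
  refine Subtype.ext (funext fun U => ?_)
  change x.1 U * y.1 U = y.1 U * x.1 U
  let : CommGroup (H ⧸ U.toSubgroup) :=
    { (inferInstance : Group (H ⧸ U.toSubgroup)) with
      mul_comm := by
        rintro ⟨a⟩ ⟨b⟩
        exact congrArg (QuotientGroup.mk) (hH a b) }
  exact mul_comm (G := MonoidAlgebra o (H ⧸ U.toSubgroup)) _ _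

/-- The component of an element of `o[[H]]` in `o[H/U]`. -/
def proj {o : Type*} [CommRing o] (x : IwasawaAlgebra o H) (U : OpenNormalSubgroup H) :
    MonoidAlgebra o (H ⧸ U.toSubgroup) := x.1 U

/-- The image of a group element `h` in `o[[H]]`. -/
def dirac (h : H) : IwasawaAlgebra o H :=
  ⟨fun U => MonoidAlgebra.single (h : H ⧸ U.toSubgroup) 1, fun U V hUV => by
    rw [MonoidAlgebra.mapDomainAlgHom_apply, MonoidAlgebra.mapDomain_single]
    rfl⟩

/-- The preimage of an open normal subgroup under a continuous homomorphism. -/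
def comapOpenNormal (f : H →* H') (hf : Continuous f) (U : OpenNormalSubgroup H') :
    OpenNormalSubgroup H where
  toOpenSubgroup := U.toOpenSubgroup.comap f hf
  isNormal' := by
    change (U.toSubgroup.comap f).Normal
    infer_instance

/-- Functoriality of `o[[H]]` in continuous group homomorphisms. -/
def map (f : H →* H') (hf : Continuous f) : IwasawaAlgebra o H →ₐ[o] IwasawaAlgebra o H' :=
  show ↥(iwasawaSubalgebra o H) →ₐ[o] ↥(iwasawaSubalgebra o H') from AlgHom.codRestrict
    (AlgHom.pi fun U : OpenNormalSubgroup H' =>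
      (MonoidAlgebra.mapDomainAlgHom o o
        (QuotientGroup.map (comapOpenNormal f hf U).toSubgroup U.toSubgroup f le_rfl)).comp
      ((Pi.evalAlgHom o (fun U : OpenNormalSubgroup H => MonoidAlgebra o (H ⧸ U.toSubgroup))
        (comapOpenNormal f hf U)).comp (iwasawaSubalgebra o H).val))
    (iwasawaSubalgebra o H')
    (fun x U V h => by
      have hx := x.2 (comapOpenNormal f hf U) (comapOpenNormal f hf V)
        (Subgroup.comap_mono (f := f) h)
      change MonoidAlgebra.mapDomainAlgHom o o _ (MonoidAlgebra.mapDomainAlgHom o o _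
        (x.1 (comapOpenNormal f hf U))) =
          MonoidAlgebra.mapDomainAlgHom o o _ (x.1 (comapOpenNormal f hf V))
      rw [← hx, ← AlgHom.comp_apply, ← AlgHom.comp_apply, ← MonoidAlgebra.mapDomainAlgHom_comp,
        ← MonoidAlgebra.mapDomainAlgHom_comp]
      congr 2
      ext y
      rfl)

end IwasawaAlgebra

/-! ### Restriction and extension of scalars along a ring homomorphism into a (possibly
noncommutative) ring -/

section BaseChange

variable {R A : Type*} [CommRing R] [Ring A]

/-- An `A`-module `D`, regarded as an `R`-module through `ρ : R → A`. -/
def Restr (_ρ : R →+* A) (D : Type*) : Type _ := D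

instance (ρ : R →+* A) (D : Type*) [AddCommGroup D] : AddCommGroup (Restr ρ D) :=
  inferInstanceAs (AddCommGroup D)

instance (ρ : R →+* A) (D : Type*) [AddCommGroup D] [Module A D] : Module R (Restr ρ D) :=
  letI : Module A (Restr ρ D) := inferInstanceAs (Module A D)
  Module.compHom _ ρ

/-- An `A`-linear map, regarded as an `R`-linear map. -/
def Restr.map (ρ : R →+* A) {D' D : Type*} [AddCommGroup D'] [Module A D'] [AddCommGroup D]
    [Module A D] (f : D' →ₗ[A] D) : Restr ρ D' →ₗ[R] Restr ρ D where
  toFun d := f d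
  map_add' := f.map_add
  map_smul' r d := f.map_smul (ρ r) d

/-- `B ⊗_R D` for an `A`-module `D`, regarded as an `R`-module through `ρ : R → A`. -/
abbrev BaseChange (B : Type*) [CommRing B] [Algebra R B] (ρ : R →+* A) (D : Type*)
    [AddCommGroup D] [Module A D] : Type _ := B ⊗[R] Restr ρ D

/-- The pure tensor `b ⊗ d`. -/
def BaseChange.tmul {B : Type*} [CommRing B] [Algebra R B] (ρ : R →+* A) {D : Type*}
    [AddCommGroup D] [Module A D] (b : B) (d : D) : BaseChange B ρ D :=
  TensorProduct.tmul R b (show Restr ρ D from d)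

/-- `id ⊗ f : B ⊗_R D' → B ⊗_R D`. -/
def BaseChange.map (B : Type*) [CommRing B] [Algebra R B] (ρ : R →+* A) {D' D : Type*}
    [AddCommGroup D'] [Module A D'] [AddCommGroup D] [Module A D] (f : D' →ₗ[A] D) :
    BaseChange B ρ D' →ₗ[B] BaseChange B ρ D :=
  (Restr.map ρ f).baseChange B

end BaseChange

section ComplLocalization

variable (R : Type*) [CommRing R] (p : ℕ) (a : R)

/-- The multiplicative closure of the complement of the ideal `aR` (equal to this complement if `aR`
is a prime ideal). -/
def complSubmonoid : Submonoid R := Submonoid.closure {x | x ∉ Ideal.span {a}}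

/-- The `p`-adic completion of the localization of `R` with respect to the complement of `aR`. -/
def ComplLocalization : Type _ :=
  AdicCompletion (Ideal.span {(p : Localization (complSubmonoid R a))})
    (Localization (complSubmonoid R a))

instance : CommRing (ComplLocalization R p a) :=
  inferInstanceAs (CommRing (AdicCompletion (Ideal.span {(p : Localization (complSubmonoid R a))})
    (Localization (complSubmonoid R a))))

instance : Algebra R (ComplLocalization R p a) :=
  inferInstanceAs (Algebra R
    (AdicCompletion (Ideal.span {(p : Localization (complSubmonoid R a))})
      (Localization (complSubmonoid R a))))

end ComplLocalization

/-! ### Coefficient systems -/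

/-- A homological coefficient system in `Λ`-modules on a graph `X`: a module for each vertex and
each edge, and a map `F(η) → F(x)` whenever the vertex `x` belongs to the edge `η`. -/
structure CoeffSystem.{w, u, v} (Λ : Type u) [CommRing Λ] {V : Type v} (X : SimpleGraph V) where
  onVert : V → Type w
  onEdge : X.edgeSet → Type w
  [acgVert : ∀ x, AddCommGroup (onVert x)]
  [modVert : ∀ x, Module Λ (onVert x)]
  [acgEdge : ∀ η, AddCommGroup (onEdge η)]
  [modEdge : ∀ η, Module Λ (onEdge η)]
  res : ∀ (x : V) (η : X.edgeSet), x ∈ (η : Sym2 V) → (onEdge η →ₗ[Λ] onVert x)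

attribute [instance] CoeffSystem.acgVert CoeffSystem.modVert CoeffSystem.acgEdge
  CoeffSystem.modEdge

/-- An `H`-equivariant coefficient system. The map `g_τ : F(τ) → F(gτ)` is written as a map
`F(τ) → F(τ')` for each `τ'` that is equal to `gτ`. -/
structure EquivariantCoeffSystem.{w, u, v, z} (Λ : Type u) [CommRing Λ] (H : Type z) [Monoid H]
    {V : Type v} [MulAction H V] (X : SimpleGraph V) extends CoeffSystem.{w} Λ X where
  actVert : ∀ (g : H) (x y : V), g • x = y → (onVert x →ₗ[Λ] onVert y)
  actEdge : ∀ (g : H) (η θ : X.edgeSet), Sym2.map (fun x => g • x) (η : Sym2 V) = θ →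
    (onEdge η →ₗ[Λ] onEdge θ)
  actVert_one : ∀ (x : V) (h : (1 : H) • x = x) (v : onVert x), actVert 1 x x h v = v
  actEdge_one : ∀ (η : X.edgeSet) (h : Sym2.map (fun x => (1 : H) • x) (η : Sym2 V) = η)
    (v : onEdge η), actEdge 1 η η h v = v
  actVert_mul : ∀ (g h : H) (x y z : V) (hxy : h • x = y) (hyz : g • y = z)
    (hxz : (g * h) • x = z) (v : onVert x),
    actVert g y z hyz (actVert h x y hxy v) = actVert (g * h) x z hxz v
  actEdge_mul : ∀ (g h : H) (η θ ζ : X.edgeSet)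
    (h₁ : Sym2.map (fun x => h • x) (η : Sym2 V) = θ)
    (h₂ : Sym2.map (fun x => g • x) (θ : Sym2 V) = ζ)
    (h₃ : Sym2.map (fun x => (g * h) • x) (η : Sym2 V) = ζ) (v : onEdge η),
    actEdge g θ ζ h₂ (actEdge h η θ h₁ v) = actEdge (g * h) η ζ h₃ v
  res_act : ∀ (g : H) (x y : V) (η θ : X.edgeSet) (hxy : g • x = y)
    (hηθ : Sym2.map (fun x => g • x) (η : Sym2 V) = θ) (hx : x ∈ (η : Sym2 V))
    (hy : y ∈ (θ : Sym2 V)) (v : onEdge η),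
    res y θ hy (actEdge g η θ hηθ v) = actVert g x y hxy (res x η hx v)

namespace CoeffSystem

variable {Λ : Type*} [CommRing Λ] {V : Type*} {X : SimpleGraph V} (𝓕 : CoeffSystem Λ X)

/-- The `0`-chains on the full closed subcomplex with vertex set `S`. -/
abbrev Chains (S : Set V) : Type _ := ⨁ x : S, 𝓕.onVert x

open Classical in
/-- The boundaries of the `1`-chains on the full closed subcomplex with vertex set `S`. -/
def boundaries (S : Set V) : Submodule Λ (𝓕.Chains S) :=
  Submodule.span Λ {c | ∃ (x y : S) (h : X.Adj x y) (v : 𝓕.onEdge ⟨s(x, y), h⟩),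
    c = DirectSum.lof Λ S (fun x => 𝓕.onVert x) x (𝓕.res x ⟨s(x, y), h⟩ (Sym2.mem_mk_left _ _) v)
      + DirectSum.lof Λ S (fun x => 𝓕.onVert x) y
          (𝓕.res y ⟨s(x, y), h⟩ (Sym2.mem_mk_right _ _) v)}

/-- `H₀(Y, F)` for the full closed subcomplex `Y` of `X` with vertex set `S`. -/
abbrev H0 (S : Set V) : Type _ := 𝓕.Chains S ⧸ 𝓕.boundaries S

open Classical in
/-- The map `F(x) → H₀(Y, F)` for a vertex `x` of `Y`; it is extended by zero to all vertices
of `X`. -/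
def cls (S : Set V) (x : V) : 𝓕.onVert x →ₗ[Λ] 𝓕.H0 S :=
  if h : x ∈ S then
    (𝓕.boundaries S).mkQ ∘ₗ DirectSum.lof Λ S (fun x => 𝓕.onVert x) ⟨x, h⟩
  else 0

end CoeffSystem

/-- The Pontryagin dual `Hom_o(M, L/o)` of a discrete (torsion) `o`-module `M`; here `M` is a
module over an `o`-algebra `Λ`, and every homomorphism from a discrete module is continuous. -/
abbrev PDual (o L Λ M : Type*) [CommRing o] [Field L] [Algebra o L] [CommRing Λ] [Algebra o Λ]
    [AddCommGroup M] [Module Λ M] : Type _ :=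
  RestrictScalars o Λ M →ₗ[o] (L ⧸ LinearMap.range (Algebra.linearMap o L))

/-- The value of `f` at `m`. -/
def PDual.eval {o L Λ M : Type*} [CommRing o] [Field L] [Algebra o L] [CommRing Λ] [Algebra o Λ]
    [AddCommGroup M] [Module Λ M] (f : PDual o L Λ M) (m : M) :
    L ⧸ LinearMap.range (Algebra.linearMap o L) :=
  f ((RestrictScalars.addEquiv o Λ M).symm m)

/-! ### The Bruhat-Tits tree of `PGL₂(F)` -/

namespace BTree

section Group

variable (F : Type*) [Field F] [ValuativeRel F]

/-- The uniformizers of `F`, as elements of `Fˣ`. -/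
def Uniformizer : Type _ := {π : Fˣ // ∃ ϖ : 𝒪[F], Irreducible ϖ ∧ (ϖ : F) = π}

/-- The subgroup `GL₂(𝒪_F)` of `GL₂(F)`. -/
def maxCompact : Subgroup (GL (Fin 2) F) :=
  (Matrix.GeneralLinearGroup.map (n := Fin 2) (algebraMap 𝒪[F] F)).range

/-- `Z · GL₂(𝒪_F)`, with `Z` the center of `GL₂(F)`. -/
def ZK : Subgroup (GL (Fin 2) F) := Subgroup.center (GL (Fin 2) F) ⊔ maxCompact F

/-- The vertices of the tree: `X⁰ = GL₂(F) / Z GL₂(𝒪_F)`, i.e. the homothety classes of lattices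
in `F²`. -/
abbrev Vert : Type _ := GL (Fin 2) F ⧸ ZK F

/-- The vertex `x₊`, with stabilizer `Z GL₂(𝒪_F)`. -/
def xPlus : Vert F := QuotientGroup.mk 1

end Group

section Affine

variable {F : Type*} [Field F]

/-- The matrix `(a b; 0 1)`. -/
def aff (a : Fˣ) (b : F) : GL (Fin 2) F :=
  Matrix.GeneralLinearGroup.mkOfDetNeZero !![(a : F), b; 0, 1] (by simp)

lemma aff_mul (a a' : Fˣ) (b b' : F) : aff a b * aff a' b' = aff (a * a') (a * b' + b) := by
  ext i j
  fin_cases i <;> fin_cases j <;>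
    simp [aff, Matrix.GeneralLinearGroup.mkOfDetNeZero, Matrix.mul_apply, Fin.sum_univ_two]

lemma aff_one : aff (1 : Fˣ) (0 : F) = 1 := by
  ext i j
  fin_cases i <;> fin_cases j <;> simp [aff, Matrix.GeneralLinearGroup.mkOfDetNeZero]

lemma aff_inv (a : Fˣ) (b : F) : (aff a b)⁻¹ = aff a⁻¹ (-((a⁻¹ : Fˣ) : F) * b) := by
  rw [inv_eq_iff_mul_eq_one, aff_mul, ← aff_one]
  congr 1
  · simp
  · simp

lemma aff_pow (a : Fˣ) (m : ℕ) : aff a 0 ^ m = aff (a ^ m) 0 := by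
  induction m with
  | zero => simp [aff_one]
  | succ k ih => rw [pow_succ, ih, aff_mul, pow_succ]; simp

variable (F)

/-- The group `NT` of all `(a b; 0 1)`. -/
def NT : Subgroup (GL (Fin 2) F) where
  carrier := {g | ∃ (a : Fˣ) (b : F), g = aff a b}
  mul_mem' := by
    rintro _ _ ⟨a, b, rfl⟩ ⟨a', b', rfl⟩
    exact ⟨_, _, aff_mul _ _ _ _⟩
  one_mem' := ⟨1, 0, aff_one.symm⟩
  inv_mem' := by
    rintro _ ⟨a, b, rfl⟩
    exact ⟨_, _, aff_inv _ _⟩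

/-- The group `N` of all `(1 b; 0 1)`. -/
def N : Subgroup (GL (Fin 2) F) where
  carrier := {g | ∃ b : F, g = aff 1 b}
  mul_mem' := by
    rintro _ _ ⟨b, rfl⟩ ⟨b', rfl⟩
    exact ⟨_, by rw [aff_mul, one_mul]⟩
  one_mem' := ⟨0, aff_one.symm⟩
  inv_mem' := by
    rintro _ ⟨b, rfl⟩
    exact ⟨_, by rw [aff_inv, inv_one]⟩

/-- The group `T` of all `(a 0; 0 1)`. -/
def T : Subgroup (GL (Fin 2) F) where
  carrier := {g | ∃ a : Fˣ, g = aff a 0}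
  mul_mem' := by
    rintro _ _ ⟨a, rfl⟩ ⟨a', rfl⟩
    exact ⟨a * a', by rw [aff_mul]; simp⟩
  one_mem' := ⟨1, aff_one.symm⟩
  inv_mem' := by
    rintro _ ⟨a, rfl⟩
    exact ⟨a⁻¹, by rw [aff_inv]; simp⟩

end Affine

section Group

variable (F : Type*) [Field F] [ValuativeRel F]

/-- The monoid `T_⋆` of all `(a 0; 0 1)` with `0 ≠ a ∈ 𝒪_F`. -/
def Tstar : Submonoid (GL (Fin 2) F) where
  carrier := {g | ∃ a : Fˣ, (a : F) ∈ 𝒪[F] ∧ g = aff a 0}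
  mul_mem' := by
    rintro _ _ ⟨a, ha, rfl⟩ ⟨a', ha', rfl⟩
    exact ⟨a * a', by simpa using mul_mem ha ha', by rw [aff_mul]; simp⟩
  one_mem' := ⟨1, by simp, aff_one.symm⟩

variable {F} (π : Uniformizer F)

lemma Uniformizer.mem : ((π.1 : Fˣ) : F) ∈ 𝒪[F] := by
  obtain ⟨ϖ, -, h⟩ := π.2
  rw [← h]
  exact ϖ.2

/-- The group `N₀^(e)` of all `(1 b; 0 1)` with `b ∈ p_F^(e-1) 𝒪_F`. -/
def N0 (e : ℕ) : Subgroup (GL (Fin 2) F) where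
  carrier := {g | ∃ c ∈ 𝒪[F], g = aff 1 ((π.1 : F) ^ (e - 1) * c)}
  mul_mem' := by
    rintro _ _ ⟨b, hb, rfl⟩ ⟨b', hb', rfl⟩
    exact ⟨b' + b, add_mem hb' hb, by rw [aff_mul, one_mul, mul_add]; simp⟩
  one_mem' := ⟨0, zero_mem _, by simp [aff_one]⟩
  inv_mem' := by
    rintro _ ⟨b, hb, rfl⟩
    exact ⟨-b, neg_mem hb, by rw [aff_inv, inv_one]; simp⟩

lemma N0_comm (e : ℕ) (m n : N0 π e) : m * n = n * m := by
  obtain ⟨_, b, hb, rfl⟩ := m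
  obtain ⟨_, b', hb', rfl⟩ := n
  refine Subtype.ext ?_
  change aff _ _ * aff _ _ = aff _ _ * aff _ _
  rw [aff_mul, aff_mul]
  simp [add_comm]

lemma N0_le_NT (e : ℕ) : N0 π e ≤ NT F := by
  rintro _ ⟨c, -, rfl⟩
  exact ⟨_, _, rfl⟩

/-- The element `t = (p_F 0; 0 1)`. -/
def t : GL (Fin 2) F := aff π.1 0

lemma t_mem_Tstar : t π ∈ Tstar F := ⟨_, π.mem, rfl⟩

/-- The vertex `x₋ = t⁻¹ x₊`. -/
def xMinus : Vert F := (t π)⁻¹ • xPlus F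

end Group

section Tree

variable {F : Type*} [Field F] [ValuativeRel F] (π : Uniformizer F)

/-- The Bruhat-Tits tree `X`: its edges are the `GL₂(F)`-translates of `{x₊, x₋}`. -/
def tree : SimpleGraph (Vert F) :=
  SimpleGraph.fromRel fun x y => ∃ g : GL (Fin 2) F, x = g • xPlus F ∧ y = g • xMinus π

lemma xPlus_ne_xMinus : xPlus F ≠ xMinus π := by
  intro h
  have h1 : (t π)⁻¹ ∈ ZK F := by
    have := QuotientGroup.eq.mp (show (QuotientGroup.mk 1 : Vert F) =
      QuotientGroup.mk ((t π)⁻¹ * 1) from h)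
    simpa using this
  rw [ZK, Subgroup.mem_sup_of_normal_left] at h1
  obtain ⟨z, hz, k, ⟨u, rfl⟩, hzk⟩ := h1
  rw [Matrix.GeneralLinearGroup.center_eq_range_scalar] at hz
  obtain ⟨c, rfl⟩ := hz
  obtain ⟨ϖ, hϖ, hπ⟩ := π.2
  -- compare determinants
  have hdet := congrArg (fun g : GL (Fin 2) F => (Matrix.GeneralLinearGroup.det g : F)) hzk
  have hu : ((Matrix.GeneralLinearGroup.det
      (Matrix.GeneralLinearGroup.map (n := Fin 2) (algebraMap 𝒪[F] F) u) : Fˣ) : F) =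
      ((Matrix.GeneralLinearGroup.det u : 𝒪[F]ˣ) : 𝒪[F]) := by
    have := Matrix.GeneralLinearGroup.map_det (algebraMap 𝒪[F] F) u
    rw [this]
    rfl
  simp only [map_mul, Units.val_mul, hu, t, aff_inv] at hdet
  set w : 𝒪[F]ˣ := Matrix.GeneralLinearGroup.det u
  have hsc : ((Matrix.GeneralLinearGroup.det (Matrix.GeneralLinearGroup.scalar (Fin 2) c) : Fˣ) : F)
      = (c : F) ^ 2 := by
    simp [Matrix.GeneralLinearGroup.scalar]
  have haf : ((Matrix.GeneralLinearGroup.det (aff π.1⁻¹ (-((π.1⁻¹ : Fˣ) : F) * 0)) : Fˣ) : F)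
      = (ϖ : F)⁻¹ := by
    simp [aff, Matrix.GeneralLinearGroup.mkOfDetNeZero, hπ]
  rw [hsc, haf] at hdet
  have hϖ0 : (ϖ : F) ≠ 0 := by rw [hπ]; exact π.1.ne_zero
  have hc0 : (c : F) ≠ 0 := c.ne_zero
  have key : (c : F) ^ 2 * (w : 𝒪[F]) * ϖ = 1 := by rw [hdet]; exact inv_mul_cancel₀ hϖ0
  rcases le_total (ValuativeRel.valuation F (c : F)) 1 with hc | hc
  · apply hϖ.not_isUnit
    refine IsUnit.of_mul_eq_one ((⟨(c : F), hc⟩ : 𝒪[F]) ^ 2 * w) (Subtype.ext ?_)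
    push_cast
    rw [mul_comm]
    exact key
  · have hc' : ValuativeRel.valuation F ((c : F)⁻¹) ≤ 1 := by
      rw [map_inv₀]
      exact inv_le_one_of_one_le₀ hc
    set d : 𝒪[F] := ⟨(c : F)⁻¹, hc'⟩ with hd
    have hdd : ϖ * w = d * d := by
      apply Subtype.ext
      push_cast
      have : (d : F) = (c : F)⁻¹ := rfl
      rw [this]
      field_simp
      linear_combination key
    have hirr : Irreducible (d * d) := by
      rw [← hdd]
      exact (irreducible_mul_units w).mpr hϖ
    rcases hirr.isUnit_or_isUnit rfl with h | h <;> exact hirr.not_isUnit (h.mul h)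

lemma adj_xPlus_xMinus : (tree π).Adj (xPlus F) (xMinus π) :=
  ⟨xPlus_ne_xMinus π, Or.inl ⟨1, by simp, by simp⟩⟩

/-- The edge `σ = {x₊, x₋}`. -/
def sigma : (tree π).edgeSet := ⟨s(xPlus F, xMinus π), adj_xPlus_xMinus π⟩

lemma adj_smul (g : GL (Fin 2) F) (x y : Vert F) :
    (tree π).Adj (g • x) (g • y) ↔ (tree π).Adj x y := by
  have key : ∀ (g : GL (Fin 2) F) (x y : Vert F), (tree π).Adj x y →
      (tree π).Adj (g • x) (g • y) := by
    rintro g x y ⟨hne, h⟩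
    refine ⟨fun h' => hne (smul_left_cancel g h'), ?_⟩
    rcases h with ⟨k, hx, hy⟩ | ⟨k, hx, hy⟩
    · exact Or.inl ⟨g * k, by rw [hx, mul_smul], by rw [hy, mul_smul]⟩
    · exact Or.inr ⟨g * k, by rw [hx, mul_smul], by rw [hy, mul_smul]⟩
  refine ⟨fun h => ?_, key g x y⟩
  have := key g⁻¹ _ _ h
  rwa [inv_smul_smul, inv_smul_smul] at this

/-- The group `Aut(X)` of automorphisms of the tree. -/
abbrev AutX : Type _ := tree π ≃g tree π

/-- The action of `GL₂(F)` on the tree. -/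
def toAut : GL (Fin 2) F →* AutX π where
  toFun g := ⟨MulAction.toPerm g, adj_smul π g _ _⟩
  map_one' := by ext x; exact one_smul (GL (Fin 2) F) x
  map_mul' g h := by ext x; exact mul_smul (g : GL (Fin 2) F) h x

@[simp] lemma toAut_apply (g : GL (Fin 2) F) (x : Vert F) : toAut π g x = g • x := rfl

/-- The set of vertices of the infinite path `[α₀, z]` which starts at `z` and passes through
almost all of the vertices `t^(-m) x₊`, `m ≥ 0`. -/
def ray (z : Vert F) : Set (Vert F) :=
  {x | ∀ᶠ m : ℕ in Filter.atTop, (tree π).dist ((t π ^ m)⁻¹ • xPlus F) x + (tree π).dist x z =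
    (tree π).dist ((t π ^ m)⁻¹ • xPlus F) z}

/-- `Z₊^(e)(x)`, the set of all vertices `z` with `d(x, z) ≤ e` and `x ∈ [α₀, z]`. -/
def Zplus (e : ℕ) (x : Vert F) : Set (Vert F) :=
  {z | (tree π).dist x z ≤ e ∧ x ∈ ray π z}

lemma self_mem_Zplus (e : ℕ) (x : Vert F) : x ∈ Zplus π e x := by
  simp [Zplus, ray]

lemma dist_smul (g : GL (Fin 2) F) (x y : Vert F) :
    (tree π).dist (g • x) (g • y) = (tree π).dist x y := by
  have key : ∀ (g : GL (Fin 2) F) (x y x' y' : Vert F), g • x = x' → g • y = y' →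
      Set.range (SimpleGraph.Walk.length : (tree π).Walk x y → ℕ) ⊆
      Set.range (SimpleGraph.Walk.length : (tree π).Walk x' y' → ℕ) := by
    rintro g x y _ _ rfl rfl _ ⟨w, rfl⟩
    exact ⟨w.map (toAut π g).toHom, SimpleGraph.Walk.length_map _ _⟩
  rw [SimpleGraph.dist_eq_sInf, SimpleGraph.dist_eq_sInf]
  congr 1
  exact Set.Subset.antisymm (key g⁻¹ _ _ _ _ (inv_smul_smul g x) (inv_smul_smul g y))
    (key g _ _ _ _ rfl rfl)

lemma aff_one_mem_ZK {c : F} (hc : c ∈ 𝒪[F]) : aff 1 c ∈ ZK F := by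
  refine (le_sup_right : maxCompact F ≤ _) ?_
  refine ⟨Matrix.GeneralLinearGroup.mk' !![1, ⟨c, hc⟩; 0, 1] (by simpa using invertibleOne), ?_⟩
  ext i j
  fin_cases i <;> fin_cases j <;> simp [aff, Matrix.GeneralLinearGroup.mkOfDetNeZero,
    Matrix.GeneralLinearGroup.mk'] <;> rfl

lemma N0_smul_end {e : ℕ} {n : GL (Fin 2) F} (hn : n ∈ N0 π e) (m : ℕ) :
    n • (t π ^ m)⁻¹ • xPlus F = (t π ^ m)⁻¹ • xPlus F := by
  obtain ⟨c, hc, rfl⟩ := hn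
  have hmem : ((π.1 : F) ^ m * ((π.1 : F) ^ (e - 1) * c)) ∈ 𝒪[F] :=
    mul_mem (pow_mem π.mem m) (mul_mem (pow_mem π.mem _) hc)
  have h1 : aff 1 ((π.1 : F) ^ m * ((π.1 : F) ^ (e - 1) * c)) • xPlus F = xPlus F := by
    refine QuotientGroup.eq.mpr ?_
    simpa using (ZK F).inv_mem (aff_one_mem_ZK hmem)
  have h2 : aff 1 ((π.1 : F) ^ (e - 1) * c) * (t π ^ m)⁻¹ =
      (t π ^ m)⁻¹ * aff 1 ((π.1 : F) ^ m * ((π.1 : F) ^ (e - 1) * c)) := by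
    rw [t, aff_pow, aff_inv, aff_mul, aff_mul]
    congr 1
    · simp
    · simp
  rw [← mul_smul, h2, mul_smul, h1]

lemma smul_mem_Zplus_iff {e e' : ℕ} {n : GL (Fin 2) F} (hn : n ∈ N0 π e) (x z : Vert F) :
    n • z ∈ Zplus π e' (n • x) ↔ z ∈ Zplus π e' x := by
  simp only [Zplus, ray, Set.mem_ofPred_eq, dist_smul]
  have : ∀ (m : ℕ) (y : Vert F), (tree π).dist ((t π ^ m)⁻¹ • xPlus F) (n • y) =
      (tree π).dist ((t π ^ m)⁻¹ • xPlus F) y := fun m y => by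
    conv_lhs => rw [← N0_smul_end π hn m]
    exact dist_smul π _ _ _
  simp only [this]

/-- `N̂₀^(e)`: the automorphisms of `X` that coincide on each `Z₊^(e)(x)` with some element of
`N₀^(e)`. -/
def Nhat0 (e : ℕ) : Subgroup (AutX π) where
  carrier := {g | ∀ x, ∃ n ∈ N0 π e, ∀ z ∈ Zplus π e x, g z = n • z}
  mul_mem' := by
    intro g f hg hf x
    obtain ⟨n, hn, hfn⟩ := hf x
    obtain ⟨k, hk, hgk⟩ := hg (n • x)
    refine ⟨k * n, mul_mem hk hn, fun z hz => ?_⟩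
    rw [RelIso.mul_apply, hfn z hz, hgk _ ((smul_mem_Zplus_iff π hn x z).mpr hz), mul_smul]
  one_mem' := fun x => ⟨1, one_mem _, fun z _ => by simp⟩
  inv_mem' := by
    intro g hg x
    obtain ⟨n, hn, hgn⟩ := hg (g⁻¹ x)
    have hx : n • (g⁻¹ x) = x := by
      rw [← hgn _ (self_mem_Zplus π e _), RelIso.apply_inv_self]
    refine ⟨n⁻¹, inv_mem hn, fun z hz => ?_⟩
    have hz' : n⁻¹ • z ∈ Zplus π e (g⁻¹ x) := by
      rw [← smul_mem_Zplus_iff π hn, smul_inv_smul, hx]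
      exact hz
    have := hgn _ hz'
    rw [smul_inv_smul] at this
    rw [← this, RelIso.inv_apply_self, this]

/-- `N̂^(e)`, the union of the increasing sequence of subgroups `t^(-m) N̂₀^(e) t^m`. -/
def Nhat (e : ℕ) : Subgroup (AutX π) :=
  ⨆ m : ℕ, (Nhat0 π e).map (MulAut.conj ((toAut π (t π) ^ m)⁻¹)).toMonoidHom

/-- `P̂_⋆^(e)`, the monoid generated by `N̂₀^(e)` and `T_⋆`. -/
def PhatStar (e : ℕ) : Submonoid (AutX π) :=
  (Nhat0 π e).toSubmonoid ⊔ (Tstar F).map (toAut π)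

/-- The monoid generated by `P̂_⋆^(e)` and `N₀^(1)`. It is `P̂_⋆^(1)` if `e = 1`. -/
def PhatStarExt (e : ℕ) : Submonoid (AutX π) :=
  PhatStar π e ⊔ (N0 π 1).toSubmonoid.map (toAut π)

lemma t_pow_mem (e m : ℕ) : toAut π (t π) ^ m ∈ PhatStarExt π e :=
  pow_mem ((le_sup_left : PhatStar π e ≤ _)
    ((le_sup_right : (Tstar F).map (toAut π) ≤ PhatStar π e) ⟨_, t_mem_Tstar π, rfl⟩)) m

lemma t_pow_inv_mem (e m : ℕ) : (toAut π (t π) ^ m)⁻¹ ∈ (PhatStarExt π e)⁻¹ := by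
  simpa using t_pow_mem π e m

lemma inv_mem_inv {e : ℕ} {s : AutX π} (hs : s ∈ PhatStarExt π e) : s⁻¹ ∈ (PhatStarExt π e)⁻¹ := by
  simpa using hs

lemma Nhat0_mem {e : ℕ} {g : AutX π} (hg : g ∈ Nhat0 π e) : g ∈ PhatStarExt π e :=
  (le_sup_left : PhatStar π e ≤ _) ((le_sup_left : (Nhat0 π e).toSubmonoid ≤ PhatStar π e) hg)

lemma Nhat0_mem_inv {e : ℕ} {g : AutX π} (hg : g ∈ Nhat0 π e) : g ∈ (PhatStarExt π e)⁻¹ :=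
  Submonoid.mem_inv.mpr (Nhat0_mem π (inv_mem hg))

lemma N0_one_mem (e : ℕ) (n : N0 π 1) : toAut π n ∈ PhatStarExt π e :=
  (le_sup_right : (N0 π 1).toSubmonoid.map (toAut π) ≤ _) ⟨_, n.2, rfl⟩

lemma N0_one_mem_inv (e : ℕ) (n : N0 π 1) : toAut π n ∈ (PhatStarExt π e)⁻¹ := by
  have := N0_one_mem π e n⁻¹
  rw [Submonoid.mem_inv, ← map_inv]
  exact this

variable (F) in
/-- `X₊⁰ = P_⋆^(1) x₊`. -/
def Xplus : Set (Vert F) :=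
  {x | ∃ (a : Fˣ) (b : F), (a : F) ∈ 𝒪[F] ∧ b ∈ 𝒪[F] ∧ x = aff a b • xPlus F}

/-- `N̂_{0,1}^(e)`: the group of permutations of `X₊⁰` which are restrictions of elements of
`N̂₀^(e)`. -/
def Nhat01 (e : ℕ) : Subgroup (Equiv.Perm (Xplus F)) where
  carrier := {h | ∃ g ∈ Nhat0 π e, ∀ x, ((h x : Xplus F) : Vert F) = g x}
  mul_mem' := by
    rintro h h' ⟨g, hg, hh⟩ ⟨g', hg', hh'⟩
    exact ⟨g * g', mul_mem hg hg', fun x => by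
      rw [Equiv.Perm.mul_apply, hh, hh', RelIso.mul_apply]⟩
  one_mem' := ⟨1, one_mem _, fun x => rfl⟩
  inv_mem' := by
    rintro h ⟨g, hg, hh⟩
    refine ⟨g⁻¹, inv_mem hg, fun x => ?_⟩
    have := hh (h⁻¹ x)
    rw [Equiv.Perm.inv_def, Equiv.apply_symm_apply] at this
    rw [this, RelIso.inv_apply_self]
    rfl

/-- The (profinite) topology of pointwise convergence on `N̂_{0,1}^(e)`. -/
instance (e : ℕ) : TopologicalSpace (Nhat01 π e) :=
  TopologicalSpace.induced (fun (h : Nhat01 π e) (x : Xplus F) => h.1 x)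
    (@Pi.topologicalSpace (Xplus F) (fun _ => Xplus F) (fun _ => ⊥))

lemma N0_smul_Xplus {e : ℕ} (n : N0 π e) {x : Vert F} (hx : x ∈ Xplus F) :
    (n : GL (Fin 2) F) • x ∈ Xplus F := by
  obtain ⟨_, c, hc, rfl⟩ := n
  obtain ⟨a, b, ha, hb, rfl⟩ := hx
  refine ⟨a, b + (π.1 : F) ^ (e - 1) * c, ha,
    add_mem hb (mul_mem (pow_mem π.mem _) hc), ?_⟩
  rw [← mul_smul]
  simp [aff_mul]

lemma toAut_mem_Nhat0 {e : ℕ} (n : N0 π e) : toAut π n ∈ Nhat0 π e :=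
  fun _ => ⟨n, n.2, fun _ _ => rfl⟩

/-- The natural homomorphism `N₀^(e) → N̂_{0,1}^(e)`. -/
def N0ToNhat01 (e : ℕ) : N0 π e →* Nhat01 π e where
  toFun n := ⟨⟨fun x => ⟨(n : GL (Fin 2) F) • (x : Vert F), N0_smul_Xplus π n x.2⟩,
      fun x => ⟨((n⁻¹ : N0 π e) : GL (Fin 2) F) • (x : Vert F), N0_smul_Xplus π n⁻¹ x.2⟩,
      fun x => Subtype.ext (by simp), fun x => Subtype.ext (by simp)⟩,
    ⟨toAut π n, toAut_mem_Nhat0 π n, fun _ => rfl⟩⟩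
  map_one' := by
    refine Subtype.ext (Equiv.ext fun x => Subtype.ext ?_)
    exact one_smul _ _
  map_mul' m n := by
    refine Subtype.ext (Equiv.ext fun x => Subtype.ext ?_)
    exact mul_smul _ _ _

/-- Conjugation by `t^m` on `N₀^(e)`. -/
def conjN0 (e m : ℕ) : N0 π e →* N0 π e :=
  ((MulAut.conj (t π ^ m)).toMonoidHom.comp (N0 π e).subtype).codRestrict (N0 π e) (by
    rintro ⟨_, c, hc, rfl⟩
    refine ⟨(π.1 : F) ^ m * c, mul_mem (pow_mem π.mem m) hc, ?_⟩
    change t π ^ m * aff _ _ * (t π ^ m)⁻¹ = _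
    rw [t, aff_pow, aff_inv, aff_mul, aff_mul]
    congr 1
    · simp
    · simp; ring)

end Tree

section Topology

variable {F : Type*} [Field F] [ValuativeRel F] [TopologicalSpace F]
  [IsNonarchimedeanLocalField F] (π : Uniformizer F)

lemma continuous_conjN0 (e m : ℕ) : Continuous (conjN0 π e m) := by
  refine Continuous.subtype_mk ?_ _
  change Continuous fun n : N0 π e => t π ^ m * (n : GL (Fin 2) F) * (t π ^ m)⁻¹
  fun_prop

lemma isOpen_ZK : IsOpen (ZK F : Set (GL (Fin 2) F)) := by
  refine Subgroup.isOpen_mono (le_sup_right : maxCompact F ≤ ZK F) ?_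
  have hO : IsOpen (𝒪[F] : Set F) := (ValuativeRel.valuation F).isOpen_integer
  have h : (maxCompact F : Set (GL (Fin 2) F)) =
      ⋂ (i : Fin 2) (j : Fin 2), ({g : GL (Fin 2) F | (g : Matrix (Fin 2) (Fin 2) F) i j ∈ 𝒪[F]} ∩
        {g : GL (Fin 2) F | ((g⁻¹ : GL (Fin 2) F) : Matrix (Fin 2) (Fin 2) F) i j ∈ 𝒪[F]}) := by
    ext g
    simp only [Set.mem_iInter, Set.mem_inter_iff, Set.mem_ofPred_eq, SetLike.mem_coe]
    constructor
    · rintro ⟨u, rfl⟩ i j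
      refine ⟨(u.1 i j).2, ?_⟩
      rw [← map_inv]
      exact ((u⁻¹).1 i j).2
    · intro hg
      have hinj : Function.Injective (fun M : Matrix (Fin 2) (Fin 2) 𝒪[F] =>
          M.map (algebraMap 𝒪[F] F)) :=
        Matrix.map_injective (FaithfulSMul.algebraMap_injective 𝒪[F] F)
      let A : Matrix (Fin 2) (Fin 2) 𝒪[F] := fun i j => ⟨_, (hg i j).1⟩
      let B : Matrix (Fin 2) (Fin 2) 𝒪[F] := fun i j => ⟨_, (hg i j).2⟩
      have hA : A.map (algebraMap 𝒪[F] F) = g.1 := rfl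
      have hB : B.map (algebraMap 𝒪[F] F) = (g⁻¹ : GL (Fin 2) F).1 := rfl
      refine ⟨⟨A, B, hinj ?_, hinj ?_⟩, Units.ext rfl⟩
      · change (A * B).map _ = (1 : Matrix _ _ _).map _
        rw [Matrix.map_mul, hA, hB, Matrix.map_one _ (map_zero _) (map_one _)]
        exact g.mul_inv
      · change (B * A).map _ = (1 : Matrix _ _ _).map _
        rw [Matrix.map_mul, hA, hB, Matrix.map_one _ (map_zero _) (map_one _)]
        exact g.inv_mul
  rw [h]
  refine isOpen_iInter_of_finite fun i => isOpen_iInter_of_finite fun j => IsOpen.inter ?_ ?_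
  · exact hO.preimage ((continuous_id.matrix_elem i j).comp Units.continuous_val)
  · exact hO.preimage ((continuous_id.matrix_elem i j).comp
      (Units.continuous_val.comp continuous_inv))

lemma continuous_N0ToNhat01 (e : ℕ) : Continuous (N0ToNhat01 π e) := by
  refine continuous_induced_rng.mpr ?_
  refine @continuous_pi _ _ _ _ (fun _ => ⊥) _ fun x => ?_
  let : TopologicalSpace (Xplus F) := ⊥
  have : DiscreteTopology (Xplus F) := ⟨rfl⟩
  have : DiscreteTopology (Vert F) := QuotientGroup.discreteTopology isOpen_ZK
  rw [continuous_discrete_rng]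
  intro y
  have hset : ((fun h : Nhat01 π e => h.1 x) ∘ N0ToNhat01 π e) ⁻¹' {y} =
      (fun n : N0 π e => (n : GL (Fin 2) F) • (x : Vert F)) ⁻¹' {(y : Vert F)} := by
    ext n
    simp only [Set.mem_preimage, Set.mem_singleton_iff, Function.comp_apply]
    exact Subtype.ext_iff
  obtain ⟨a, ha⟩ := QuotientGroup.mk_surjective (x : Vert F)
  have hcont : Continuous fun n : N0 π e => (n : GL (Fin 2) F) • (x : Vert F) := by
    rw [← ha]
    change Continuous fun n : N0 π e => (QuotientGroup.mk ((n : GL (Fin 2) F) * a) : Vert F)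
    exact QuotientGroup.continuous_mk.comp (continuous_subtype_val.mul continuous_const)
  change IsOpen (((fun h : Nhat01 π e => h.1 x) ∘ N0ToNhat01 π e) ⁻¹' {y})
  rw [hset]
  exact (isOpen_discrete _).preimage hcont

end Topology

section Hypotheses

variable {F : Type*} [Field F] [ValuativeRel F] (π : Uniformizer F)

/-- `x = x₊^μ`: the vertex `x` belongs to the edge `μ`, and the other vertex of `μ` lies on
`[α₀, x]`. -/
def IsPlusVertex (μ : (tree π).edgeSet) (x : Vert F) : Prop :=
  ∃ y, (μ : Sym2 (Vert F)) = s(x, y) ∧ y ∈ ray π x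

/-- `N_x^(e)`, the elements of `N` which fix `Z₊^(e-1)(x)` pointwise. -/
def Nfix (e : ℕ) (x : Vert F) : Set (NT F) :=
  {g | (g : GL (Fin 2) F) ∈ N F ∧ ∀ z ∈ Zplus π (e - 1) x, g • z = z}

variable {π} {Λ : Type*} [CommRing Λ] (𝓕 : EquivariantCoeffSystem Λ (NT F) (tree π))

/-- All transition maps are injective. -/
def Hyp1 : Prop :=
  ∀ (x : Vert F) (η : (tree π).edgeSet) (h : x ∈ (η : Sym2 (Vert F))),
    Function.Injective (𝓕.res x η h)

/-- `F(x₊^μ) = ∑_{η ∈ S_μ} im(F(η) → F(x₊^μ))`, where `S_μ = {η | μ ∩ η = {x₊^μ}}`. -/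
def Hyp2 : Prop :=
  ∀ (μ : (tree π).edgeSet) (x : Vert F), IsPlusVertex π μ x →
    Submodule.span Λ {w : 𝓕.onVert x | ∃ (η : (tree π).edgeSet) (h : x ∈ (η : Sym2 (Vert F))),
      {v | v ∈ (μ : Sym2 (Vert F)) ∧ v ∈ (η : Sym2 (Vert F))} = {x} ∧
      ∃ v : 𝓕.onEdge η, 𝓕.res x η h v = w} = ⊤

/-- The image of `F(μ) → F(x₊^μ)` is the submodule of `N_{x₊^μ}^(e)`-invariants. -/
def Hyp3 (e : ℕ) : Prop :=
  ∀ (μ : (tree π).edgeSet) (x : Vert F) (h : x ∈ (μ : Sym2 (Vert F))), IsPlusVertex π μ x →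
    ∀ w : 𝓕.onVert x, (∃ v : 𝓕.onEdge μ, 𝓕.res x μ h v = w) ↔
      ∀ g ∈ Nfix π e x, ∀ hg : g • x = x, 𝓕.actVert g x x hg w = w

/-- For a uniformizer `a` of the local ring `Λ` with residue field `k = Λ/(a)`: the `k`-vector space
`F(x₊)^{N₀^(e), a=0}` of `N₀^(e)`-invariants in `F(x₊)` which are killed by `a`. -/
def invTorsion (e : ℕ) (a : Λ) :
    Submodule (Λ ⧸ Ideal.span {a}) (Submodule.torsionBy Λ (𝓕.onVert (xPlus F)) a) where
  carrier := {v | ∀ (g : GL (Fin 2) F) (hg : g ∈ N0 π e)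
    (h : (⟨g, N0_le_NT π e hg⟩ : NT F) • xPlus F = xPlus F),
    𝓕.actVert ⟨g, N0_le_NT π e hg⟩ (xPlus F) (xPlus F) h v = v}
  add_mem' := fun hv hw g hg h => by
    rw [Submodule.coe_add, map_add, hv g hg h, hw g hg h]
  zero_mem' := fun g hg h => by simp
  smul_mem' := fun c v hv g hg h => by
    obtain ⟨r, rfl⟩ := Ideal.Quotient.mk_surjective c
    change 𝓕.actVert _ _ _ _ (r • (v : 𝓕.onVert (xPlus F))) = r • (v : 𝓕.onVert (xPlus F))
    rw [map_smul, hv g hg h]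

end Hypotheses

section Action

variable {F : Type*} [Field F] [ValuativeRel F] {π : Uniformizer F}
  {Λ : Type*} [CommRing Λ] (𝓕 : EquivariantCoeffSystem Λ (NT F) (tree π))

variable (π) in
/-- `g ∈ NT` represents the automorphism `s` near the vertex `x`: the elements `s` and `g` coincide
on `Z₊^(e)(x)`, and they have the same component `τ ∈ T`, i.e. `s ∈ N̂^(e) τ` and `g ∈ N τ`. -/
def IsLocalRep (e : ℕ) (s : AutX π) (x : Vert F) (g : NT F) : Prop :=
  ∃ τ ∈ T F, s * (toAut π τ)⁻¹ ∈ Nhat π e ∧ (g : GL (Fin 2) F) * τ⁻¹ ∈ N F ∧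
    ∀ z ∈ Zplus π e x, s z = g • z

open Classical in
/-- The action `F(x) → F(sx)` of an automorphism `s ∈ P̂^(e)`: choose `g ∈ NT` representing `s`
near `x`, and let `s` act like `g`. (For coefficient systems satisfying the three hypotheses above
such a `g` exists, and the map does not depend on its choice.) -/
def autAct (e : ℕ) (s : AutX π) (x : Vert F) : 𝓕.onVert x →ₗ[Λ] 𝓕.onVert (s x) :=
  if h : ∃ g, IsLocalRep π e s x g then
    𝓕.actVert h.choose x (s x) (by
      obtain ⟨τ, -, -, -, hz⟩ := h.choose_spec
      exact (hz x (self_mem_Zplus π e x)).symm)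
  else 0

/-- `H₀(X₊, F)`. -/
abbrev H0plus : Type _ := 𝓕.H0 (Xplus F)

/-- The image of `F(σ) → F(x₊) → H₀(X₊, F)`. -/
def imSigma : Submodule Λ (H0plus 𝓕) :=
  LinearMap.range (𝓕.cls (Xplus F) (xPlus F) ∘ₗ
    𝓕.res (xPlus F) (sigma π) (Sym2.mem_mk_left _ _))

variable (o L : Type*) [CommRing o] [Field L] [Algebra o L] [Algebra o Λ]

/-- `D(F)`, the Pontryagin dual of `H₀(X₊, F)`. -/
abbrev DD : Type _ := PDual o L Λ (H0plus 𝓕)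

/-- `D'(F)`, the Pontryagin dual of `H₀(X₊, F) / F(σ)`. -/
abbrev DD' : Type _ := PDual o L Λ (H0plus 𝓕 ⧸ imSigma 𝓕)

end Action

section Etale

variable {F : Type*} [Field F] [ValuativeRel F] [TopologicalSpace F]
  [IsNonarchimedeanLocalField F] (π : Uniformizer F) (e : ℕ)
  (o : Type*) [CommRing o]

instance : CommRing (IwasawaAlgebra o (N0 π e)) :=
  { (inferInstance : Ring (IwasawaAlgebra o (N0 π e))) with
    mul_comm := IwasawaAlgebra.mul_comm_of_comm o (N0_comm π e) }

/-- The homomorphism `o[[N₀^(e)]] → o[[N̂_{0,1}^(e)]]`. -/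
def iwN0 : IwasawaAlgebra o (N0 π e) →+* IwasawaAlgebra o (Nhat01 π e) :=
  (IwasawaAlgebra.map o (N0ToNhat01 π e) (continuous_N0ToNhat01 π e)).toRingHom

/-- The endomorphism of `o[[N₀^(e)]]` induced by `n ↦ t^m n t^(-m)`. -/
def iwConj (m : ℕ) : IwasawaAlgebra o (N0 π e) →+* IwasawaAlgebra o (N0 π e) :=
  (IwasawaAlgebra.map o (conjN0 π e m) (continuous_conjN0 π e m)).toRingHom

variable {o} (p : ℕ) (ϖ : o)

/-- `O_E^(e)`, the `p`-adic completion of the localization of `o[[N₀^(e)]]` with respect to the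
complement of `ϖ o[[N₀^(e)]]`. -/
abbrev OE : Type _ :=
  ComplLocalization (IwasawaAlgebra o (N0 π e)) p (algebraMap o (IwasawaAlgebra o (N0 π e)) ϖ)

/-- An étale `((P̂_⋆^(e))⁻¹, P̂_⋆^(e))`-pair `∂ : D' → D` over `o[[N̂_{0,1}^(e)]]`. The actions are
actions of the monoid generated by `P̂_⋆^(e)` and `N₀^(1)` (which is `P̂_⋆^(e)` if `e = 1`) and of its
inverse monoid, since the operators `n ∈ N₀^(1)` occur in the last condition. -/
structure EtalePair (D' D : Type*) [AddCommGroup D'] [Module o D'] [AddCommGroup D]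
    [Module o D] where
  [modD' : Module (IwasawaAlgebra o (Nhat01 π e)) D']
  [modD : Module (IwasawaAlgebra o (Nhat01 π e)) D]
  [towerD' : IsScalarTower o (IwasawaAlgebra o (Nhat01 π e)) D']
  [towerD : IsScalarTower o (IwasawaAlgebra o (Nhat01 π e)) D]
  /-- the morphism `∂` -/
  bd : D' →ₗ[IwasawaAlgebra o (Nhat01 π e)] D
  bd_injective : Function.Injective bd
  /-- the action of the inverse monoid on `D` -/
  actD : ↥((PhatStarExt π e)⁻¹) →* Module.End o D
  /-- the action of the monoid on `D'` -/
  actD' : ↥(PhatStarExt π e) →* Module.End o D'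
  -- the actions extend the given action of `N̂₀^(e)` through its quotient `N̂_{0,1}^(e)`
  actD_eq : ∀ (g : AutX π) (hg : g ∈ Nhat0 π e) (h : Nhat01 π e),
    (∀ x, ((h.1 x : Xplus F) : Vert F) = g x) →
    ∀ d, actD ⟨g, Nhat0_mem_inv π hg⟩ d = IwasawaAlgebra.dirac o h • d
  actD'_eq : ∀ (g : AutX π) (hg : g ∈ Nhat0 π e) (h : Nhat01 π e),
    (∀ x, ((h.1 x : Xplus F) : Vert F) = g x) →
    ∀ d, actD' ⟨g, Nhat0_mem π hg⟩ d = IwasawaAlgebra.dirac o h • d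
  -- `∂` commutes with `N₀^(1)`
  bd_act : ∀ (n : N0 π 1) (d : D'),
    bd (actD' ⟨toAut π n, N0_one_mem π e n⟩ d) = actD ⟨toAut π n, N0_one_mem_inv π e n⟩ (bd d)
  -- `ψ_{t^m} ∂ φ_{t^m} = ∂`
  psi_bd_phi : ∀ (m : ℕ) (d : D'),
    actD ⟨(toAut π (t π) ^ m)⁻¹, t_pow_inv_mem π e m⟩
      (bd (actD' ⟨toAut π (t π) ^ m, t_pow_mem π e m⟩ d)) = bd d
  finite_coker : Finite (D ⧸ LinearMap.range bd)
  -- `∂` induces an isomorphism `O_E ⊗ D' → O_E ⊗ D`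
  baseChange_bijective : Function.Bijective (BaseChange.map (OE π e p ϖ) (iwN0 π e o) bd)
  -- `∑ n φ_{t^m} ψ_{t^m} n⁻¹ = id` on `O_E ⊗ D`, with `n` running through representatives of
  -- `N₀^(1) / t^m N₀^(1) t^(-m)`. Here `phi`, `psi`, `nu n` are the additive maps obtained from
  -- `φ_{t^m}`, `ψ_{t^m}`, `n` by base extension: `phi` is semilinear with respect to the
  -- endomorphism `phiE` of `O_E` which extends conjugation by `t^m` on `o[[N₀^(e)]]`, and `psi` is
  -- semilinear in the inverse direction.
  etale : ∀ m : ℕ, ∃ (phiE : OE π e p ϖ →+* OE π e p ϖ)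
    (phi : BaseChange (OE π e p ϖ) (iwN0 π e o) D' →+ BaseChange (OE π e p ϖ) (iwN0 π e o) D')
    (psi : BaseChange (OE π e p ϖ) (iwN0 π e o) D →+ BaseChange (OE π e p ϖ) (iwN0 π e o) D)
    (nu : N0 π 1 →
      BaseChange (OE π e p ϖ) (iwN0 π e o) D →+ BaseChange (OE π e p ϖ) (iwN0 π e o) D),
    (∀ r : IwasawaAlgebra o (N0 π e),
      phiE (algebraMap _ (OE π e p ϖ) r) = algebraMap _ (OE π e p ϖ) (iwConj π e o m r)) ∧
    (∀ a d, phi (BaseChange.tmul _ a d) =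
      BaseChange.tmul _ (phiE a) (actD' ⟨toAut π (t π) ^ m, t_pow_mem π e m⟩ d)) ∧
    (∀ a d, psi (BaseChange.tmul _ (phiE a) d) =
      BaseChange.tmul _ a (actD ⟨(toAut π (t π) ^ m)⁻¹, t_pow_inv_mem π e m⟩ d)) ∧
    (∀ n a d, nu n (BaseChange.tmul _ a d) =
      BaseChange.tmul _ a (actD ⟨toAut π n, N0_one_mem_inv π e n⟩ d)) ∧
    ∀ rep : (N0 π 1 ⧸ (conjN0 π 1 m).range) → N0 π 1,
      (∀ q, (rep q : N0 π 1 ⧸ (conjN0 π 1 m).range) = q) →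
      ∀ z, ∑ᶠ q, nu (rep q) (BaseChange.map (OE π e p ϖ) (iwN0 π e o) bd
        (phi ((Equiv.ofBijective _ baseChange_bijective).symm (psi (nu (rep q)⁻¹ z))))) = z

/-- An étale pair with underlying modules `D'(F)` and `D(F)` has the natural structure: `∂` is dual
to the projection `H₀(X₊, F) → H₀(X₊, F)/F(σ)`; the monoids act as dual to the actions on
`H₀(X₊, F)` and on `H₀(X, F)/H₀(X₋, F) ≅ H₀(X₊, F)/F(σ)`; and the module structures over
`o[[N̂_{0,1}^(e)]]` are continuous for the topologies of pointwise convergence on `D'(F)` and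
`D(F)`. -/
structure EtalePair.IsNatural {π : Uniformizer F} {e p : ℕ} {ϖ : o} {Λ L : Type*} [CommRing Λ]
    [Field L] [Algebra o L] [Algebra o Λ] {𝓕 : EquivariantCoeffSystem Λ (NT F) (tree π)}
    (E : EtalePair π e p ϖ (DD' 𝓕 o L) (DD 𝓕 o L)) : Prop where
  bd_apply : ∀ (f : DD' 𝓕 o L) (c : H0plus 𝓕), (E.bd f).eval c = f.eval ((imSigma 𝓕).mkQ c)
  actD_apply : ∀ (s : AutX π) (hs : s ∈ PhatStarExt π e) (f : DD 𝓕 o L), ∀ x ∈ Xplus F,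
    ∀ v : 𝓕.onVert x, (E.actD ⟨s⁻¹, inv_mem_inv π hs⟩ f).eval (𝓕.cls (Xplus F) x v) =
      f.eval (𝓕.cls (Xplus F) (s x) (autAct 𝓕 e s x v))
  actD'_apply : ∀ (s : AutX π) (hs : s ∈ PhatStarExt π e) (f : DD' 𝓕 o L), ∀ x ∈ Xplus F,
    ∀ v : 𝓕.onVert x, (E.actD' ⟨s, hs⟩ f).eval ((imSigma 𝓕).mkQ (𝓕.cls (Xplus F) x v)) =
      f.eval ((imSigma 𝓕).mkQ (𝓕.cls (Xplus F) (s⁻¹ x) (autAct 𝓕 e s⁻¹ x v)))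
  continuousD : ∀ (f : DD 𝓕 o L) (c : H0plus 𝓕), ∃ U : OpenNormalSubgroup (Nhat01 π e),
    ∀ a : IwasawaAlgebra o (Nhat01 π e), a.proj U = 0 → (letI := E.modD; (a • f : DD 𝓕 o L)).eval c = 0
  continuousD' : ∀ (f : DD' 𝓕 o L) (c : H0plus 𝓕 ⧸ imSigma 𝓕),
    ∃ U : OpenNormalSubgroup (Nhat01 π e),
    ∀ a : IwasawaAlgebra o (Nhat01 π e), a.proj U = 0 → (letI := E.modD'; (a • f : DD' 𝓕 o L)).eval c = 0

end Etale

end BTree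

end

set_option linter.unusedSectionVars false

/-! ### The coefficient ring -/

section CoeffRing

/-! The vertices of the tree are the balls `b + p_F^i 𝒪` of `F`, with coordinates `vtx i b`. The map
`par` passes to the next larger ball and `adj_iff` says that all edges arise in this way. Thus `[α₀,
z]` consists of the ancestors of `z`, `Z₊^(e)(x)` of the descendants of `x` up to generation `e`,
and `X₊` of all descendants of `x₊`. By the three hypotheses, an element of `N` that fixes
`Z₊^(e)(x)` pointwise acts trivially on `F(x)` (`actVert_eq_self`). This makes the action of
`P̂^(e)` through local representatives well defined and compatible with the transition maps
(`autAct_eq`, `autAct_res`), so the monoids act on `H₀(X₊, F)` and on `H₀(X₊, F)/F(σ)`. Every class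
in `H₀(X₊, F)` is fixed by an open normal subgroup of `N̂_{0,1}^(e)`. Viewing elements of `o[[H]]`
as measures on `H`, one lets them act on the dual of a smooth representation by `(a f)(c) = ∫ f(h⁻¹
c) da(h)`.

Generators come from a dual form of Nakayama's lemma, `exists_eq_sum_smoothSMul`. A nonzero smooth
torsion representation of a pro-`p`-group contains a nonzero invariant vector killed by `ϖ`, so
functionals that separate these vectors embed the representation into functions on the group with
values in `L/o`. As `L/o` is injective with endomorphism ring `o`, every functional is then a
combination of the given ones with measures as coefficients. The geometric input is
`exists_eq_cls_of_invariant`: the invariants of `N̂₀^(e)` in `H₀(X₊, F)` are the classes of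
`N₀^(e)`-invariants in `F(x₊)`. By (Hyp 2) a class can be represented by a chain on the vertices of
one level. An automorphism which acts by an element of `N_y^(e)` below one vertex `y` and trivially
elsewhere shows that the component of an invariant class at `y` is `N_y^(e)`-invariant. By (Hyp 3)
this component comes from the edge towards the parent of `y`, and so the chain descends level by
level to `x₊`. The injectivity of `F(y) → H₀(X₊, F)`, `cls_injective`, is used throughout.

The image of `F(σ)` is finite, which bounds the cokernel of `∂`. Since `N₀^(e)` acts trivially on
it, `s = [h] - 1` carries `D(F)` into `∂ D'(F)` for each `h` in `N₀^(e)`. If `h` lies outside some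
open subgroup, `s` is a unit of `O_E`, so `∂` becomes bijective over `O_E`.

The étale relation is first proved without denominators, in the form `∑ n ∂ φ(s ψ(n⁻¹ d)) = φ(s) d`
(`BTree.sum_phi_psi`). Evaluated at a vertex `x` of level at least `m`, exactly one coset
representative `n` has `t^(-m) n⁻¹ x` in `X₊`, and its summand is the right hand side; at lower
levels both sides vanish. To pass to `O_E`, one needs conjugation by `t^m` on `O_E` together with a
basis of `O_E` over its image; otherwise `ψ` could not be extended. The representatives of `N₀^(e) /
t^m N₀^(e) t^(-m)` are a basis for `o[[N₀^(e)]]`, and this survives localization and completion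
because modulo powers of `p` every denominator can be replaced by one in the image of `φ`
(`exists_mul_sub_dvd`): the `p^m`-th power of any element lies in this image modulo `ϖ`. -/

lemma isAdicComplete_span_singleton {R : Type*} [CommRing R] (a : R)
    (hsep : ∀ x : R, (∀ n : ℕ, a ^ n ∣ x) → x = 0)
    (hlim : ∀ f : ℕ → R, (∀ n, a ^ n ∣ f (n + 1) - f n) → ∃ l, ∀ n, a ^ n ∣ f n - l) :
    IsAdicComplete (Ideal.span {a}) R where
  haus' x hx := hsep x fun n => by
    have := hx n
    rw [SModEq.zero, Ideal.span_singleton_pow, smul_eq_mul, Ideal.mul_top,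
      Ideal.mem_span_singleton] at this
    exact this
  prec' f hf := by
    obtain ⟨l, hl⟩ := hlim f fun n => by
      have := (hf (Nat.le_succ n)).symm
      rwa [SModEq.sub_mem, Ideal.span_singleton_pow, smul_eq_mul, Ideal.mul_top,
        Ideal.mem_span_singleton] at this
    refine ⟨l, fun n => ?_⟩
    rw [SModEq.sub_mem, Ideal.span_singleton_pow, smul_eq_mul, Ideal.mul_top,
      Ideal.mem_span_singleton]
    exact hl n

lemma PadicInt.exists_limit (p : ℕ) [Fact p.Prime] (f : ℕ → ℤ_[p])
    (hf : ∀ n, (p : ℤ_[p]) ^ n ∣ f (n + 1) - f n) : ∃ l, ∀ n, (p : ℤ_[p]) ^ n ∣ f n - l := by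
  have key : ∀ m n, m ≤ n → (p : ℤ_[p]) ^ m ∣ f m - f n := by
    intro m n hmn
    induction n, hmn using Nat.le_induction with
    | base => simp
    | succ n hmn ih =>
      have : f m - f (n + 1) = (f m - f n) - (f (n + 1) - f n) := by ring
      rw [this]
      exact dvd_sub ih ((pow_dvd_pow _ hmn).trans (hf n))
  obtain ⟨l, hl⟩ := IsPrecomplete.prec (I := IsLocalRing.maximalIdeal ℤ_[p]) inferInstance (f := f)
    fun {m n} hmn => by
      rw [SModEq.sub_mem, PadicInt.maximalIdeal_eq_span_p, Ideal.span_singleton_pow, smul_eq_mul,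
        Ideal.mul_top, Ideal.mem_span_singleton]
      exact key m n hmn
  refine ⟨l, fun n => ?_⟩
  have := hl n
  rwa [SModEq.sub_mem, PadicInt.maximalIdeal_eq_span_p, Ideal.span_singleton_pow, smul_eq_mul,
    Ideal.mul_top, Ideal.mem_span_singleton] at this

lemma PadicInt.eq_zero_of_pow_dvd (p : ℕ) [Fact p.Prime] (x : ℤ_[p])
    (hx : ∀ n : ℕ, (p : ℤ_[p]) ^ n ∣ x) : x = 0 := by
  refine IsHausdorff.haus (I := IsLocalRing.maximalIdeal ℤ_[p]) inferInstance x fun n => ?_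
  rw [SModEq.zero, PadicInt.maximalIdeal_eq_span_p, Ideal.span_singleton_pow, smul_eq_mul,
    Ideal.mul_top, Ideal.mem_span_singleton]
  exact hx n

/-- Multiplication by `p ^ n` in `o` is scalar multiplication by an element of `ℤ_p`, so it acts
coordinatewise. In this way completeness is inherited from `ℤ_p`. -/
lemma pow_dvd_iff_repr {p : ℕ} [Fact p.Prime] {o ι : Type*} [CommRing o] [Algebra ℤ_[p] o]
    (b : Module.Basis ι ℤ_[p] o) (n : ℕ) (x : o) :
    (p : o) ^ n ∣ x ↔ ∀ i, (p : ℤ_[p]) ^ n ∣ b.repr x i := by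
  have hp : ∀ y : o, (p : o) ^ n * y = ((p : ℤ_[p]) ^ n) • y := fun y => by
    rw [Algebra.smul_def]; simp
  constructor
  · rintro ⟨y, rfl⟩ i
    rw [hp, map_smul]
    exact ⟨b.repr y i, rfl⟩
  · intro h
    choose c hc using h
    refine ⟨(b.repr.symm (Finsupp.onFinset (b.repr x).support c fun i hi => ?_)), ?_⟩
    · rw [Finsupp.mem_support_iff, hc]
      exact mul_ne_zero (pow_ne_zero _ (by exact_mod_cast (Fact.out : p.Prime).ne_zero)) hi
    · rw [hp, ← map_smul, LinearEquiv.eq_symm_apply]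
      ext i
      simpa using hc i

lemma isAdicComplete_of_free (p : ℕ) [Fact p.Prime] (o : Type*) [CommRing o] [Algebra ℤ_[p] o]
    [Module.Free ℤ_[p] o] [Module.Finite ℤ_[p] o] : IsAdicComplete (Ideal.span {(p : o)}) o := by
  let b := Module.Free.chooseBasis ℤ_[p] o
  refine isAdicComplete_span_singleton _ (fun x hx => ?_) fun f hf => ?_
  · refine b.ext_elem fun i => ?_
    rw [map_zero, Finsupp.zero_apply]
    exact PadicInt.eq_zero_of_pow_dvd p _ fun n => (pow_dvd_iff_repr b n x).mp (hx n) i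
  · have h : ∀ i, ∃ l, ∀ n, (p : ℤ_[p]) ^ n ∣ b.repr (f n) i - l := fun i =>
      PadicInt.exists_limit p (fun n => b.repr (f n) i) fun n => by
        have := (pow_dvd_iff_repr b n _).mp (hf n) i
        simpa using this
    choose l hl using h
    refine ⟨b.repr.symm (Finsupp.equivFunOnFinite.symm l), fun n => ?_⟩
    rw [pow_dvd_iff_repr b]
    intro i
    simpa using hl i n

/-- The quotient is killed by `p`, hence is a finitely generated module over the field with `p`
elements. -/
lemma finite_quotient_of_mem {p : ℕ} [Fact p.Prime] {o : Type*} [CommRing o] [Algebra ℤ_[p] o]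
    [Module.Finite ℤ_[p] o] (I : Ideal o) (hI : (p : o) ∈ I) : Finite (o ⧸ I) := by
  let J : Ideal ℤ_[p] := IsLocalRing.maximalIdeal ℤ_[p]
  have hJ : J ≤ Module.annihilator ℤ_[p] (o ⧸ I) := by
    rw [show J = _ from PadicInt.maximalIdeal_eq_span_p, Ideal.span_singleton_le_iff_mem,
      Module.mem_annihilator]
    rintro ⟨y⟩
    change Ideal.Quotient.mk I ((p : ℤ_[p]) • y) = 0
    rw [Ideal.Quotient.eq_zero_iff_mem, Algebra.smul_def, map_natCast]
    exact I.mul_mem_right _ hI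
  let : Module (ℤ_[p] ⧸ J) (o ⧸ I) := Module.IsTorsionBySet.module
    ((Module.isTorsionBySet_iff_subset_annihilator (M := o ⧸ I) (s := (J : Set ℤ_[p]))).mpr hJ)
  have : IsScalarTower ℤ_[p] (ℤ_[p] ⧸ J) (o ⧸ I) :=
    ⟨fun x y m => by
      obtain ⟨y, rfl⟩ := Ideal.Quotient.mk_surjective y
      exact mul_smul x y m⟩
  have : Module.Finite (ℤ_[p] ⧸ J) (o ⧸ I) := Module.Finite.of_restrictScalars_finite ℤ_[p] _ _
  have : Finite (ℤ_[p] ⧸ J) :=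
    Finite.of_equiv (ZMod p) (PadicInt.residueField (p := p)).symm.toEquiv
  exact Module.finite_of_finite (ℤ_[p] ⧸ J)

/-- A domain which is `I`-adically complete with finite quotient by `I` is local. -/
lemma isLocalRing_of_isAdicComplete {o : Type*} [CommRing o] [IsDomain o] (I : Ideal o)
    [IsAdicComplete I o] [Finite (o ⧸ I)] (hI : I ≠ ⊤) : IsLocalRing o := by
  have hjac : I ≤ Ideal.jacobson ⊥ := IsAdicComplete.le_jacobson_bot I
  have hunit : ∀ x y : o, x - y ∈ I → IsUnit y → IsUnit x := by
    intro x y hxy hy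
    have := isLocalHom_of_le_jacobson_bot I hjac
    refine IsUnit.of_map (Ideal.Quotient.mk I) x ?_
    rw [Ideal.Quotient.eq.mpr hxy]
    exact hy.map _
  -- Some power `y ^ N` of the residue class `y` of `x` is idempotent, because the quotient is
  -- finite. Hensel's lemma lifts it to a root of `X² - X` in the domain `o`, which is `0` or `1`:
  -- either `x ^ N` lies in `I`, or `x ^ N` is congruent to `1` and `x` is a unit. Hence the
  -- nonunits lie in the radical of `I`.
  have key : ∀ x : o, ¬ IsUnit x → ∃ N, x ^ N ∈ I := by
    intro x hx
    obtain ⟨m, n, hmn, heq⟩ := Finite.exists_ne_map_eq_of_infinite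
      (fun n : ℕ => Ideal.Quotient.mk I x ^ n)
    obtain ⟨m, d, hd, heq⟩ : ∃ m d : ℕ, 0 < d ∧
        Ideal.Quotient.mk I x ^ m = Ideal.Quotient.mk I x ^ (m + d) := by
      rcases lt_or_gt_of_ne hmn with h | h
      · exact ⟨m, n - m, by omega, by rw [Nat.add_sub_cancel' h.le]; exact heq⟩
      · exact ⟨n, m - n, by omega, by rw [Nat.add_sub_cancel' h.le]; exact heq.symm⟩
    set y := Ideal.Quotient.mk I x with hy
    have h1 : ∀ k j, y ^ (m + j) = y ^ (m + j + k * d) := by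
      intro k
      induction k with
      | zero => simp
      | succ k ih =>
        intro j
        rw [ih j, show m + j + k * d = m + (j + k * d) by ring, pow_add, heq, ← pow_add]
        congr 1; ring
    -- A multiple of the period `d` which is at least the preperiod `m`; this makes `y ^ N`
    -- idempotent.
    set N := (m + 1) * d with hN
    have hmN : m ≤ N := by nlinarith
    have hidem : y ^ N * y ^ N = y ^ N := by
      have := h1 (m + 1) (N - m)
      rw [Nat.add_sub_cancel' hmN] at this
      rw [← pow_add]
      exact this.symm
    have hN0 : N ≠ 0 := by positivity
    have hmon : (Polynomial.X ^ 2 - Polynomial.X : Polynomial o).Monic := by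
      monicity!
    obtain ⟨E, hE, hEx⟩ := HenselianRing.is_henselian (R := o) (I := I)
      (Polynomial.X ^ 2 - Polynomial.X) hmon (x ^ N)
      (by
        rw [← Ideal.Quotient.eq_zero_iff_mem]
        simp only [Polynomial.eval_sub, Polynomial.eval_pow, Polynomial.eval_X, map_sub, map_pow]
        rw [← hy, sq, hidem, sub_self])
      (by
        -- The derivative at an idempotent is its own inverse: `(2 y^N - 1)² = 1`.
        refine IsUnit.of_mul_eq_one (2 * y ^ N - 1) ?_
        simp only [Polynomial.derivative_X_pow,
          Polynomial.derivative_X, Polynomial.eval_sub, Polynomial.eval_mul, Polynomial.eval_pow,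
          Polynomial.eval_X, Nat.cast_ofNat, Polynomial.eval_ofNat, map_ofNat, Polynomial.eval_one,
          map_sub, map_mul, map_pow,
          map_one, ← hy]
        push_cast
        linear_combination 4 * hidem)
    simp only [Polynomial.IsRoot, Polynomial.eval_sub, Polynomial.eval_pow,
      Polynomial.eval_X] at hE
    rcases mul_eq_zero.mp (show E * (E - 1) = 0 by linear_combination hE) with h0 | h0
    · rw [h0, zero_sub, Ideal.neg_mem_iff] at hEx
      exact ⟨N, hEx⟩
    · refine absurd ((isUnit_pow_iff hN0).mp (hunit _ E ?_ ?_)) hx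
      · rw [← Ideal.neg_mem_iff, neg_sub]; exact hEx
      · rw [sub_eq_zero.mp h0]; exact isUnit_one
  refine IsLocalRing.of_nonunits_add fun a b ha hb => ?_
  obtain ⟨N, hN⟩ := key a ha
  obtain ⟨N', hN'⟩ := key b hb
  intro hab
  have ha' : a ∈ I.radical := ⟨N, hN⟩
  have hb' : b ∈ I.radical := ⟨N', hN'⟩
  have htop := Ideal.eq_top_of_isUnit_mem _ (add_mem ha' hb') hab
  exact hI (Ideal.radical_eq_top.mp htop)

lemma isDomain_of_isIntegralClosure (A L o : Type*) [CommRing A] [Field L] [CommRing o]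
    [Algebra A L] [Algebra A o] [Algebra o L] [IsIntegralClosure o A L] : IsDomain o :=
  (IsIntegralClosure.algebraMap_injective o A L).isDomain (algebraMap o L)

/-- The ring of integers of a finite extension of `ℚ_p` is a complete discrete valuation ring. -/
theorem discreteValuationRing_integers (p : ℕ) [Fact p.Prime] (L : Type*) [Field L]
    [Algebra ℚ_[p] L] [FiniteDimensional ℚ_[p] L]
    (o : Type*) [CommRing o] [Algebra ℤ_[p] o] [Algebra o L] [Algebra ℤ_[p] L]
    [IsScalarTower ℤ_[p] ℚ_[p] L] [IsScalarTower ℤ_[p] o L] [IsIntegralClosure o ℤ_[p] L] :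
    ∃ _ : IsDomain o, IsDiscreteValuationRing o ∧ IsFractionRing o L ∧
      IsAdicComplete (Ideal.span {(p : o)}) o ∧ (p : o) ≠ 0 ∧ ¬ IsUnit (p : o) ∧
      Finite (o ⧸ Ideal.span {(p : o)}) := by
  have hdom := isDomain_of_isIntegralClosure ℤ_[p] L o
  have : Module.IsTorsionFree ℤ_[p] L := Module.IsTorsionFree.trans_faithfulSMul ℤ_[p] ℚ_[p] L
  have : Module.Finite ℤ_[p] o := IsIntegralClosure.finite ℤ_[p] ℚ_[p] L o
  have : Module.Free ℤ_[p] o := IsIntegralClosure.module_free ℤ_[p] ℚ_[p] L o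
  have hcomp : IsAdicComplete (Ideal.span {(p : o)}) o := isAdicComplete_of_free p o
  have hp0 : (p : o) ≠ 0 := by
    have : CharZero L := charZero_of_injective_algebraMap (algebraMap ℚ_[p] L).injective
    intro h
    have h1 := congrArg (algebraMap o L) h
    rw [map_natCast, map_zero] at h1
    exact (Fact.out : p.Prime).ne_zero (by exact_mod_cast h1)
  have htop : Ideal.span {(p : o)} ≠ ⊤ := by
    intro h
    rw [h] at hcomp
    have := hcomp.subsingleton
    exact not_subsingleton o this
  have hpu : ¬ IsUnit (p : o) := fun h => htop (Ideal.span_singleton_eq_top.mpr h)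
  have hfin : Finite (o ⧸ Ideal.span {(p : o)}) :=
    finite_quotient_of_mem _ (Ideal.mem_span_singleton_self _)
  have : IsLocalRing o := isLocalRing_of_isAdicComplete _ htop
  have : IsDedekindDomain o := IsIntegralClosure.isDedekindDomain ℤ_[p] ℚ_[p] L o
  have hnf : ¬ IsField o := fun h => by
    let := h.toField
    exact hpu (IsUnit.mk0 _ hp0)
  have hiff : IsDiscreteValuationRing o ↔ IsDedekindDomain o :=
    (IsDiscreteValuationRing.TFAE o hnf).out 0 2
  exact ⟨hdom, hiff.mpr this,
    IsIntegralClosure.isFractionRing_of_finite_extension ℤ_[p] ℚ_[p] L o, hcomp, hp0, hpu, hfin⟩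

end CoeffRing

/-! ### The module `L/o`: injectivity, torsion and endomorphisms -/

section DVR

variable {o : Type*} [CommRing o] [IsDomain o] [IsDiscreteValuationRing o] {ϖ : o}

lemma mem_span_uniformizer_of_not_isUnit (hϖ : Irreducible ϖ) {x : o} (hx : ¬ IsUnit x) :
    x ∈ Ideal.span {ϖ} := by
  rw [← hϖ.maximalIdeal_eq]
  exact hx

variable (o) (L : Type*) [Field L] [Algebra o L] [IsFractionRing o L]

/-- The module `L/o`. -/
abbrev FracQuot : Type _ := L ⧸ LinearMap.range (Algebra.linearMap o L)

lemma FracQuot.divisible {a : o} (ha : a ≠ 0) (x : FracQuot o L) :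
    ∃ y : FracQuot o L, a • y = x := by
  obtain ⟨x, rfl⟩ := Submodule.mkQ_surjective _ x
  have ha' : algebraMap o L a ≠ 0 := by
    simpa using ha
  refine ⟨Submodule.mkQ _ ((algebraMap o L a)⁻¹ * x), ?_⟩
  rw [← map_smul, Algebra.smul_def, mul_inv_cancel_left₀ ha']

/-- A divisible module over a principal ideal domain is injective. -/
lemma FracQuot.baer : Module.Baer o (FracQuot o L) := by
  intro I g
  obtain ⟨a, ha⟩ := (IsPrincipalIdealRing.principal I).principal
  have ha : I = Ideal.span {a} := ha
  subst ha
  by_cases h0 : a = 0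
  · refine ⟨0, fun x hx => ?_⟩
    have : (⟨x, hx⟩ : Ideal.span {a}) = 0 := by
      subst h0
      simpa [Ideal.mem_span_singleton] using hx
    rw [this, map_zero]
    rfl
  · obtain ⟨y, hy⟩ := FracQuot.divisible o L h0 (g ⟨a, Ideal.mem_span_singleton_self a⟩)
    refine ⟨LinearMap.toSpanSingleton o _ y, fun x hx => ?_⟩
    obtain ⟨c, rfl⟩ := Ideal.mem_span_singleton.mp hx
    have : (⟨a * c, hx⟩ : Ideal.span {a}) = c • ⟨a, Ideal.mem_span_singleton_self a⟩ :=
      Subtype.ext (mul_comm a c)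
    rw [LinearMap.toSpanSingleton_apply, this, map_smul, ← hy, smul_smul, mul_comm]

variable {L}

lemma FracQuot.mk_eq_zero_iff {x : L} :
    (Submodule.Quotient.mk x : FracQuot o L) = 0 ↔ ∃ r : o, algebraMap o L r = x := by
  rw [Submodule.Quotient.mk_eq_zero]
  rfl

/-- Multiplication by `b⁻¹`, as a map from `o` to `L/o`. -/
noncomputable def FracQuot.divBy (b : o) : o →ₗ[o] FracQuot o L :=
  LinearMap.toSpanSingleton o _ (Submodule.Quotient.mk (algebraMap o L b)⁻¹)

variable {o}

lemma FracQuot.divBy_eq_zero_iff {b : o} (hb : b ≠ 0) {x : o} :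
    FracQuot.divBy o (L := L) b x = 0 ↔ b ∣ x := by
  have hb' : algebraMap o L b ≠ 0 := by simpa using hb
  rw [divBy, LinearMap.toSpanSingleton_apply, ← Submodule.Quotient.mk_smul, mk_eq_zero_iff]
  rw [Algebra.smul_def]
  constructor
  · rintro ⟨r, hr⟩
    refine ⟨r, IsFractionRing.injective o L ?_⟩
    rw [map_mul, hr]
    field_simp
  · rintro ⟨r, rfl⟩
    refine ⟨r, ?_⟩
    rw [map_mul]
    field_simp

lemma FracQuot.exists_divBy {b : o} (hb : b ≠ 0) {x : FracQuot o L} (hx : b • x = 0) :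
    ∃ r : o, FracQuot.divBy o (L := L) b r = x := by
  have hb' : algebraMap o L b ≠ 0 := by simpa using hb
  obtain ⟨x, rfl⟩ := Submodule.mkQ_surjective _ x
  rw [Submodule.mkQ_apply, ← Submodule.Quotient.mk_smul, mk_eq_zero_iff] at hx
  obtain ⟨r, hr⟩ := hx
  refine ⟨r, ?_⟩
  rw [divBy, LinearMap.toSpanSingleton_apply, ← Submodule.Quotient.mk_smul, Submodule.mkQ_apply]
  congr 1
  rw [Algebra.smul_def, hr, Algebra.smul_def]
  field_simp

lemma FracQuot.finite_torsion {b : o} (hb : b ≠ 0) [Finite (o ⧸ Ideal.span {b})] :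
    {x : FracQuot o L | b • x = 0}.Finite := by
  let g : (o ⧸ Ideal.span {b}) → FracQuot o L :=
    Quotient.lift (s := Submodule.quotientRel (Ideal.span {b})) (FracQuot.divBy o (L := L) b) (by
      intro x y hxy
      have h1 : x - y ∈ Ideal.span {b} := (Submodule.quotientRel_def _).mp hxy
      rw [← sub_eq_zero, ← map_sub, divBy_eq_zero_iff hb]
      exact Ideal.mem_span_singleton.mp h1)
  refine (Set.finite_range g).subset fun x hx => ?_
  obtain ⟨r, hr⟩ := exists_divBy hb hx
  exact ⟨Ideal.Quotient.mk _ r, hr⟩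

/-- If `o` is complete, the endomorphisms of `L/o` are the multiplications by elements of `o`. -/
lemma FracQuot.exists_smul {a : o} (ha0 : a ≠ 0) (ha : ¬ IsUnit a)
    [IsAdicComplete (Ideal.span {a}) o] (f : FracQuot o L →ₗ[o] FracQuot o L) :
    ∃ r : o, ∀ x, f x = r • x := by
  have hpow : ∀ n, a ^ n ≠ 0 := fun n => pow_ne_zero n ha0
  -- `L/o` is the union of the cyclic modules generated by the classes `u n` of `a⁻ⁿ`. On `u n` the
  -- endomorphism is multiplication by a scalar `r n`, unique modulo `a ^ n`. Since `a • u (n + 1) =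
  -- u n`, the scalars form a Cauchy sequence, and its limit is the required element.
  let u : ℕ → FracQuot o L := fun n => divBy o (L := L) (a ^ n) 1
  have hu : ∀ n, a ^ n • u n = 0 := fun n => by
    rw [← map_smul, divBy_eq_zero_iff (hpow n)]
    simp
  have hus : ∀ n, a • u (n + 1) = u n := fun n => by
    have h1 : algebraMap o L a ≠ 0 := by simpa using ha0
    simp only [u, divBy, LinearMap.toSpanSingleton_apply, one_smul]
    rw [← Submodule.Quotient.mk_smul]
    congr 1
    rw [Algebra.smul_def]
    simp only [map_pow]
    field_simp
    ring
  have huu : ∀ n r, r • u n = divBy o (L := L) (a ^ n) r := fun n r => by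
    rw [← map_smul, smul_eq_mul, mul_one]
  have h : ∀ n, ∃ r : o, f (u n) = r • u n := fun n => by
    obtain ⟨r, hr⟩ := exists_divBy (L := L) (hpow n) (x := f (u n))
      (by rw [← map_smul, hu, map_zero])
    exact ⟨r, by rw [← hr, huu]⟩
  choose r hr using h
  have hcauchy : ∀ n, a ^ n ∣ r (n + 1) - r n := fun n => by
    rw [← divBy_eq_zero_iff (L := L) (hpow n), ← huu, sub_smul, ← hr, sub_eq_zero, ← hus n,
      map_smul, hr, smul_comm]
  have hmono : ∀ m n, m ≤ n → a ^ m ∣ r m - r n := by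
    intro m n hmn
    induction n, hmn using Nat.le_induction with
    | base => simp
    | succ n hmn ih =>
      have : r m - r (n + 1) = (r m - r n) - (r (n + 1) - r n) := by ring
      rw [this]
      exact dvd_sub ih ((pow_dvd_pow _ hmn).trans (hcauchy n))
  obtain ⟨l, hl⟩ := IsPrecomplete.prec (I := Ideal.span {a}) inferInstance (f := r)
    fun {m n} hmn => by
      rw [SModEq.sub_mem, Ideal.span_singleton_pow, smul_eq_mul,
        Ideal.mul_top, Ideal.mem_span_singleton]
      exact hmono m n hmn
  refine ⟨l, fun x => ?_⟩
  -- Every nonzero denominator divides a power of the nonunit `a`, as `o` is a discrete valuation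
  -- ring.
  have htor : ∃ n, a ^ n • x = 0 := by
    obtain ⟨x, rfl⟩ := Submodule.mkQ_surjective _ x
    obtain ⟨c, d, hd, rfl⟩ := IsFractionRing.div_surjective (A := o) x
    have hd0 : d ≠ 0 := nonZeroDivisors.ne_zero hd
    obtain ⟨ϖ, hϖ⟩ := IsDiscreteValuationRing.exists_irreducible o
    obtain ⟨n, hn⟩ := IsDiscreteValuationRing.associated_pow_irreducible hd0 hϖ
    obtain ⟨y, hy⟩ : d ∣ a ^ n := by
      rw [hn.dvd_iff_dvd_left]
      exact pow_dvd_pow_of_dvd (Ideal.mem_span_singleton.mp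
        (mem_span_uniformizer_of_not_isUnit hϖ ha)) n
    refine ⟨n, ?_⟩
    rw [Submodule.mkQ_apply, ← Submodule.Quotient.mk_smul, mk_eq_zero_iff]
    refine ⟨y * c, ?_⟩
    have hd' : algebraMap o L d ≠ 0 := by simpa using hd0
    rw [Algebra.smul_def, hy]
    simp only [map_mul]
    field_simp
  obtain ⟨n, hn⟩ := htor
  obtain ⟨c, rfl⟩ := exists_divBy (hpow n) hn
  have hln := hl n
  rw [SModEq.sub_mem, Ideal.span_singleton_pow, smul_eq_mul, Ideal.mul_top,
    Ideal.mem_span_singleton] at hln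
  rw [← huu, map_smul, hr, smul_comm l, ← sub_eq_zero, ← smul_sub, ← sub_smul, huu n (_ - _),
    (divBy_eq_zero_iff (hpow n)).mpr hln, smul_zero]

/-- If `r - s` kills the classes of all `ϖ⁻ⁿ`, it is divisible by all powers of `ϖ`, hence zero. -/
lemma FracQuot.smul_injective {r s : o} (h : ∀ x : FracQuot o L, r • x = s • x) : r = s := by
  obtain ⟨ϖ, hϖ⟩ := IsDiscreteValuationRing.exists_irreducible o
  refine sub_eq_zero.mp
    (IsHausdorff.haus (I := IsLocalRing.maximalIdeal o) inferInstance _ fun n => ?_)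
  rw [SModEq.zero, hϖ.maximalIdeal_eq, Ideal.span_singleton_pow, smul_eq_mul,
    Ideal.mul_top, Ideal.mem_span_singleton,
    ← FracQuot.divBy_eq_zero_iff (L := L) (pow_ne_zero n hϖ.ne_zero), map_sub, sub_eq_zero,
    ← mul_one r, ← mul_one s, ← smul_eq_mul, ← smul_eq_mul, map_smul, map_smul]
  exact h _

end DVR

/-! ### Integration of locally constant functions -/

noncomputable section

section MonoidAlgebraIntegral

variable {o G G' Q : Type*} [CommRing o] [AddCommGroup Q] [Module o Q]

/-- The `o`-linear extension `o[G] → Q` of a function `G → Q`. -/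
def MonoidAlgebra.integral (F : G → Q) : MonoidAlgebra o G →ₗ[o] Q :=
  Finsupp.linearCombination o F ∘ₗ (MonoidAlgebra.coeffLinearEquiv o).toLinearMap

@[simp] lemma MonoidAlgebra.integral_single (F : G → Q) (g : G) (r : o) :
    MonoidAlgebra.integral F (MonoidAlgebra.single g r) = r • F g := by
  simp [MonoidAlgebra.integral]

lemma MonoidAlgebra.integral_mapDomain (f : G → G') (F : G' → Q) (x : MonoidAlgebra o G) :
    MonoidAlgebra.integral F (MonoidAlgebra.mapDomain f x) =
      MonoidAlgebra.integral (F ∘ f) x := by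
  induction x using MonoidAlgebra.induction_linear with
  | zero => simp
  | add x y hx hy => simp [MonoidAlgebra.mapDomain_add, hx, hy]
  | single g r => simp

lemma MonoidAlgebra.integral_mul [Monoid G] (F : G → Q) (x y : MonoidAlgebra o G) :
    MonoidAlgebra.integral F (x * y) =
      MonoidAlgebra.integral (fun g => MonoidAlgebra.integral (fun h => F (g * h)) y) x := by
  induction x using MonoidAlgebra.induction_linear with
  | zero => simp
  | add x x' hx hy => simp [add_mul, hx, hy]
  | single g r =>
    rw [integral_single]
    induction y using MonoidAlgebra.induction_linear with
    | zero => simp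
    | add y y' hx hy => simp [mul_add, hx, hy]
    | single h s => simp [MonoidAlgebra.single_mul_single, mul_smul]

lemma MonoidAlgebra.integral_add_fun (F F' : G → Q) (x : MonoidAlgebra o G) :
    MonoidAlgebra.integral (F + F') x =
      MonoidAlgebra.integral F x + MonoidAlgebra.integral F' x := by
  induction x using MonoidAlgebra.induction_linear with
  | zero => simp
  | add x y hx hy => rw [map_add, hx, hy, map_add, map_add]; abel
  | single g r => simp

lemma MonoidAlgebra.integral_comp {Q' : Type*} [AddCommGroup Q'] [Module o Q'] (f : Q →ₗ[o] Q')
    (F : G → Q) (x : MonoidAlgebra o G) :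
    MonoidAlgebra.integral (f ∘ F) x = f (MonoidAlgebra.integral F x) := by
  induction x using MonoidAlgebra.induction_linear with
  | zero => simp
  | add x y hx hy => simp [hx, hy]
  | single g r => simp

lemma MonoidAlgebra.integral_indicator [DecidableEq G] (g : G) (x : MonoidAlgebra o G) :
    MonoidAlgebra.integral (fun h => if h = g then (1 : o) else 0) x = x.coeff g := by
  induction x using MonoidAlgebra.induction_linear with
  | zero => simp
  | add x y hx hy => simp [hx, hy]
  | single h r => simp [Finsupp.single_apply]

end MonoidAlgebraIntegral

section LocConst

variable (o H Q : Type*) [CommRing o] [Group H] [TopologicalSpace H] [AddCommGroup Q] [Module o Q]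

/-- The functions on `H` which are invariant under an open normal subgroup. -/
def LocConst : Submodule o (H → Q) where
  carrier := {F | ∃ U : OpenNormalSubgroup H, ∀ h, ∀ u ∈ U, F (h * u) = F h}
  add_mem' := by
    rintro F F' ⟨U, hU⟩ ⟨V, hV⟩
    exact ⟨U ⊓ V, fun h u hu => by simp [hU h u hu.1, hV h u hu.2]⟩
  zero_mem' := ⟨⟨⊤, inferInstanceAs (⊤ : Subgroup H).Normal⟩, fun _ _ _ => rfl⟩
  smul_mem' := by
    rintro r F ⟨U, hU⟩
    exact ⟨U, fun h u hu => by simp [hU h u hu]⟩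

variable {o H Q}

lemma LocConst.const_mem (q : Q) : (fun _ => q) ∈ LocConst o H Q :=
  ⟨⟨⊤, inferInstanceAs (⊤ : Subgroup H).Normal⟩, fun _ _ _ => rfl⟩

lemma LocConst.mul_fun {F : H → o} {F' : H → Q} (hF : F ∈ LocConst o H o)
    (hF' : F' ∈ LocConst o H Q) : (fun h => F h • F' h) ∈ LocConst o H Q := by
  obtain ⟨U, hU⟩ := hF
  obtain ⟨V, hV⟩ := hF'
  exact ⟨U ⊓ V, fun h u hu => by
    change F (h * u) • F' (h * u) = F h • F' h
    rw [hU h u hu.1, hV h u hu.2]⟩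

lemma LocConst.comp_mul_left {F : H → Q} (hF : F ∈ LocConst o H Q) (g : H) :
    (fun h => F (g * h)) ∈ LocConst o H Q := by
  obtain ⟨U, hU⟩ := hF
  exact ⟨U, fun h u hu => by
    change F (g * (h * u)) = F (g * h)
    rw [← mul_assoc, hU _ u hu]⟩

lemma LocConst.comp_hom {H' : Type*} [Group H'] [TopologicalSpace H'] {F : H → Q}
    (hF : F ∈ LocConst o H Q) (f : H' →* H) (hf : Continuous f) : F ∘ f ∈ LocConst o H' Q := by
  obtain ⟨U, hU⟩ := hF
  refine ⟨IwasawaAlgebra.comapOpenNormal f hf U, fun h u hu => ?_⟩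
  simp only [Function.comp_apply, map_mul]
  exact hU _ _ hu

open Classical in
lemma LocConst.indicator_mem (U : OpenNormalSubgroup H) (q : H ⧸ U.toSubgroup) (x : Q) :
    (fun h : H => if (h : H ⧸ U.toSubgroup) = q then x else 0) ∈ LocConst o H Q :=
  ⟨U, fun h u hu => by
    have : ((h * u : H) : H ⧸ U.toSubgroup) = h := by
      rw [QuotientGroup.eq]
      simpa using U.toSubgroup.inv_mem hu
    simp only [this]⟩

end LocConst

namespace IwasawaAlgebra

variable {o H Q : Type*} [CommRing o] [Group H] [TopologicalSpace H] [AddCommGroup Q] [Module o Q]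

lemma out_invariant {U : OpenNormalSubgroup H} {F : H → Q} (hU : ∀ h, ∀ u ∈ U, F (h * u) = F h)
    (h : H) : F (Quotient.out (h : H ⧸ U.toSubgroup)) = F h := by
  obtain ⟨u, hu⟩ := QuotientGroup.mk_out_eq_mul U.toSubgroup h
  rw [hu, hU h u u.2]

open Classical in
/-- The integral of a locally constant function `F` with respect to the measure `a ∈ o[[H]]`. -/
def integral (a : IwasawaAlgebra o H) (F : H → Q) : Q :=
  if h : ∃ U : OpenNormalSubgroup H, ∀ h, ∀ u ∈ U, F (h * u) = F h then
    MonoidAlgebra.integral (fun q : H ⧸ h.choose.toSubgroup => F q.out) (a.proj h.choose)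
  else 0

/-- The compatibility of the components of `a` makes the Riemann sums agree at all levels, so the
choice of a subgroup in `integral` is immaterial. -/
lemma integral_proj_eq_of_le (a : IwasawaAlgebra o H) {F : H → Q} {U V : OpenNormalSubgroup H}
    (hle : U.toSubgroup ≤ V.toSubgroup) (hV : ∀ h, ∀ u ∈ V, F (h * u) = F h) :
    MonoidAlgebra.integral (fun q : H ⧸ U.toSubgroup => F q.out) (a.proj U) =
      MonoidAlgebra.integral (fun q : H ⧸ V.toSubgroup => F q.out) (a.proj V) := by
  have h1 : a.proj V = MonoidAlgebra.mapDomain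
      (QuotientGroup.map U.toSubgroup V.toSubgroup (MonoidHom.id H) hle) (a.proj U) :=
    (a.2 U V hle).symm
  rw [h1, MonoidAlgebra.integral_mapDomain]
  congr 2
  funext q
  obtain ⟨h, rfl⟩ := QuotientGroup.mk_surjective q
  change _ = F (Quotient.out (h : H ⧸ V.toSubgroup))
  rw [out_invariant hV, out_invariant (U := U) fun h u hu => hV h u (hle hu)]

lemma integral_eq (a : IwasawaAlgebra o H) {F : H → Q} {U : OpenNormalSubgroup H}
    (hU : ∀ h, ∀ u ∈ U, F (h * u) = F h) :
    integral a F = MonoidAlgebra.integral (fun q : H ⧸ U.toSubgroup => F q.out) (a.proj U) := by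
  have h : ∃ U : OpenNormalSubgroup H, ∀ h, ∀ u ∈ U, F (h * u) = F h := ⟨U, hU⟩
  rw [integral, dif_pos h]
  set V := h.choose
  rw [← integral_proj_eq_of_le a (U := U ⊓ V) inf_le_left hU,
    ← integral_proj_eq_of_le a (U := U ⊓ V) inf_le_right h.choose_spec]

lemma integral_eq_zero_of_proj (a : IwasawaAlgebra o H) {F : H → Q} {U : OpenNormalSubgroup H}
    (hU : ∀ h, ∀ u ∈ U, F (h * u) = F h) (ha : a.proj U = 0) : integral a F = 0 := by
  rw [integral_eq a hU, ha, map_zero]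

lemma integral_add_left (a b : IwasawaAlgebra o H) {F : H → Q} (hF : F ∈ LocConst o H Q) :
    integral (a + b) F = integral a F + integral b F := by
  obtain ⟨U, hU⟩ := hF
  rw [integral_eq _ hU, integral_eq _ hU, integral_eq _ hU, ← map_add]
  rfl

lemma integral_smul_left (r : o) (a : IwasawaAlgebra o H) {F : H → Q} (hF : F ∈ LocConst o H Q) :
    integral (r • a) F = r • integral a F := by
  obtain ⟨U, hU⟩ := hF
  rw [integral_eq _ hU, integral_eq _ hU, ← map_smul]
  rfl

lemma integral_zero_left {F : H → Q} (hF : F ∈ LocConst o H Q) :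
    integral (0 : IwasawaAlgebra o H) F = 0 := by
  rw [← zero_smul o (0 : IwasawaAlgebra o H), integral_smul_left _ _ hF, zero_smul]

lemma integral_sum_left {ι : Type*} (s : Finset ι) (a : ι → IwasawaAlgebra o H) {F : H → Q}
    (hF : F ∈ LocConst o H Q) : integral (∑ i ∈ s, a i) F = ∑ i ∈ s, integral (a i) F := by
  classical
  induction s using Finset.induction_on with
  | empty => simpa using integral_zero_left hF
  | insert i s hi ih =>
    rw [Finset.sum_insert hi, Finset.sum_insert hi, integral_add_left _ _ hF, ih]

lemma integral_add (a : IwasawaAlgebra o H) {F F' : H → Q} (hF : F ∈ LocConst o H Q)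
    (hF' : F' ∈ LocConst o H Q) :
    integral a (fun h => F h + F' h) = integral a F + integral a F' := by
  obtain ⟨U, hU⟩ := hF
  obtain ⟨V, hV⟩ := hF'
  have hU' : ∀ h, ∀ u ∈ U ⊓ V, F (h * u) = F h := fun h u hu => hU h u hu.1
  have hV' : ∀ h, ∀ u ∈ U ⊓ V, F' (h * u) = F' h := fun h u hu => hV h u hu.2
  rw [integral_eq a hU', integral_eq a hV', integral_eq a (U := U ⊓ V) (F := fun h => F h + F' h)
    (fun h u hu => by rw [hU' h u hu, hV' h u hu]), ← MonoidAlgebra.integral_add_fun]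
  rfl

lemma integral_comp {Q' : Type*} [AddCommGroup Q'] [Module o Q'] (a : IwasawaAlgebra o H)
    {F : H → Q} (hF : F ∈ LocConst o H Q) (f : Q →ₗ[o] Q') :
    integral a (fun h => f (F h)) = f (integral a F) := by
  obtain ⟨U, hU⟩ := hF
  rw [integral_eq a hU, integral_eq a (U := U) (F := fun h => f (F h))
    (fun h u hu => by rw [hU h u hu]), ← MonoidAlgebra.integral_comp]
  rfl

lemma integral_smul (a : IwasawaAlgebra o H) {F : H → Q} (hF : F ∈ LocConst o H Q) (r : o) :
    integral a (fun h => r • F h) = r • integral a F :=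
  integral_comp a hF (LinearMap.lsmul o Q r)

lemma integral_zero (a : IwasawaAlgebra o H) : integral a (fun _ => (0 : Q)) = 0 := by
  have := integral_smul a (LocConst.const_mem (o := o) (H := H) (0 : Q)) 0
  simpa using this

lemma integral_sum (a : IwasawaAlgebra o H) {ι : Type*} (s : Finset ι) {F : ι → H → Q}
    (hF : ∀ i ∈ s, F i ∈ LocConst o H Q) :
    integral a (fun h => ∑ i ∈ s, F i h) = ∑ i ∈ s, integral a (F i) := by
  classical
  induction s using Finset.induction_on with
  | empty => simpa using integral_zero a
  | insert i s hi ih =>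
    have hs : ∀ i ∈ s, F i ∈ LocConst o H Q := fun j hj => hF j (Finset.mem_insert_of_mem hj)
    have hs' : (fun h => ∑ i ∈ s, F i h) ∈ LocConst o H Q := by
      have := (LocConst o H Q).sum_mem hs
      convert this using 1
      funext h
      simp
    rw [Finset.sum_insert hi, ← ih hs, ← integral_add a (hF i (Finset.mem_insert_self _ _)) hs']
    congr 1
    funext h
    rw [Finset.sum_insert hi]

lemma integral_dirac (h : H) {F : H → Q} (hF : F ∈ LocConst o H Q) :
    integral (dirac o h) F = F h := by
  obtain ⟨U, hU⟩ := hF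
  rw [integral_eq _ hU]
  change MonoidAlgebra.integral _ (MonoidAlgebra.single _ _) = _
  rw [MonoidAlgebra.integral_single, one_smul, out_invariant hU]

lemma dirac_one : dirac o (1 : H) = 1 := rfl

lemma dirac_mul (g h : H) : dirac o (g * h) = dirac o g * dirac o h := by
  refine Subtype.ext (funext fun U => ?_)
  change MonoidAlgebra.single ((g * h : H) : H ⧸ U.toSubgroup) (1 : o) =
    MonoidAlgebra.single (g : H ⧸ U.toSubgroup) (1 : o) *
      MonoidAlgebra.single (h : H ⧸ U.toSubgroup) (1 : o)
  rw [MonoidAlgebra.single_mul_single, one_mul]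
  rfl

lemma integral_one {F : H → Q} (hF : F ∈ LocConst o H Q) :
    integral (1 : IwasawaAlgebra o H) F = F 1 := by
  rw [← dirac_one (o := o), integral_dirac _ hF]

lemma integral_map {H' : Type*} [Group H'] [TopologicalSpace H'] (f : H' →* H)
    (hf : Continuous f) (a : IwasawaAlgebra o H') {F : H → Q} (hF : F ∈ LocConst o H Q) :
    integral (map o f hf a) F = integral a (F ∘ f) := by
  obtain ⟨U, hU⟩ := hF
  rw [integral_eq _ hU, integral_eq a (U := comapOpenNormal f hf U) (F := F ∘ f)
    (fun h u hu => by
      simp only [Function.comp_apply, map_mul]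
      exact hU _ _ hu)]
  change MonoidAlgebra.integral _ (MonoidAlgebra.mapDomain _ _) = _
  rw [MonoidAlgebra.integral_mapDomain]
  congr 2
  funext q
  obtain ⟨h, rfl⟩ := QuotientGroup.mk_surjective q
  change F (Quotient.out ((f h : H) : H ⧸ U.toSubgroup)) = (F ∘ f) _
  rw [out_invariant hU, out_invariant (U := comapOpenNormal f hf U) (F := F ∘ f)]
  · rfl
  · intro h u hu
    simp only [Function.comp_apply, map_mul]
    exact hU _ _ hu

/-- Since `U` is normal, `u` can be conjugated past `h`. The inner integral in the convolution
formula is therefore again locally constant. -/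
lemma integral_inner_invariant (b : IwasawaAlgebra o H) {F : H → Q} {U : OpenNormalSubgroup H}
    (hU : ∀ h, ∀ u ∈ U, F (h * u) = F h) (g u : H) (hu : u ∈ U) :
    integral b (fun h => F (g * u * h)) = integral b (fun h => F (g * h)) := by
  congr 1
  funext h
  have : g * u * h = g * h * (h⁻¹ * u * h) := by group
  rw [this, hU]
  have := U.isNormal'.conj_mem u hu h⁻¹
  rwa [inv_inv] at this

lemma integral_mul (a b : IwasawaAlgebra o H) {F : H → Q} (hF : F ∈ LocConst o H Q) :
    integral (a * b) F = integral a (fun g => integral b (fun h => F (g * h))) := by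
  obtain ⟨U, hU⟩ := hF
  rw [integral_eq _ hU, integral_eq a (U := U) (F := fun g => integral b (fun h => F (g * h)))
    (fun h u hu => integral_inner_invariant b hU h u hu)]
  change MonoidAlgebra.integral _ (a.proj U * b.proj U) = _
  rw [MonoidAlgebra.integral_mul]
  congr 2
  funext q
  rw [integral_eq b (U := U) (F := fun h => F (q.out * h))
    fun h u hu => by rw [← mul_assoc, hU _ u hu]]
  congr 2
  funext q'
  have : q * q' = ((q.out * q'.out : H) : H ⧸ U.toSubgroup) := by
    rw [QuotientGroup.mk_mul, QuotientGroup.out_eq', QuotientGroup.out_eq']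
  rw [this, out_invariant hU]

open Classical in
-- The coefficients of `a` are the measures of the cosets of `U`. Hence an element of `o[[H]]` is
-- determined by its integrals, and identities in `o[[H]]` can be verified on locally constant
-- functions.
lemma coeff_proj (a : IwasawaAlgebra o H) (U : OpenNormalSubgroup H) (q : H ⧸ U.toSubgroup) :
    (a.proj U).coeff q =
      integral a (fun h : H => if (h : H ⧸ U.toSubgroup) = q then (1 : o) else 0) := by
  rw [integral_eq a (U := U) (F := fun h : H => if (h : H ⧸ U.toSubgroup) = q then (1 : o) else 0),
    ← MonoidAlgebra.integral_indicator]
  · congr 2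
    funext q'
    rw [QuotientGroup.out_eq']
  · intro h u hu
    have : ((h * u : H) : H ⧸ U.toSubgroup) = h := by
      rw [QuotientGroup.eq]
      simpa using U.toSubgroup.inv_mem hu
    rw [this]

lemma ext_integral {a b : IwasawaAlgebra o H}
    (h : ∀ F ∈ LocConst o H o, integral a F = integral b F) : a = b := by
  refine Subtype.ext (funext fun U => MonoidAlgebra.ext (Finsupp.ext fun q => ?_))
  change (a.proj U).coeff q = (b.proj U).coeff q
  rw [coeff_proj, coeff_proj]
  exact h _ (LocConst.indicator_mem U q 1)

lemma locConst_eq_sum {F : H → Q} {U : OpenNormalSubgroup H} [Fintype (H ⧸ U.toSubgroup)]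
    [DecidableEq (H ⧸ U.toSubgroup)] (hU : ∀ h, ∀ u ∈ U, F (h * u) = F h) :
    F = ∑ q : H ⧸ U.toSubgroup, fun h : H => if (h : H ⧸ U.toSubgroup) = q then F q.out else 0 := by
  funext h
  rw [Finset.sum_apply, Finset.sum_ite_eq Finset.univ, if_pos (Finset.mem_univ _),
    out_invariant hU]

open Classical in
/-- If all quotients of `H` by open normal subgroups are finite, every linear functional on the
locally constant functions is a measure. -/
lemma exists_integral_eq [∀ U : OpenNormalSubgroup H, Finite (H ⧸ U.toSubgroup)]
    (l : LocConst o H o →ₗ[o] o) :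
    ∃ a : IwasawaAlgebra o H, ∀ F : LocConst o H o, integral a (F : H → o) = l F := by
  let ind (U : OpenNormalSubgroup H) (q : H ⧸ U.toSubgroup) : LocConst o H o :=
    ⟨_, LocConst.indicator_mem U q (1 : o)⟩
  have hfin : ∀ U : OpenNormalSubgroup H, Fintype (H ⧸ U.toSubgroup) := fun U => Fintype.ofFinite _
  -- The measure of a coset is the value of `l` on its indicator function. Compatibility of the
  -- components holds because the indicator function of a coset of `V` is the sum of those of the
  -- cosets of `U` inside it.
  let a : IwasawaAlgebra o H := ⟨fun U =>
      ∑ q : H ⧸ U.toSubgroup, MonoidAlgebra.single q (l (ind U q)),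
    fun U V hUV => by
      ext q
      rw [map_sum, MonoidAlgebra.coeff_sum, MonoidAlgebra.coeff_sum, Finset.sum_apply',
        Finset.sum_apply']
      simp only [MonoidAlgebra.mapDomainAlgHom_apply, MonoidAlgebra.mapDomain_single,
        MonoidAlgebra.coeff_single, Finsupp.single_apply]
      rw [Finset.sum_ite_eq' Finset.univ, if_pos (Finset.mem_univ _), ← Finset.sum_filter,
        ← map_sum]
      congr 1
      refine Subtype.ext (funext fun h => ?_)
      rw [AddSubmonoidClass.coe_finsetSum, Finset.sum_apply]
      simp only [ind]
      rw [Finset.sum_ite_eq]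
      refine if_congr ?_ rfl rfl
      rw [Finset.mem_filter]
      exact ⟨fun h => h.2, fun h => ⟨Finset.mem_univ _, h⟩⟩⟩
  refine ⟨a, fun F => ?_⟩
  obtain ⟨F, U, hU⟩ := F
  rw [integral_eq a hU]
  change MonoidAlgebra.integral _ (∑ q : H ⧸ U.toSubgroup, MonoidAlgebra.single q (l (ind U q))) = _
  rw [map_sum]
  simp only [MonoidAlgebra.integral_single, smul_eq_mul]
  have : (⟨F, U, hU⟩ : LocConst o H o) = ∑ q : H ⧸ U.toSubgroup, F q.out • ind U q := by
    refine Subtype.ext ?_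
    rw [AddSubmonoidClass.coe_finsetSum]
    refine (locConst_eq_sum hU).trans ?_
    refine Finset.sum_congr rfl fun q _ => funext fun h => ?_
    simp [ind]
  rw [this, map_sum]
  simp [mul_comm]

end IwasawaAlgebra

end

/-! ### The dual of a smooth representation -/

noncomputable section

section SmoothDual

variable {o H M Q : Type*} [CommRing o] [Group H] [TopologicalSpace H] [AddCommMonoid M]
  [Module o M] [AddCommGroup Q] [Module o Q]

/-- Every vector is fixed by an open normal subgroup. -/
def IsSmooth (ρ : H →* Module.End o M) : Prop :=
  ∀ c : M, ∃ U : OpenNormalSubgroup H, ∀ u ∈ U, ρ u c = c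

variable {ρ : H →* Module.End o M}

/-- The element `(h u)⁻¹` is `h⁻¹` times a conjugate of `u⁻¹`, and this conjugate lies in `U` and
fixes `c`. -/
lemma smooth_orbit_invariant (f : M → Q) {c : M} {U : OpenNormalSubgroup H}
    (hU : ∀ u ∈ U, ρ u c = c) (h u : H) (hu : u ∈ U) : f (ρ (h * u)⁻¹ c) = f (ρ h⁻¹ c) := by
  have h1 : (h * u)⁻¹ = h⁻¹ * (h * u⁻¹ * h⁻¹) := by group
  have h2 : ρ (h * u⁻¹ * h⁻¹) c = c := hU _ (U.isNormal'.conj_mem _ (inv_mem hu) h)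
  rw [h1, map_mul, Module.End.mul_apply, h2]

lemma IsSmooth.locConst (hρ : IsSmooth ρ) (f : M → Q) (c : M) :
    (fun h => f (ρ h⁻¹ c)) ∈ LocConst o H Q := by
  obtain ⟨U, hU⟩ := hρ c
  exact ⟨U, fun h u hu => smooth_orbit_invariant f hU h u hu⟩

/-- The action of `a ∈ o[[H]]` on the dual of a smooth representation. -/
def smoothSMul (hρ : IsSmooth ρ) (a : IwasawaAlgebra o H) (f : M →ₗ[o] Q) : M →ₗ[o] Q where
  toFun c := a.integral fun h => f (ρ h⁻¹ c)
  map_add' c c' := by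
    simp only [map_add]
    exact a.integral_add (hρ.locConst f c) (hρ.locConst f c')
  map_smul' r c := by
    simp only [map_smul, RingHom.id_apply]
    exact a.integral_smul (hρ.locConst f c) r

/-- The `o[[H]]`-module structure on the dual of a smooth representation. -/
@[reducible] def smoothModule (hρ : IsSmooth ρ) : Module (IwasawaAlgebra o H) (M →ₗ[o] Q) where
  smul := smoothSMul hρ
  one_smul f := LinearMap.ext fun c => by
    change IwasawaAlgebra.integral (1 : IwasawaAlgebra o H) (fun h => f (ρ h⁻¹ c)) = f c
    rw [IwasawaAlgebra.integral_one (hρ.locConst f c), inv_one, map_one, Module.End.one_apply]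
  mul_smul a b f := LinearMap.ext fun c => by
    change IwasawaAlgebra.integral (a * b) (fun h => f (ρ h⁻¹ c)) =
      a.integral fun g => b.integral fun h => f (ρ h⁻¹ (ρ g⁻¹ c))
    rw [IwasawaAlgebra.integral_mul _ _ (hρ.locConst f c)]
    simp only [mul_inv_rev, map_mul, Module.End.mul_apply]
  smul_zero a := LinearMap.ext fun c => a.integral_zero
  smul_add a f g := LinearMap.ext fun c => a.integral_add (hρ.locConst f c) (hρ.locConst g c)
  add_smul a b f := LinearMap.ext fun c => a.integral_add_left b (hρ.locConst f c)
  zero_smul f := LinearMap.ext fun c => IwasawaAlgebra.integral_zero_left (hρ.locConst f c)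

lemma smoothModule_tower (hρ : IsSmooth ρ) :
    letI := smoothModule (Q := Q) hρ
    IsScalarTower o (IwasawaAlgebra o H) (M →ₗ[o] Q) := by
  let := smoothModule (Q := Q) hρ
  exact ⟨fun r a f => LinearMap.ext fun c => a.integral_smul_left r (hρ.locConst f c)⟩

end SmoothDual

/-! ### Generators of the dual of a smooth torsion representation -/

section Generation

lemma Module.finite_of_smul_eq_zero {o M : Type*} [CommRing o] [AddCommGroup M] [Module o M]
    [Module.Finite o M] (b : o) [Finite (o ⧸ Ideal.span {b})] (hb : ∀ m : M, b • m = 0) :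
    Finite M := by
  have ht : Module.IsTorsionBySet o M (Ideal.span {b} : Ideal o) := by
    rintro m ⟨a, ha⟩
    obtain ⟨c, rfl⟩ := Ideal.mem_span_singleton.mp ha
    change (b * c) • m = 0
    rw [mul_comm, mul_smul, hb, smul_zero]
  let : Module (o ⧸ Ideal.span {b}) M := ht.module
  have : IsScalarTower o (o ⧸ Ideal.span {b}) M :=
    ⟨fun x y m => by
      obtain ⟨y, rfl⟩ := Ideal.Quotient.mk_surjective y
      exact mul_smul x y m⟩
  have : Module.Finite (o ⧸ Ideal.span {b}) M := Module.Finite.of_restrictScalars_finite o _ _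
  exact Module.finite_of_finite (o ⧸ Ideal.span {b})

variable {o H M : Type*} [CommRing o] [IsDomain o] [IsDiscreteValuationRing o]
  [Group H] [TopologicalSpace H] [AddCommGroup M] [Module o M] {ρ : H →* Module.End o M}

lemma finite_quotient_span_pow {ϖ : o} [Finite (o ⧸ Ideal.span {ϖ})] (K : ℕ) :
    Finite (o ⧸ Ideal.span {ϖ ^ K}) := by
  rw [← Ideal.span_singleton_pow]
  exact Ideal.finite_quotient_pow ⟨{ϖ}, by simp⟩ K

lemma exists_torsion_ne_zero {ϖ : o} {c : M} (hc : c ≠ 0) {K : ℕ} (hK : ϖ ^ K • c = 0) :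
    ∃ j, ϖ ^ j • c ≠ 0 ∧ ϖ • ϖ ^ j • c = 0 := by
  classical
  have hex : ∃ K, ϖ ^ K • c = 0 := ⟨K, hK⟩
  have h0 : Nat.find hex ≠ 0 := fun h => by
    have := Nat.find_spec hex
    rw [h, pow_zero, one_smul] at this
    exact hc this
  refine ⟨Nat.find hex - 1, Nat.find_min hex (by omega), ?_⟩
  rw [smul_smul, ← pow_succ', Nat.sub_add_cancel (Nat.one_le_iff_ne_zero.mpr h0)]
  exact Nat.find_spec hex

/-- A nonzero submodule of a smooth torsion representation of a pro-`p`-group contains a nonzero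
invariant vector killed by `ϖ`. -/
lemma exists_invariant_torsion (p : ℕ) [Fact p.Prime] {ϖ : o} [Finite (o ⧸ Ideal.span {ϖ})]
    (hp : (p : o) ∈ Ideal.span {ϖ}) [∀ U : OpenNormalSubgroup H, Finite (H ⧸ U.toSubgroup)]
    (hpg : ∀ U : OpenNormalSubgroup H, IsPGroup p (H ⧸ U.toSubgroup)) (hρ : IsSmooth ρ)
    (htor : ∀ c : M, ∃ K, ϖ ^ K • c = 0) (S : Submodule o M) (hS : ∀ h, ∀ c ∈ S, ρ h c ∈ S)
    (hS0 : S ≠ ⊥) : ∃ c ∈ S, c ≠ 0 ∧ (∀ h, ρ h c = c) ∧ ϖ • c = 0 := by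
  obtain ⟨c, hcS, hc0⟩ := (Submodule.ne_bot_iff S).mp hS0
  obtain ⟨U, hU⟩ := hρ c
  obtain ⟨K, hK⟩ := htor c
  -- The orbit of `c` is finite because `U` fixes `c`. Its span `N` is thus finitely generated and
  -- killed by `ϖ ^ K`, hence finite.
  let N : Submodule o M := Submodule.span o (Set.range fun h => ρ h c)
  have hNS : N ≤ S := Submodule.span_le.mpr (by rintro _ ⟨h, rfl⟩; exact hS h c hcS)
  have hNfin : (Set.range fun h => ρ h c).Finite := by
    let g : H ⧸ U.toSubgroup → M := fun q => ρ q.out c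
    refine (Set.finite_range g).subset ?_
    rintro _ ⟨h, rfl⟩
    refine ⟨h, ?_⟩
    obtain ⟨u, hu⟩ := QuotientGroup.mk_out_eq_mul U.toSubgroup h
    change ρ (Quotient.out (h : H ⧸ U.toSubgroup)) c = ρ h c
    rw [hu, map_mul, Module.End.mul_apply, hU u u.2]
  have : Module.Finite o N := Module.Finite.iff_fg.mpr (Submodule.fg_span hNfin)
  have hNK : ∀ m ∈ N, ϖ ^ K • m = 0 := by
    intro m hm
    induction hm using Submodule.span_induction with
    | mem x hx => obtain ⟨h, rfl⟩ := hx; rw [← map_smul, hK, map_zero]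
    | zero => rw [smul_zero]
    | add x y _ _ hx hy => rw [smul_add, hx, hy, add_zero]
    | smul r x _ hx => rw [smul_comm, hx, smul_zero]
  have := finite_quotient_span_pow (ϖ := ϖ) K
  have hfinN : Finite N := Module.finite_of_smul_eq_zero (o := o) (ϖ ^ K)
    fun m => Subtype.ext (hNK m m.2)
  have hNρ : ∀ h, ∀ m ∈ N, ρ h m ∈ N := by
    intro h m hm
    induction hm using Submodule.span_induction with
    | mem x hx =>
      obtain ⟨h', rfl⟩ := hx
      refine Submodule.subset_span ⟨h * h', ?_⟩
      simp
    | zero => rw [map_zero]; exact N.zero_mem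
    | add x y _ _ hx hy => rw [map_add]; exact N.add_mem hx hy
    | smul r x _ hx => rw [map_smul]; exact N.smul_mem r hx
  have hNU : ∀ u ∈ U, ∀ m ∈ N, ρ u m = m := by
    intro u hu m hm
    induction hm using Submodule.span_induction with
    | mem x hx =>
      obtain ⟨h, rfl⟩ := hx
      have h1 : u * h = h * (h⁻¹ * u * h) := by group
      have h2 : ρ (h⁻¹ * u * h) c = c := hU _ (by
        have := U.isNormal'.conj_mem u hu h⁻¹
        rwa [inv_inv] at this)
      change ρ u (ρ h c) = ρ h c
      rw [← Module.End.mul_apply, ← map_mul, h1, map_mul, Module.End.mul_apply, h2]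
    | zero => rw [map_zero]
    | add x y _ _ hx hy => rw [map_add, hx, hy]
    | smul r x _ hx => rw [map_smul, hx]
  -- The `p`-group `H/U` acts on the `ϖ`-torsion `N'` of `N`, a finite group whose order is
  -- divisible by `p`. Since `0` is a fixed point, counting orbits modulo `p` provides another one.
  let N' : Submodule o M := N ⊓ Submodule.torsionBy o M ϖ
  have hN'ρ : ∀ h, ∀ m ∈ N', ρ h m ∈ N' := fun h m hm =>
    ⟨hNρ h m hm.1, by
      rw [SetLike.mem_coe, Submodule.mem_torsionBy_iff, ← map_smul,
        (Submodule.mem_torsionBy_iff _ _).mp hm.2, map_zero]⟩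
  have hfinN' : Finite N' := Finite.of_injective (Submodule.inclusion (inf_le_left : N' ≤ N))
    (Submodule.inclusion_injective _)
  let act : H →* Equiv.Perm N' :=
    { toFun h := ⟨fun m => ⟨ρ h m, hN'ρ h m m.2⟩, fun m => ⟨ρ h⁻¹ m, hN'ρ h⁻¹ m m.2⟩,
        fun m => Subtype.ext (by
          change ρ h⁻¹ (ρ h m) = m
          rw [← Module.End.mul_apply, ← map_mul, inv_mul_cancel, map_one, Module.End.one_apply]),
        fun m => Subtype.ext (by
          change ρ h (ρ h⁻¹ m) = m
          rw [← Module.End.mul_apply, ← map_mul, mul_inv_cancel, map_one, Module.End.one_apply])⟩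
      map_one' := Equiv.ext fun m => Subtype.ext (by
        change ρ 1 (m : M) = m
        rw [map_one, Module.End.one_apply])
      map_mul' g h := Equiv.ext fun m => Subtype.ext (by
        change ρ (g * h) (m : M) = ρ g (ρ h m)
        rw [map_mul, Module.End.mul_apply]) }
  let actU : H ⧸ U.toSubgroup →* Equiv.Perm N' := QuotientGroup.lift U.toSubgroup act fun u hu =>
    Equiv.ext fun m => Subtype.ext (hNU u hu m m.2.1)
  let : MulAction (H ⧸ U.toSubgroup) N' := MulAction.compHom N' actU
  obtain ⟨j, hj0, hj⟩ := exists_torsion_ne_zero hc0 hK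
  have hcN : c ∈ N := Submodule.subset_span ⟨1, by simp⟩
  let x : N' := ⟨ϖ ^ j • c, N.smul_mem _ hcN, (Submodule.mem_torsionBy_iff _ _).mpr hj⟩
  have hx0 : x ≠ 0 := fun h => hj0 (congrArg Subtype.val h)
  have hdvd : p ∣ Nat.card N' := by
    have h1 : addOrderOf x = p := addOrderOf_eq_prime (by
      obtain ⟨b, hb⟩ := Ideal.mem_span_singleton.mp hp
      refine Subtype.ext ?_
      change p • (x : M) = 0
      rw [← Nat.cast_smul_eq_nsmul o, hb, mul_comm, mul_smul]
      change b • ϖ • ϖ ^ j • c = 0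
      rw [hj, smul_zero]) hx0
    rw [← h1]
    exact addOrderOf_dvd_natCard x
  obtain ⟨b, hb, hb0⟩ := (hpg U).exists_fixed_point_of_prime_dvd_card_of_fixed_point N' hdvd
    (a := 0) (by
      intro q
      obtain ⟨h, rfl⟩ := QuotientGroup.mk_surjective q
      exact Subtype.ext (map_zero (ρ h)))
  refine ⟨b, hNS b.2.1, fun h => hb0 (Subtype.ext h.symm), fun h => ?_,
    (Submodule.mem_torsionBy_iff _ _).mp b.2.2⟩
  exact congrArg Subtype.val (hb (h : H ⧸ U.toSubgroup))

variable {L : Type*} [Field L] [Algebra o L] [IsFractionRing o L]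

/-- If `o` is complete, every linear functional `λ` on the locally constant `L/o`-valued functions
is given by a measure. -/
lemma exists_integral_eq_fracQuot {a : o} (ha0 : a ≠ 0) (ha : ¬ IsUnit a)
    [IsAdicComplete (Ideal.span {a}) o] [∀ U : OpenNormalSubgroup H, Finite (H ⧸ U.toSubgroup)]
    (l : LocConst o H (FracQuot o L) →ₗ[o] FracQuot o L) :
    ∃ b : IwasawaAlgebra o H, ∀ F : LocConst o H (FracQuot o L),
      b.integral (F : H → FracQuot o L) = l F := by
  classical
  -- For fixed `F` the map `x ↦ l (F x)` is an endomorphism of `L/o`, hence multiplication by a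
  -- scalar `r F`. The scalar depends linearly on `F`, and so defines an `o`-valued functional, to
  -- which `IwasawaAlgebra.exists_integral_eq` applies.
  let tens (F : LocConst o H o) : FracQuot o L →ₗ[o] LocConst o H (FracQuot o L) :=
    { toFun x := ⟨fun h => (F : H → o) h • x, LocConst.mul_fun F.2 (LocConst.const_mem x)⟩
      map_add' x y := Subtype.ext (funext fun h => smul_add _ _ _)
      map_smul' r x := Subtype.ext (funext fun h => smul_comm _ _ _) }
  have hr : ∀ F : LocConst o H o, ∃ r : o, ∀ x, l (tens F x) = r • x := fun F =>
    FracQuot.exists_smul ha0 ha (l ∘ₗ tens F)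
  choose r hr using hr
  let l' : LocConst o H o →ₗ[o] o :=
    { toFun := r
      map_add' F F' := FracQuot.smul_injective (L := L) fun x => by
        rw [← hr, add_smul, ← hr, ← hr, ← map_add]
        congr 1
        exact Subtype.ext (funext fun h => add_smul _ _ _)
      map_smul' s F := FracQuot.smul_injective (L := L) fun x => by
        rw [← hr, RingHom.id_apply, smul_eq_mul, mul_smul, ← hr, ← map_smul]
        congr 1
        exact Subtype.ext (funext fun h => mul_smul _ _ _) }
  obtain ⟨b, hb⟩ := IwasawaAlgebra.exists_integral_eq l'
  refine ⟨b, ?_⟩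
  rintro ⟨F, U, hU⟩
  have : Fintype (H ⧸ U.toSubgroup) := Fintype.ofFinite _
  let ind (q : H ⧸ U.toSubgroup) : LocConst o H o := ⟨_, LocConst.indicator_mem U q (1 : o)⟩
  have hF : ∀ h, F h = ∑ q : H ⧸ U.toSubgroup, (ind q : H → o) h • F q.out := fun h => by
    conv_lhs => rw [IwasawaAlgebra.locConst_eq_sum hU]
    rw [Finset.sum_apply]
    refine Finset.sum_congr rfl fun q _ => ?_
    simp [ind]
  have hF' : (⟨F, U, hU⟩ : LocConst o H (FracQuot o L)) =
      ∑ q : H ⧸ U.toSubgroup, tens (ind q) (F q.out) := by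
    refine Subtype.ext (funext fun h => ?_)
    rw [AddSubmonoidClass.coe_finsetSum, Finset.sum_apply]
    exact hF h
  rw [hF', map_sum]
  have : b.integral F =
      ∑ q : H ⧸ U.toSubgroup, b.integral fun h => (ind q : H → o) h • F q.out := by
    rw [← IwasawaAlgebra.integral_sum]
    · congr 1
      funext h
      exact hF h
    · exact fun q _ => LocConst.mul_fun (ind q).2 (LocConst.const_mem (F q.out))
  rw [← hF']
  change b.integral F = _
  rw [this]
  refine Finset.sum_congr rfl fun q _ => ?_
  rw [hr]
  change _ = l' (ind q) • _
  rw [← hb]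
  exact b.integral_comp (ind q).2 (LinearMap.toSpanSingleton o _ (F q.out))

/-- Generators of the dual of a smooth torsion representation `M` of a pro-`p`-group: it suffices
that they separate the `ϖ`-torsion invariants. -/
theorem exists_eq_sum_smoothSMul (p : ℕ) [Fact p.Prime] (hp0 : (p : o) ≠ 0) (hpu : ¬ IsUnit (p : o))
    [IsAdicComplete (Ideal.span {(p : o)}) o] {ϖ : o} (hϖ : Irreducible ϖ)
    [Finite (o ⧸ Ideal.span {ϖ})]
    [∀ U : OpenNormalSubgroup H, Finite (H ⧸ U.toSubgroup)]
    (hpg : ∀ U : OpenNormalSubgroup H, IsPGroup p (H ⧸ U.toSubgroup)) (hρ : IsSmooth ρ)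
    (htor : ∀ c : M, ∃ K, ϖ ^ K • c = 0) {n : ℕ} (f : Fin n → (M →ₗ[o] FracQuot o L))
    (hf : ∀ c : M, (∀ h, ρ h c = c) → ϖ • c = 0 → (∀ i, f i c = 0) → c = 0)
    (g : M →ₗ[o] FracQuot o L) :
    ∃ a : Fin n → IwasawaAlgebra o H, g = ∑ i, smoothSMul hρ (a i) (f i) := by
  -- A vector is sent to its matrix coefficients `h ↦ f i (h⁻¹ c)`. The kernel is stable under `H`;
  -- if it were nonzero, it would contain a nonzero invariant vector killed by `ϖ` and by all `f i`,
  -- contrary to `hf`.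
  let ι : M →ₗ[o] (Fin n → LocConst o H (FracQuot o L)) :=
    { toFun c i := ⟨_, hρ.locConst (f i) c⟩
      map_add' c c' := funext fun i => Subtype.ext (funext fun h => by
        change f i (ρ h⁻¹ (c + c')) = f i (ρ h⁻¹ c) + f i (ρ h⁻¹ c')
        simp)
      map_smul' r c := funext fun i => Subtype.ext (funext fun h => by
        change f i (ρ h⁻¹ (r • c)) = r • f i (ρ h⁻¹ c)
        simp) }
  have hι : ∀ c, c ∈ LinearMap.ker ι ↔ ∀ i h, f i (ρ h c) = 0 := fun c => by
    rw [LinearMap.mem_ker]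
    constructor
    · intro h i g
      have h1 := congrArg (fun F => (F i : H → FracQuot o L) g⁻¹) h
      change f i (ρ g⁻¹⁻¹ c) = 0 at h1
      rwa [inv_inv] at h1
    · intro h
      exact funext fun i => Subtype.ext (funext fun g => h i g⁻¹)
  have hinj : Function.Injective ι := by
    rw [← LinearMap.ker_eq_bot]
    by_contra hne
    obtain ⟨c, hc, hc0, hinv, hct⟩ := exists_invariant_torsion p
      (mem_span_uniformizer_of_not_isUnit hϖ hpu) hpg hρ htor (LinearMap.ker ι) (by
        intro h c hc
        rw [hι] at hc ⊢
        intro i g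
        rw [← Module.End.mul_apply, ← map_mul]
        exact hc i _) hne
    refine hc0 (hf c hinv hct fun i => ?_)
    have := (hι c).mp hc i 1
    rwa [map_one, Module.End.one_apply] at this
  -- As `L/o` is injective, `g` extends along `ι` to all tuples of locally constant functions. Each
  -- component of the extension is integration against a measure, and these measures are the
  -- coefficients.
  obtain ⟨l, hl⟩ := (FracQuot.baer o L).extension_property ι hinj g
  have hb := fun i => exists_integral_eq_fracQuot hp0 hpu
    (l ∘ₗ LinearMap.single o (fun _ : Fin n => LocConst o H (FracQuot o L)) i)
  choose a ha using hb
  refine ⟨a, LinearMap.ext fun c => ?_⟩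
  rw [← hl, LinearMap.comp_apply, LinearMap.sum_apply]
  have hs : ι c =
      ∑ i, LinearMap.single o (fun _ : Fin n => LocConst o H (FracQuot o L)) i (ι c i) := by
    simp only [LinearMap.coe_single]
    exact (Finset.univ_sum_single (ι c)).symm
  rw [hs, map_sum]
  exact Finset.sum_congr rfl fun i _ => (ha i (ι c i)).symm

end Generation

end

/-! ### Measures supported on cosets -/

noncomputable section

namespace IwasawaAlgebra

section Coset

variable {o H : Type*} [CommRing o] [Group H] [TopologicalSpace H]

open Classical in
/-- The function on `H` which is supported on the coset `g · α(H)`, where it is given by `F`. -/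
def cosetExtend (α : H →* H) (g : H) (F : H → o) (h : H) : o :=
  if hx : ∃ x, g * α x = h then F hx.choose else 0

lemma cosetExtend_apply {α : H →* H} (hinj : Function.Injective α) (g : H) (F : H → o) (x : H) :
    cosetExtend α g F (g * α x) = F x := by
  have hx : ∃ y, g * α y = g * α x := ⟨x, rfl⟩
  rw [cosetExtend, dif_pos hx]
  congr 1
  exact hinj (mul_left_cancel hx.choose_spec)

lemma cosetExtend_of_notMem {α : H →* H} {g h : H} (F : H → o) (hx : ¬ ∃ x, g * α x = h) :
    cosetExtend α g F h = 0 := by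
  rw [cosetExtend, dif_neg hx]

/-- If `F` is invariant under `U`, its extension is invariant under `α(U)`. This subgroup is open
because `α` is an open map, and normal because `H` is commutative. -/
lemma cosetExtend_mem (hcomm : ∀ a b : H, a * b = b * a) {α : H →* H}
    (hinj : Function.Injective α) (hopen : IsOpenMap α) (g : H) {F : H → o}
    (hF : F ∈ LocConst o H o) : cosetExtend α g F ∈ LocConst o H o := by
  obtain ⟨U, hU⟩ := hF
  let V : OpenNormalSubgroup H :=
    { toSubgroup := U.toSubgroup.map α
      isOpen' := hopen _ U.isOpen'
      isNormal' := ⟨fun n hn h => by rwa [hcomm h n, mul_inv_cancel_right]⟩ }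
  refine ⟨V, ?_⟩
  rintro h _ ⟨u, hu, rfl⟩
  by_cases hx : ∃ x, g * α x = h
  · obtain ⟨x, rfl⟩ := hx
    rw [mul_assoc, ← map_mul, cosetExtend_apply hinj, cosetExtend_apply hinj, hU x u hu]
  · rw [cosetExtend_of_notMem F hx, cosetExtend_of_notMem F]
    rintro ⟨x, hx'⟩
    exact hx ⟨x * u⁻¹, by rw [map_mul, ← mul_assoc, hx', map_inv, mul_inv_cancel_right]⟩

lemma cosetExtend_add (α : H →* H) (g : H) (F F' : H → o) :
    cosetExtend α g (F + F') = fun h => cosetExtend α g F h + cosetExtend α g F' h := by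
  funext h
  by_cases hx : ∃ x, g * α x = h
  · simp only [cosetExtend, dif_pos hx, Pi.add_apply]
  · simp only [cosetExtend, dif_neg hx, add_zero]

lemma cosetExtend_smul (α : H →* H) (g : H) (r : o) (F : H → o) :
    cosetExtend α g (r • F) = fun h => r • cosetExtend α g F h := by
  funext h
  by_cases hx : ∃ x, g * α x = h
  · simp only [cosetExtend, dif_pos hx, Pi.smul_apply]
  · simp only [cosetExtend, dif_neg hx, smul_zero]

lemma sum_cosetExtend {α : H →* H} (hinj : Function.Injective α) [Fintype (H ⧸ α.range)]
    {rep : H ⧸ α.range → H} (hrep : ∀ q, (rep q : H ⧸ α.range) = q) (F : H → o) (h : H) :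
    ∑ q, cosetExtend α (rep q) (fun x => F (rep q * α x)) h = F h := by
  have hx : ∀ q : H ⧸ α.range, (∃ x, rep q * α x = h) ↔ q = h := by
    intro q
    rw [← hrep q, QuotientGroup.eq]
    constructor
    · rintro ⟨x, rfl⟩
      exact ⟨x, by rw [hrep, inv_mul_cancel_left]⟩
    · rintro ⟨x, hx⟩
      exact ⟨x, by rw [hx, hrep, mul_inv_cancel_left]⟩
  rw [Finset.sum_eq_single (h : H ⧸ α.range)]
  · obtain ⟨x, hx'⟩ := (hx (h : H ⧸ α.range)).mpr rfl
    generalize (h : H ⧸ α.range) = q at hx'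
    rw [← hx', cosetExtend_apply hinj]
  · intro q _ hq
    exact cosetExtend_of_notMem _ fun h' => hq ((hx q).mp h')
  · intro h
    exact absurd (Finset.mem_univ _) h

/-- For an open injective endomorphism `α` of a commutative profinite group `H`, `o[[H]]` is free
over `α(o[[H]])`, a basis being given by representatives of `H / α(H)`. -/
theorem exists_coefficients (hcomm : ∀ a b : H, a * b = b * a) {α : H →* H} (hα : Continuous α)
    (hinj : Function.Injective α) (hopen : IsOpenMap α) [Fintype (H ⧸ α.range)]
    [DecidableEq (H ⧸ α.range)]
    [∀ U : OpenNormalSubgroup H, Finite (H ⧸ U.toSubgroup)] {rep : H ⧸ α.range → H}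
    (hrep : ∀ q, (rep q : H ⧸ α.range) = q) :
    ∃ c : H ⧸ α.range → IwasawaAlgebra o H →ₗ[o] IwasawaAlgebra o H,
      (∀ r, r = ∑ q, dirac o (rep q) * map o α hα (c q r)) ∧
      ∀ q q' s, c q (dirac o (rep q') * map o α hα s) = if q' = q then s else 0 := by
  -- The coefficient at `q` is the restriction of the measure `r` to the coset of `rep q`, pulled
  -- back to `H` along `x ↦ rep q * α x`.
  have hex : ∀ (q : H ⧸ α.range) (r : IwasawaAlgebra o H), ∃ c : IwasawaAlgebra o H,
      ∀ F : LocConst o H o, c.integral (F : H → o) = r.integral (cosetExtend α (rep q) F) := by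
    intro q r
    exact exists_integral_eq
      { toFun := fun F : LocConst o H o => r.integral (cosetExtend α (rep q) (F : H → o))
        map_add' := fun F F' => by
          change r.integral (cosetExtend α (rep q) ((F : H → o) + (F' : H → o))) = _
          rw [cosetExtend_add, integral_add _ (cosetExtend_mem hcomm hinj hopen _ F.2)
            (cosetExtend_mem hcomm hinj hopen _ F'.2)]
        map_smul' := fun s F => by
          change r.integral (cosetExtend α (rep q) (s • (F : H → o))) = _
          rw [cosetExtend_smul, integral_smul _ (cosetExtend_mem hcomm hinj hopen _ F.2)]
          rfl }
  choose c hc using hex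
  have hc' : ∀ q r F, F ∈ LocConst o H o →
    (c q r).integral F = r.integral (cosetExtend α (rep q) F) := fun q r F hF => hc q r ⟨F, hF⟩
  let C (q : H ⧸ α.range) : IwasawaAlgebra o H →ₗ[o] IwasawaAlgebra o H :=
    { toFun := c q
      map_add' := fun r s => ext_integral fun F hF => by
        rw [hc' _ _ _ hF, integral_add_left _ _ (cosetExtend_mem hcomm hinj hopen _ hF),
          integral_add_left _ _ hF, hc' _ _ _ hF, hc' _ _ _ hF]
      map_smul' := fun x r => ext_integral fun F hF => by
        rw [hc' _ _ _ hF, integral_smul_left _ _ (cosetExtend_mem hcomm hinj hopen _ hF),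
          RingHom.id_apply, integral_smul_left _ _ hF, hc' _ _ _ hF] }
  refine ⟨C, fun r => ?_, ?_⟩
  · refine ext_integral fun F hF => ?_
    rw [integral_sum_left _ _ hF]
    have h1 : ∀ q, (fun x => F (rep q * α x)) ∈ LocConst o H o := fun q =>
      LocConst.comp_hom (LocConst.comp_mul_left hF (rep q)) α hα
    have h2 : ∀ q, (dirac o (rep q) * map o α hα (c q r)).integral F =
        r.integral (cosetExtend α (rep q) fun x => F (rep q * α x)) := by
      intro q
      obtain ⟨U, hU⟩ := hF
      rw [integral_mul _ _ ⟨U, hU⟩, integral_dirac, integral_map _ _ _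
        (LocConst.comp_mul_left ⟨U, hU⟩ _), ← hc' _ _ _ (h1 q)]
      · rfl
      · exact ⟨U, fun h u hu => integral_inner_invariant _ hU h u hu⟩
    change _ = ∑ q, (dirac o (rep q) * map o α hα (c q r)).integral F
    rw [Finset.sum_congr rfl fun q _ => h2 q, ← integral_sum _ _
      fun q _ => cosetExtend_mem hcomm hinj hopen _ (h1 q)]
    congr 1
    funext h
    exact (sum_cosetExtend hinj hrep F h).symm
  · intro q q' s
    refine ext_integral fun F hF => ?_
    have hF' := cosetExtend_mem hcomm hinj hopen (rep q) hF
    change (c q _).integral F = _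
    rw [hc' _ _ _ hF]
    obtain ⟨U, hU⟩ := hF'
    rw [integral_mul _ _ ⟨U, hU⟩, integral_dirac, integral_map _ _ _
      (LocConst.comp_mul_left ⟨U, hU⟩ _)]
    · split_ifs with hq
      · subst hq
        congr 1
        funext x
        exact cosetExtend_apply hinj _ _ _
      · rw [integral_zero_left hF]
        convert s.integral_zero with x
        refine cosetExtend_of_notMem _ ?_
        rintro ⟨y, hy⟩
        apply hq
        rw [← hrep q', ← hrep q, eq_comm, QuotientGroup.eq]
        refine ⟨y * x⁻¹, ?_⟩
        rw [map_mul, map_inv, mul_inv_eq_iff_eq_mul, mul_assoc, ← hy, inv_mul_cancel_left]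
    · exact ⟨U, fun h u hu => integral_inner_invariant _ hU h u hu⟩

end Coset

end IwasawaAlgebra

/-! ### Semilinear bases of completed localizations -/

section SemilinearBasis

/-- Surjectivity is obtained by successive approximation. Solutions modulo `x ^ k` and modulo `x ^
(k + 1)` differ by a family whose image is divisible by `x ^ k`; by `hinj` the family itself is, so
the approximations form Cauchy sequences. Injectivity is `hinj` for all `k` at once. -/
lemma AdicCompletion.exists_semilinear_basis {A Q : Type*} [CommRing A] [Fintype Q] (x : A)
    (f : A →+* A) (hfx : f x = x) (g : Q → A)
    (hsurj : ∀ y k, ∃ z : Q → A, x ^ k ∣ y - ∑ q, g q * f (z q))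
    (hinj : ∀ (z : Q → A) (k : ℕ), x ^ k ∣ ∑ q, g q * f (z q) → ∀ q, x ^ k ∣ z q) :
    ∃ F : AdicCompletion (Ideal.span {x}) A →+* AdicCompletion (Ideal.span {x}) A,
      (∀ y, F (algebraMap A _ y) = algebraMap A _ (f y)) ∧
      Function.Bijective fun z : Q → AdicCompletion (Ideal.span {x}) A =>
        ∑ q, algebraMap A _ (g q) * F (z q) := by
  set I := Ideal.span {x} with hI
  have hIk : ∀ k y, y ∈ I ^ k ↔ x ^ k ∣ y := fun k y => by
    rw [hI, Ideal.span_singleton_pow, Ideal.mem_span_singleton]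
  have hle : ∀ k, I ^ k ≤ (I ^ k).comap f := fun k y hy => by
    rw [Ideal.mem_comap]
    rw [hIk] at hy ⊢
    obtain ⟨c, rfl⟩ := hy
    rw [map_mul, map_pow, hfx]
    exact ⟨_, rfl⟩
  let F : AdicCompletion I A →+* AdicCompletion I A := AdicCompletion.liftRingHom I
    (fun k => (Ideal.quotientMap (I ^ k) f (hle k)).comp (AdicCompletion.evalₐ I k).toRingHom)
    (by
      intro m n hmn
      ext y
      induction y using AdicCompletion.induction_on with
      | h c =>
        change Ideal.Quotient.factorPow I hmn (Ideal.quotientMap (I ^ n) f (hle n)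
          (AdicCompletion.evalₐ I n (AdicCompletion.mk I A c))) =
          Ideal.quotientMap (I ^ m) f (hle m) (AdicCompletion.evalₐ I m (AdicCompletion.mk I A c))
        rw [AdicCompletion.evalₐ_mk, AdicCompletion.evalₐ_mk, Ideal.quotientMap_mk,
          Ideal.quotientMap_mk]
        change Ideal.Quotient.mk (I ^ m) _ = _
        rw [Ideal.Quotient.eq, ← map_sub]
        refine hle m ?_
        have := (c.2 hmn).symm
        rw [SModEq.sub_mem] at this
        simpa using this)
  have hFev : ∀ k (b : AdicCompletion I A) (y : A),
      AdicCompletion.evalₐ I k b = Ideal.Quotient.mk _ y →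
      AdicCompletion.evalₐ I k (F b) = Ideal.Quotient.mk _ (f y) := by
    intro k b y hy
    rw [AdicCompletion.evalₐ_liftRingHom]
    change Ideal.quotientMap (I ^ k) f (hle k) (AdicCompletion.evalₐ I k b) = _
    rw [hy, Ideal.quotientMap_mk]
  have hof : ∀ k y, AdicCompletion.evalₐ I k (algebraMap A _ y) = Ideal.Quotient.mk _ y :=
    fun k y => AdicCompletion.evalₐ_of I k y
  have hΨev : ∀ k (b : Q → AdicCompletion I A) (y : Q → A),
      (∀ q, AdicCompletion.evalₐ I k (b q) = Ideal.Quotient.mk _ (y q)) →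
      AdicCompletion.evalₐ I k (∑ q, algebraMap A _ (g q) * F (b q)) =
        Ideal.Quotient.mk _ (∑ q, g q * f (y q)) := by
    intro k b y hy
    rw [map_sum, map_sum]
    refine Finset.sum_congr rfl fun q _ => ?_
    rw [map_mul, hof, hFev k _ _ (hy q), map_mul]
  refine ⟨F, fun y => AdicCompletion.ext_evalₐ fun k => ?_, ?_, ?_⟩
  · rw [hFev k _ y (hof k y), hof]
  · have hadd : ∀ b b' : Q → AdicCompletion I A, ∑ q, algebraMap A _ (g q) * F (b q) =
        ∑ q, algebraMap A _ (g q) * F (b' q) → b = b' := by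
      intro b b' hbb
      have h0 : ∑ q, algebraMap A (AdicCompletion I A) (g q) * F ((b - b') q) = 0 := by
        simp only [Pi.sub_apply, map_sub, mul_sub, Finset.sum_sub_distrib, hbb, sub_self]
      rw [← sub_eq_zero]
      refine funext fun q => AdicCompletion.ext_evalₐ fun k => ?_
      have hy : ∀ q, ∃ y, AdicCompletion.evalₐ I k ((b - b') q) = Ideal.Quotient.mk _ y := fun q =>
        (Ideal.Quotient.mk_surjective _).imp fun _ h => h.symm
      choose y hy using hy
      have h1 := hΨev k (b - b') y hy
      rw [h0, _root_.map_zero, eq_comm, Ideal.Quotient.eq_zero_iff_mem, hIk] at h1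
      rw [hy, Pi.zero_apply, _root_.map_zero, Ideal.Quotient.eq_zero_iff_mem, hIk]
      exact hinj y k h1 q
    exact fun b b' h => hadd b b' h
  · intro b
    obtain ⟨c, rfl⟩ := AdicCompletion.mk_surjective I A b
    choose z hz using fun k => hsurj (c k) k
    have hcauchy : ∀ q k, z k q ≡ z (k + 1) q [SMOD (I ^ k • ⊤ : Submodule A A)] := by
      intro q k
      rw [SModEq.sub_mem, smul_eq_mul, Ideal.mul_top, hIk]
      refine hinj (z k - z (k + 1)) k ?_ q
      have h1 : ∑ q, g q * f ((z k - z (k + 1)) q) = (c k - c (k + 1)) -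
          (c k - ∑ q, g q * f (z k q)) + (c (k + 1) - ∑ q, g q * f (z (k + 1) q)) := by
        simp only [Pi.sub_apply, map_sub, mul_sub, Finset.sum_sub_distrib]
        ring
      rw [h1]
      refine dvd_add (dvd_sub ?_ (hz k)) ((pow_dvd_pow x (Nat.le_succ k)).trans (hz (k + 1)))
      have := c.2 (Nat.le_succ k)
      rwa [SModEq.sub_mem, smul_eq_mul, Ideal.mul_top, hIk] at this
    refine ⟨fun q => AdicCompletion.mk I A (AdicCompletion.AdicCauchySequence.mk I A
      (fun k => z k q) (hcauchy q)), AdicCompletion.ext_evalₐ fun k => ?_⟩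
    rw [hΨev k _ (z k) fun q => AdicCompletion.evalₐ_mk I k _, AdicCompletion.evalₐ_mk, eq_comm,
      Ideal.Quotient.eq, hIk]
    exact hz k

variable {R : Type*} [CommRing R]

/-- Modulo `p ^ k`, denominators can be moved into the image of `φ`. Indeed `s ^ N = φ b + a y`
divides `(φ b) ^ (E k) - (-(a y)) ^ (E k)`, and `a ^ (E k)` is a multiple of `p ^ k`. -/
lemma exists_mul_sub_dvd {Q : Type*} [Fintype Q] [Nonempty Q] (p : ℕ) (a : R) (φ : R →+* R)
    (E : ℕ) (hE : (p : R) ∣ a ^ E)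
    {N : ℕ} (hN : N ≠ 0) (hpow : ∀ s : R, ∃ b y, s ^ N = φ b + a * y)
    (hrad : ∀ s : R, a ∣ s ^ N → a ∣ s) (hφa : φ a = a) (k : ℕ) (s : R)
    (hs : s ∈ complSubmonoid R a) :
    ∃ w b, b ∈ complSubmonoid R a ∧ (p : R) ^ k ∣ s * w - φ b := by
  induction hs using Submonoid.closure_induction with
  | mem s hs =>
    obtain ⟨b, y, hb⟩ := hpow s
    have hbS : b ∈ complSubmonoid R a := by
      -- If `a` divided `b`, it would divide `φ b`, as `φ a = a`; hence it would divide `s ^ N` and,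
      -- by `hrad`, also `s`.
      refine Submonoid.subset_closure fun hb' => hs ?_
      rw [Ideal.mem_span_singleton] at hb' ⊢
      obtain ⟨b, rfl⟩ := hb'
      refine hrad s ⟨φ b + y, ?_⟩
      rw [hb, map_mul, hφa]; ring
    obtain ⟨d, hd⟩ := sub_dvd_pow_sub_pow (φ b) (-(a * y)) (E * k)
    obtain ⟨e, he⟩ := hE
    refine ⟨s ^ (N - 1) * d, b ^ (E * k), pow_mem hbS _,
      ⟨(-1) ^ (E * k) * (-1) * (e ^ k * y ^ (E * k)), ?_⟩⟩
    have h1 : s * s ^ (N - 1) = s ^ N := by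
      rw [← pow_succ', Nat.sub_add_cancel (Nat.one_le_iff_ne_zero.mpr hN)]
    have h2 : (-(a * y)) ^ (E * k) = (-1) ^ (E * k) * ((p : R) ^ k * (e ^ k * y ^ (E * k))) := by
      rw [← mul_assoc ((p : R) ^ k), ← mul_pow, ← he, ← pow_mul, ← mul_pow, neg_eq_neg_one_mul,
        mul_pow]
    rw [h2] at hd
    rw [map_pow, ← mul_assoc, h1, hb]
    linear_combination -hd
  | one => exact ⟨1, 1, one_mem _, by simp⟩
  | mul s t _ _ hs ht =>
    obtain ⟨w, b, hb, d, hd⟩ := hs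
    obtain ⟨w', b', hb', d', hd'⟩ := ht
    refine ⟨w * w', b * b', mul_mem hb hb', s * w * d' + φ b' * d, ?_⟩
    rw [map_mul]
    linear_combination s * w * hd' + φ b' * hd

lemma dvd_algebraMap_localization (S : Submonoid R) (x r : R)
    (h : algebraMap R (Localization S) x ∣ algebraMap R (Localization S) r) :
    ∃ u ∈ S, x ∣ u * r := by
  obtain ⟨y, hy⟩ := h
  obtain ⟨⟨t, v⟩, hv⟩ := IsLocalization.surj S y
  have h1 : algebraMap R (Localization S) (r * v) = algebraMap R (Localization S) (x * t) := by
    rw [map_mul, map_mul, hy, ← hv]; ring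
  obtain ⟨w, hw⟩ := (IsLocalization.eq_iff_exists S _).mp h1
  exact ⟨w * v, mul_mem w.2 v.2, w * t, by linear_combination hw⟩

/-- A basis `g` of `R` over its subring `φ(R)` is also a basis of the completed localization `B` of
`R` over its subring `φ(B)`, unless `B = 0`. -/
theorem ComplLocalization.exists_semilinear_basis {Q : Type*} [Fintype Q] [Nonempty Q] (p : ℕ)
    (a : R) (φ : R →+* R) (hφa : φ a = a) (E : ℕ) (hE : (p : R) ∣ a ^ E)
    {N : ℕ} (hN : N ≠ 0) (hpow : ∀ s : R, ∃ b y, s ^ N = φ b + a * y)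
    (g : Q → R) (c : Q → R →+ R) (hc : ∀ r, r = ∑ q, g q * φ (c q r))
    (hc' : ∀ q (s : Q → R), c q (∑ q', g q' * φ (s q')) = s q)
    (hca : ∀ q r, c q (a * r) = a * c q r) :
    Subsingleton (ComplLocalization R p a) ∨
    ∃ F : ComplLocalization R p a →+* ComplLocalization R p a,
      (∀ r, F (algebraMap R _ r) = algebraMap R _ (φ r)) ∧
      Function.Bijective fun z : Q → ComplLocalization R p a =>
        ∑ q, algebraMap R _ (g q) * F (z q) := by
  classical
  set S := complSubmonoid R a with hS
  -- If `a` divides `s ^ N` but not `s`, then `s` is inverted in the localization. So `a` and its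
  -- multiple-bound `p ∣ a ^ E` become units, and the `p`-adic completion is zero. No primality of
  -- `aR` is needed.
  by_cases hrad : ∀ s : R, a ∣ s ^ N → a ∣ s
  swap
  · left
    push Not at hrad
    obtain ⟨s, hs, hs'⟩ := hrad
    have hsu : IsUnit (algebraMap R (Localization S) s) := by
      refine IsLocalization.map_units (Localization S)
        (⟨s, Submonoid.subset_closure fun h => hs' ?_⟩ : S)
      exact Ideal.mem_span_singleton.mp h
    have hau : IsUnit (algebraMap R (Localization S) a) :=
      isUnit_of_dvd_unit (map_dvd _ hs) (by rw [map_pow]; exact hsu.pow N)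
    have hpu : IsUnit ((p : Localization S)) := by
      have := isUnit_of_dvd_unit (map_dvd (algebraMap R (Localization S)) hE)
        (by rw [map_pow]; exact hau.pow E)
      rwa [map_natCast] at this
    have htop : Ideal.span {(p : Localization S)} = ⊤ := Ideal.span_singleton_eq_top.mpr hpu
    have : Subsingleton (AdicCompletion (Ideal.span {(p : Localization S)}) (Localization S)) := by
      refine ⟨fun x y => AdicCompletion.ext_evalₐ fun n => ?_⟩
      have hn : Ideal.span {(p : Localization S)} ^ n = ⊤ := by rw [htop, Ideal.top_pow]
      have := Ideal.Quotient.subsingleton_iff.mpr hn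
      exact Subsingleton.elim _ _
    exact this
  right
  have key := exists_mul_sub_dvd (Q := Q) p a φ E hE hN hpow hrad hφa
  have hca' : ∀ q (s : R), a ∣ s → a ∣ c q s := by
    rintro q _ ⟨r, rfl⟩
    exact ⟨c q r, hca q r⟩
  have hcs : ∀ q s, c q (g q * φ s) = s := fun q s => by
    have := hc' q (Pi.single q s)
    rw [Finset.sum_eq_single q] at this
    · simpa using this
    · intro q' _ hq'
      simp [hq']
    · simp
  -- Denominators are preserved by `φ`: if `a` divided `φ s`, then it would divide the coordinate `c
  -- q (g q * φ s) = s`.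
  have hφS : S ≤ S.comap φ := by
    rw [hS, complSubmonoid, Submonoid.closure_le]
    intro s hs
    refine Submonoid.subset_closure fun hs' => hs ?_
    rw [Ideal.mem_span_singleton] at hs' ⊢
    obtain ⟨q⟩ := ‹Nonempty Q›
    rw [← hcs q s]
    exact hca' q _ (hs'.mul_left _)
  let ℓ := algebraMap R (Localization S)
  let f : Localization S →+* Localization S := IsLocalization.map (Localization S) φ hφS
  have hf : ∀ r, f (ℓ r) = ℓ (φ r) := fun r => IsLocalization.map_eq hφS r
  have hunit : ∀ s ∈ S, IsUnit (ℓ s) := fun s hs =>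
    IsLocalization.map_units (Localization S) (⟨s, hs⟩ : S)
  have hlp : ∀ k, ℓ ((p : R) ^ k) = (p : Localization S) ^ k := fun k => by simp [ℓ]
  have hcp : ∀ q k r, c q ((p : R) ^ k * r) = (p : R) ^ k * c q r := fun q k r => by
    have h1 : ∀ r : R, (p : R) ^ k * r = (p ^ k) • r := fun r => by
      rw [nsmul_eq_mul, Nat.cast_pow]
    rw [h1, h1, map_nsmul]
  obtain ⟨F, hF, hbij⟩ := AdicCompletion.exists_semilinear_basis (p : Localization S) f
    (map_natCast f p) (fun q => ℓ (g q)) (by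
      intro y k
      obtain ⟨⟨r, s⟩, hy⟩ := IsLocalization.surj S y
      obtain ⟨w, b, hb, d, hd⟩ := key k s s.2
      obtain ⟨b', hb'⟩ := (hunit b hb).exists_right_inv
      -- For `y = r / s` and `s w ≡ φ b` modulo `p ^ k` one has `y ≡ r w / φ b`. The coordinates are
      -- therefore those of `r w`, divided by `b`.
      refine ⟨fun q => ℓ (c q (r * w)) * b', ?_⟩
      have hφb : IsUnit (ℓ (φ b)) := hunit _ (hφS hb)
      rw [← hφb.dvd_mul_left]
      refine ⟨-(ℓ d * y), ?_⟩
      have h1 : ℓ (φ b) * ∑ q, ℓ (g q) * f (ℓ (c q (r * w)) * b') = ℓ (r * w) := by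
        conv_rhs => rw [hc (r * w)]
        rw [Finset.mul_sum, map_sum]
        refine Finset.sum_congr rfl fun q _ => ?_
        have h2 : ℓ (φ b) * f b' = 1 := by rw [← hf, ← map_mul, hb', map_one]
        rw [map_mul f, hf, map_mul ℓ (g q)]
        linear_combination ℓ (g q) * ℓ (φ (c q (r * w))) * h2
      rw [mul_sub, h1]
      have h3 := congrArg ℓ hd
      rw [map_sub, map_mul, map_mul, hlp] at h3
      rw [map_mul]
      have hy' : y * ℓ s = ℓ r := hy
      linear_combination ℓ w * hy' - y * h3) (by
      intro z k hz q
      -- After clearing denominators the divisibility holds in `R` up to a factor `u` in `S`.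
      -- Multiplication by `w` replaces `u` by `φ b`, which can be absorbed into the coordinates.
      obtain ⟨s, hs⟩ := IsLocalization.exist_integer_multiples_of_finite S z
      choose r hr using hs
      have hr' : ∀ q, ℓ (r q) = ℓ s * z q := fun q => by rw [hr, Algebra.smul_def]
      have h1 : ℓ ((p : R) ^ k) ∣ ℓ (∑ q, g q * φ (r q)) := by
        rw [hlp]
        refine (hz.mul_left (ℓ (φ s))).trans (dvd_of_eq ?_)
        rw [Finset.mul_sum, map_sum]
        refine Finset.sum_congr rfl fun q _ => ?_
        rw [map_mul, ← hf, ← hf, hr', map_mul]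
        ring
      obtain ⟨u, hu, h2⟩ := dvd_algebraMap_localization S _ _ h1
      obtain ⟨w, b, hb, hd⟩ := key k u hu
      have h3 : (p : R) ^ k ∣ ∑ q, g q * φ (b * r q) := by
        have h4 : ∑ q, g q * φ (b * r q) = w * (u * ∑ q, g q * φ (r q)) -
            (u * w - φ b) * ∑ q, g q * φ (r q) := by
          have : ∑ q, g q * φ (b * r q) = φ b * ∑ q, g q * φ (r q) := by
            rw [Finset.mul_sum]
            exact Finset.sum_congr rfl fun q _ => by rw [map_mul]; ring
          rw [this]; ring
        rw [h4]
        exact dvd_sub (h2.mul_left _) (hd.mul_right _)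
      have h5 : (p : R) ^ k ∣ b * r q := by
        rw [← hc' q fun q => b * r q]
        obtain ⟨e, he⟩ := h3
        exact ⟨c q e, by rw [he, hcp]⟩
      have h6 := map_dvd ℓ h5
      rw [hlp, map_mul, hr', (hunit b hb).dvd_mul_left, (hunit s s.2).dvd_mul_left] at h6
      exact h6)
  refine ⟨F, fun r => ?_, hbij⟩
  have := hF (ℓ r)
  rw [hf] at this
  exact this

end SemilinearBasis

end

/-! ### Semilinear operators on base extensions -/

noncomputable section

namespace BaseChange

variable {R A B D D' : Type*} [CommRing R] [Ring A] [CommRing B] [Algebra R B] {ρ : R →+* A}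
  [AddCommGroup D] [Module A D] [AddCommGroup D'] [Module A D']

lemma tmul_add (b : B) (d e : D) : tmul ρ b (d + e) = tmul ρ b d + tmul ρ b e :=
  TensorProduct.tmul_add (R := R) b (show Restr ρ D from d) (show Restr ρ D from e)

lemma add_tmul (b c : B) (d : D) : tmul ρ (b + c) d = tmul ρ b d + tmul ρ c d :=
  TensorProduct.add_tmul (R := R) b c (show Restr ρ D from d)

lemma zero_tmul (d : D) : tmul ρ (0 : B) d = 0 :=
  TensorProduct.zero_tmul (R := R) B (show Restr ρ D from d)

lemma tmul_zero (b : B) : tmul ρ b (0 : D) = 0 :=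
  TensorProduct.tmul_zero (R := R) (Restr ρ D) b

lemma tmul_smul (r : R) (b : B) (d : D) : tmul ρ b (ρ r • d) = tmul ρ (algebraMap R B r * b) d := by
  have := (TensorProduct.smul_tmul (R := R) r b (show Restr ρ D from d)).symm
  rw [Algebra.smul_def] at this
  exact this

lemma sum_tmul {ι : Type*} (s : Finset ι) (b : ι → B) (d : D) :
    tmul ρ (∑ i ∈ s, b i) d = ∑ i ∈ s, tmul ρ (b i) d :=
  TensorProduct.sum_tmul (R := R) s b (show Restr ρ D from d)

lemma tmul_sum {ι : Type*} (s : Finset ι) (b : B) (d : ι → D) :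
    tmul ρ b (∑ i ∈ s, d i) = ∑ i ∈ s, tmul ρ b (d i) :=
  TensorProduct.tmul_sum (R := R) b s (fun i => show Restr ρ D from d i)

lemma map_tmul (f : D' →ₗ[A] D) (b : B) (d : D') : map B ρ f (tmul ρ b d) = tmul ρ b (f d) :=
  LinearMap.baseChange_tmul (Restr.map ρ f) b (show Restr ρ D' from d)

lemma addHom_ext {P : Type*} [AddCommMonoid P] {F G : BaseChange B ρ D →+ P}
    (h : ∀ b d, F (tmul ρ b d) = G (tmul ρ b d)) : F = G := by
  refine AddMonoidHom.ext fun z => ?_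
  induction z using TensorProduct.induction_on with
  | zero => rw [map_zero, map_zero]
  | tmul b d => exact h b d
  | add x y hx hy => rw [map_add, map_add, hx, hy]

/-- Additive maps out of `B ⊗ D` are given by balanced biadditive maps. -/
lemma exists_lift {P : Type*} [AddCommMonoid P] (F : B → D → P)
    (hadd : ∀ b c d, F (b + c) d = F b d + F c d) (hzero : ∀ d, F 0 d = 0)
    (hadd' : ∀ b d e, F b (d + e) = F b d + F b e) (hzero' : ∀ b, F b 0 = 0)
    (hbal : ∀ r b d, F (algebraMap R B r * b) d = F b (ρ r • d)) :
    ∃ G : BaseChange B ρ D →+ P, ∀ b d, G (tmul ρ b d) = F b d := by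
  let F' : B →+ Restr ρ D →+ P :=
    { toFun b := { toFun d := F b d, map_zero' := hzero' b, map_add' := hadd' b }
      map_zero' := AddMonoidHom.ext hzero
      map_add' b c := AddMonoidHom.ext (hadd b c) }
  refine ⟨TensorProduct.liftAddHom F' fun r b d => ?_, fun b d => rfl⟩
  rw [Algebra.smul_def]
  exact hbal r b d

lemma exists_semilinear {φ : R →+* R} {phiE : B →+* B}
    (hE : ∀ r, phiE (algebraMap R B r) = algebraMap R B (φ r)) (Φ : D →+ D)
    (hΦ : ∀ r d, Φ (ρ r • d) = ρ (φ r) • Φ d) :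
    ∃ phi : BaseChange B ρ D →+ BaseChange B ρ D,
      ∀ b d, phi (tmul ρ b d) = tmul ρ (phiE b) (Φ d) := by
  refine exists_lift (fun b d => tmul ρ (phiE b) (Φ d)) (fun b c d => ?_) (fun d => ?_)
    (fun b d e => ?_) (fun b => ?_) fun r b d => ?_
  · rw [map_add, add_tmul]
  · rw [map_zero, zero_tmul]
  · rw [map_add, tmul_add]
  · rw [map_zero, tmul_zero]
  · rw [hΦ, tmul_smul, map_mul, hE]

lemma exists_linear (ν : D →+ D) (hν : ∀ r d, ν (ρ r • d) = ρ r • ν d) :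
    ∃ nu : BaseChange B ρ D →+ BaseChange B ρ D, ∀ b d, nu (tmul ρ b d) = tmul ρ b (ν d) :=
  exists_semilinear (φ := RingHom.id R) (phiE := RingHom.id B) (fun _ => rfl) ν hν

variable {Q : Type*} [Fintype Q] {φ : R →+* R} {phiE : B →+* B} {g : Q → R}

lemma tmul_eq_sum {z : Q → B} (b : B) (d : D)
    (hz : ∑ q, algebraMap R B (g q) * phiE (z q) = b) :
    tmul ρ b d = ∑ q, tmul ρ (phiE (z q)) (ρ (g q) • d) := by
  rw [← hz, sum_tmul]
  exact Finset.sum_congr rfl fun q _ => (tmul_smul _ _ _).symm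

/-- Writing `b = ∑ g_q phiE(z_q)` gives `b ⊗ d = ∑ phiE(z_q) ⊗ g_q d`, so the only possible value of
`psi` is `∑ z_q ⊗ Ψ(g_q d)`. Uniqueness of the coordinates `z_q` allows to take this as the
definition. -/
lemma exists_inverse_semilinear
    (hE : ∀ r, phiE (algebraMap R B r) = algebraMap R B (φ r))
    (hg : Function.Bijective fun z : Q → B => ∑ q, algebraMap R B (g q) * phiE (z q))
    (hc : ∀ r, ∃ c : Q → R, r = ∑ q, g q * φ (c q)) (Ψ : D →+ D)
    (hΨ : ∀ r d, Ψ (ρ (φ r) • d) = ρ r • Ψ d) :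
    ∃ psi : BaseChange B ρ D →+ BaseChange B ρ D,
      ∀ b d, psi (tmul ρ (phiE b) d) = tmul ρ b (Ψ d) := by
  let C : B → Q → B := (Equiv.ofBijective _ hg).symm
  have hC : ∀ b, ∑ q, algebraMap R B (g q) * phiE (C b q) = b := fun b =>
    (Equiv.ofBijective _ hg).apply_symm_apply b
  have hC' : ∀ b z, ∑ q, algebraMap R B (g q) * phiE (z q) = b → C b = z := fun b z h =>
    (Equiv.symm_apply_eq _).mpr h.symm
  have hCadd : ∀ b c, C (b + c) = C b + C c := fun b c => hC' _ _ (by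
    simp only [Pi.add_apply, map_add, mul_add, Finset.sum_add_distrib, hC])
  have hC0 : C 0 = 0 := hC' _ _ (by simp)
  let F : B → D → BaseChange B ρ D := fun b d => ∑ q, tmul ρ (C b q) (Ψ (ρ (g q) • d))
  have hFadd : ∀ b c d, F (b + c) d = F b d + F c d := fun b c d => by
    simp only [F, hCadd, Pi.add_apply, add_tmul, Finset.sum_add_distrib]
  have hFadd' : ∀ b d e, F b (d + e) = F b d + F b e := fun b d e => by
    simp only [F, smul_add, map_add, tmul_add, Finset.sum_add_distrib]
  have hF0 : ∀ d, F 0 d = 0 := fun d => by simp [F, hC0, zero_tmul]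
  have hFsum : ∀ (z : Q → B) d, F (∑ q, z q) d = ∑ q, F (z q) d := fun z d =>
    map_sum ({ toFun := fun b => F b d, map_zero' := hF0 d, map_add' := fun b c => hFadd b c d } :
      B →+ BaseChange B ρ D) z Finset.univ
  -- The coordinates of `β phiE(a)` are those of `β` over `φ(R)`, multiplied by `a`. This gives both
  -- the balancedness of `F` over `R` and the formula for `psi`.
  have key : ∀ (β : R) (a : B) (d : D),
      F (algebraMap R B β * phiE a) d = tmul ρ a (Ψ (ρ β • d)) := by
    intro β a d
    obtain ⟨c, hcβ⟩ := hc β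
    have h1 : C (algebraMap R B β * phiE a) = fun q => algebraMap R B (c q) * a := hC' _ _ (by
      conv_rhs => rw [hcβ]
      rw [map_sum, Finset.sum_mul]
      refine Finset.sum_congr rfl fun q _ => ?_
      rw [map_mul, hE, map_mul]; ring)
    simp only [F, h1]
    conv_rhs => rw [hcβ]
    rw [map_sum, Finset.sum_smul, map_sum, tmul_sum]
    refine Finset.sum_congr rfl fun q _ => ?_
    rw [← tmul_smul, ← hΨ, ← mul_smul, ← map_mul, mul_comm]
  obtain ⟨psi, hpsi⟩ := exists_lift (ρ := ρ) F hFadd hF0 hFadd' (fun b => by simp [F, tmul_zero])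
    (fun r b d => by
      conv_lhs => rw [← hC b, Finset.mul_sum, hFsum]
      conv_rhs => rw [← hC b, hFsum]
      refine Finset.sum_congr rfl fun q _ => ?_
      rw [← mul_assoc, ← map_mul, key, key, ← mul_smul, ← map_mul, mul_comm])
  refine ⟨psi, fun b d => ?_⟩
  have := key 1 b d
  rw [map_one, one_mul, map_one, one_smul] at this
  rw [hpsi, this]

/-- Multiplication by `s` factors as `f ∘ κ` on `D`, and `κ ∘ f` is multiplication by `s` on `D'`.
After base change `s` is invertible. -/
lemma map_bijective (f : D' →ₗ[A] D) (hf : Function.Injective f) (s : R)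
    (hs : IsUnit (algebraMap R B s)) {κ : D → D'} (hκ : ∀ d, f (κ d) = ρ s • d) :
    Function.Bijective (map B ρ f) := by
  have hκadd : ∀ x y : D, κ (x + y) = κ x + κ y := fun x y =>
    hf (by rw [map_add, hκ, hκ, hκ, smul_add])
  have hκsmul : ∀ (r : R) (x : D), κ (ρ r • x) = ρ r • κ x := fun r x => hf (by
    rw [map_smul, hκ, hκ, smul_smul, smul_smul, ← map_mul, ← map_mul, mul_comm])
  let k : Restr ρ D →ₗ[R] Restr ρ D' :=
    { toFun := κ
      map_add' := hκadd
      map_smul' := hκsmul }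
  have h1 : ∀ z, map B ρ f (k.baseChange B z) = algebraMap R B s • z := by
    intro z
    induction z using TensorProduct.induction_on with
    | zero => simp
    | add x y hx hy => rw [map_add, map_add, hx, hy, smul_add]
    | tmul b d =>
      rw [LinearMap.baseChange_tmul, TensorProduct.smul_tmul', smul_eq_mul]
      exact (map_tmul f b (κ d)).trans ((congrArg (tmul ρ b) (hκ d)).trans
        (tmul_smul s b (show D from d)))
  have h2 : ∀ z, k.baseChange B (map B ρ f z) = algebraMap R B s • z := by
    intro z
    induction z using TensorProduct.induction_on with
    | zero => simp
    | add x y hx hy => rw [map_add, map_add, hx, hy, smul_add]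
    | tmul b d =>
      have h3 : κ (f d) = ρ s • (show D' from d) := hf (by rw [hκ, map_smul])
      rw [TensorProduct.smul_tmul', smul_eq_mul]
      have h4 : k.baseChange B (map B ρ f (tmul ρ b (show D' from d))) = tmul ρ b (κ (f d)) := by
        rw [map_tmul]
        exact LinearMap.baseChange_tmul k b _
      exact h4.trans ((congrArg (tmul ρ b) h3).trans (tmul_smul s b (show D' from d)))
  obtain ⟨u, hu⟩ := hs
  constructor
  · intro x y hxy
    have := congrArg (fun z => (u⁻¹ : Bˣ) • k.baseChange B z) hxy
    simp only [h2, ← hu] at this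
    change u⁻¹ • u • x = u⁻¹ • u • y at this
    rwa [inv_smul_smul, inv_smul_smul] at this
  · intro z
    refine ⟨k.baseChange B ((u⁻¹ : Bˣ) • z), ?_⟩
    rw [h1, ← hu]
    change u • u⁻¹ • z = z
    rw [smul_inv_smul]

lemma map_symm_tmul (f : D' →ₗ[A] D) (hbij : Function.Bijective (map B ρ f)) (s : R) (u : Bˣ)
    (hu : (u : B) = algebraMap R B s) {κ : D → D'} (hκ : ∀ d, f (κ d) = ρ s • d) (b : B) (d : D) :
    (Equiv.ofBijective _ hbij).symm (tmul ρ b d) = tmul ρ ((u⁻¹ : Bˣ) * b) (κ d) := by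
  rw [Equiv.symm_apply_eq, Equiv.ofBijective_apply, map_tmul, hκ, tmul_smul, ← hu,
    Units.mul_inv_cancel_left]

/-- The relation `∑ n φ ψ n⁻¹ = id` on `B ⊗ D`, deduced from the relation
`∑ n ∂ φ (s ψ (n⁻¹ d)) = φ(s) d` on `D`, with `s` a unit in `B` such that `s D ⊆ ∂ D'`. -/
lemma sum_phi_psi (f : D' →ₗ[A] D) (hbij : Function.Bijective (map B ρ f)) (s : R)
    (hs : IsUnit (algebraMap R B s)) {κ : D → D'} (hκ : ∀ d, f (κ d) = ρ s • d)
    (hE : ∀ r, phiE (algebraMap R B r) = algebraMap R B (φ r))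
    (hg : Function.Surjective fun z : Q → B => ∑ q, algebraMap R B (g q) * phiE (z q))
    {Φ : D' → D'} {Ψ : D → D} {Q' : Type*} [Fintype Q'] {ν ν' : Q' → D → D}
    {phi : BaseChange B ρ D' →+ BaseChange B ρ D'} {psi : BaseChange B ρ D →+ BaseChange B ρ D}
    {nu nu' : Q' → BaseChange B ρ D →+ BaseChange B ρ D}
    (hphi : ∀ b d, phi (tmul ρ b d) = tmul ρ (phiE b) (Φ d))
    (hpsi : ∀ b d, psi (tmul ρ (phiE b) d) = tmul ρ b (Ψ d))
    (hnu : ∀ q b d, nu q (tmul ρ b d) = tmul ρ b (ν q d))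
    (hnu' : ∀ q b d, nu' q (tmul ρ b d) = tmul ρ b (ν' q d))
    (hsum : ∀ d, ∑ q, ν q (f (Φ (κ (Ψ (ν' q d))))) = ρ (φ s) • d) (z : BaseChange B ρ D) :
    ∑ q, nu q (map B ρ f (phi ((Equiv.ofBijective _ hbij).symm (psi (nu' q z))))) = z := by
  obtain ⟨u, hu⟩ := hs
  let e : BaseChange B ρ D →+ BaseChange B ρ D' :=
    { toFun := (Equiv.ofBijective _ hbij).symm
      map_zero' := (Equiv.symm_apply_eq _).mpr (map_zero (map B ρ f)).symm
      map_add' := fun x y => (Equiv.symm_apply_eq _).mpr (by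
        rw [Equiv.ofBijective_apply, map_add]
        exact congrArg₂ (· + ·) (Equiv.ofBijective_apply_symm_apply _ hbij x).symm
          (Equiv.ofBijective_apply_symm_apply _ hbij y).symm) }
  let G : BaseChange B ρ D →+ BaseChange B ρ D :=
    ∑ q, (nu q).comp ((map B ρ f).toAddMonoidHom.comp (phi.comp (e.comp (psi.comp (nu' q)))))
  have hG : ∀ z, G z =
      ∑ q, nu q (map B ρ f (phi ((Equiv.ofBijective _ hbij).symm (psi (nu' q z))))) := fun z => by
    simp only [G, AddMonoidHom.finsetSum_apply]
    rfl
  rw [← hG]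
  -- Inverting `∂` after `psi` contributes the scalar `s⁻¹`, which `phi` turns into `phiE(s⁻¹)`; it
  -- cancels the factor `φ(s)` supplied by `hsum`. The tensors considered here generate `B ⊗ D` by
  -- `hg`.
  have h1 : ∀ b d, G (tmul ρ (phiE b) d) = tmul ρ (phiE b) d := by
    intro b d
    rw [hG]
    have h2 : ∀ q, nu q (map B ρ f (phi ((Equiv.ofBijective _ hbij).symm
        (psi (nu' q (tmul ρ (phiE b) d)))))) =
        tmul ρ (phiE ((u⁻¹ : Bˣ) * b)) (ν q (f (Φ (κ (Ψ (ν' q d)))))) := fun q => by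
      rw [hnu', hpsi, map_symm_tmul f hbij s u hu hκ, hphi, map_tmul, hnu]
    rw [Finset.sum_congr rfl fun q _ => h2 q, ← tmul_sum, hsum, tmul_smul, ← hE, ← hu, ← map_mul,
      Units.mul_inv_cancel_left]
  have h3 : G = AddMonoidHom.id _ := addHom_ext fun b d => by
    obtain ⟨z, hz⟩ := hg b
    rw [AddMonoidHom.id_apply, tmul_eq_sum b d hz, map_sum]
    exact Finset.sum_congr rfl fun q _ => h1 _ _
  rw [h3, AddMonoidHom.id_apply]

end BaseChange

end

/-! ### Coordinates on the tree -/

noncomputable section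

namespace BTree

section Lattice

variable {F : Type*} [Field F] [ValuativeRel F]

lemma algebraMap_integer (x : 𝒪[F]) : algebraMap 𝒪[F] F x = (x : F) := rfl

lemma mem_ZK_of_eq_smul {g : GL (Fin 2) F} (c : Fˣ) (A : Matrix (Fin 2) (Fin 2) 𝒪[F])
    (hA : IsUnit A.det) (h : (g : Matrix (Fin 2) (Fin 2) F) = (c : F) • A.map (algebraMap 𝒪[F] F)) :
    g ∈ ZK F := by
  rw [ZK, Subgroup.mem_sup_of_normal_left]
  refine ⟨Matrix.GeneralLinearGroup.scalar (Fin 2) c, ?_,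
    Matrix.GeneralLinearGroup.map (algebraMap 𝒪[F] F)
      (Matrix.GeneralLinearGroup.mk'' A hA), ⟨_, rfl⟩, ?_⟩
  · rw [Matrix.GeneralLinearGroup.center_eq_range_scalar]
    exact ⟨c, rfl⟩
  · refine Units.ext ?_
    rw [h, Units.val_mul]
    ext i j
    simp [Matrix.GeneralLinearGroup.scalar, Matrix.scalar_apply, Matrix.diagonal_mul]

lemma exists_eq_smul_of_mem_ZK {g : GL (Fin 2) F} (hg : g ∈ ZK F) :
    ∃ (c : Fˣ) (A : Matrix (Fin 2) (Fin 2) 𝒪[F]), IsUnit A.det ∧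
      (g : Matrix (Fin 2) (Fin 2) F) = (c : F) • A.map (algebraMap 𝒪[F] F) := by
  rw [ZK, Subgroup.mem_sup_of_normal_left] at hg
  obtain ⟨z, hz, k, ⟨u, rfl⟩, rfl⟩ := hg
  rw [Matrix.GeneralLinearGroup.center_eq_range_scalar] at hz
  obtain ⟨c, rfl⟩ := hz
  refine ⟨c, u.1, (Matrix.isUnit_iff_isUnit_det _).mp u.isUnit, ?_⟩
  rw [Units.val_mul]
  ext i j
  simp [Matrix.GeneralLinearGroup.scalar, Matrix.scalar_apply, Matrix.diagonal_mul]

/-- The bottom row `(0, 1)` forces the diagonal entries of the integral matrix to be units, so the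
central factor is a unit as well. -/
lemma aff_mem_ZK_iff (a : Fˣ) (b : F) :
    aff a b ∈ ZK F ↔ (∃ u : 𝒪[F]ˣ, ((u : 𝒪[F]) : F) = a) ∧ b ∈ 𝒪[F] := by
  constructor
  · intro h
    obtain ⟨c, A, hA, h⟩ := exists_eq_smul_of_mem_ZK h
    have e := fun i j => congrFun (congrFun h i) j
    have h00 : (a : F) = c * A 0 0 := by
      simpa [aff, Matrix.GeneralLinearGroup.mkOfDetNeZero, algebraMap_integer] using e 0 0
    have h01 : b = c * A 0 1 := by
      simpa [aff, Matrix.GeneralLinearGroup.mkOfDetNeZero, algebraMap_integer] using e 0 1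
    have h10 : A 1 0 = 0 := by
      simpa [aff, Matrix.GeneralLinearGroup.mkOfDetNeZero, algebraMap_integer] using e 1 0
    have h11 : (1 : F) = c * A 1 1 := by
      simpa [aff, Matrix.GeneralLinearGroup.mkOfDetNeZero, algebraMap_integer] using e 1 1
    rw [Matrix.det_fin_two, h10, mul_zero, sub_zero] at hA
    obtain ⟨u, hu⟩ := isUnit_of_mul_isUnit_left hA
    obtain ⟨w, hw⟩ := isUnit_of_mul_isUnit_right hA
    have hc : (c : F) = ((w⁻¹ : 𝒪[F]ˣ) : 𝒪[F]) := by
      have h1 : (((w : 𝒪[F]) * (w⁻¹ : 𝒪[F]ˣ) : 𝒪[F]) : F) = 1 := by rw [Units.mul_inv]; rfl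
      push_cast at h1
      rw [← hw] at h11
      have hw0 : ((w : 𝒪[F]) : F) ≠ 0 := fun h0 => by rw [h0, zero_mul] at h1; exact zero_ne_one h1
      exact mul_right_cancel₀ hw0 (by rw [← h11, mul_comm, h1])
    refine ⟨⟨w⁻¹ * u, ?_⟩, ?_⟩
    · rw [h00, hc, ← hu]; rfl
    · rw [h01, hc]; exact mul_mem (Subtype.mem _) (Subtype.mem _)
  · rintro ⟨⟨u, hu⟩, hb⟩
    refine mem_ZK_of_eq_smul 1 !![(u : 𝒪[F]), ⟨b, hb⟩; 0, 1] (by simp) ?_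
    ext i j
    fin_cases i <;> fin_cases j <;>
      simp [aff, Matrix.GeneralLinearGroup.mkOfDetNeZero, ← hu] <;> rfl

lemma mem_integer_or_inv_mem (x : F) : x ∈ 𝒪[F] ∨ x⁻¹ ∈ 𝒪[F] := by
  rcases le_total (ValuativeRel.valuation F x) 1 with h | h
  · exact Or.inl h
  · refine Or.inr ?_
    change ValuativeRel.valuation F x⁻¹ ≤ 1
    rw [map_inv₀]
    exact inv_le_one_of_one_le₀ h

/-- The Iwasawa decomposition on vertices. -/
lemma exists_aff_smul_xPlus (x : Vert F) : ∃ (a : Fˣ) (b : F), x = aff a b • xPlus F := by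
  obtain ⟨g, rfl⟩ := QuotientGroup.mk_surjective x
  have hdet : g.1 0 0 * g.1 1 1 - g.1 0 1 * g.1 1 0 ≠ 0 := by
    rw [← Matrix.det_fin_two]
    exact ((Matrix.isUnit_iff_isUnit_det _).mp g.isUnit).ne_zero
  suffices h : ∃ (a : Fˣ) (b : F) (c : Fˣ) (A : Matrix (Fin 2) (Fin 2) 𝒪[F]), IsUnit A.det ∧
      g.1 = (aff a b).1 * ((c : F) • A.map (algebraMap 𝒪[F] F)) by
    obtain ⟨a, b, c, A, hA, h⟩ := h
    refine ⟨a, b, ?_⟩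
    change (QuotientGroup.mk g : Vert F) = QuotientGroup.mk (aff a b * 1)
    rw [mul_one, QuotientGroup.eq, ← (ZK F).inv_mem_iff, mul_inv_rev, inv_inv]
    refine mem_ZK_of_eq_smul c A hA ?_
    rw [Units.val_mul, h, ← mul_assoc, ← Units.val_mul, inv_mul_cancel, Units.val_one, one_mul]
  set a := g.1 0 0
  set b := g.1 0 1
  set r := g.1 1 0
  set s := g.1 1 1
  have hg : g.1 = !![a, b; r, s] := Matrix.eta_fin_two g.1
  -- The bottom entry of larger absolute value is split off as a scalar. The quotient of the two
  -- bottom entries is then integral and becomes an entry of the matrix in `GL₂(𝒪)`.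
  have key : (s ≠ 0 ∧ r / s ∈ 𝒪[F]) ∨ (r ≠ 0 ∧ s / r ∈ 𝒪[F]) := by
    by_cases hs : s = 0
    · have hr : r ≠ 0 := fun h => hdet (by rw [hs, h]; ring)
      exact Or.inr ⟨hr, by rw [hs, zero_div]; exact zero_mem _⟩
    by_cases hr : r = 0
    · exact Or.inl ⟨hs, by rw [hr, zero_div]; exact zero_mem _⟩
    rcases mem_integer_or_inv_mem (r / s) with h | h
    · exact Or.inl ⟨hs, h⟩
    · exact Or.inr ⟨hr, by rwa [inv_div] at h⟩
  rcases key with ⟨h0, hO⟩ | ⟨h0, hO⟩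
  · have ha : (a - b * (r / s)) / s ≠ 0 := by
      refine div_ne_zero (fun h => hdet ?_) h0
      field_simp at h
      linear_combination h
    refine ⟨Units.mk0 _ ha, b / s, Units.mk0 s h0, !![1, 0; ⟨r / s, hO⟩, 1], by simp, ?_⟩
    rw [hg]
    ext i j
    fin_cases i <;> fin_cases j <;>
      simp [aff, Matrix.GeneralLinearGroup.mkOfDetNeZero, Matrix.mul_apply, Fin.sum_univ_two,
        algebraMap_integer] <;> field_simp <;> ring
  · have ha : (b - a * (s / r)) / r ≠ 0 := by
      refine div_ne_zero (fun h => hdet ?_) h0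
      field_simp at h
      linear_combination -h
    refine ⟨Units.mk0 _ ha, a / r, Units.mk0 r h0, !![0, 1; 1, ⟨s / r, hO⟩], by simp, ?_⟩
    rw [hg]
    ext i j
    fin_cases i <;> fin_cases j <;>
      simp [aff, Matrix.GeneralLinearGroup.mkOfDetNeZero, Matrix.mul_apply, Fin.sum_univ_two,
        algebraMap_integer] <;> field_simp <;> ring

end Lattice

section Vertices

variable {F : Type*} [Field F] [ValuativeRel F] [TopologicalSpace F]
  [IsNonarchimedeanLocalField F] (π : Uniformizer F)

/-- The uniformizer as an element of the ring of integers. -/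
def Uniformizer.integer : 𝒪[F] := ⟨(π.1 : F), π.mem⟩

lemma Uniformizer.irreducible : Irreducible π.integer := by
  obtain ⟨ϖ, hϖ, h⟩ := π.2
  have : ϖ = π.integer := Subtype.ext h
  rwa [← this]

lemma exists_unit_mul_zpow (a : Fˣ) :
    ∃ (u : 𝒪[F]ˣ) (i : ℤ), (a : F) = ((u : 𝒪[F]) : F) * (π.1 : F) ^ i := by
  have hpos : ∀ a : Fˣ, (a : F) ∈ 𝒪[F] →
      ∃ (u : 𝒪[F]ˣ) (i : ℤ), (a : F) = ((u : 𝒪[F]) : F) * (π.1 : F) ^ i := by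
    intro a ha
    obtain ⟨n, u, h⟩ := IsDiscreteValuationRing.eq_unit_mul_pow_irreducible
      (x := (⟨a, ha⟩ : 𝒪[F])) (fun h => a.ne_zero (congrArg Subtype.val h)) π.irreducible
    refine ⟨u, n, ?_⟩
    rw [zpow_natCast]
    exact congrArg Subtype.val h
  rcases mem_integer_or_inv_mem (a : F) with h | h
  · exact hpos a h
  · obtain ⟨u, i, hu⟩ := hpos a⁻¹ (by simpa using h)
    refine ⟨u⁻¹, -i, ?_⟩
    rw [Units.val_inv_eq_inv_val, inv_eq_iff_eq_inv] at hu
    rw [hu, mul_inv, zpow_neg]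
    congr 1
    refine inv_eq_of_mul_eq_one_right ?_
    exact congrArg Subtype.val (Units.mul_inv u)

lemma zpow_mem_integer {i : ℤ} (hi : 0 ≤ i) : (π.1 : F) ^ i ∈ 𝒪[F] := by
  obtain ⟨n, rfl⟩ := Int.eq_ofNat_of_zero_le hi
  exact (zpow_natCast (π.1 : F) n).symm ▸ pow_mem π.mem n

lemma zpow_mem_integer_iff {i : ℤ} : (π.1 : F) ^ i ∈ 𝒪[F] ↔ 0 ≤ i := by
  refine ⟨fun h => ?_, zpow_mem_integer π⟩
  by_contra! hi
  have h1 : (π.1 : F)⁻¹ ∈ 𝒪[F] := by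
    have := mul_mem h (zpow_mem_integer π (show 0 ≤ -i - 1 by lia))
    rwa [← zpow_add₀ π.1.ne_zero, show i + (-i - 1) = -1 by ring, zpow_neg_one] at this
  refine π.irreducible.not_isUnit (IsUnit.of_mul_eq_one ⟨_, h1⟩ (Subtype.ext ?_))
  exact mul_inv_cancel₀ π.1.ne_zero

lemma unit_eq_zpow_iff {i : ℤ} : (∃ u : 𝒪[F]ˣ, ((u : 𝒪[F]) : F) = (π.1 : F) ^ i) ↔ i = 0 := by
  constructor
  · rintro ⟨u, hu⟩
    have h1 := (zpow_mem_integer_iff π).mp (hu ▸ (u : 𝒪[F]).2)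
    have h2 : (π.1 : F) ^ (-i) ∈ 𝒪[F] := by
      rw [zpow_neg, ← hu, inv_eq_of_mul_eq_one_right (b := (((u⁻¹ : 𝒪[F]ˣ) : 𝒪[F]) : F))
        (congrArg Subtype.val (Units.mul_inv u))]
      exact Subtype.mem _
    have h3 := (zpow_mem_integer_iff π).mp h2
    lia
  · rintro rfl
    exact ⟨1, by simp⟩

/-- The vertex `(p_F^i, b) x₊`. -/
def vtx (i : ℤ) (b : F) : Vert F := aff (π.1 ^ i) b • xPlus F

lemma aff_smul_eq_iff (a a' : Fˣ) (b b' : F) : aff a b • xPlus F = aff a' b' • xPlus F ↔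
    (∃ u : 𝒪[F]ˣ, ((u : 𝒪[F]) : F) = (a' : F) / a) ∧ (b' - b) / a ∈ 𝒪[F] := by
  have h1 : (aff a b)⁻¹ * aff a' b' = aff (a⁻¹ * a') ((b' - b) / a) := by
    rw [aff_inv, aff_mul]
    congr 1
    rw [Units.val_inv_eq_inv_val]
    ring
  have h2 : aff a b • xPlus F = aff a' b' • xPlus F ↔ (aff a b)⁻¹ * aff a' b' ∈ ZK F := by
    rw [← QuotientGroup.eq]
    simp [xPlus]
  rw [h2, h1, aff_mem_ZK_iff, Units.val_mul, Units.val_inv_eq_inv_val,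
    div_eq_inv_mul ((a' : Fˣ) : F)]

variable {π}

/-- Vertices thus correspond to the balls `b + p_F^i 𝒪` of `F`, and the geometry of the tree can be
read off from these coordinates. -/
lemma vtx_eq_iff {i j : ℤ} {b c : F} :
    vtx π i b = vtx π j c ↔ i = j ∧ (c - b) * (π.1 : F) ^ (-i) ∈ 𝒪[F] := by
  rw [vtx, vtx, aff_smul_eq_iff]
  simp only [Units.val_zpow_eq_zpow_val]
  rw [← zpow_sub₀ π.1.ne_zero, unit_eq_zpow_iff, zpow_neg, div_eq_mul_inv]
  exact and_congr_left' (by lia)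

variable (π) in
lemma exists_vtx (x : Vert F) : ∃ (i : ℤ) (b : F), x = vtx π i b := by
  obtain ⟨a, b, rfl⟩ := exists_aff_smul_xPlus x
  obtain ⟨u, i, h⟩ := exists_unit_mul_zpow π a
  refine ⟨i, b, ?_⟩
  rw [vtx, aff_smul_eq_iff]
  refine ⟨⟨u⁻¹, ?_⟩, by rw [sub_self, zero_div]; exact zero_mem _⟩
  have h1 : ((u : 𝒪[F]) : F) * ((u⁻¹ : 𝒪[F]ˣ) : 𝒪[F]) = 1 := congrArg Subtype.val (Units.mul_inv u)
  rw [eq_div_iff a.ne_zero, h, ← mul_assoc, mul_comm (((u⁻¹ : 𝒪[F]ˣ) : 𝒪[F]) : F), h1, one_mul,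
    Units.val_zpow_eq_zpow_val]

variable (π) in
lemma xPlus_eq_vtx : xPlus F = vtx π 0 0 := by
  rw [vtx, zpow_zero, aff_one, one_smul]

variable (π) in
lemma end_eq_vtx (m : ℕ) : (t π ^ m)⁻¹ • xPlus F = vtx π (-m) 0 := by
  rw [vtx, t, aff_pow, aff_inv, mul_zero, zpow_neg, zpow_natCast]

variable (π) in
lemma xMinus_eq_vtx : xMinus π = vtx π (-1) 0 := by
  have := end_eq_vtx π 1
  rwa [pow_one] at this

variable (π) in
/-- The level of a vertex: its height over `x₊`, measured from the end `α₀`. -/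
def lvl (x : Vert F) : ℤ := (exists_vtx π x).choose

variable (π) in
/-- The neighbour of `x` on the path from `x` to the end `α₀`. -/
def par (x : Vert F) : Vert F := vtx π (lvl π x - 1) (exists_vtx π x).choose_spec.choose

@[simp] lemma lvl_vtx (i : ℤ) (b : F) : lvl π (vtx π i b) = i :=
  (vtx_eq_iff.mp (exists_vtx π (vtx π i b)).choose_spec.choose_spec).1.symm

@[simp] lemma par_vtx (i : ℤ) (b : F) : par π (vtx π i b) = vtx π (i - 1) b := by
  have h := vtx_eq_iff.mp (exists_vtx π (vtx π i b)).choose_spec.choose_spec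
  have h1 := lvl_vtx (π := π) i b
  rw [par, h1, eq_comm, vtx_eq_iff]
  refine ⟨rfl, ?_⟩
  have := mul_mem h.2 π.mem
  rwa [mul_assoc, ← zpow_add_one₀ π.1.ne_zero, show -i + 1 = -(i - 1) by ring] at this

lemma lvl_par (x : Vert F) : lvl π (par π x) = lvl π x - 1 := by
  obtain ⟨i, b, rfl⟩ := exists_vtx π x
  simp

lemma par_iterate_vtx (n : ℕ) (i : ℤ) (b : F) : (par π)^[n] (vtx π i b) = vtx π (i - n) b := by
  induction n with
  | zero => simp
  | succ n ih =>
    rw [Function.iterate_succ_apply', ih, par_vtx]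
    congr 1
    push_cast; ring

lemma lvl_par_iterate (n : ℕ) (x : Vert F) : lvl π ((par π)^[n] x) = lvl π x - n := by
  obtain ⟨i, b, rfl⟩ := exists_vtx π x
  rw [par_iterate_vtx, lvl_vtx, lvl_vtx]

lemma lvl_xPlus : lvl π (xPlus F) = 0 := by rw [xPlus_eq_vtx π, lvl_vtx]

lemma par_xPlus : par π (xPlus F) = xMinus π := by
  rw [xPlus_eq_vtx π, xMinus_eq_vtx, par_vtx, zero_sub]

variable (π) in
/-- The elements of `NT` shift levels and commute with `par`. -/
lemma exists_aff_shift (a : Fˣ) (b : F) : ∃ j : ℤ, ((a : F) ∈ 𝒪[F] ↔ 0 ≤ j) ∧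
    ∀ i c, aff a b • vtx π i c = vtx π (i + j) (a * c + b) := by
  obtain ⟨u, j, h⟩ := exists_unit_mul_zpow π a
  have h1 : ((u : 𝒪[F]) : F) * ((u⁻¹ : 𝒪[F]ˣ) : 𝒪[F]) = 1 := congrArg Subtype.val (Units.mul_inv u)
  refine ⟨j, ?_, fun i c => ?_⟩
  · rw [← zpow_mem_integer_iff π]
    refine ⟨fun ha => ?_, fun hj => ?_⟩
    · have := mul_mem ((u⁻¹ : 𝒪[F]ˣ) : 𝒪[F]).2 ha
      rwa [h, ← mul_assoc, mul_comm (((u⁻¹ : 𝒪[F]ˣ) : 𝒪[F]) : F), h1, one_mul] at this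
    · rw [h]; exact mul_mem (u : 𝒪[F]).2 hj
  · rw [vtx, vtx, ← mul_smul, aff_mul, aff_smul_eq_iff]
    refine ⟨⟨u⁻¹, ?_⟩, by rw [sub_self, zero_div]; exact zero_mem _⟩
    rw [eq_div_iff (Units.ne_zero _)]
    simp only [Units.val_mul, Units.val_zpow_eq_zpow_val, h, zpow_add₀ π.1.ne_zero]
    linear_combination (π.1 : F) ^ i * (π.1 : F) ^ j * h1

lemma par_aff_smul (a : Fˣ) (b : F) (x : Vert F) :
    par π (aff a b • x) = aff a b • par π x := by
  obtain ⟨j, -, h⟩ := exists_aff_shift π a b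
  obtain ⟨i, c, rfl⟩ := exists_vtx π x
  rw [h, par_vtx, par_vtx, h]
  congr 1
  ring

lemma aff_one_smul_vtx (b : F) (i : ℤ) (c : F) : aff 1 b • vtx π i c = vtx π i (c + b) := by
  rw [vtx, vtx, ← mul_smul, aff_mul, one_mul, Units.val_one, one_mul]

lemma lvl_aff_one_smul (b : F) (x : Vert F) : lvl π (aff 1 b • x) = lvl π x := by
  obtain ⟨i, c, rfl⟩ := exists_vtx π x
  rw [aff_one_smul_vtx, lvl_vtx, lvl_vtx]

/-- The neighbours of `x₊` are distinguished by the lower left entry of the integral matrix of `k`.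
If `p_F` divides it, then `k` fixes `x₋`; otherwise it is a unit, and `k x₋` is the vertex of level
`1` given by the quotient of the entries in the first column. -/
lemma maxCompact_smul_xMinus {k : GL (Fin 2) F} (hk : k ∈ ZK F) :
    k • xMinus π = xMinus π ∨ par π (k • xMinus π) = xPlus F := by
  obtain ⟨c, A, hA, hkA⟩ := exists_eq_smul_of_mem_ZK hk
  have hdet : ∃ u : 𝒪[F]ˣ, (u : 𝒪[F]) = A 0 0 * A 1 1 - A 0 1 * A 1 0 := by
    rw [← Matrix.det_fin_two]; exact hA
  have key : ∀ (g : GL (Fin 2) F) (d : Fˣ) (B : Matrix (Fin 2) (Fin 2) 𝒪[F]), IsUnit B.det →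
      k.1 * ((t π)⁻¹).1 = g.1 * ((d : F) • B.map (algebraMap 𝒪[F] F)) →
      k • xMinus π = g • xPlus F := by
    intro g d B hB h
    rw [xMinus, ← mul_smul]
    change (QuotientGroup.mk (k * (t π)⁻¹ * 1) : Vert F) = QuotientGroup.mk (g * 1)
    rw [mul_one, mul_one, eq_comm, QuotientGroup.eq]
    refine mem_ZK_of_eq_smul d B hB ?_
    rw [Units.val_mul, Units.val_mul, h, ← mul_assoc, ← Units.val_mul, inv_mul_cancel,
      Units.val_one, one_mul]
  have hπ := π.1.ne_zero
  by_cases h10 : π.integer ∣ A 1 0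
  · obtain ⟨s, hs⟩ := h10
    refine Or.inl (key ((t π)⁻¹) c !![A 0 0, π.integer * A 0 1; s, A 1 1] ?_ ?_)
    · rw [Matrix.det_fin_two] at hA ⊢
      rw [hs] at hA
      simpa [mul_comm, mul_left_comm] using hA
    · rw [hkA, t, aff_inv]
      have hs' : ((A 1 0 : 𝒪[F]) : F) = (π.1 : F) * s := congrArg Subtype.val hs
      have hpi : ((π.integer : 𝒪[F]) : F) = π.1 := rfl
      ext i j
      fin_cases i <;> fin_cases j <;>
        simp [aff, Matrix.GeneralLinearGroup.mkOfDetNeZero, Matrix.mul_apply, Fin.sum_univ_two,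
          algebraMap_integer, hs', hpi] <;> field_simp
  · have hu : IsUnit (A 1 0) := by
      by_contra hu
      exact h10 (((IsDiscreteValuationRing.irreducible_iff_uniformizer _).mp π.irreducible ▸
        (IsLocalRing.mem_maximalIdeal _).mpr hu : A 1 0 ∈ Ideal.span {π.integer}) |>
          Ideal.mem_span_singleton.mp)
    obtain ⟨w, hw⟩ := hu
    obtain ⟨u, hu⟩ := hdet
    have hw' : ((A 1 0 : 𝒪[F]) : F) = ((w : 𝒪[F]) : F) := by rw [hw]
    have hw0 : ((w : 𝒪[F]) : F) ≠ 0 := fun h0 => w.ne_zero (Subtype.ext h0)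
    have hu' : ((u : 𝒪[F]) : F) = A 0 0 * A 1 1 - A 0 1 * A 1 0 := by rw [hu]; rfl
    have hwi : (((w⁻¹ : 𝒪[F]ˣ) : 𝒪[F]) : F) = ((w : 𝒪[F]) : F)⁻¹ :=
      (inv_eq_of_mul_eq_one_right (congrArg Subtype.val (Units.mul_inv w))).symm
    refine Or.inr ?_
    rw [key (aff (π.1 ^ (1 : ℤ)) ((A 0 0 : F) * ((w⁻¹ : 𝒪[F]ˣ) : 𝒪[F]))) (c * π.1⁻¹)
      !![0, -(u * (w⁻¹ : 𝒪[F]ˣ)); w, π.integer * A 1 1] (by simp) ?_]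
    · change par π (vtx π 1 _) = _
      rw [par_vtx, xPlus_eq_vtx π, vtx_eq_iff]
      refine ⟨by ring, ?_⟩
      simpa using mul_mem (A 0 0).2 ((w⁻¹ : 𝒪[F]ˣ) : 𝒪[F]).2
    · rw [hkA, t, aff_inv]
      have hpi : ((π.integer : 𝒪[F]) : F) = π.1 := rfl
      ext i j
      fin_cases i <;> fin_cases j <;>
        simp [aff, Matrix.GeneralLinearGroup.mkOfDetNeZero, Matrix.mul_apply, Fin.sum_univ_two,
          algebraMap_integer, hw', hpi, hwi, hu'] <;> field_simp <;> ring

lemma adj_par (x : Vert F) : (tree π).Adj x (par π x) := by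
  obtain ⟨a, b, rfl⟩ := exists_aff_smul_xPlus x
  rw [par_aff_smul, adj_smul, par_xPlus]
  exact adj_xPlus_xMinus π

/-- By the Iwasawa decomposition `g x₊ = (a, b) x₊`, and `(a, b)` commutes with `par`. So one may
assume that `g` lies in `ZK`, where the neighbours of `x₊` are known. -/
lemma adj_iff {x y : Vert F} : (tree π).Adj x y ↔ par π x = y ∨ par π y = x := by
  constructor
  · have key : ∀ g : GL (Fin 2) F, par π (g • xPlus F) = g • xMinus π ∨
        par π (g • xMinus π) = g • xPlus F := by
      intro g
      obtain ⟨a, b, h⟩ := exists_aff_smul_xPlus (g • xPlus F)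
      have hk : (aff a b)⁻¹ * g ∈ ZK F := by
        have := (QuotientGroup.eq (s := ZK F)).mp (show (QuotientGroup.mk (aff a b * 1) : Vert F) =
          QuotientGroup.mk (g * 1) from h.symm)
        simpa using this
      rcases maxCompact_smul_xMinus (π := π) hk with h1 | h1
      · left
        rw [h, par_aff_smul, par_xPlus, ← h1, ← mul_smul, mul_inv_cancel_left, h1]
      · right
        rw [h, ← h1, ← par_aff_smul, ← mul_smul, mul_inv_cancel_left]
    rintro ⟨-, ⟨g, rfl, rfl⟩ | ⟨g, rfl, rfl⟩⟩
    · exact key g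
    · exact (key g).symm
  · rintro (rfl | rfl)
    · exact adj_par x
    · exact (adj_par y).symm

end Vertices

end BTree

end

/-! ### Distances, rays and levels -/

noncomputable section

namespace BTree

variable {F : Type*} [Field F] [ValuativeRel F] [TopologicalSpace F]
  [IsNonarchimedeanLocalField F] {π : Uniformizer F}

lemma lvl_of_adj {x y : Vert F} (h : (tree π).Adj x y) :
    lvl π y = lvl π x - 1 ∨ lvl π x = lvl π y - 1 := by
  rcases adj_iff.mp h with rfl | rfl
  · exact Or.inl (lvl_par x)
  · exact Or.inr (lvl_par y)

lemma lvl_le_of_walk {x y : Vert F} (w : (tree π).Walk x y) :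
    lvl π y ≤ lvl π x + w.length := by
  induction w with
  | nil => simp
  | cons h w ih =>
    rw [SimpleGraph.Walk.length_cons]
    rcases lvl_of_adj h with h | h <;> push_cast <;> lia

/-- Each step changes the level by one. A walk whose length equals the gain in level therefore moves
to a child in every step and is traced back by `par`. -/
lemma par_iterate_of_walk {x y : Vert F} (w : (tree π).Walk x y)
    (h : lvl π y = lvl π x + w.length) : (par π)^[w.length] y = x := by
  induction w with
  | nil => rfl
  | cons ha w ih =>
    rw [SimpleGraph.Walk.length_cons] at h ⊢
    have h1 := lvl_le_of_walk w
    push_cast at h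
    rcases adj_iff.mp ha with h2 | h2
    · have h3 := congrArg (lvl π) h2
      rw [lvl_par] at h3
      lia
    · have h3 := congrArg (lvl π) h2
      rw [lvl_par] at h3
      rw [Function.iterate_succ_apply', ih (by lia), h2]

lemma exists_walk_par_iterate (n : ℕ) (x : Vert F) :
    ∃ w : (tree π).Walk ((par π)^[n] x) x, w.length = n := by
  induction n with
  | zero => exact ⟨SimpleGraph.Walk.nil, rfl⟩
  | succ n ih =>
    obtain ⟨w, hw⟩ := ih
    rw [Function.iterate_succ_apply']
    exact ⟨SimpleGraph.Walk.cons (adj_par _).symm w, by simp [hw]⟩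

lemma dist_par_iterate (n : ℕ) (x : Vert F) : (tree π).dist ((par π)^[n] x) x = n := by
  obtain ⟨w, hw⟩ := exists_walk_par_iterate (π := π) n x
  refine le_antisymm ((SimpleGraph.dist_le w).trans hw.le) ?_
  obtain ⟨v, hv⟩ := w.reachable.exists_walk_length_eq_dist
  have := lvl_le_of_walk v
  rw [lvl_par_iterate, hv] at this
  lia

/-- A sufficiently large ball contains `0`, so the ancestors of `x` eventually are the vertices
`t^(-m) x₊`. -/
lemma eventually_par_iterate_eq_end (x : Vert F) :
    ∀ᶠ m : ℕ in Filter.atTop, ∃ n : ℕ, (n : ℤ) = lvl π x + m ∧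
      (par π)^[n] x = (t π ^ m)⁻¹ • xPlus F := by
  obtain ⟨i, b, rfl⟩ := exists_vtx π x
  by_cases hb : b = 0
  · refine Filter.eventually_atTop.mpr ⟨i.natAbs, fun m hm => ⟨(i + m).toNat, ?_, ?_⟩⟩
    · rw [lvl_vtx]; lia
    · rw [par_iterate_vtx, end_eq_vtx, hb]
      congr 1
      lia
  · obtain ⟨u, j, h⟩ := exists_unit_mul_zpow π (Units.mk0 b hb)
    rw [Units.val_mk0] at h
    refine Filter.eventually_atTop.mpr ⟨i.natAbs + j.natAbs, fun m hm => ⟨(i + m).toNat, ?_, ?_⟩⟩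
    · rw [lvl_vtx]; lia
    · rw [par_iterate_vtx, end_eq_vtx, vtx_eq_iff]
      refine ⟨by lia, ?_⟩
      rw [zero_sub, h, neg_mul, mul_assoc, ← zpow_add₀ π.1.ne_zero]
      exact neg_mem (mul_mem (u : 𝒪[F]).2 (zpow_mem_integer π (by lia)))

lemma reachable (x y : Vert F) : (tree π).Reachable x y := by
  obtain ⟨m, ⟨n, -, hn⟩, k, -, hk⟩ :=
    ((eventually_par_iterate_eq_end (π := π) x).and (eventually_par_iterate_eq_end y)).exists
  obtain ⟨v, -⟩ := exists_walk_par_iterate (π := π) n x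
  obtain ⟨w, -⟩ := exists_walk_par_iterate (π := π) k y
  exact v.reachable.symm.trans ((hn.trans hk.symm) ▸ w.reachable)

/-- For large `m` the distance from `t^(-m) x₊` to any vertex `y` is `lvl y + m`. The condition
defining the ray then says that `d(x, z) = lvl z - lvl x`, so that a shortest walk from `x` to `z`
gains a level in every step. -/
lemma mem_ray_iff {x z : Vert F} : x ∈ ray π z ↔ ∃ n : ℕ, (par π)^[n] z = x := by
  have key : ∀ y : Vert F, ∀ᶠ m : ℕ in Filter.atTop,
      ((tree π).dist ((t π ^ m)⁻¹ • xPlus F) y : ℤ) = lvl π y + m := fun y => by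
    filter_upwards [eventually_par_iterate_eq_end (π := π) y] with m ⟨n, hn, h⟩
    rw [← h, dist_par_iterate, hn]
  constructor
  · intro h
    obtain ⟨m, h1, h2, h3⟩ := (h.and ((key x).and (key z))).exists
    obtain ⟨w, hw⟩ := (reachable (π := π) x z).exists_walk_length_eq_dist
    exact ⟨w.length, par_iterate_of_walk w (by rw [hw]; lia)⟩
  · rintro ⟨n, rfl⟩
    filter_upwards [key ((par π)^[n] z), key z] with m h1 h2
    rw [dist_par_iterate]
    rw [lvl_par_iterate] at h1
    lia

lemma mem_Zplus_iff {e : ℕ} {x z : Vert F} :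
    z ∈ Zplus π e x ↔ ∃ n ≤ e, (par π)^[n] z = x := by
  simp only [Zplus, Set.mem_ofPred_eq, mem_ray_iff]
  constructor
  · rintro ⟨h, n, rfl⟩
    rw [dist_par_iterate] at h
    exact ⟨n, h, rfl⟩
  · rintro ⟨n, h, rfl⟩
    rw [dist_par_iterate]
    exact ⟨h, n, rfl⟩

lemma mem_Zplus_of_par_eq {e : ℕ} (he : 1 ≤ e) {x y : Vert F} (h : par π y = x) :
    y ∈ Zplus π e x :=
  mem_Zplus_iff.mpr ⟨1, he, h⟩

/-- This shift of the index links the groups `N_y^(e)` of (Hyp 3), defined by `Z₊^(e-1)(y)`, to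
agreement on `Z₊^(e)` of the parent of `y`. -/
lemma Zplus_par {e : ℕ} (he : 1 ≤ e) (y : Vert F) : Zplus π (e - 1) y ⊆ Zplus π e (par π y) := by
  intro z hz
  obtain ⟨n, hn, rfl⟩ := mem_Zplus_iff.mp hz
  exact mem_Zplus_iff.mpr ⟨n + 1, by lia, Function.iterate_succ_apply' _ _ _⟩

lemma Zplus_mono {e e' : ℕ} (h : e ≤ e') (x : Vert F) : Zplus π e x ⊆ Zplus π e' x := by
  intro z hz
  obtain ⟨n, hn, rfl⟩ := mem_Zplus_iff.mp hz
  exact mem_Zplus_iff.mpr ⟨n, hn.trans h, rfl⟩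

lemma lvl_le_of_mem_Zplus {e : ℕ} {x z : Vert F} (h : z ∈ Zplus π e x) :
    lvl π z ≤ lvl π x + e := by
  obtain ⟨n, hn, rfl⟩ := mem_Zplus_iff.mp h
  rw [lvl_par_iterate]
  lia

lemma vtx_mem_Xplus_iff {i : ℤ} {b : F} : vtx π i b ∈ Xplus F ↔ 0 ≤ i ∧ b ∈ 𝒪[F] := by
  constructor
  · rintro ⟨a, c, ha, hc, h⟩
    obtain ⟨j, hj, hs⟩ := exists_aff_shift π a c
    rw [xPlus_eq_vtx π, hs, vtx_eq_iff, mul_zero, zero_add, zero_add] at h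
    obtain ⟨rfl, h⟩ := h
    have hj0 := hj.mp ha
    refine ⟨hj0, ?_⟩
    have := mul_mem h (zpow_mem_integer π hj0)
    rw [mul_assoc, ← zpow_add₀ π.1.ne_zero, neg_add_cancel, zpow_zero, mul_one] at this
    simpa using sub_mem hc this
  · rintro ⟨hi, hb⟩
    refine ⟨π.1 ^ i, b, ?_, hb, rfl⟩
    rw [Units.val_zpow_eq_zpow_val]
    exact zpow_mem_integer π hi

variable (π) in
lemma mem_Xplus_iff {x : Vert F} : x ∈ Xplus F ↔ ∃ n : ℕ, (par π)^[n] x = xPlus F := by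
  obtain ⟨i, b, rfl⟩ := exists_vtx π x
  rw [vtx_mem_Xplus_iff]
  simp only [par_iterate_vtx, xPlus_eq_vtx π, vtx_eq_iff]
  constructor
  · rintro ⟨hi, hb⟩
    exact ⟨i.toNat, by lia, by
      rw [show i - (i.toNat : ℤ) = 0 by lia]; simpa using hb⟩
  · rintro ⟨n, hn, h⟩
    rw [hn] at h
    exact ⟨by lia, by simpa using h⟩

variable (π) in
lemma lvl_nonneg_of_mem_Xplus {x : Vert F} (hx : x ∈ Xplus F) : 0 ≤ lvl π x := by
  obtain ⟨i, b, rfl⟩ := exists_vtx π x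
  rw [lvl_vtx]
  exact (vtx_mem_Xplus_iff.mp hx).1

lemma xPlus_mem_Xplus : xPlus F ∈ Xplus F :=
  ⟨1, 0, by simp, zero_mem _, by rw [aff_one, one_smul]⟩

lemma mem_Xplus_of_par {x : Vert F} (hx : par π x ∈ Xplus F) : x ∈ Xplus F := by
  obtain ⟨n, h⟩ := (mem_Xplus_iff π).mp hx
  exact (mem_Xplus_iff π).mpr ⟨n + 1, h⟩

lemma mem_Xplus_of_par_iterate {x : Vert F} {n : ℕ} (hx : (par π)^[n] x ∈ Xplus F) :
    x ∈ Xplus F := by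
  induction n with
  | zero => exact hx
  | succ n ih => exact ih (mem_Xplus_of_par (by rwa [← Function.iterate_succ_apply' (par π)]))

lemma Zplus_subset_Xplus {e : ℕ} {x : Vert F} (hx : x ∈ Xplus F) : Zplus π e x ⊆ Xplus F := by
  intro z hz
  obtain ⟨n, -, rfl⟩ := mem_Zplus_iff.mp hz
  exact mem_Xplus_of_par_iterate hx

lemma par_mem_Xplus {x : Vert F} (hx : x ∈ Xplus F) (h : x ≠ xPlus F) : par π x ∈ Xplus F := by
  obtain ⟨n, hn⟩ := (mem_Xplus_iff π).mp hx
  rcases n with _ | n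
  · exact absurd hn h
  · exact (mem_Xplus_iff π).mpr ⟨n, hn⟩

variable (π) in
lemma eq_xPlus_of_lvl_le {x : Vert F} (hx : x ∈ Xplus F) (h : lvl π x ≤ 0) : x = xPlus F := by
  obtain ⟨n, hn⟩ := (mem_Xplus_iff π).mp hx
  have := congrArg (lvl π) hn
  rw [lvl_par_iterate, lvl_xPlus] at this
  rw [show n = 0 by lia] at hn
  exact hn

variable (π) in
lemma par_xPlus_notMem : par π (xPlus F) ∉ Xplus F := fun h => by
  have := lvl_nonneg_of_mem_Xplus π h
  rw [lvl_par, lvl_xPlus] at this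
  lia

/-! ### Fixed points of translations -/

lemma aff_one_smul_eq_iff {b : F} {z : Vert F} :
    aff 1 b • z = z ↔ b * (π.1 : F) ^ (-lvl π z) ∈ 𝒪[F] := by
  obtain ⟨i, c, rfl⟩ := exists_vtx π z
  rw [aff_one_smul_vtx, vtx_eq_iff, lvl_vtx]
  simp

variable (π) in
lemma mul_zpow_mem_of_le {b : F} {i j : ℤ} (h : b * (π.1 : F) ^ i ∈ 𝒪[F]) (hij : i ≤ j) :
    b * (π.1 : F) ^ j ∈ 𝒪[F] := by
  have := mul_mem h (zpow_mem_integer π (show 0 ≤ j - i by lia))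
  rwa [mul_assoc, ← zpow_add₀ π.1.ne_zero, add_sub_cancel] at this

/-- A translation fixes a ball of level `i` if and only if it is by an element of `p_F^i 𝒪`. The
strongest condition comes from the descendants of the last generation, of level `lvl x + k`. -/
lemma aff_one_fix_Zplus_iff {b : F} {k : ℕ} {x : Vert F} :
    (∀ z ∈ Zplus π k x, aff 1 b • z = z) ↔ b * (π.1 : F) ^ (-(lvl π x + k)) ∈ 𝒪[F] := by
  constructor
  · intro h
    obtain ⟨i, c, rfl⟩ := exists_vtx π x
    have := h (vtx π (i + k) c) (mem_Zplus_iff.mpr ⟨k, le_rfl, by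
      rw [par_iterate_vtx, add_sub_cancel_right]⟩)
    rw [aff_one_smul_eq_iff (π := π), lvl_vtx] at this
    rwa [lvl_vtx]
  · intro h z hz
    rw [aff_one_smul_eq_iff (π := π)]
    have := lvl_le_of_mem_Zplus hz
    exact mul_zpow_mem_of_le π h (by lia)

lemma aff_one_mem_N0_iff {e : ℕ} {b : F} :
    aff 1 b ∈ N0 π e ↔ b * (π.1 : F) ^ (-((e - 1 : ℕ) : ℤ)) ∈ 𝒪[F] := by
  have hinj : ∀ b c : F, aff 1 b = aff 1 c → b = c := fun b c h => by
    simpa [aff, Matrix.GeneralLinearGroup.mkOfDetNeZero] using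
      congrArg (fun g : GL (Fin 2) F => g.1 0 1) h
  have h0 : (π.1 : F) ^ (e - 1) ≠ 0 := pow_ne_zero _ π.1.ne_zero
  rw [zpow_neg, zpow_natCast]
  constructor
  · rintro ⟨c, hc, h⟩
    rw [hinj _ _ h, mul_comm ((π.1 : F) ^ (e - 1)), mul_inv_cancel_right₀ h0]
    exact hc
  · intro h
    refine ⟨_, h, ?_⟩
    rw [mul_comm, inv_mul_cancel_right₀ h0]

lemma N0_eq_aff {e : ℕ} {n : GL (Fin 2) F} (hn : n ∈ N0 π e) :
    ∃ b : F, n = aff 1 b ∧ b * (π.1 : F) ^ (-((e - 1 : ℕ) : ℤ)) ∈ 𝒪[F] := by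
  obtain ⟨c, hc, rfl⟩ := id hn
  exact ⟨_, rfl, aff_one_mem_N0_iff.mp hn⟩

lemma N0_le_N (e : ℕ) : N0 π e ≤ N F := by
  rintro _ ⟨c, -, rfl⟩
  exact ⟨_, rfl⟩

lemma N0_smul_of_lvl_le {e : ℕ} {n : GL (Fin 2) F} (hn : n ∈ N0 π e) {x : Vert F}
    (hx : lvl π x ≤ (e - 1 : ℕ)) : n • x = x := by
  obtain ⟨b, rfl, hb⟩ := N0_eq_aff hn
  rw [aff_one_smul_eq_iff (π := π)]
  exact mul_zpow_mem_of_le π hb (by lia)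

lemma par_NT_smul {g : GL (Fin 2) F} (hg : g ∈ NT F) (x : Vert F) :
    par π (g • x) = g • par π x := by
  obtain ⟨a, b, rfl⟩ := hg
  exact par_aff_smul a b x

lemma N_le_NT : N F ≤ NT F := by
  rintro _ ⟨b, rfl⟩
  exact ⟨_, _, rfl⟩

lemma T_le_NT : T F ≤ NT F := by
  rintro _ ⟨b, rfl⟩
  exact ⟨_, _, rfl⟩

lemma lvl_N_smul {g : GL (Fin 2) F} (hg : g ∈ N F) (x : Vert F) :
    lvl π (g • x) = lvl π x := by
  obtain ⟨b, rfl⟩ := hg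
  exact lvl_aff_one_smul b x

/-! ### Finiteness -/

variable (π) in
-- The balls of the next level inside a given one are indexed by the finite residue field.
lemma finite_children (x : Vert F) : {y | par π y = x}.Finite := by
  obtain ⟨i, b, rfl⟩ := exists_vtx π x
  refine (Set.finite_range fun c : 𝓀[F] =>
    vtx π (i + 1) (b + (π.1 : F) ^ i * (Function.surjInv (IsLocalRing.residue_surjective) c :
      𝒪[F]))).subset ?_
  intro y hy
  obtain ⟨j, c, rfl⟩ := exists_vtx π y
  rw [Set.mem_ofPred_eq, par_vtx, vtx_eq_iff] at hy
  obtain ⟨rfl, h⟩ := hy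
  have h' : (c - b) * (π.1 : F) ^ (-(j - 1)) ∈ 𝒪[F] := by
    rw [← neg_mem_iff, ← neg_mul, neg_sub]; exact h
  set u : 𝒪[F] := ⟨_, h'⟩
  refine ⟨IsLocalRing.residue 𝒪[F] u, ?_⟩
  set v := Function.surjInv (IsLocalRing.residue_surjective) (IsLocalRing.residue 𝒪[F] u)
  have hv : IsLocalRing.residue 𝒪[F] v = IsLocalRing.residue 𝒪[F] u :=
    Function.surjInv_eq (IsLocalRing.residue_surjective) _
  have hd : u - v ∈ IsLocalRing.maximalIdeal 𝒪[F] := by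
    rw [← IsLocalRing.residue_eq_zero_iff, map_sub, hv, sub_self]
  rw [(IsDiscreteValuationRing.irreducible_iff_uniformizer _).mp π.irreducible,
    Ideal.mem_span_singleton] at hd
  obtain ⟨w, hw⟩ := hd
  change vtx π _ _ = _
  rw [vtx_eq_iff]
  refine ⟨by ring, ?_⟩
  have hw' : (c - b) * (π.1 : F) ^ (-(j - 1)) - v = (π.1 : F) * w := congrArg Subtype.val hw
  have h0 : (π.1 : F) ^ (j - 1) ≠ 0 := zpow_ne_zero _ π.1.ne_zero
  have h1 : c - (b + (π.1 : F) ^ (j - 1) * (v : F)) = (π.1 : F) ^ j * w := by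
    have h2 : (c - b) = (π.1 : F) ^ (j - 1) * ((π.1 : F) * w + v) := by
      rw [← hw', zpow_neg]; field_simp; ring
    have h3 : (π.1 : F) ^ j = (π.1 : F) ^ (j - 1) * π.1 := by
      rw [← zpow_add_one₀ π.1.ne_zero, sub_add_cancel]
    rw [h3]
    linear_combination h2
  rw [h1, show -(j - 1 + 1) = -j by ring, mul_right_comm, ← zpow_add₀ π.1.ne_zero, add_neg_cancel,
    zpow_zero, one_mul]
  exact w.2

variable (π) in
lemma finite_lvl_le (m : ℤ) : {x | x ∈ Xplus F ∧ lvl π x ≤ m}.Finite := by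
  rcases lt_or_ge m 0 with hm | hm
  · refine Set.finite_empty.subset fun x hx => ?_
    have := lvl_nonneg_of_mem_Xplus π hx.1
    have := hx.2
    lia
  lift m to ℕ using hm
  induction m with
  | zero =>
    refine (Set.finite_singleton (xPlus F)).subset fun x hx => ?_
    exact eq_xPlus_of_lvl_le π hx.1 hx.2
  | succ m ih =>
    refine ((ih.biUnion fun x _ => finite_children π x).union
      (Set.finite_singleton (xPlus F))).subset fun x hx => ?_
    by_cases h : x = xPlus F
    · exact Or.inr h
    · refine Or.inl (Set.mem_iUnion₂.mpr ⟨par π x, ⟨par_mem_Xplus hx.1 h, ?_⟩, rfl⟩)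
      rw [lvl_par]
      have := hx.2
      push_cast at this
      lia

/-! ### Edges -/

variable (π) in
/-- The edge joining `x` to its neighbour in the direction of `α₀`. -/
def edge (x : Vert F) : (tree π).edgeSet := ⟨s(x, par π x), adj_par x⟩

lemma mem_edge_left (x : Vert F) : x ∈ (edge π x : Sym2 (Vert F)) := Sym2.mem_mk_left _ _

lemma mem_edge_right (x : Vert F) : par π x ∈ (edge π x : Sym2 (Vert F)) := Sym2.mem_mk_right _ _

lemma sigma_eq_edge : sigma π = edge π (xPlus F) :=
  Subtype.ext (congrArg (fun y => s(xPlus F, y)) par_xPlus.symm)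

lemma exists_eq_edge (η : (tree π).edgeSet) : ∃ x, η = edge π x := by
  obtain ⟨η, hη⟩ := η
  induction η using Sym2.ind with
  | _ x y =>
    have h : (tree π).Adj x y := hη
    rcases adj_iff.mp h with rfl | rfl
    · exact ⟨x, rfl⟩
    · exact ⟨y, Subtype.ext Sym2.eq_swap⟩

lemma par_ne_self (x : Vert F) : par π x ≠ x := fun h => by
  have := congrArg (lvl π) h
  rw [lvl_par] at this
  lia

lemma isPlusVertex_edge (x : Vert F) : IsPlusVertex π (edge π x) x :=
  ⟨par π x, rfl, mem_ray_iff.mpr ⟨1, rfl⟩⟩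

/-- An edge meeting the edge from `x` to its parent only in `x` must lead to a child of `x`. So the
sum in (Hyp 2) runs over the edges to the children. -/
lemma inter_edge_eq {x y : Vert F}
    (h : {v | v ∈ (edge π x : Sym2 (Vert F)) ∧ v ∈ (edge π y : Sym2 (Vert F))} = {x}) :
    par π y = x := by
  have hx : x ∈ (edge π y : Sym2 (Vert F)) := (Set.ext_iff.mp h x).mpr rfl |>.2
  rcases Sym2.mem_iff.mp hx with rfl | h1
  · have := (Set.ext_iff.mp h (par π x)).mp ⟨mem_edge_right x, mem_edge_right x⟩
    exact absurd this (par_ne_self x)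
  · exact h1.symm

section Hypotheses

variable {Λ : Type*} [CommRing Λ] {𝓕 : EquivariantCoeffSystem Λ (NT F) (tree π)}

lemma Hyp2.span_eq (h2 : Hyp2 𝓕) (x : Vert F) :
    Submodule.span Λ {w : 𝓕.onVert x | ∃ (y : Vert F) (h : x ∈ (edge π y : Sym2 (Vert F))),
      par π y = x ∧ ∃ v : 𝓕.onEdge (edge π y), 𝓕.res x (edge π y) h v = w} = ⊤ := by
  refine top_le_iff.mp ((h2 (edge π x) x (isPlusVertex_edge x)).ge.trans (Submodule.span_mono ?_))
  rintro w ⟨η, h, hη, v, rfl⟩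
  obtain ⟨y, rfl⟩ := exists_eq_edge η
  exact ⟨y, h, inter_edge_eq hη, v, rfl⟩

lemma Hyp3.mem_range_iff {e : ℕ} (h3 : Hyp3 𝓕 e) (x : Vert F) (w : 𝓕.onVert x) :
    (∃ v, 𝓕.res x (edge π x) (mem_edge_left x) v = w) ↔
      ∀ g ∈ Nfix π e x, ∀ hg : g • x = x, 𝓕.actVert g x x hg w = w :=
  h3 (edge π x) x (mem_edge_left x) (isPlusVertex_edge x) w

end Hypotheses

end BTree

end

/-! ### Local representatives of automorphisms -/

noncomputable section

namespace BTree

variable {F : Type*} [Field F] [ValuativeRel F] [TopologicalSpace F]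
  [IsNonarchimedeanLocalField F] {π : Uniformizer F}

lemma smul_mem_Zplus_of_NT {g : GL (Fin 2) F} (hg : g ∈ NT F) {e : ℕ} {x z : Vert F}
    (hz : z ∈ Zplus π e x) : g • z ∈ Zplus π e (g • x) := by
  obtain ⟨n, hn, rfl⟩ := mem_Zplus_iff.mp hz
  refine mem_Zplus_iff.mpr ⟨n, hn, ?_⟩
  clear hn hz
  induction n with
  | zero => rfl
  | succ n ih => rw [Function.iterate_succ_apply', ih, par_NT_smul hg, Function.iterate_succ_apply']

lemma N_conj_mem {g n : GL (Fin 2) F} (hg : g ∈ NT F) (hn : n ∈ N F) : g * n * g⁻¹ ∈ N F := by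
  obtain ⟨a, b, rfl⟩ := hg
  obtain ⟨c, rfl⟩ := hn
  refine ⟨a * c, ?_⟩
  rw [mul_inv_eq_iff_eq_mul, aff_mul, aff_mul, mul_one, one_mul, Units.val_one, one_mul]
  congr 1
  ring

lemma Tstar_conj_mem_Nhat0 {e : ℕ} {τ : GL (Fin 2) F} (hτ : τ ∈ Tstar F) {s : AutX π}
    (hs : s ∈ Nhat0 π e) : toAut π τ * s * (toAut π τ)⁻¹ ∈ Nhat0 π e := by
  obtain ⟨a, ha, rfl⟩ := hτ
  have hNT : aff a (0 : F) ∈ NT F := ⟨a, 0, rfl⟩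
  intro x
  obtain ⟨_, ⟨c, hc, rfl⟩, h⟩ := hs ((aff a (0 : F))⁻¹ • x)
  refine ⟨aff 1 ((π.1 : F) ^ (e - 1) * (a * c)), ⟨_, mul_mem ha hc, rfl⟩, fun z hz => ?_⟩
  rw [RelIso.mul_apply, RelIso.mul_apply, ← map_inv, toAut_apply, toAut_apply,
    h _ (smul_mem_Zplus_of_NT (inv_mem hNT) hz), ← mul_smul, ← mul_smul]
  congr 1
  rw [← mul_assoc, mul_inv_eq_iff_eq_mul, aff_mul, aff_mul, mul_one, one_mul, Units.val_one,
    one_mul]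
  congr 1
  ring

lemma T_comm {τ τ' : GL (Fin 2) F} (hτ : τ ∈ T F) (hτ' : τ' ∈ T F) : τ * τ' = τ' * τ := by
  obtain ⟨a, rfl⟩ := hτ
  obtain ⟨b, rfl⟩ := hτ'
  rw [aff_mul, aff_mul, mul_comm a b, mul_zero, mul_zero]

lemma t_pow_mem_T (m : ℕ) : t π ^ m ∈ T F := ⟨π.1 ^ m, aff_pow _ _⟩

/-- Conjugation by `t` maps `N̂₀^(e)` into itself, so the groups `t^(-m) N̂₀^(e) t^m` increase with
`m` and their supremum is their union. -/
lemma mem_Nhat_iff {e : ℕ} {s : AutX π} :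
    s ∈ Nhat π e ↔ ∃ m : ℕ, toAut π (t π) ^ m * s * (toAut π (t π) ^ m)⁻¹ ∈ Nhat0 π e := by
  have h1 : ∀ (m : ℕ) (s : AutX π),
      s ∈ (Nhat0 π e).map (MulAut.conj ((toAut π (t π) ^ m)⁻¹)).toMonoidHom ↔
      toAut π (t π) ^ m * s * (toAut π (t π) ^ m)⁻¹ ∈ Nhat0 π e := by
    intro m s
    generalize toAut π (t π) ^ m = c
    constructor
    · rintro ⟨s, hs, rfl⟩
      change c * (c⁻¹ * s * c⁻¹⁻¹) * c⁻¹ ∈ _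
      simpa [mul_assoc] using hs
    · intro hs
      refine ⟨_, hs, ?_⟩
      change c⁻¹ * (c * s * c⁻¹) * c⁻¹⁻¹ = s
      simp [mul_assoc]
  have h2 : Monotone fun m : ℕ =>
      (Nhat0 π e).map (MulAut.conj ((toAut π (t π) ^ m)⁻¹)).toMonoidHom := by
    refine monotone_nat_of_le_succ fun m s hs => ?_
    rw [h1] at hs ⊢
    have := Tstar_conj_mem_Nhat0 (t_mem_Tstar π) hs
    simpa [pow_succ', mul_assoc] using this
  rw [Nhat, Subgroup.mem_iSup_of_directed h2.directed_le]
  exact exists_congr fun m => h1 m s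

lemma Nhat0_le_Nhat (e : ℕ) : Nhat0 π e ≤ Nhat π e := fun s hs =>
  mem_Nhat_iff.mpr ⟨0, by simpa using hs⟩

lemma Nhat_local {e : ℕ} {s : AutX π} (hs : s ∈ Nhat π e) (x : Vert F) :
    ∃ n ∈ N F, ∀ z ∈ Zplus π e x, s z = n • z := by
  obtain ⟨m, h⟩ := mem_Nhat_iff.mp hs
  obtain ⟨n, hn, h⟩ := h (t π ^ m • x)
  have hT := T_le_NT (t_pow_mem_T (π := π) m)
  refine ⟨(t π ^ m)⁻¹ * n * t π ^ m, ?_, fun z hz => ?_⟩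
  · simpa using N_conj_mem (inv_mem hT) (N0_le_N e hn)
  · have := h _ (smul_mem_Zplus_of_NT hT hz)
    rw [RelIso.mul_apply, RelIso.mul_apply, ← map_pow, ← map_inv, toAut_apply, toAut_apply,
      inv_smul_smul] at this
    rw [mul_smul, mul_smul, ← this, inv_smul_smul]

lemma Nhat0_apply_of_lvl_le {e : ℕ} {s : AutX π} (hs : s ∈ Nhat0 π e) {x : Vert F}
    (hx : lvl π x ≤ (e - 1 : ℕ)) : s x = x := by
  obtain ⟨n, hn, h⟩ := hs x
  rw [h x (self_mem_Zplus π e x), N0_smul_of_lvl_le hn hx]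

lemma lvl_t_pow_smul (m : ℕ) (x : Vert F) : lvl π (t π ^ m • x) = lvl π x + m := by
  obtain ⟨i, b, rfl⟩ := exists_vtx π x
  have : t π ^ m • vtx π i b = vtx π (i + m) ((π.1 : F) ^ m * b) := by
    rw [vtx, vtx, ← mul_smul, t, aff_pow, aff_mul, add_zero, Units.val_pow_eq_pow_val,
      ← zpow_natCast, ← zpow_add, add_comm]
  rw [this, lvl_vtx, lvl_vtx]

lemma Nhat_eventually_fix {e : ℕ} {s : AutX π} (hs : s ∈ Nhat π e) :
    ∃ M : ℤ, ∀ x, lvl π x ≤ M → s x = x := by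
  obtain ⟨m, h⟩ := mem_Nhat_iff.mp hs
  refine ⟨-m, fun x hx => ?_⟩
  have := Nhat0_apply_of_lvl_le h (x := t π ^ m • x) (by rw [lvl_t_pow_smul]; lia)
  rw [RelIso.mul_apply, RelIso.mul_apply, ← map_pow, ← map_inv, toAut_apply, toAut_apply,
    inv_smul_smul] at this
  exact smul_left_cancel _ this

/-- A power of `t` makes any element of `T` integral, and such a power can be absorbed into the
exponent `m` of `mem_Nhat_iff`. -/
lemma T_conj_mem_Nhat {e : ℕ} {τ : GL (Fin 2) F} (hτ : τ ∈ T F) {s : AutX π}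
    (hs : s ∈ Nhat π e) : toAut π τ * s * (toAut π τ)⁻¹ ∈ Nhat π e := by
  obtain ⟨m, h⟩ := mem_Nhat_iff.mp hs
  obtain ⟨a, rfl⟩ := id hτ
  obtain ⟨u, j, hj⟩ := exists_unit_mul_zpow π a
  have hk : t π ^ j.natAbs * aff a 0 ∈ Tstar F := by
    refine ⟨π.1 ^ j.natAbs * a, ?_, by rw [t, aff_pow, aff_mul, mul_zero, add_zero]⟩
    rw [Units.val_mul, hj, Units.val_pow_eq_pow_val, mul_left_comm, ← zpow_natCast,
      ← zpow_add₀ π.1.ne_zero]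
    exact mul_mem (u : 𝒪[F]).2 (zpow_mem_integer π (by lia))
  refine mem_Nhat_iff.mpr ⟨j.natAbs + m, ?_⟩
  have h1 := Tstar_conj_mem_Nhat0 hk h
  have h2 : toAut π (t π) ^ (j.natAbs + m) * toAut π (aff a 0) =
      toAut π (t π ^ j.natAbs * aff a 0) * toAut π (t π) ^ m := by
    rw [← map_pow, ← map_pow, ← map_mul, ← map_mul, mul_assoc, T_comm hτ (t_pow_mem_T m),
      ← mul_assoc, pow_add]
  have h3 : toAut π (t π) ^ (j.natAbs + m) * (toAut π (aff a 0) * s * (toAut π (aff a 0))⁻¹) *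
      (toAut π (t π) ^ (j.natAbs + m))⁻¹ =
      (toAut π (t π) ^ (j.natAbs + m) * toAut π (aff a 0)) * s *
        (toAut π (t π) ^ (j.natAbs + m) * toAut π (aff a 0))⁻¹ := by
    simp only [mul_inv_rev, mul_assoc]
  rw [h3, h2]
  simpa only [mul_inv_rev, mul_assoc] using h1

/-- Elements of `N̂^(e)` fix all vertices of sufficiently low level, whereas `(a, 0)` with `a ≠ 1`
moves some vertex of every level. Hence the `T`-component of an element of `P̂^(e)` is unique. -/
lemma eq_one_of_toAut_mem_Nhat {e : ℕ} {τ : GL (Fin 2) F} (hτ : τ ∈ T F)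
    (h : toAut π τ ∈ Nhat π e) : τ = 1 := by
  obtain ⟨a, rfl⟩ := hτ
  obtain ⟨M, hM⟩ := Nhat_eventually_fix h
  obtain ⟨j, -, hj⟩ := exists_aff_shift π a 0
  by_contra hne
  have ha : (a : F) - 1 ≠ 0 := fun h0 => hne (by
    rw [show a = 1 from Units.ext (sub_eq_zero.mp h0), aff_one])
  -- The point `b` is chosen such that `b - a b = p_F^(M-1)`, which is not in `p_F^M 𝒪`.
  have := hM (vtx π M ((π.1 : F) ^ (M - 1) / (1 - a))) (by rw [lvl_vtx])
  rw [toAut_apply, hj, vtx_eq_iff] at this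
  obtain ⟨h0, h1⟩ := this
  rw [h0] at h1
  have ha' : (1 : F) - a ≠ 0 := fun h0 => ha (by linear_combination -h0)
  have h2 : ((π.1 : F) ^ (M - 1) / (1 - a) - (a * ((π.1 : F) ^ (M - 1) / (1 - a)) + 0)) =
      (π.1 : F) ^ (M - 1) := by
    field_simp; ring
  rw [h2, ← zpow_add₀ π.1.ne_zero, zpow_mem_integer_iff] at h1
  lia

variable (π) in
/-- The group `P̂^(e)`, as the set of all `s` with `s ∈ N̂^(e) τ` for some `τ ∈ T`. -/
def Phat (e : ℕ) : Subgroup (AutX π) where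
  carrier := {s | ∃ τ ∈ T F, s * (toAut π τ)⁻¹ ∈ Nhat π e}
  mul_mem' := by
    rintro s s' ⟨τ, hτ, h⟩ ⟨τ', hτ', h'⟩
    refine ⟨τ * τ', mul_mem hτ hτ', ?_⟩
    have := mul_mem h (T_conj_mem_Nhat hτ h')
    simpa [mul_assoc] using this
  one_mem' := ⟨1, one_mem _, by simp [one_mem]⟩
  inv_mem' := by
    rintro s ⟨τ, hτ, h⟩
    refine ⟨τ⁻¹, inv_mem hτ, ?_⟩
    have := T_conj_mem_Nhat (inv_mem hτ) (inv_mem h)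
    simpa [mul_assoc] using this

lemma Nhat_le_Phat (e : ℕ) : Nhat π e ≤ Phat π e := fun s hs => ⟨1, one_mem _, by simpa using hs⟩

lemma toAut_mem_Phat (e : ℕ) {g : GL (Fin 2) F} (hg : g ∈ T F) : toAut π g ∈ Phat π e :=
  ⟨g, hg, by simp [one_mem]⟩

lemma toAut_N_mem_Nhat (e : ℕ) {g : GL (Fin 2) F} (hg : g ∈ N F) : toAut π g ∈ Nhat π e := by
  obtain ⟨b, rfl⟩ := hg
  obtain ⟨m, hm⟩ : ∃ m : ℕ, (π.1 : F) ^ m * b ∈ 𝒪[F] := by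
    by_cases hb : b = 0
    · exact ⟨0, by rw [hb, mul_zero]; exact zero_mem _⟩
    obtain ⟨u, j, hj⟩ := exists_unit_mul_zpow π (Units.mk0 b hb)
    rw [Units.val_mk0] at hj
    refine ⟨j.natAbs, ?_⟩
    rw [hj, mul_left_comm, ← zpow_natCast, ← zpow_add₀ π.1.ne_zero]
    exact mul_mem (u : 𝒪[F]).2 (zpow_mem_integer π (by lia))
  refine mem_Nhat_iff.mpr ⟨(e - 1) + m, ?_⟩
  have : toAut π (t π) ^ ((e - 1) + m) * toAut π (aff 1 b) * (toAut π (t π) ^ ((e - 1) + m))⁻¹ =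
      toAut π (aff 1 ((π.1 : F) ^ (e - 1) * ((π.1 : F) ^ m * b))) := by
    rw [← map_pow, mul_inv_eq_iff_eq_mul, ← map_mul, ← map_mul, t, aff_pow, aff_mul, aff_mul]
    congr 2
    · rw [mul_one, one_mul]
    · rw [Units.val_pow_eq_pow_val, pow_add]; simp [mul_assoc]
  rw [this]
  exact toAut_mem_Nhat0 π (⟨_, ⟨_, hm, rfl⟩⟩ : N0 π e)

lemma exists_isLocalRep {e : ℕ} {s : AutX π} (hs : s ∈ Phat π e) (x : Vert F) :
    ∃ g, IsLocalRep π e s x g := by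
  obtain ⟨τ, hτ, h⟩ := hs
  obtain ⟨n, hn, hx⟩ := Nhat_local h (τ • x)
  refine ⟨⟨n * τ, mul_mem (N_le_NT hn) (T_le_NT hτ)⟩, τ, hτ, h, ?_, fun z hz => ?_⟩
  · simpa using hn
  · have := hx _ (smul_mem_Zplus_of_NT (T_le_NT hτ) hz)
    rw [RelIso.mul_apply, ← map_inv, toAut_apply, inv_smul_smul] at this
    rw [this, ← mul_smul]
    rfl

lemma IsLocalRep.apply {e : ℕ} {s : AutX π} {x : Vert F} {g : NT F} (h : IsLocalRep π e s x g)
    {z : Vert F} (hz : z ∈ Zplus π e x) : s z = g • z := by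
  obtain ⟨τ, hτ, h1, h2, h3⟩ := h
  exact h3 z hz

lemma IsLocalRep.self {e : ℕ} {s : AutX π} {x : Vert F} {g : NT F} (h : IsLocalRep π e s x g) :
    g • x = s x := (h.apply (self_mem_Zplus π e x)).symm

lemma IsLocalRep.mul {e : ℕ} {s s' : AutX π} {x : Vert F} {g g' : NT F}
    (h : IsLocalRep π e s (s' x) g) (h' : IsLocalRep π e s' x g') :
    IsLocalRep π e (s * s') x (g * g') := by
  have hx := h'.self
  obtain ⟨τ, hτ, h1, h2, h3⟩ := h
  obtain ⟨τ', hτ', h1', h2', h3'⟩ := h'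
  refine ⟨τ * τ', mul_mem hτ hτ', ?_, ?_, fun z hz => ?_⟩
  · have := mul_mem h1 (T_conj_mem_Nhat hτ h1')
    simpa [mul_assoc] using this
  · have := mul_mem h2 (N_conj_mem (T_le_NT hτ) h2')
    simpa [mul_assoc] using this
  · have h4 : g' • z ∈ Zplus π e (s' x) := by
      rw [← hx]
      exact smul_mem_Zplus_of_NT g'.2 hz
    rw [RelIso.mul_apply, h3' z hz, h3 _ h4, mul_smul]

lemma isLocalRep_of_mem_N {e : ℕ} {s : AutX π} (hs : s ∈ Nhat π e) {x : Vert F} {g : NT F}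
    (hg : (g : GL (Fin 2) F) ∈ N F) (h : ∀ z ∈ Zplus π e x, s z = g • z) :
    IsLocalRep π e s x g :=
  ⟨1, one_mem _, by simpa using hs, by simpa using hg, h⟩

lemma isLocalRep_toAut_N (e : ℕ) {n : GL (Fin 2) F} (hn : n ∈ N F) (x : Vert F) :
    IsLocalRep π e (toAut π n) x ⟨n, N_le_NT hn⟩ :=
  isLocalRep_of_mem_N (toAut_N_mem_Nhat e hn) hn fun _ _ => rfl

/-- Two elements of `NT` that represent the same automorphism `s` differ by an element of `N`. -/
lemma IsLocalRep.inv_mul_mem {e : ℕ} {s : AutX π} {x y : Vert F} {g g' : NT F}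
    (h : IsLocalRep π e s x g) (h' : IsLocalRep π e s y g') :
    ((g⁻¹ * g' : NT F) : GL (Fin 2) F) ∈ N F := by
  obtain ⟨τ, hτ, h1, h2, -⟩ := h
  obtain ⟨τ', hτ', h1', h2', -⟩ := h'
  have h3 : τ = τ' := by
    rw [← mul_inv_eq_one]
    refine eq_one_of_toAut_mem_Nhat (π := π) (e := e) (mul_mem hτ (inv_mem hτ')) ?_
    have := mul_mem (inv_mem h1) h1'
    simpa using this
  subst h3
  have h4 := mul_mem (inv_mem h2) h2'
  have h5 := N_conj_mem (inv_mem (T_le_NT hτ)) h4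
  simpa [mul_assoc] using h5

lemma par_apply_of_mem_Phat {e : ℕ} (he : 1 ≤ e) {s : AutX π} (hs : s ∈ Phat π e) (x : Vert F) :
    par π (s x) = s (par π x) := by
  obtain ⟨g, hg⟩ := exists_isLocalRep hs (par π x)
  rw [hg.apply (mem_Zplus_of_par_eq he rfl), hg.apply (self_mem_Zplus π e _)]
  exact par_NT_smul g.2 x

/-! ### Triviality of the action of small elements of `N` -/

section Coeff

variable {Λ : Type*} [CommRing Λ] {𝓕 : EquivariantCoeffSystem Λ (NT F) (tree π)}

lemma map_edge {g : NT F} {x y : Vert F} (h : g • x = y) :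
    Sym2.map (fun x => g • x) (edge π x : Sym2 (Vert F)) = edge π y := by
  subst h
  change s(g • x, g • par π x) = s(g • x, par π (g • x))
  rw [show par π (g • x) = g • par π x from par_NT_smul g.2 x]

lemma actVert_congr {g g' : NT F} (h : g = g') {x y : Vert F} (hg : g • x = y) (hg' : g' • x = y)
    (v : 𝓕.onVert x) : 𝓕.actVert g x y hg v = 𝓕.actVert g' x y hg' v := by
  subst h; rfl

lemma actEdge_congr {g g' : NT F} (h : g = g') {η θ : (tree π).edgeSet}
    (hg : Sym2.map (fun x => g • x) (η : Sym2 (Vert F)) = θ)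
    (hg' : Sym2.map (fun x => g' • x) (η : Sym2 (Vert F)) = θ)
    (v : 𝓕.onEdge η) : 𝓕.actEdge g η θ hg v = 𝓕.actEdge g' η θ hg' v := by
  subst h; rfl

/-- By (Hyp 3) the image of `F(edge y)` in `F(y)` consists of `N_y^(e)`-invariants, and by (Hyp 1)
nothing is lost under this map. -/
lemma actEdge_eq_self {e : ℕ} (h1 : Hyp1 𝓕) (h3 : Hyp3 𝓕 e) {y : Vert F} {n : NT F}
    (hn : n ∈ Nfix π e y) (hη : Sym2.map (fun x => n • x) (edge π y : Sym2 (Vert F)) = edge π y)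
    (w : 𝓕.onEdge (edge π y)) : 𝓕.actEdge n (edge π y) (edge π y) hη w = w := by
  have hy : n • y = y := hn.2 y (self_mem_Zplus π _ y)
  refine h1 y (edge π y) (mem_edge_left y) ?_
  rw [𝓕.res_act n y y _ _ hy hη (mem_edge_left y) (mem_edge_left y)]
  exact (h3.mem_range_iff y _).mp ⟨w, rfl⟩ n hn hy

/-- By (Hyp 2), `F(x)` is spanned by the contributions of the edges to the children `y` of `x`.
Since `Z₊^(e-1)(y) ⊆ Z₊^(e)(x)`, the element `n` belongs to each `N_y^(e)` and acts trivially on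
these edges. -/
lemma actVert_eq_self {e : ℕ} (he : 1 ≤ e) (h1 : Hyp1 𝓕) (h2 : Hyp2 𝓕) (h3 : Hyp3 𝓕 e)
    {x : Vert F} {n : NT F} (hn : (n : GL (Fin 2) F) ∈ N F) (hfix : ∀ z ∈ Zplus π e x, n • z = z)
    (hx : n • x = x) (v : 𝓕.onVert x) : 𝓕.actVert n x x hx v = v := by
  have hv : v ∈ Submodule.span Λ {w : 𝓕.onVert x |
      ∃ (y : Vert F) (h : x ∈ (edge π y : Sym2 (Vert F))),
      par π y = x ∧ ∃ v : 𝓕.onEdge (edge π y), 𝓕.res x (edge π y) h v = w} := by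
    rw [h2.span_eq]; trivial
  induction hv using Submodule.span_induction with
  | zero => rw [map_zero]
  | add a b _ _ ha hb => rw [map_add, ha, hb]
  | smul r a _ ha => rw [map_smul, ha]
  | mem w hw =>
    obtain ⟨y, h, rfl, w, rfl⟩ := hw
    have hy : n • y = y := hfix y (mem_Zplus_of_par_eq he rfl)
    rw [← 𝓕.res_act n _ _ _ _ hx (map_edge hy) h h, actEdge_eq_self h1 h3
      ⟨hn, fun z hz => hfix z (Zplus_par he y hz)⟩]

variable {e : ℕ} (he : 1 ≤ e) (h1 : Hyp1 𝓕) (h2 : Hyp2 𝓕) (h3 : Hyp3 𝓕 e)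

/-- Two local representatives differ by an element of `N` which fixes `Z₊^(e)(x)` pointwise, and
such an element acts trivially on `F(x)`. -/
lemma autAct_eq (he : 1 ≤ e) (h1 : Hyp1 𝓕) (h2 : Hyp2 𝓕) (h3 : Hyp3 𝓕 e) {s : AutX π}
    {x : Vert F} {g : NT F} (h : IsLocalRep π e s x g) (v : 𝓕.onVert x) :
    autAct 𝓕 e s x v = 𝓕.actVert g x (s x) h.self v := by
  have hex : ∃ g, IsLocalRep π e s x g := ⟨g, h⟩
  rw [autAct, dif_pos hex]
  have hc := hex.choose_spec
  set g' := hex.choose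
  have hfix : ∀ z ∈ Zplus π e x, (g⁻¹ * g') • z = z := fun z hz => by
    rw [mul_smul, ← hc.apply hz, h.apply hz, inv_smul_smul]
  have hx := hfix x (self_mem_Zplus π e x)
  have := 𝓕.actVert_mul g (g⁻¹ * g') x x (s x) hx h.self
        (by rw [mul_inv_cancel_left]; exact hc.self) v
  rw [actVert_eq_self he h1 h2 h3 (h.inv_mul_mem hc) hfix] at this
  rw [this]
  exact actVert_congr (mul_inv_cancel_left g g').symm _ _ _

lemma autAct_one (he : 1 ≤ e) (h1 : Hyp1 𝓕) (h2 : Hyp2 𝓕) (h3 : Hyp3 𝓕 e)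
    (x : Vert F) (v : 𝓕.onVert x) : autAct 𝓕 e 1 x v = v := by
  have h : IsLocalRep π e 1 x 1 := isLocalRep_of_mem_N (one_mem _) (one_mem _) fun z _ => by simp
  rw [autAct_eq he h1 h2 h3 h]
  exact 𝓕.actVert_one x _ v

lemma autAct_mul (he : 1 ≤ e) (h1 : Hyp1 𝓕) (h2 : Hyp2 𝓕) (h3 : Hyp3 𝓕 e) {s s' : AutX π}
    (hs : s ∈ Phat π e) (hs' : s' ∈ Phat π e) (x : Vert F) (v : 𝓕.onVert x) :
    autAct 𝓕 e (s * s') x v = autAct 𝓕 e s (s' x) (autAct 𝓕 e s' x v) := by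
  obtain ⟨g', hg'⟩ := exists_isLocalRep hs' x
  obtain ⟨g, hg⟩ := exists_isLocalRep hs (s' x)
  rw [autAct_eq he h1 h2 h3 (hg.mul hg'), autAct_eq he h1 h2 h3 hg, autAct_eq he h1 h2 h3 hg']
  exact (𝓕.actVert_mul g g' x (s' x) (s (s' x)) _ _ _ v).symm

lemma apply_mem_edge {η : Vert F} (s : AutX π) (hs : par π (s η) = s (par π η)) :
    s (par π η) ∈ (edge π (s η) : Sym2 (Vert F)) := by
  rw [← hs]; exact mem_edge_right _

/-- Compatibility of the action of `P̂^(e)` with the transition maps. -/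
lemma autAct_res (he : 1 ≤ e) (h1 : Hyp1 𝓕) (h2 : Hyp2 𝓕) (h3 : Hyp3 𝓕 e) {s : AutX π}
    (hs : s ∈ Phat π e) (y : Vert F) (w : 𝓕.onEdge (edge π y)) :
    ∃ w' : 𝓕.onEdge (edge π (s y)),
      autAct 𝓕 e s y (𝓕.res y (edge π y) (mem_edge_left y) w) =
        𝓕.res (s y) (edge π (s y)) (mem_edge_left _) w' ∧
      autAct 𝓕 e s (par π y) (𝓕.res (par π y) (edge π y) (mem_edge_right y) w) =
        𝓕.res (s (par π y)) (edge π (s y))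
          (apply_mem_edge s (par_apply_of_mem_Phat he hs y)) w' := by
  obtain ⟨g, hg⟩ := exists_isLocalRep hs y
  obtain ⟨g', hg'⟩ := exists_isLocalRep hs (par π y)
  refine ⟨𝓕.actEdge g _ _ (map_edge hg.self) w, ?_, ?_⟩
  · rw [autAct_eq he h1 h2 h3 hg, 𝓕.res_act g y (s y) _ _ hg.self]
  -- The representatives at `y` and at its parent agree on `Z₊^(e-1)(y)`. They differ by an element
  -- of `N_y^(e)`, which is trivial on the edge between the two vertices.
  · have hfix : ∀ z ∈ Zplus π (e - 1) y, (g'⁻¹ * g) • z = z := fun z hz => by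
      rw [mul_smul, ← hg.apply (Zplus_mono (Nat.sub_le e 1) y hz), hg'.apply (Zplus_par he y hz),
        inv_smul_smul]
    have hy := hfix y (self_mem_Zplus π _ y)
    have hg'y : g' • y = s y := (hg'.apply (mem_Zplus_of_par_eq he rfl)).symm
    have := 𝓕.actEdge_mul g' (g'⁻¹ * g) (edge π y) (edge π y) (edge π (s y)) (map_edge hy)
      (map_edge hg'y) (map_edge (by rw [mul_inv_cancel_left]; exact hg.self)) w
    rw [actEdge_eq_self h1 h3 ⟨hg'.inv_mul_mem hg, hfix⟩] at this
    rw [autAct_eq he h1 h2 h3 hg', ← 𝓕.res_act g' (par π y) _ _ (edge π (s y)) hg'.self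
      (map_edge hg'y), this]
    exact congrArg _ (actEdge_congr (mul_inv_cancel_left g' g) _ _ _)

end Coeff

end BTree

end

/-! ### Functoriality of `H₀` and of the Pontryagin dual -/

noncomputable section

namespace CoeffSystem

variable {Λ : Type*} [CommRing Λ] {V : Type*} {X : SimpleGraph V} (𝓕 : CoeffSystem Λ X) (S : Set V)

open Classical in
lemma cls_of_mem {x : V} (hx : x ∈ S) (v : 𝓕.onVert x) :
    𝓕.cls S x v = (𝓕.boundaries S).mkQ (DirectSum.lof Λ S (fun x => 𝓕.onVert x) ⟨x, hx⟩ v) := by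
  rw [cls, dif_pos hx]; rfl

lemma cls_of_notMem {x : V} (hx : x ∉ S) (v : 𝓕.onVert x) : 𝓕.cls S x v = 0 := by
  rw [cls, dif_neg hx]; rfl

lemma cls_add_cls {x y : V} (hx : x ∈ S) (hy : y ∈ S) (h : X.Adj x y)
    (v : 𝓕.onEdge ⟨s(x, y), h⟩) :
    𝓕.cls S x (𝓕.res x ⟨s(x, y), h⟩ (Sym2.mem_mk_left _ _) v) +
      𝓕.cls S y (𝓕.res y ⟨s(x, y), h⟩ (Sym2.mem_mk_right _ _) v) = 0 := by
  rw [𝓕.cls_of_mem S hx, 𝓕.cls_of_mem S hy, ← map_add]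
  exact (Submodule.Quotient.mk_eq_zero _).mpr (Submodule.subset_span ⟨⟨x, hx⟩, ⟨y, hy⟩, h, v, rfl⟩)

lemma iSup_range_cls : ⨆ x, LinearMap.range (𝓕.cls S x) = ⊤ := by
  classical
  refine eq_top_iff.mpr fun c _ => ?_
  obtain ⟨c, rfl⟩ := Submodule.mkQ_surjective _ c
  induction c using DirectSum.induction_on with
  | zero => rw [map_zero]; exact zero_mem _
  | add a b ha hb => rw [map_add]; exact add_mem (ha trivial) (hb trivial)
  | of x v =>
    refine Submodule.mem_iSup_of_mem (x : V) ⟨v, ?_⟩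
    rw [𝓕.cls_of_mem S x.2]
    rfl

variable {𝓕 S} in
lemma H0_induction {P : 𝓕.H0 S → Prop} (c : 𝓕.H0 S) (hcls : ∀ x ∈ S, ∀ v, P (𝓕.cls S x v))
    (h0 : P 0) (hadd : ∀ c d, P c → P d → P (c + d)) : P c := by
  have hc : c ∈ ⨆ x, LinearMap.range (𝓕.cls S x) := by rw [iSup_range_cls]; trivial
  induction hc using Submodule.iSup_induction' with
  | zero => exact h0
  | add a b _ _ ha hb => exact hadd a b ha hb
  | mem x c hc =>
    obtain ⟨v, rfl⟩ := hc
    by_cases hx : x ∈ S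
    · exact hcls x hx v
    · rw [𝓕.cls_of_notMem S hx]; exact h0

variable {𝓕 S} in
lemma H0_hom_ext {P : Type*} [AddCommGroup P] [Module Λ P] {f g : 𝓕.H0 S →ₗ[Λ] P}
    (h : ∀ x ∈ S, ∀ v, f (𝓕.cls S x v) = g (𝓕.cls S x v)) : f = g :=
  LinearMap.ext fun c => H0_induction (P := fun c => f c = g c) c h (by rw [map_zero, map_zero])
    fun a b ha hb => by rw [map_add, map_add, ha, hb]

open Classical in
/-- The universal property of `H₀`. -/
def lift {P : Type*} [AddCommGroup P] [Module Λ P] (f : ∀ x, 𝓕.onVert x →ₗ[Λ] P)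
    (hf : ∀ x ∈ S, ∀ y ∈ S, ∀ (h : X.Adj x y) (v : 𝓕.onEdge ⟨s(x, y), h⟩),
      f x (𝓕.res x ⟨s(x, y), h⟩ (Sym2.mem_mk_left _ _) v) +
        f y (𝓕.res y ⟨s(x, y), h⟩ (Sym2.mem_mk_right _ _) v) = 0) : 𝓕.H0 S →ₗ[Λ] P :=
  (𝓕.boundaries S).liftQ (DirectSum.toModule Λ S P fun x => f x) (by
    refine Submodule.span_le.mpr ?_
    rintro _ ⟨x, y, h, v, rfl⟩
    rw [SetLike.mem_coe, LinearMap.mem_ker, map_add, DirectSum.toModule_lof, DirectSum.toModule_lof]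
    exact hf x x.2 y y.2 h v)

lemma lift_cls {P : Type*} [AddCommGroup P] [Module Λ P] (f : ∀ x, 𝓕.onVert x →ₗ[Λ] P) (hf)
    {x : V} (hx : x ∈ S) (v : 𝓕.onVert x) : 𝓕.lift S f hf (𝓕.cls S x v) = f x v := by
  classical
  rw [cls_of_mem _ _ hx]
  exact DirectSum.toModule_lof (M := fun x : S => 𝓕.onVert x) (φ := fun x : S => f x) Λ
    (⟨x, hx⟩ : S) v

end CoeffSystem

namespace PDual

variable {o L Λ : Type*} [CommRing o] [Field L] [Algebra o L] [CommRing Λ] [Algebra o Λ]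
  {M M' M'' : Type*} [AddCommGroup M] [Module Λ M] [AddCommGroup M'] [Module Λ M']
  [AddCommGroup M''] [Module Λ M'']

variable (o) in
/-- A `Λ`-linear map, regarded as an `o`-linear map. -/
def restrict (φ : M →ₗ[Λ] M') : RestrictScalars o Λ M →ₗ[o] RestrictScalars o Λ M' where
  toFun := φ
  map_add' := φ.map_add
  map_smul' r c := φ.map_smul (algebraMap o Λ r) c

variable (o) in
/-- Restriction of scalars on endomorphism rings. -/
def restrictEnd : Module.End Λ M →* Module.End o (RestrictScalars o Λ M) where
  toFun := restrict o
  map_one' := rfl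
  map_mul' _ _ := rfl

/-- Precomposition with a `Λ`-linear map. -/
def comap (φ : M →ₗ[Λ] M') : PDual o L Λ M' →ₗ[o] PDual o L Λ M :=
  LinearMap.lcomp o _ (restrict o φ)

lemma ext_eval {f g : PDual o L Λ M} (h : ∀ c, f.eval c = g.eval c) : f = g := LinearMap.ext h

end PDual

namespace BTree

/-- The standing assumptions on a coefficient system. -/
structure Admissible {F : Type*} [Field F] [ValuativeRel F] {π : Uniformizer F} {Λ : Type*}
    [CommRing Λ] (𝓕 : EquivariantCoeffSystem Λ (NT F) (tree π)) (e : ℕ) : Prop where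
  one_le : 1 ≤ e
  hyp1 : Hyp1 𝓕
  hyp2 : Hyp2 𝓕
  hyp3 : Hyp3 𝓕 e

variable {F : Type*} [Field F] [ValuativeRel F] [TopologicalSpace F]
  [IsNonarchimedeanLocalField F] {π : Uniformizer F} {e : ℕ}

/-! ### Automorphisms preserving `X₊` -/

lemma PhatStarExt_le_Phat (e : ℕ) : PhatStarExt π e ≤ (Phat π e).toSubmonoid := by
  refine sup_le (sup_le ?_ ?_) ?_
  · exact (Nhat0_le_Nhat e).trans (Nhat_le_Phat e)
  · rintro _ ⟨_, ⟨a, -, rfl⟩, rfl⟩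
    exact toAut_mem_Phat e ⟨a, rfl⟩
  · rintro _ ⟨n, hn, rfl⟩
    exact Nhat_le_Phat e (toAut_N_mem_Nhat e (N0_le_N 1 hn))

variable (π) in
/-- The elements of `P̂^(e)` that map `X₊` into itself. -/
def PhatPlus (e : ℕ) : Submonoid (AutX π) where
  carrier := {s | s ∈ Phat π e ∧ ∀ x ∈ Xplus F, s x ∈ Xplus F}
  mul_mem' := fun h h' => ⟨mul_mem h.1 h'.1, fun x hx => h.2 _ (h'.2 x hx)⟩
  one_mem' := ⟨one_mem _, fun _ hx => hx⟩

lemma Nhat0_apply_xPlus {s : AutX π} (hs : s ∈ Nhat0 π e) : s (xPlus F) = xPlus F :=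
  Nhat0_apply_of_lvl_le hs (by rw [lvl_xPlus]; lia)

lemma par_iterate_apply (he : 1 ≤ e) {s : AutX π} (hs : s ∈ Phat π e) (n : ℕ) (x : Vert F) :
    (par π)^[n] (s x) = s ((par π)^[n] x) := by
  induction n with
  | zero => rfl
  | succ n ih =>
    rw [Function.iterate_succ_apply', ih, par_apply_of_mem_Phat he hs, Function.iterate_succ_apply']

lemma Nhat0_apply_mem_Xplus (he : 1 ≤ e) {s : AutX π} (hs : s ∈ Nhat0 π e) {x : Vert F}
    (hx : x ∈ Xplus F) : s x ∈ Xplus F := by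
  obtain ⟨n, hn⟩ := (mem_Xplus_iff π).mp hx
  refine (mem_Xplus_iff π).mpr ⟨n, ?_⟩
  rw [par_iterate_apply he (Nhat_le_Phat e (Nhat0_le_Nhat e hs)), hn, Nhat0_apply_xPlus hs]

lemma PhatStarExt_le_PhatPlus (he : 1 ≤ e) : PhatStarExt π e ≤ PhatPlus π e := by
  intro s hs
  suffices h : PhatStarExt π e ≤ (show Submonoid (AutX π) from
      { carrier := {s | ∀ x ∈ Xplus F, s x ∈ Xplus F}
        mul_mem' := fun h h' x hx => h _ (h' x hx)
        one_mem' := fun x hx => hx }) from ⟨PhatStarExt_le_Phat e hs, h hs⟩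
  refine sup_le (sup_le ?_ ?_) ?_
  · exact fun s hs x hx => Nhat0_apply_mem_Xplus he hs hx
  · rintro _ ⟨_, ⟨a, ha, rfl⟩, rfl⟩ _ ⟨a', b', ha', hb', rfl⟩
    refine ⟨a * a', a * b', mul_mem ha ha', mul_mem ha hb', ?_⟩
    rw [toAut_apply, ← mul_smul, aff_mul, add_zero]
  · rintro _ ⟨n, hn, rfl⟩ x hx
    exact N0_smul_Xplus π (⟨n, hn⟩ : N0 π 1) hx

/-- An automorphism `s` whose inverse maps `X₊` into itself can only map `x₊` to `x₊` or to a vertex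
outside of `X₊`. -/
lemma apply_xPlus_eq_of_mem (he : 1 ≤ e) {s : AutX π} (hs : s⁻¹ ∈ PhatPlus π e)
    (h : s (xPlus F) ∈ Xplus F) : s (xPlus F) = xPlus F := by
  by_contra hne
  have h1 := hs.2 _ (par_mem_Xplus (π := π) h hne)
  rw [← par_apply_of_mem_Phat he hs.1, RelIso.inv_apply_self] at h1
  exact par_xPlus_notMem π h1

lemma mem_Xplus_of_apply_mem {s : AutX π} (hs : s⁻¹ ∈ PhatPlus π e) {x : Vert F}
    (h : s x ∈ Xplus F) : x ∈ Xplus F := by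
  have := hs.2 _ h
  rwa [RelIso.inv_apply_self] at this

lemma mem_Phat_of_inv_mem {s : AutX π} (hs : s⁻¹ ∈ PhatPlus π e) : s ∈ Phat π e := by
  have := inv_mem hs.1
  rwa [inv_inv] at this

/-! ### The actions on `H₀` -/

section Actions

variable {Λ : Type*} [CommRing Λ] {𝓕 : EquivariantCoeffSystem Λ (NT F) (tree π)}

lemma cls_edge (S : Set (Vert F)) {y z : Vert F} (hz : z = par π y) (hyS : y ∈ S) (hzS : z ∈ S)
    (hy : y ∈ (edge π y : Sym2 (Vert F))) (h : z ∈ (edge π y : Sym2 (Vert F)))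
    (v : 𝓕.onEdge (edge π y)) :
    𝓕.cls S y (𝓕.res y (edge π y) hy v) + 𝓕.cls S z (𝓕.res z (edge π y) h v) = 0 := by
  subst hz
  exact 𝓕.cls_add_cls S hyS hzS (adj_par y) v

/-- Edges are unordered pairs, while `edge π y` is labelled by its child end `y`. It suffices to
verify boundary relations for the latter. -/
lemma edge_relation {S : Set (Vert F)} {P : Type*} [AddCommGroup P] [Module Λ P]
    {f : ∀ x, 𝓕.onVert x →ₗ[Λ] P}
    (hf : ∀ y ∈ S, par π y ∈ S → ∀ v, f y (𝓕.res y (edge π y) (mem_edge_left y) v) +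
      f (par π y) (𝓕.res (par π y) (edge π y) (mem_edge_right y) v) = 0)
    (x : Vert F) (hx : x ∈ S) (y : Vert F) (hy : y ∈ S) (h : (tree π).Adj x y)
    (v : 𝓕.onEdge ⟨s(x, y), h⟩) :
    f x (𝓕.res x ⟨s(x, y), h⟩ (Sym2.mem_mk_left _ _) v) +
        f y (𝓕.res y ⟨s(x, y), h⟩ (Sym2.mem_mk_right _ _) v) = 0 := by
  rcases adj_iff.mp h with rfl | rfl
  · exact hf x hx hy v
  · have key : ∀ (η : (tree π).edgeSet) (hη : η = edge π y) (h1 : y ∈ (η : Sym2 (Vert F)))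
        (h2 : par π y ∈ (η : Sym2 (Vert F))) (v : 𝓕.onEdge η),
        f (par π y) (𝓕.res (par π y) η h2 v) + f y (𝓕.res y η h1 v) = 0 := by
      rintro _ rfl h1 h2 v
      rw [add_comm]
      exact hf y hy hx v
    exact key _ (Subtype.ext Sym2.eq_swap) _ _ v

/-- The action on `H₀(X₊, F)` of an element of `P̂^(e)` that preserves `X₊`. -/
def actH0 (H : Admissible 𝓕 e) {s : AutX π} (hs : s ∈ PhatPlus π e) :
    H0plus 𝓕 →ₗ[Λ] H0plus 𝓕 :=
  𝓕.lift (Xplus F) (fun x => 𝓕.cls (Xplus F) (s x) ∘ₗ autAct 𝓕 e s x) (edge_relation (by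
    intro y hy hpy v
    obtain ⟨w, h1, h2⟩ := autAct_res H.one_le H.hyp1 H.hyp2 H.hyp3 hs.1 y v
    rw [LinearMap.comp_apply, LinearMap.comp_apply, h1, h2]
    exact cls_edge _ (par_apply_of_mem_Phat H.one_le hs.1 y).symm (hs.2 _ hy) (hs.2 _ hpy) _ _ w))

lemma actH0_cls (H : Admissible 𝓕 e) {s : AutX π} (hs : s ∈ PhatPlus π e) {x : Vert F}
    (hx : x ∈ Xplus F) (v : 𝓕.onVert x) :
    actH0 H hs (𝓕.cls (Xplus F) x v) = 𝓕.cls (Xplus F) (s x) (autAct 𝓕 e s x v) :=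
  𝓕.lift_cls _ _ _ hx v

lemma actH0_one (H : Admissible 𝓕 e) : actH0 H (one_mem (PhatPlus π e)) = 1 :=
  CoeffSystem.H0_hom_ext fun x hx v => by
    rw [actH0_cls H _ hx, autAct_one H.one_le H.hyp1 H.hyp2 H.hyp3]; rfl

lemma actH0_mul (H : Admissible 𝓕 e) {s s' : AutX π} (hs : s ∈ PhatPlus π e)
    (hs' : s' ∈ PhatPlus π e) : actH0 H (mul_mem hs hs') = actH0 H hs * actH0 H hs' :=
  CoeffSystem.H0_hom_ext fun x hx v => by
    rw [actH0_cls H _ hx, autAct_mul H.one_le H.hyp1 H.hyp2 H.hyp3 hs.1 hs'.1, Module.End.mul_apply,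
      actH0_cls H _ hx, actH0_cls H _ (hs'.2 x hx)]
    rfl

lemma actH0_congr (H : Admissible 𝓕 e) {s s' : AutX π} (h : s = s') (hs : s ∈ PhatPlus π e)
    (hs' : s' ∈ PhatPlus π e) : actH0 H hs = actH0 H hs' := by
  subst h; rfl

lemma mem_imSigma_iff {c : H0plus 𝓕} : c ∈ imSigma 𝓕 ↔ ∃ v : 𝓕.onEdge (edge π (xPlus F)),
    𝓕.cls (Xplus F) (xPlus F) (𝓕.res (xPlus F) (edge π (xPlus F)) (mem_edge_left _) v) = c := by
  have key : ∀ (η : (tree π).edgeSet) (h : sigma π = η) (h1 : xPlus F ∈ (η : Sym2 (Vert F))),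
      c ∈ imSigma 𝓕 ↔ ∃ v : 𝓕.onEdge η, 𝓕.cls (Xplus F) (xPlus F) (𝓕.res (xPlus F) η h1 v) = c := by
    rintro _ rfl h1
    rfl
  exact key _ sigma_eq_edge _

lemma cls_edge_mem_imSigma {y : Vert F} (hy : y = xPlus F) (h : y ∈ (edge π y : Sym2 (Vert F)))
    (v : 𝓕.onEdge (edge π y)) : 𝓕.cls (Xplus F) y (𝓕.res y (edge π y) h v) ∈ imSigma 𝓕 := by
  subst hy
  exact mem_imSigma_iff.mpr ⟨v, rfl⟩

lemma cls_autAct_res_mem_imSigma (H : Admissible 𝓕 e) {s : AutX π} (hs : s⁻¹ ∈ PhatPlus π e)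
    (v : 𝓕.onEdge (edge π (xPlus F))) :
    𝓕.cls (Xplus F) (s (xPlus F)) (autAct 𝓕 e s (xPlus F)
      (𝓕.res (xPlus F) (edge π (xPlus F)) (mem_edge_left _) v)) ∈ imSigma 𝓕 := by
  obtain ⟨w, h1, -⟩ := autAct_res H.one_le H.hyp1 H.hyp2 H.hyp3 (mem_Phat_of_inv_mem hs) (xPlus F) v
  rw [h1]
  by_cases hx : s (xPlus F) ∈ Xplus F
  · exact cls_edge_mem_imSigma (apply_xPlus_eq_of_mem H.one_le hs hx) _ w
  · rw [𝓕.cls_of_notMem _ hx]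
    exact zero_mem _

/-- The map `H₀(X₊, F) → H₀(X₊, F) / F(σ)` given by an element of `P̂^(e)` whose inverse preserves
`X₊`. -/
def actToQuot (H : Admissible 𝓕 e) {s : AutX π} (hs : s⁻¹ ∈ PhatPlus π e) :
    H0plus 𝓕 →ₗ[Λ] (H0plus 𝓕 ⧸ imSigma 𝓕) :=
  𝓕.lift (Xplus F) (fun x => (imSigma 𝓕).mkQ ∘ₗ 𝓕.cls (Xplus F) (s x) ∘ₗ autAct 𝓕 e s x)
    (edge_relation (by
      intro y hy hpy v
      have hsP := mem_Phat_of_inv_mem hs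
      obtain ⟨w, h1, h2⟩ := autAct_res H.one_le H.hyp1 H.hyp2 H.hyp3 hsP y v
      have hpar := par_apply_of_mem_Phat H.one_le hsP y
      rw [LinearMap.comp_apply, LinearMap.comp_apply, LinearMap.comp_apply,
        LinearMap.comp_apply, h1, h2, ← map_add]
      -- The image edge is in one of three positions. Inside `X₊` it gives a relation of `H₀(X₊,
      -- F)`. If only its child end is in `X₊`, this end is `x₊`, the edge is `σ`, and its
      -- contribution is divided out. Otherwise both ends lie outside `X₊`, where `cls` is zero.
      by_cases h3 : s (par π y) ∈ Xplus F
      · have h4 : s y ∈ Xplus F := mem_Xplus_of_par (π := π) (by rwa [hpar])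
        rw [cls_edge _ hpar.symm h4 h3, map_zero]
      · rw [𝓕.cls_of_notMem _ h3, add_zero]
        by_cases h4 : s y ∈ Xplus F
        · have h5 : s y = xPlus F := by
            by_contra h5
            exact h3 (hpar ▸ par_mem_Xplus (π := π) h4 h5)
          exact (Submodule.Quotient.mk_eq_zero _).mpr (cls_edge_mem_imSigma h5 _ w)
        · rw [𝓕.cls_of_notMem _ h4, map_zero]))

lemma actToQuot_cls (H : Admissible 𝓕 e) {s : AutX π} (hs : s⁻¹ ∈ PhatPlus π e) {x : Vert F}
    (hx : x ∈ Xplus F) (v : 𝓕.onVert x) :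
    actToQuot H hs (𝓕.cls (Xplus F) x v) =
      (imSigma 𝓕).mkQ (𝓕.cls (Xplus F) (s x) (autAct 𝓕 e s x v)) :=
  𝓕.lift_cls _ _ _ hx v

lemma actToQuot_of_mem (H : Admissible 𝓕 e) {s : AutX π} (hs : s⁻¹ ∈ PhatPlus π e)
    {c : H0plus 𝓕} (hc : c ∈ imSigma 𝓕) : actToQuot H hs c = 0 := by
  obtain ⟨v, rfl⟩ := mem_imSigma_iff.mp hc
  rw [actToQuot_cls H hs xPlus_mem_Xplus]
  exact (Submodule.Quotient.mk_eq_zero _).mpr (cls_autAct_res_mem_imSigma H hs v)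

/-- The action on `H₀(X₊, F) / F(σ)` of an element of `P̂^(e)` whose inverse preserves `X₊`. -/
def actQuot (H : Admissible 𝓕 e) {s : AutX π} (hs : s⁻¹ ∈ PhatPlus π e) :
    (H0plus 𝓕 ⧸ imSigma 𝓕) →ₗ[Λ] (H0plus 𝓕 ⧸ imSigma 𝓕) :=
  (imSigma 𝓕).liftQ (actToQuot H hs)
    (fun _ hc => LinearMap.mem_ker.mpr (actToQuot_of_mem H hs hc))

lemma actQuot_cls (H : Admissible 𝓕 e) {s : AutX π} (hs : s⁻¹ ∈ PhatPlus π e) {x : Vert F}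
    (hx : x ∈ Xplus F) (v : 𝓕.onVert x) :
    actQuot H hs ((imSigma 𝓕).mkQ (𝓕.cls (Xplus F) x v)) =
      (imSigma 𝓕).mkQ (𝓕.cls (Xplus F) (s x) (autAct 𝓕 e s x v)) := by
  exact actToQuot_cls H hs hx v

/-- For `x` outside `X₊` both sides vanish, as `s⁻¹` preserves `X₊`. This extension is needed for
composing two such actions, because the first one may leave `X₊`. -/
lemma actQuot_cls' (H : Admissible 𝓕 e) {s : AutX π} (hs : s⁻¹ ∈ PhatPlus π e) (x : Vert F)
    (v : 𝓕.onVert x) :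
    actQuot H hs ((imSigma 𝓕).mkQ (𝓕.cls (Xplus F) x v)) =
      (imSigma 𝓕).mkQ (𝓕.cls (Xplus F) (s x) (autAct 𝓕 e s x v)) := by
  by_cases hx : x ∈ Xplus F
  · exact actQuot_cls H hs hx v
  · rw [𝓕.cls_of_notMem _ hx, 𝓕.cls_of_notMem _ fun h => hx (mem_Xplus_of_apply_mem hs h), map_zero,
      map_zero]

lemma quot_hom_ext {P : Type*} [AddCommGroup P] [Module Λ P]
    {f g : (H0plus 𝓕 ⧸ imSigma 𝓕) →ₗ[Λ] P}
    (h : ∀ x ∈ Xplus F, ∀ v, f ((imSigma 𝓕).mkQ (𝓕.cls (Xplus F) x v)) =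
      g ((imSigma 𝓕).mkQ (𝓕.cls (Xplus F) x v))) : f = g :=
  Submodule.linearMap_qext _ (CoeffSystem.H0_hom_ext h)

lemma actQuot_one (H : Admissible 𝓕 e) (h : (1 : AutX π)⁻¹ ∈ PhatPlus π e) :
    actQuot H h = 1 :=
  quot_hom_ext fun x hx v => by
    rw [actQuot_cls H _ hx, autAct_one H.one_le H.hyp1 H.hyp2 H.hyp3]; rfl

lemma actQuot_mul (H : Admissible 𝓕 e) {s s' : AutX π} (hs : s⁻¹ ∈ PhatPlus π e)
    (hs' : s'⁻¹ ∈ PhatPlus π e) (h : (s * s')⁻¹ ∈ PhatPlus π e) :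
    actQuot H h = actQuot H hs * actQuot H hs' :=
  quot_hom_ext fun x hx v => by
    rw [actQuot_cls H _ hx, autAct_mul H.one_le H.hyp1 H.hyp2 H.hyp3 (mem_Phat_of_inv_mem hs)
      (mem_Phat_of_inv_mem hs'), Module.End.mul_apply, actQuot_cls H _ hx, actQuot_cls' H hs]
    rfl

lemma actQuot_congr (H : Admissible 𝓕 e) {s s' : AutX π} (h : s = s') (hs : s⁻¹ ∈ PhatPlus π e)
    (hs' : s'⁻¹ ∈ PhatPlus π e) : actQuot H hs = actQuot H hs' := by
  subst h; rfl

/-- If both `s` and `s⁻¹` preserve `X₊`, the two actions are compatible. -/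
lemma actQuot_mkQ (H : Admissible 𝓕 e) {s : AutX π} (hs : s ∈ PhatPlus π e)
    (hs' : s⁻¹ ∈ PhatPlus π e) (c : H0plus 𝓕) :
    actQuot H hs' ((imSigma 𝓕).mkQ c) = (imSigma 𝓕).mkQ (actH0 H hs c) :=
  LinearMap.congr_fun (CoeffSystem.H0_hom_ext (f := actQuot H hs' ∘ₗ (imSigma 𝓕).mkQ)
    (g := (imSigma 𝓕).mkQ ∘ₗ actH0 H hs) fun x hx v => by
      rw [LinearMap.comp_apply, LinearMap.comp_apply, actQuot_cls H _ hx, actH0_cls H _ hx]) c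

lemma cls_actVert_congr (S : Set (Vert F)) {g : NT F} {x y z : Vert F} (hy : g • x = y)
    (hz : g • x = z) (v : 𝓕.onVert x) :
    𝓕.cls S y (𝓕.actVert g x y hy v) = 𝓕.cls S z (𝓕.actVert g x z hz v) := by
  subst hy; subst hz; rfl

/-- The class of `s v` in terms of a local representative. -/
lemma cls_autAct (H : Admissible 𝓕 e) (S : Set (Vert F)) {s : AutX π} {x y : Vert F} {g : NT F}
    (h : IsLocalRep π e s x g) (hy : g • x = y) (v : 𝓕.onVert x) :
    𝓕.cls S (s x) (autAct 𝓕 e s x v) = 𝓕.cls S y (𝓕.actVert g x y hy v) := by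
  rw [autAct_eq H.one_le H.hyp1 H.hyp2 H.hyp3 h]
  exact cls_actVert_congr _ _ _ _

/-- An element of `N̂^(e)` that fixes `Z₊^(e)(x)` pointwise acts trivially at `x`. -/
lemma cls_autAct_of_fix (H : Admissible 𝓕 e) (S : Set (Vert F)) {s : AutX π} (hs : s ∈ Nhat π e)
    {x : Vert F} (h : ∀ z ∈ Zplus π e x, s z = z) (v : 𝓕.onVert x) :
    𝓕.cls S (s x) (autAct 𝓕 e s x v) = 𝓕.cls S x v := by
  have hr : IsLocalRep π e s x 1 := isLocalRep_of_mem_N hs (one_mem _) fun z hz => by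
    rw [h z hz, one_smul]
  rw [cls_autAct H S hr (one_smul _ x), 𝓕.actVert_one]

end Actions

end BTree

end

/-! ### The topology of `N̂_{0,1}^(e)` and of `N₀^(e)` -/

noncomputable section

namespace BTree

variable {F : Type*} [Field F] [ValuativeRel F] [TopologicalSpace F]
  [IsNonarchimedeanLocalField F] {π : Uniformizer F} {e : ℕ}

lemma lvl_Nhat0_apply {s : AutX π} (hs : s ∈ Nhat0 π e) (x : Vert F) :
    lvl π (s x) = lvl π x := by
  obtain ⟨n, hn, h⟩ := hs x
  rw [h x (self_mem_Zplus π e x), lvl_N_smul (N0_le_N e hn)]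

lemma lvl_Nhat01_apply (h : Nhat01 π e) (x : Xplus F) :
    lvl π (h.1 x : Vert F) = lvl π (x : Vert F) := by
  obtain ⟨g, hg, hh⟩ := h.2
  rw [hh, lvl_Nhat0_apply hg]

lemma Nhat01_coe_mul (g h : Nhat01 π e) (x : Xplus F) : (g * h).1 x = g.1 (h.1 x) := rfl

lemma Nhat01_inv_apply_self (g : Nhat01 π e) (x : Xplus F) : (g⁻¹).1 (g.1 x) = x :=
  g.1.symm_apply_apply x

lemma Nhat01_apply_inv_self (g : Nhat01 π e) (x : Xplus F) : g.1 ((g⁻¹).1 x) = x :=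
  g.1.apply_symm_apply x

lemma isOpen_setOf_apply_eq (x y : Xplus F) : IsOpen {h : Nhat01 π e | h.1 x = y} := by
  let : TopologicalSpace (Xplus F) := ⊥
  have : DiscreteTopology (Xplus F) := ⟨rfl⟩
  have h1 : Continuous fun h : Nhat01 π e => fun x : Xplus F => h.1 x := continuous_induced_dom
  exact (isOpen_discrete {y}).preimage ((continuous_apply x).comp h1)

variable (π e) in
/-- The open normal subgroup of all elements that fix every vertex of level at most `m`. -/
def levelSubgroup (m : ℤ) : OpenNormalSubgroup (Nhat01 π e) where
  carrier := {h | ∀ x : Xplus F, lvl π (x : Vert F) ≤ m → h.1 x = x}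
  mul_mem' := fun {g h} hg hh x hx => by rw [Nhat01_coe_mul, hh x hx, hg x hx]
  one_mem' := fun x _ => rfl
  inv_mem' := fun {g} hg x hx => by
    conv_lhs => rw [← hg x hx]
    exact Nhat01_inv_apply_self g x
  isOpen' := by
    have hfin : {x : Xplus F | lvl π (x : Vert F) ≤ m}.Finite :=
      Set.Finite.of_finite_image ((finite_lvl_le π m).subset (by
        rintro _ ⟨x, hx, rfl⟩
        exact ⟨x.2, hx⟩)) Subtype.val_injective.injOn
    have : {h : Nhat01 π e | ∀ x : Xplus F, lvl π (x : Vert F) ≤ m → h.1 x = x} =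
        ⋂ x ∈ {x : Xplus F | lvl π (x : Vert F) ≤ m}, {h : Nhat01 π e | h.1 x = x} := by
      ext h
      simp
    exact this ▸ hfin.isOpen_biInter fun x _ => isOpen_setOf_apply_eq x x
  isNormal' := ⟨fun h hh g x hx => by
    change (g * h * g⁻¹).1 x = x
    have : lvl π (((g⁻¹).1 x : Xplus F) : Vert F) ≤ m := by rwa [lvl_Nhat01_apply]
    rw [Nhat01_coe_mul, Nhat01_coe_mul, hh _ this, Nhat01_apply_inv_self]⟩

lemma mem_levelSubgroup {m : ℤ} {h : Nhat01 π e} :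
    h ∈ levelSubgroup π e m ↔ ∀ x : Xplus F, lvl π (x : Vert F) ≤ m → h.1 x = x := Iff.rfl

/-- A neighbourhood of `1` for pointwise convergence is controlled by finitely many vertices, whose
levels are bounded. -/
lemma exists_levelSubgroup_le (U : OpenNormalSubgroup (Nhat01 π e)) :
    ∃ m : ℕ, (levelSubgroup π e m).toSubgroup ≤ U.toSubgroup := by
  let : TopologicalSpace (Xplus F) := ⊥
  have : DiscreteTopology (Xplus F) := ⟨rfl⟩
  obtain ⟨V, hV, hVU⟩ := isOpen_induced_iff.mp U.isOpen'
  have h1 : (fun x : Xplus F => (1 : Nhat01 π e).1 x) ∈ V := by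
    have : (1 : Nhat01 π e) ∈ (U : Set (Nhat01 π e)) := one_mem U
    exact (Set.ext_iff.mp hVU 1).mpr this
  obtain ⟨I, u, hu, hI⟩ := isOpen_pi_iff.mp hV _ h1
  refine ⟨I.sup fun x => (lvl π (x : Vert F)).toNat, fun h hh => ?_⟩
  refine (Set.ext_iff.mp hVU h).mp (hI fun x hx => ?_)
  have h2 : h.1 x = x := hh x (by
    have := Finset.le_sup (f := fun x : Xplus F => (lvl π (x : Vert F)).toNat) hx
    lia)
  change h.1 x ∈ u x
  rw [h2]
  exact (hu x hx).2

/-- The group preserves levels, and only finitely many vertices of `X₊` have level at most `m`. So a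
coset is determined by a self-map of a finite set. -/
instance finite_Nhat01_quotient (U : OpenNormalSubgroup (Nhat01 π e)) :
    Finite (Nhat01 π e ⧸ U.toSubgroup) := by
  obtain ⟨m, hm⟩ := exists_levelSubgroup_le U
  let Y := {x : Xplus F // lvl π (x : Vert F) ≤ m}
  have : Finite Y := by
    have : Finite {x | x ∈ Xplus F ∧ lvl π x ≤ m} := finite_lvl_le π m
    refine Finite.of_injective (β := {x | x ∈ Xplus F ∧ lvl π x ≤ m})
      (fun x : Y => ⟨(x.1 : Vert F), x.1.2, x.2⟩) fun x y hxy => ?_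
    have h := Subtype.ext_iff.mp hxy
    exact Subtype.ext (Subtype.ext h)
  let r : Nhat01 π e → Y → Y := fun h x => ⟨h.1 x.1, by rw [lvl_Nhat01_apply]; exact x.2⟩
  let j : Nhat01 π e ⧸ U.toSubgroup → (Y → Y) := fun q => r q.out
  refine Finite.of_injective j fun q q' hqq => ?_
  rw [← q.out_eq, ← q'.out_eq]
  refine QuotientGroup.eq.mpr (hm fun x hx => ?_)
  have h1 : q.out.1 x = q'.out.1 x := congrArg Subtype.val (congrFun hqq ⟨x, hx⟩)
  rw [Nhat01_coe_mul, ← h1, Nhat01_inv_apply_self]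

lemma natCast_mem_uniformizer (p : ℕ) [CharP 𝓀[F] p] :
    ∃ c ∈ 𝒪[F], (p : F) = (π.1 : F) * c := by
  have h : (p : 𝒪[F]) ∈ IsLocalRing.maximalIdeal 𝒪[F] := by
    rw [← IsLocalRing.residue_eq_zero_iff, map_natCast]
    exact CharP.cast_eq_zero 𝓀[F] p
  rw [(IsDiscreteValuationRing.irreducible_iff_uniformizer _).mp π.irreducible,
    Ideal.mem_span_singleton] at h
  obtain ⟨c, hc⟩ := h
  refine ⟨c, c.2, ?_⟩
  have := congrArg Subtype.val hc
  push_cast at this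
  exact this

lemma aff_one_pow (b : F) (m : ℕ) : aff 1 b ^ m = aff 1 (m * b) := by
  induction m with
  | zero => simp [aff_one]
  | succ k ih => rw [pow_succ, ih, aff_mul, one_mul, Units.val_one, one_mul]; push_cast; ring_nf

/-- If `h` fixes all vertices of level at most `j`, it acts on the children of each vertex of level
`j` by a translation. The `p`-th power of this translation is trivial on the children, because `p`
lies in `p_F 𝒪`. So each `p`-th power gains one level, starting from the fact that `x₊` is fixed. -/
lemma isPGroup_Nhat01_quotient (he : 1 ≤ e) (p : ℕ) [CharP 𝓀[F] p]
    (U : OpenNormalSubgroup (Nhat01 π e)) : IsPGroup p (Nhat01 π e ⧸ U.toSubgroup) := by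
  obtain ⟨m, hm⟩ := exists_levelSubgroup_le U
  have step : ∀ (j : ℤ) (h : Nhat01 π e), h ∈ levelSubgroup π e j →
      h ^ p ∈ levelSubgroup π e (j + 1) := by
    intro j h hh x hx
    rcases lt_or_eq_of_le hx with hx | hx
    · exact pow_mem hh p x (by lia)
    by_cases hx0 : (x : Vert F) = xPlus F
    · obtain ⟨g, hg, hhg⟩ := (h ^ p).2
      refine Subtype.ext ?_
      rw [hhg, hx0, Nhat0_apply_xPlus hg]
    obtain ⟨g, hg, hhg⟩ := h.2
    have hpar := par_mem_Xplus (π := π) x.2 hx0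
    have hfix : g (par π (x : Vert F)) = par π x := by
      have := hh ⟨_, hpar⟩ (by rw [lvl_par]; lia)
      rw [← hhg ⟨_, hpar⟩, this]
    obtain ⟨n, hn, hgn⟩ := hg (par π (x : Vert F))
    have hgP := Nhat_le_Phat e (Nhat0_le_Nhat e hg)
    have key : ∀ k : ℕ, ((h ^ k).1 x : Vert F) = n ^ k • (x : Vert F) ∧
        par π (n ^ k • (x : Vert F)) = par π x := by
      intro k
      induction k with
      | zero => exact ⟨by simp, by simp⟩
      | succ k ih =>
        have h1 : g (n ^ k • (x : Vert F)) = n • n ^ k • (x : Vert F) :=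
          hgn _ (mem_Zplus_of_par_eq he ih.2)
        rw [pow_succ', pow_succ', mul_smul, Nhat01_coe_mul, hhg, ih.1, h1]
        exact ⟨rfl, by rw [← h1, par_apply_of_mem_Phat he hgP, ih.2, hfix]⟩
    refine Subtype.ext ?_
    rw [(key p).1]
    obtain ⟨b, rfl⟩ := N0_le_N e hn
    have h2 : aff 1 b • par π (x : Vert F) = par π x := by
      rw [← hgn _ (self_mem_Zplus π e _), hfix]
    rw [aff_one_smul_eq_iff (π := π), lvl_par] at h2
    rw [aff_one_pow, aff_one_smul_eq_iff (π := π)]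
    obtain ⟨c, hc, hpc⟩ := natCast_mem_uniformizer (π := π) p
    have h3 := mul_mem hc h2
    have h4 : (p : F) * b * (π.1 : F) ^ (-lvl π (x : Vert F)) =
        c * (b * (π.1 : F) ^ (-(lvl π (x : Vert F) - 1))) := by
      rw [hpc, show -(lvl π (x : Vert F) - 1) = -lvl π (x : Vert F) + 1 by ring,
        zpow_add_one₀ π.1.ne_zero]
      ring
    rwa [h4]
  have h0 : ∀ h : Nhat01 π e, h ∈ levelSubgroup π e 0 := by
    intro h x hx
    obtain ⟨g, hg, hhg⟩ := h.2
    refine Subtype.ext ?_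
    rw [hhg, eq_xPlus_of_lvl_le π x.2 hx, Nhat0_apply_xPlus hg]
  intro q
  refine ⟨m, ?_⟩
  rw [← q.out_eq]
  have hk : ∀ k : ℕ, q.out ^ p ^ k ∈ levelSubgroup π e k := by
    intro k
    induction k with
    | zero => simpa using h0 _
    | succ k ih =>
      rw [pow_succ p, pow_mul]
      push_cast
      exact step _ _ ih
  exact (QuotientGroup.eq_one_iff (N := U.toSubgroup) (q.out ^ p ^ m)).mpr (hm (hk m))

/-! ### The group `N₀^(e)` -/

lemma continuous_aff_one : Continuous fun b : F => aff 1 b := by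
  refine Units.continuous_iff.mpr ⟨?_, ?_⟩
  · refine continuous_matrix fun i j => ?_
    fin_cases i <;> fin_cases j <;>
      simp [aff, Matrix.GeneralLinearGroup.mkOfDetNeZero] <;> fun_prop
  · have : (fun b : F => (((aff 1 b)⁻¹ : GL (Fin 2) F) : Matrix (Fin 2) (Fin 2) F)) =
        fun b => (aff 1 (-b)).1 := by
      funext b
      rw [aff_inv, inv_one, Units.val_one, neg_mul, one_mul]
    change Continuous fun b : F => (((aff 1 b)⁻¹ : GL (Fin 2) F) : Matrix (Fin 2) (Fin 2) F)
    rw [this]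
    refine continuous_matrix fun i j => ?_
    fin_cases i <;> fin_cases j <;>
      simp [aff, Matrix.GeneralLinearGroup.mkOfDetNeZero] <;> fun_prop

/-- The group is a continuous image of the compact ring `𝒪`. Compactness makes its quotients by open
subgroups finite, as the construction of measures from functionals requires. -/
instance compactSpace_N0 : CompactSpace (N0 π e) := by
  have h : Function.Surjective fun c : 𝒪[F] =>
      (⟨aff 1 ((π.1 : F) ^ (e - 1) * c), c, c.2, rfl⟩ : N0 π e) := by
    rintro ⟨_, c, hc, rfl⟩
    exact ⟨⟨c, hc⟩, rfl⟩
  have hc : Continuous fun c : 𝒪[F] =>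
      (⟨aff 1 ((π.1 : F) ^ (e - 1) * c), c, c.2, rfl⟩ : N0 π e) :=
    Continuous.subtype_mk (continuous_aff_one.comp (by fun_prop)) _
  exact ⟨h.range_eq ▸ isCompact_range hc⟩

instance finite_N0_quotient (U : OpenNormalSubgroup (N0 π e)) :
    Finite (N0 π e ⧸ U.toSubgroup) :=
  Subgroup.quotient_finite_of_isOpen _ U.isOpen'

lemma coe_conjN0 (m : ℕ) (n : N0 π e) :
    ((conjN0 π e m n : N0 π e) : GL (Fin 2) F) = t π ^ m * n * (t π ^ m)⁻¹ := rfl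

lemma conjN0_injective (m : ℕ) : Function.Injective (conjN0 π e m) := fun n n' h => by
  have := congrArg Subtype.val h
  rw [coe_conjN0, coe_conjN0, mul_left_inj, mul_right_inj] at this
  exact Subtype.ext this

lemma t_pow_conj_aff (m : ℕ) (b : F) :
    t π ^ m * aff 1 b * (t π ^ m)⁻¹ = aff 1 ((π.1 : F) ^ m * b) := by
  rw [mul_inv_eq_iff_eq_mul, t, aff_pow, aff_mul, aff_mul]
  congr 1
  · rw [mul_one, one_mul]
  · simp

lemma mem_conjN0_range {m : ℕ} {b : F} (hb : aff 1 b ∈ N0 π e) :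
    (⟨aff 1 b, hb⟩ : N0 π e) ∈ (conjN0 π e m).range ↔
      b * (π.1 : F) ^ (-(m + (e - 1 : ℕ) : ℤ)) ∈ 𝒪[F] := by
  have h0 : (π.1 : F) ^ m ≠ 0 := pow_ne_zero _ π.1.ne_zero
  have hz : (π.1 : F) ^ (-(m + (e - 1 : ℕ) : ℤ)) =
      ((π.1 : F) ^ m)⁻¹ * (π.1 : F) ^ (-((e - 1 : ℕ) : ℤ)) := by
    rw [neg_add, zpow_add₀ π.1.ne_zero, zpow_neg, zpow_natCast]
  rw [hz]
  constructor
  · rintro ⟨⟨n, hn⟩, h⟩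
    obtain ⟨c, rfl, hc⟩ := N0_eq_aff hn
    have h1 := congrArg (fun g : N0 π e => g.1.1 0 1) h
    simp only [coe_conjN0, t_pow_conj_aff] at h1
    have h2 : (π.1 : F) ^ m * c = b := by
      simpa [aff, Matrix.GeneralLinearGroup.mkOfDetNeZero] using h1
    rw [← h2, mul_comm ((π.1 : F) ^ m) c, mul_assoc, mul_inv_cancel_left₀ h0]
    exact hc
  · intro h
    refine ⟨⟨aff 1 (b * ((π.1 : F) ^ m)⁻¹), aff_one_mem_N0_iff.mpr (by rwa [mul_assoc])⟩, ?_⟩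
    refine Subtype.ext ?_
    rw [coe_conjN0, t_pow_conj_aff, mul_comm b, mul_inv_cancel_left₀ h0]

lemma isOpen_conjN0_range (m : ℕ) : IsOpen ((conjN0 π e m).range : Set (N0 π e)) := by
  have hO : IsOpen (𝒪[F] : Set F) := (ValuativeRel.valuation F).isOpen_integer
  have hc : Continuous fun n : N0 π e =>
      (n : GL (Fin 2) F).1 0 1 * (π.1 : F) ^ (-(m + (e - 1 : ℕ) : ℤ)) := by
    have h1 : Continuous fun n : N0 π e => (n : GL (Fin 2) F).1 :=
      Units.continuous_val.comp continuous_subtype_val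
    exact (h1.matrix_elem 0 1).mul continuous_const
  convert hO.preimage hc using 1
  ext ⟨n, hn⟩
  obtain ⟨b, rfl⟩ := N0_le_N e hn
  rw [SetLike.mem_coe, mem_conjN0_range]
  simp [aff, Matrix.GeneralLinearGroup.mkOfDetNeZero]

lemma isOpenMap_conjN0 (m : ℕ) : IsOpenMap (conjN0 π e m) := by
  refine Topology.IsInducing.isOpenMap ?_ (isOpen_conjN0_range m)
  have h1 : Topology.IsInducing fun n : N0 π e => t π ^ m * (n : GL (Fin 2) F) * (t π ^ m)⁻¹ :=
    ((Homeomorph.mulRight (t π ^ m)⁻¹).isInducing.comp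
      (Homeomorph.mulLeft (t π ^ m)).isInducing).comp Topology.IsInducing.subtypeVal
  exact Topology.IsInducing.of_comp (continuous_conjN0 π e m) continuous_subtype_val h1

instance finite_conjN0_quotient (m : ℕ) : Finite (N0 π e ⧸ (conjN0 π e m).range) :=
  Subgroup.quotient_finite_of_isOpen _ (isOpen_conjN0_range m)

/-- In additive terms, raising to the power `p ^ m` is multiplication by `p ^ m`, which lies in
`p_F^m 𝒪`. -/
lemma pow_mem_conjN0_range (p : ℕ) [CharP 𝓀[F] p] (m : ℕ) (n : N0 π e) :
    n ^ p ^ m ∈ (conjN0 π e m).range := by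
  obtain ⟨n, hn⟩ := n
  obtain ⟨b, rfl, hb⟩ := N0_eq_aff hn
  obtain ⟨c, hc, hpc⟩ := natCast_mem_uniformizer (π := π) p
  have h1 : (⟨aff 1 b, hn⟩ : N0 π e) ^ p ^ m =
      ⟨aff 1 (((p ^ m : ℕ) : F) * b), aff_one_pow (F := F) b (p ^ m) ▸ pow_mem hn _⟩ :=
    Subtype.ext (aff_one_pow b _)
  rw [h1, mem_conjN0_range]
  have h2 : ((p ^ m : ℕ) : F) * b * (π.1 : F) ^ (-(m + (e - 1 : ℕ) : ℤ)) =
      c ^ m * (b * (π.1 : F) ^ (-((e - 1 : ℕ) : ℤ))) := by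
    have h0 : (π.1 : F) ^ m ≠ 0 := pow_ne_zero _ π.1.ne_zero
    rw [neg_add, zpow_add₀ π.1.ne_zero, zpow_neg _ (m : ℤ), zpow_natCast]
    push_cast
    rw [hpc, mul_pow]
    field_simp
  rw [h2]
  exact mul_mem (pow_mem hc m) hb

/-- `N₀^(e)` has a nontrivial element that lies outside of some open normal subgroup. -/
lemma exists_notMem_openNormal (π : Uniformizer F) (e : ℕ) :
    ∃ (h : N0 π e) (U : OpenNormalSubgroup (N0 π e)), h ∉ U := by
  have hm : aff 1 ((π.1 : F) ^ (e - 1)) ∈ N0 π e := ⟨1, one_mem _, by rw [mul_one]⟩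
  let U : OpenNormalSubgroup (N0 π e) :=
    { toSubgroup := (conjN0 π e 1).range
      isOpen' := isOpen_conjN0_range 1
      isNormal' := ⟨fun n hn g => by rwa [N0_comm π e g n, mul_inv_cancel_right]⟩ }
  refine ⟨⟨_, hm⟩, U, fun h => ?_⟩
  have := (mem_conjN0_range hm).mp h
  rw [← zpow_natCast, ← zpow_add₀ π.1.ne_zero, zpow_mem_integer_iff] at this
  push_cast at this
  lia

end BTree

end

/-! ### Invariants in `H₀(X₊, F)` -/

noncomputable section

namespace CoeffSystem

variable {Λ : Type*} [CommRing Λ] {V : Type*} {X : SimpleGraph V} (𝓕 : CoeffSystem Λ X) {S : Set V}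

open Classical in
/-- The `0`-chain supported at one vertex. -/
def chain (x : V) (hx : x ∈ S) : 𝓕.onVert x →ₗ[Λ] 𝓕.Chains S :=
  DirectSum.lof Λ S (fun x => 𝓕.onVert x) ⟨x, hx⟩

/-- The coefficient of a `0`-chain at a vertex. -/
def coeff (x : V) (hx : x ∈ S) : 𝓕.Chains S →ₗ[Λ] 𝓕.onVert x :=
  DirectSum.component Λ S (fun x => 𝓕.onVert x) ⟨x, hx⟩

variable {𝓕}

lemma coeff_chain_self {x : V} (hx : x ∈ S) (v : 𝓕.onVert x) :
    𝓕.coeff x hx (𝓕.chain x hx v) = v := by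
  classical
  exact DirectSum.component.lof_self (M := fun x : S => 𝓕.onVert x) Λ ⟨x, hx⟩ v

lemma coeff_chain_of_ne {x y : V} (hx : x ∈ S) (hy : y ∈ S) (h : x ≠ y)
    (v : 𝓕.onVert x) : 𝓕.coeff y hy (𝓕.chain x hx v) = 0 := by
  classical
  have h1 : (⟨x, hx⟩ : S) ≠ ⟨y, hy⟩ := fun h' => h (congrArg Subtype.val h')
  exact (DirectSum.component.of (M := fun x : S => 𝓕.onVert x) (R := Λ) ⟨y, hy⟩ ⟨x, hx⟩ v).trans
    (dif_neg h1)

lemma boundaries_le {P : Submodule Λ (𝓕.Chains S)}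
    (h : ∀ (x y : V) (hx : x ∈ S) (hy : y ∈ S) (h : X.Adj x y) (v : 𝓕.onEdge ⟨s(x, y), h⟩),
      𝓕.chain x hx (𝓕.res x ⟨s(x, y), h⟩ (Sym2.mem_mk_left _ _) v) +
        𝓕.chain y hy (𝓕.res y ⟨s(x, y), h⟩ (Sym2.mem_mk_right _ _) v) ∈ P) :
    𝓕.boundaries S ≤ P := by
  refine Submodule.span_le.mpr ?_
  rintro _ ⟨⟨x, hx⟩, ⟨y, hy⟩, hadj, v, rfl⟩
  exact h x y hx hy hadj v

lemma chain_mem_boundaries {x : V} {hx : x ∈ S} {v : 𝓕.onVert x} (h : 𝓕.cls S x v = 0) :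
    𝓕.chain x hx v ∈ 𝓕.boundaries S := by
  rw [𝓕.cls_of_mem S hx] at h
  exact (Submodule.Quotient.mk_eq_zero _).mp h

end CoeffSystem

namespace BTree

open CoeffSystem (coeff_chain_self coeff_chain_of_ne)

variable {F : Type*} [Field F] [ValuativeRel F] [TopologicalSpace F]
  [IsNonarchimedeanLocalField F] {π : Uniformizer F} {e : ℕ}
  {Λ : Type*} [CommRing Λ] {𝓕 : EquivariantCoeffSystem Λ (NT F) (tree π)}

/-! #### Injectivity of `F(y) → H₀(X₊, F)` -/

section Injective

variable (F) in
/-- The vertices of `X₊` different from `x₊`; they correspond to the edges of `X₊`. -/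
abbrev XplusEdges : Type _ := {z : Vert F // z ∈ Xplus F ∧ z ≠ xPlus F}

open Classical in
/-- The boundary operator on `X₊`. -/
def boundary (𝓕 : EquivariantCoeffSystem Λ (NT F) (tree π)) :
    (⨁ z : XplusEdges F, 𝓕.onEdge (edge π z.1)) →ₗ[Λ] 𝓕.Chains (Xplus F) :=
  DirectSum.toModule Λ _ _ fun z =>
    𝓕.chain z.1 z.2.1 ∘ₗ 𝓕.res z.1 (edge π z.1) (mem_edge_left _) +
    𝓕.chain (par π z.1) (par_mem_Xplus z.2.1 z.2.2) ∘ₗ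
      𝓕.res (par π z.1) (edge π z.1) (mem_edge_right _)

lemma boundaries_le_range_boundary :
    𝓕.boundaries (Xplus F) ≤ LinearMap.range (boundary 𝓕) := by
  classical
  have key : ∀ (x y : Vert F) (hx : x ∈ Xplus F) (hy : y ∈ Xplus F) (hpar : y = par π x)
      (η : (tree π).edgeSet) (hη : η = edge π x) (h1 : x ∈ (η : Sym2 (Vert F)))
      (h2 : y ∈ (η : Sym2 (Vert F))) (v : 𝓕.onEdge η),
      𝓕.chain x hx (𝓕.res x η h1 v) + 𝓕.chain y hy (𝓕.res y η h2 v) ∈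
      LinearMap.range (boundary 𝓕) := by
    rintro x _ hx hy rfl _ rfl h1 h2 v
    have hne : x ≠ xPlus F := fun h0 => par_xPlus_notMem π (h0 ▸ hy)
    refine ⟨DirectSum.lof Λ (XplusEdges F) (fun z => 𝓕.onEdge (edge π z.1)) ⟨x, hx, hne⟩ v, ?_⟩
    rw [boundary, DirectSum.toModule_lof]
    rfl
  refine CoeffSystem.boundaries_le fun x y hx hy h0 v => ?_
  rcases adj_iff.mp h0 with h' | h'
  · exact key x y hx hy h'.symm ⟨s(x, y), h0⟩
      (Subtype.ext (congrArg (fun z => s(x, z)) h'.symm)) (Sym2.mem_mk_left _ _)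
      (Sym2.mem_mk_right _ _) v
  · have := key y x hy hx h'.symm ⟨s(x, y), h0⟩
      (Subtype.ext (Sym2.eq_swap.trans (congrArg (fun z => s(y, z)) h'.symm)))
      (Sym2.mem_mk_right _ _) (Sym2.mem_mk_left _ _) v
    rw [add_comm] at this
    exact this

open Classical in
lemma coeff_boundary (w : ⨁ z : XplusEdges F, 𝓕.onEdge (edge π z.1)) (x : Vert F)
    (hx : x ∈ Xplus F) :
    𝓕.coeff x hx (boundary 𝓕 w) =
      ∑ z ∈ DFinsupp.support w, (𝓕.coeff x hx (𝓕.chain z.1 z.2.1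
            (𝓕.res z.1 (edge π z.1) (mem_edge_left _) (w z))) +
        𝓕.coeff x hx (𝓕.chain (par π z.1) (par_mem_Xplus z.2.1 z.2.2)
            (𝓕.res (par π z.1) (edge π z.1) (mem_edge_right _) (w z)))) := by
  conv_lhs => rw [← DirectSum.sum_support_of w]
  rw [map_sum, map_sum]
  refine Finset.sum_congr rfl fun z _ => ?_
  rw [← map_add]
  congr 1
  exact DirectSum.toModule_lof (M := fun z : XplusEdges F => 𝓕.onEdge (edge π z.1)) Λ z (w z)

lemma coeff_boundary_top (w : ⨁ z : XplusEdges F, 𝓕.onEdge (edge π z.1)) (x : XplusEdges F)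
    (h : ∀ z : XplusEdges F, par π z.1 = x.1 → w z = 0) :
    𝓕.coeff x.1 x.2.1 (boundary 𝓕 w) = 𝓕.res x.1 (edge π x.1) (mem_edge_left _) (w x) := by
  classical
  rw [coeff_boundary, Finset.sum_eq_single x]
  · rw [coeff_chain_self, coeff_chain_of_ne _ _ (par_ne_self x.1), add_zero]
  · intro z _ hz
    rw [coeff_chain_of_ne _ _ (fun h => hz (Subtype.ext h)), zero_add]
    by_cases hz' : par π z.1 = x.1
    · rw [h z hz', map_zero, map_zero, map_zero]
    · exact coeff_chain_of_ne _ _ hz' _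
  · intro hx
    rw [DFinsupp.notMem_support_iff.mp hx, map_zero, map_zero, map_zero, map_zero, map_zero,
      map_zero, add_zero]

lemma coeff_boundary_child (w : ⨁ z : XplusEdges F, 𝓕.onEdge (edge π z.1)) (y : XplusEdges F)
    (h : ∀ z : XplusEdges F, z ≠ y → par π z.1 = par π y.1 → w z = 0)
    (h' : ∀ z : XplusEdges F, z.1 = par π y.1 → w z = 0) :
    𝓕.coeff (par π y.1) (par_mem_Xplus y.2.1 y.2.2) (boundary 𝓕 w) =
      𝓕.res (par π y.1) (edge π y.1) (mem_edge_right _) (w y) := by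
  classical
  rw [coeff_boundary, Finset.sum_eq_single y]
  · rw [coeff_chain_of_ne _ _ (par_ne_self y.1).symm, coeff_chain_self, zero_add]
  · intro z _ hz
    by_cases h1 : z.1 = par π y.1
    · rw [h' z h1, map_zero, map_zero, map_zero, map_zero, map_zero, map_zero, add_zero]
    by_cases h2 : par π z.1 = par π y.1
    · rw [h z hz h2, map_zero, map_zero, map_zero, map_zero, map_zero, map_zero, add_zero]
    rw [coeff_chain_of_ne _ _ h1, coeff_chain_of_ne _ _ h2, add_zero]
  · intro hx
    rw [DFinsupp.notMem_support_iff.mp hx, map_zero, map_zero, map_zero, map_zero, map_zero,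
      map_zero, add_zero]

/-- The graph `X₊` is a tree and the transition maps are injective, so an extremal edge in the
support of `w` leaves a nonzero boundary at its free end. Among the edges off the path from `y` to
`x₊`, one of maximal level would do so at its child end. Hence the support lies on this path, where
the edge of minimal level would do so at its parent end. Neither of these ends is `y`. -/
lemma eq_zero_of_boundary_eq_chain (h1 : Hyp1 𝓕) {y : Vert F} (hy : y ∈ Xplus F)
    {v : 𝓕.onVert y} {w : ⨁ z : XplusEdges F, 𝓕.onEdge (edge π z.1)}
    (hw : boundary 𝓕 w = 𝓕.chain y hy v) : w = 0 := by
  classical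
  have hcomp : ∀ (x : Vert F) (hx : x ∈ Xplus F), x ≠ y → 𝓕.coeff x hx (boundary 𝓕 w) = 0 :=
    fun x hx hxy => by rw [hw, coeff_chain_of_ne _ _ hxy.symm]
  have hanc : ∀ z : XplusEdges F, w z ≠ 0 → ∃ k : ℕ, (par π)^[k] y = z.1 := by
    by_contra! hne
    obtain ⟨z₀, hz₀, hz₀'⟩ := hne
    obtain ⟨z, hz, hmax⟩ := Finset.exists_max_image
      ((DFinsupp.support w).filter fun z => ∀ k : ℕ, (par π)^[k] y ≠ z.1) (fun z => lvl π z.1)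
      ⟨z₀, Finset.mem_filter.mpr ⟨DFinsupp.mem_support_iff.mpr hz₀, hz₀'⟩⟩
    obtain ⟨hz, hz'⟩ := Finset.mem_filter.mp hz
    refine DFinsupp.mem_support_iff.mp hz (h1 z.1 _ (mem_edge_left _) ?_)
    rw [map_zero, ← coeff_boundary_top w z, hcomp]
    · exact fun h => hz' 0 h.symm
    · intro x hx
      by_contra hx0
      by_cases hxa : ∃ k : ℕ, (par π)^[k] y = x.1
      · obtain ⟨k, hk⟩ := hxa
        exact hz' (k + 1) (by rw [Function.iterate_succ_apply', hk, hx])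
      · push Not at hxa
        have := hmax x (Finset.mem_filter.mpr ⟨DFinsupp.mem_support_iff.mpr hx0, hxa⟩)
        have h2 := congrArg (lvl π) hx
        rw [lvl_par] at h2
        lia
  by_contra hne
  have hsupp : (DFinsupp.support w).Nonempty := by
    rw [Finset.nonempty_iff_ne_empty]
    exact fun h => hne (DFinsupp.support_eq_empty.mp h)
  obtain ⟨z, hz, hmin⟩ := Finset.exists_min_image _ (fun z : XplusEdges F => lvl π z.1) hsupp
  have hwz := DFinsupp.mem_support_iff.mp hz
  obtain ⟨k, hk⟩ := hanc z hwz
  have hkl := congrArg (lvl π) hk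
  rw [lvl_par_iterate] at hkl
  have h3 : par π z.1 ≠ y := fun h => by
    have := congrArg (lvl π) h
    rw [lvl_par] at this
    lia
  refine hwz (h1 (par π z.1) _ (mem_edge_right _) ?_)
  rw [map_zero, ← coeff_boundary_child w z ?_ ?_, hcomp _ _ h3]
  · intro x hxz hx
    by_contra hx0
    obtain ⟨l, hl⟩ := hanc x hx0
    have hll := congrArg (lvl π) hl
    have h2 := congrArg (lvl π) hx
    rw [lvl_par_iterate] at hll
    rw [lvl_par, lvl_par] at h2
    have : l = k := by lia
    exact hxz (Subtype.ext (by rw [← hl, ← hk, this]))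
  · intro x hx
    by_contra hx0
    have := hmin x (DFinsupp.mem_support_iff.mpr hx0)
    rw [hx, lvl_par] at this
    lia

lemma cls_injective (h1 : Hyp1 𝓕) {y : Vert F} (hy : y ∈ Xplus F) :
    Function.Injective (𝓕.cls (Xplus F) y) := by
  refine (injective_iff_map_eq_zero _).mpr fun v hv => ?_
  obtain ⟨w, hw⟩ := boundaries_le_range_boundary
    (CoeffSystem.chain_mem_boundaries (hx := hy) hv)
  rw [eq_zero_of_boundary_eq_chain h1 hy hw, map_zero] at hw
  rw [← coeff_chain_self hy v, ← hw, map_zero]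

end Injective

/-! #### Chains concentrated on one level -/

variable (π) in
/-- The vertices of `X₊` of level `j`. -/
def levelSet (j : ℕ) : Finset (Vert F) :=
  (show {x | x ∈ Xplus F ∧ lvl π x = j}.Finite from
    (finite_lvl_le π j).subset fun _ hx => ⟨hx.1, le_of_eq hx.2⟩).toFinset

lemma mem_levelSet {j : ℕ} {x : Vert F} : x ∈ levelSet π j ↔ x ∈ Xplus F ∧ lvl π x = j := by
  simp [levelSet]

variable (𝓕) in
/-- The classes of the chains concentrated on the vertices of level `j`. -/
def levelPart (j : ℕ) : Submodule Λ (H0plus 𝓕) where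
  carrier := {c | ∃ v : ∀ x, 𝓕.onVert x, c = ∑ x ∈ levelSet π j, 𝓕.cls (Xplus F) x (v x)}
  add_mem' := by
    rintro _ _ ⟨v, rfl⟩ ⟨w, rfl⟩
    exact ⟨v + w, by simp [Finset.sum_add_distrib]⟩
  zero_mem' := ⟨0, by simp⟩
  smul_mem' := by
    rintro r _ ⟨v, rfl⟩
    exact ⟨r • v, by simp [Finset.smul_sum]⟩

lemma cls_mem_levelPart {j : ℕ} {x : Vert F} (hx : x ∈ levelSet π j) (v : 𝓕.onVert x) :
    𝓕.cls (Xplus F) x v ∈ levelPart 𝓕 j := by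
  classical
  refine ⟨Pi.single x v, ?_⟩
  rw [Finset.sum_eq_single_of_mem x hx fun y _ hy => by rw [Pi.single_eq_of_ne hy, map_zero],
    Pi.single_eq_same]

/-- By (Hyp 2) a vector at `x` is a sum of vectors coming from the edges to the children of `x`, and
each such edge moves its summand, up to sign, to the child. -/
lemma levelPart_le_succ (h2 : Hyp2 𝓕) (j : ℕ) : levelPart 𝓕 j ≤ levelPart 𝓕 (j + 1) := by
  rintro _ ⟨v, rfl⟩
  refine sum_mem fun x hx => ?_
  obtain ⟨hxX, hxj⟩ := mem_levelSet.mp hx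
  generalize v x = u
  have hv : u ∈ Submodule.span Λ {w : 𝓕.onVert x |
      ∃ (y : Vert F) (h : x ∈ (edge π y : Sym2 (Vert F))),
      par π y = x ∧ ∃ v : 𝓕.onEdge (edge π y), 𝓕.res x (edge π y) h v = w} := by
    rw [h2.span_eq]; trivial
  induction hv using Submodule.span_induction with
  | zero => rw [map_zero]; exact zero_mem _
  | add a b _ _ ha hb => rw [map_add]; exact add_mem ha hb
  | smul r a _ ha => rw [map_smul]; exact Submodule.smul_mem _ r ha
  | mem w hw =>
    obtain ⟨y, h, hyx, w, rfl⟩ := hw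
    have hyX : y ∈ Xplus F := mem_Xplus_of_par (by rwa [hyx])
    have h3 := eq_neg_of_add_eq_zero_right
      (cls_edge (Xplus F) hyx.symm hyX hxX (mem_edge_left y) h w)
    rw [h3]
    refine neg_mem (cls_mem_levelPart (mem_levelSet.mpr ⟨hyX, ?_⟩) _)
    have h4 := lvl_par (π := π) y
    rw [hyx] at h4
    push_cast
    lia

lemma exists_mem_levelPart (h2 : Hyp2 𝓕) (c : H0plus 𝓕) : ∃ j, c ∈ levelPart 𝓕 j := by
  have hmono : Monotone (levelPart 𝓕) := monotone_nat_of_le_succ (levelPart_le_succ h2)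
  refine CoeffSystem.H0_induction (P := fun c => ∃ j, c ∈ levelPart 𝓕 j) c (fun x hx v => ?_)
    ⟨0, zero_mem _⟩ ?_
  · refine ⟨(lvl π x).toNat, cls_mem_levelPart (mem_levelSet.mpr ⟨hx, ?_⟩) v⟩
    have := lvl_nonneg_of_mem_Xplus π hx
    lia
  · rintro c d ⟨i, hc⟩ ⟨j, hd⟩
    exact ⟨max i j, add_mem (hmono (le_max_left i j) hc) (hmono (le_max_right i j) hd)⟩

/-! #### Automorphisms concentrated below a vertex -/

section Shear

open Classical in
variable (π) in
/-- The map which is given by `n` on the descendants of `y`, and by the identity elsewhere. -/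
def shearFun (y : Vert F) (n : GL (Fin 2) F) (x : Vert F) : Vert F :=
  if ∃ k : ℕ, (par π)^[k] x = y then n • x else x

lemma par_iterate_N_smul {n : GL (Fin 2) F} (hn : n ∈ N F) (k : ℕ) (x : Vert F) :
    (par π)^[k] (n • x) = n • (par π)^[k] x := by
  induction k with
  | zero => rfl
  | succ k ih =>
    rw [Function.iterate_succ_apply', ih, par_NT_smul (N_le_NT hn), Function.iterate_succ_apply']

lemma shearFun_of_mem {y : Vert F} (n : GL (Fin 2) F) {x : Vert F}
    (h : ∃ k : ℕ, (par π)^[k] x = y) :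
    shearFun π y n x = n • x := if_pos h

lemma shearFun_of_notMem {y : Vert F} (n : GL (Fin 2) F) {x : Vert F}
    (h : ¬ ∃ k : ℕ, (par π)^[k] x = y) : shearFun π y n x = x := if_neg h

lemma shearFun_inv {y : Vert F} {n : GL (Fin 2) F} (hn : n ∈ N F) (hy : n • y = y) (x : Vert F) :
    shearFun π y n⁻¹ (shearFun π y n x) = x := by
  by_cases h : ∃ k : ℕ, (par π)^[k] x = y
  · rw [shearFun_of_mem n h, shearFun_of_mem, inv_smul_smul]
    obtain ⟨k, hk⟩ := h
    exact ⟨k, by rw [par_iterate_N_smul hn, hk, hy]⟩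
  · rw [shearFun_of_notMem n h, shearFun_of_notMem _ h]

lemma par_shearFun {y : Vert F} {n : GL (Fin 2) F} (hn : n ∈ N F) (hy : n • y = y) (x : Vert F) :
    par π (shearFun π y n x) = shearFun π y n (par π x) := by
  by_cases h : ∃ k : ℕ, (par π)^[k] x = y
  · rw [shearFun_of_mem n h, par_NT_smul (N_le_NT hn)]
    obtain ⟨k, hk⟩ := h
    rcases k with _ | k
    · have hxy : x = y := hk
      rw [shearFun_of_notMem, ← par_NT_smul (N_le_NT hn), hxy, hy]
      rintro ⟨l, hl⟩
      rw [hxy, ← Function.iterate_succ_apply (par π)] at hl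
      have := congrArg (lvl π) hl
      rw [lvl_par_iterate] at this
      push_cast at this
      lia
    · rw [shearFun_of_mem n ⟨k, hk⟩]
  · rw [shearFun_of_notMem n h, shearFun_of_notMem n]
    rintro ⟨k, hk⟩
    exact h ⟨k + 1, hk⟩

lemma adj_shearFun {y : Vert F} {n : GL (Fin 2) F} (hn : n ∈ N F) (hy : n • y = y) {a b : Vert F}
    (h : (tree π).Adj a b) : (tree π).Adj (shearFun π y n a) (shearFun π y n b) := by
  rw [adj_iff] at h ⊢
  rw [par_shearFun hn hy, par_shearFun hn hy]
  exact h.imp (congrArg _) (congrArg _)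

/-- The automorphism which is given by `n` on the descendants of `y`, and by the identity
elsewhere. -/
def shear {y : Vert F} {n : GL (Fin 2) F} (hn : n ∈ N F) (hy : n • y = y) : AutX π where
  toFun := shearFun π y n
  invFun := shearFun π y n⁻¹
  left_inv := shearFun_inv hn hy
  right_inv x := by
    have := shearFun_inv (π := π) (inv_mem hn) (inv_smul_eq_iff.mpr hy.symm) x
    rwa [inv_inv] at this
  map_rel_iff' := by
    intro a b
    refine ⟨fun h => ?_, adj_shearFun hn hy⟩
    have := adj_shearFun (π := π) (inv_mem hn) (inv_smul_eq_iff.mpr hy.symm) h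
    change (tree π).Adj (shearFun π y n⁻¹ (shearFun π y n a))
      (shearFun π y n⁻¹ (shearFun π y n b)) at this
    rwa [shearFun_inv hn hy, shearFun_inv hn hy] at this

lemma shear_apply_of_mem {y : Vert F} {n : GL (Fin 2) F} (hn : n ∈ N F) (hy : n • y = y)
    {x : Vert F} (h : ∃ k : ℕ, (par π)^[k] x = y) : (shear hn hy : AutX π) x = n • x :=
  shearFun_of_mem n h

lemma shear_apply_of_notMem {y : Vert F} {n : GL (Fin 2) F} (hn : n ∈ N F) (hy : n • y = y)
    {x : Vert F} (h : ¬ ∃ k : ℕ, (par π)^[k] x = y) : (shear hn hy : AutX π) x = x :=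
  shearFun_of_notMem n h

/-- Near a descendant of `y` the automorphism is `n`. For any other `x`, a descendant of `x` of
generation at most `e` that also descends from `y` has generation at most `e - 1` over `y`, because
`y` then lies strictly below `x`; there `n` is the identity by `hfix`. -/
lemma shear_mem_Nhat0 (he : 1 ≤ e) {y : Vert F} (hyX : y ∈ Xplus F) {n : GL (Fin 2) F}
    (hn : n ∈ N F) (hfix : ∀ z ∈ Zplus π (e - 1) y, n • z = z) :
    (shear hn (hfix y (self_mem_Zplus π _ y)) : AutX π) ∈ Nhat0 π e := by
  intro x
  by_cases h : ∃ k : ℕ, (par π)^[k] x = y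
  · obtain ⟨k, hk⟩ := h
    refine ⟨n, ?_, fun z hz => ?_⟩
    -- Fixing descendants of `y` of level `lvl y + (e - 1) ≥ e - 1` forces `n` into `N₀^(e)`.
    · obtain ⟨b, rfl⟩ := hn
      rw [aff_one_mem_N0_iff]
      have h1 := aff_one_fix_Zplus_iff.mp hfix
      have := lvl_nonneg_of_mem_Xplus π hyX
      exact mul_zpow_mem_of_le π h1 (by lia)
    · obtain ⟨l, -, hl⟩ := mem_Zplus_iff.mp hz
      exact shear_apply_of_mem hn _ ⟨k + l, by rw [Function.iterate_add_apply, hl, hk]⟩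
  · refine ⟨1, one_mem _, fun z hz => ?_⟩
    rw [one_smul]
    obtain ⟨l, hle, hl⟩ := mem_Zplus_iff.mp hz
    by_cases hz' : ∃ k : ℕ, (par π)^[k] z = y
    · rw [shear_apply_of_mem hn _ hz']
      obtain ⟨k, hk⟩ := hz'
      refine hfix z (mem_Zplus_iff.mpr ⟨k, ?_, hk⟩)
      by_contra! hlt
      refine h ⟨k - l, ?_⟩
      rw [← hl, ← Function.iterate_add_apply, Nat.sub_add_cancel (by lia), hk]
    · exact shear_apply_of_notMem hn _ hz'

end Shear

/-! #### The invariants -/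

lemma Nhat0_mem_PhatPlus (he : 1 ≤ e) {s : AutX π} (hs : s ∈ Nhat0 π e) : s ∈ PhatPlus π e :=
  PhatStarExt_le_PhatPlus he (Nhat0_mem π hs)

/-- The shear at `y` attached to `g ∈ N_y^(e)` acts trivially at all other vertices of the level.
Invariance of `c` and injectivity of `F(y) → H₀(X₊, F)` thus show that the component of `c` at `y`
is fixed by `g`. By (Hyp 3) this component comes from the edge to the parent of `y`, along which it
descends. -/
lemma mem_levelPart_of_invariant (H : Admissible 𝓕 e) {c : H0plus 𝓕}
    (hc : ∀ (s : AutX π) (hs : s ∈ Nhat0 π e),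
      actH0 H (Nhat0_mem_PhatPlus H.one_le hs) c = c) {j : ℕ}
    (hj : c ∈ levelPart 𝓕 (j + 1)) : c ∈ levelPart 𝓕 j := by
  obtain ⟨v, rfl⟩ := hj
  refine sum_mem fun y hy => ?_
  obtain ⟨hyX, hyj⟩ := mem_levelSet.mp hy
  have hinv : ∀ g ∈ Nfix π e y, ∀ hg : g • y = y, 𝓕.actVert g y y hg (v y) = v y := by
    intro g hg hgy
    have hs := shear_mem_Nhat0 H.one_le hyX hg.1 hg.2
    set s : AutX π := shear hg.1 (hg.2 y (self_mem_Zplus π _ y))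
    have hs' := hc s hs
    rw [map_sum, ← sub_eq_zero, ← Finset.sum_sub_distrib, Finset.sum_eq_single_of_mem y hy] at hs'
    · refine cls_injective H.hyp1 hyX ?_
      have hrep : IsLocalRep π e s y g := isLocalRep_of_mem_N (Nhat0_le_Nhat e hs) hg.1
        fun z hz => by
          obtain ⟨k, -, hk⟩ := mem_Zplus_iff.mp hz
          exact shear_apply_of_mem hg.1 _ ⟨k, hk⟩
      rw [actH0_cls H _ hyX, cls_autAct H _ hrep hgy, sub_eq_zero] at hs'
      exact hs'
    · intro x hx hxy
      obtain ⟨hxX, hxj⟩ := mem_levelSet.mp hx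
      rw [actH0_cls H _ hxX, cls_autAct_of_fix H _ (Nhat0_le_Nhat e hs), sub_self]
      intro z hz
      refine shear_apply_of_notMem hg.1 _ ?_
      rintro ⟨k, hk⟩
      obtain ⟨l, -, hl⟩ := mem_Zplus_iff.mp hz
      have h1 := congrArg (lvl π) hk
      have h2 := congrArg (lvl π) hl
      rw [lvl_par_iterate] at h1 h2
      have : k = l := by lia
      exact hxy (by rw [← hl, ← hk, this])
  obtain ⟨w, hw⟩ := (H.hyp3.mem_range_iff y (v y)).mpr hinv
  have hne : y ≠ xPlus F := by
    rintro rfl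
    rw [lvl_xPlus] at hyj
    push_cast at hyj
    lia
  have hpX := par_mem_Xplus (π := π) hyX hne
  rw [← hw, eq_neg_of_add_eq_zero_left
    (cls_edge (Xplus F) rfl hyX hpX (mem_edge_left y) (mem_edge_right y) w)]
  refine neg_mem (cls_mem_levelPart (mem_levelSet.mpr ⟨hpX, ?_⟩) _)
  rw [lvl_par, hyj]
  push_cast
  ring

/-- The invariants of `N̂₀^(e)` in `H₀(X₊, F)` are the images of the invariants of `N₀^(e)`
in `F(x₊)`. -/
lemma exists_eq_cls_of_invariant (H : Admissible 𝓕 e) {c : H0plus 𝓕}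
    (hc : ∀ (s : AutX π) (hs : s ∈ Nhat0 π e),
      actH0 H (Nhat0_mem_PhatPlus H.one_le hs) c = c) :
    ∃ v : 𝓕.onVert (xPlus F), c = 𝓕.cls (Xplus F) (xPlus F) v ∧
      ∀ (g : GL (Fin 2) F) (hg : g ∈ N0 π e)
        (h : (⟨g, N0_le_NT π e hg⟩ : NT F) • xPlus F = xPlus F),
        𝓕.actVert ⟨g, N0_le_NT π e hg⟩ (xPlus F) (xPlus F) h v = v := by
  obtain ⟨j, hj⟩ := exists_mem_levelPart H.hyp2 c
  have h0 : c ∈ levelPart 𝓕 0 := by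
    induction j with
    | zero => exact hj
    | succ j ih => exact ih (mem_levelPart_of_invariant H hc hj)
  obtain ⟨v, rfl⟩ := h0
  have hset : levelSet π 0 = {xPlus F} := by
    ext x
    rw [mem_levelSet, Finset.mem_singleton]
    constructor
    · rintro ⟨hx, h⟩
      exact eq_xPlus_of_lvl_le π hx (by simp [h])
    · rintro rfl
      exact ⟨xPlus_mem_Xplus, by simp [lvl_xPlus]⟩
  rw [hset, Finset.sum_singleton] at hc ⊢
  refine ⟨v (xPlus F), rfl, fun g hg h => cls_injective H.hyp1 xPlus_mem_Xplus ?_⟩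
  have := hc (toAut π g) (toAut_mem_Nhat0 π (⟨g, hg⟩ : N0 π e))
  rwa [actH0_cls H _ xPlus_mem_Xplus,
    cls_autAct H _ (isLocalRep_toAut_N e (N0_le_N e hg) _) h] at this

end BTree

end

/-! ### The module structures on `D(F)` and `D'(F)` -/

noncomputable section

namespace BTree

variable {F : Type*} [Field F] [ValuativeRel F] [TopologicalSpace F]
  [IsNonarchimedeanLocalField F] {π : Uniformizer F} {e : ℕ}
  {Λ : Type*} [CommRing Λ] {𝓕 : EquivariantCoeffSystem Λ (NT F) (tree π)}

section Representation

lemma Nhat0_inv_mem_PhatPlus (he : 1 ≤ e) {s : AutX π} (hs : s ∈ Nhat0 π e) :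
    s⁻¹ ∈ PhatPlus π e :=
  Nhat0_mem_PhatPlus he (inv_mem hs)

/-- The action of an element of `N̂₀^(e)` on `H₀(X₊, F)` depends only on its restriction
to `X₊`. -/
lemma actH0_eq_of_eqOn (H : Admissible 𝓕 e) {s s' : AutX π} (hs : s ∈ Nhat0 π e)
    (hs' : s' ∈ Nhat0 π e) (h : ∀ x ∈ Xplus F, s x = s' x) :
    actH0 H (Nhat0_mem_PhatPlus H.one_le hs) = actH0 H (Nhat0_mem_PhatPlus H.one_le hs') :=
  CoeffSystem.H0_hom_ext fun x hx v => by
    obtain ⟨n, hn, hsn⟩ := hs x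
    have h1 : IsLocalRep π e s x ⟨n, N0_le_NT π e hn⟩ :=
      isLocalRep_of_mem_N (Nhat0_le_Nhat e hs) (N0_le_N e hn) hsn
    have h2 : IsLocalRep π e s' x ⟨n, N0_le_NT π e hn⟩ :=
      isLocalRep_of_mem_N (Nhat0_le_Nhat e hs') (N0_le_N e hn) fun z hz => by
        rw [← h z (Zplus_subset_Xplus hx hz)]
        exact hsn z hz
    rw [actH0_cls H _ hx, actH0_cls H _ hx, cls_autAct H _ h1 rfl, cls_autAct H _ h2 rfl]

/-- An extension of `h ∈ N̂_{0,1}^(e)` to the tree. -/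
def lift01 (h : Nhat01 π e) : AutX π := h.2.choose

lemma lift01_mem (h : Nhat01 π e) : lift01 h ∈ Nhat0 π e := h.2.choose_spec.1

lemma lift01_apply (h : Nhat01 π e) (x : Xplus F) : lift01 h x = (h.1 x : Vert F) :=
  (h.2.choose_spec.2 x).symm

/-- The representation of `N̂_{0,1}^(e)` on `H₀(X₊, F)`. -/
def repH (H : Admissible 𝓕 e) : Nhat01 π e →* Module.End Λ (H0plus 𝓕) where
  toFun h := actH0 H (Nhat0_mem_PhatPlus H.one_le (lift01_mem h))
  map_one' := by
    rw [actH0_eq_of_eqOn H (lift01_mem 1) (one_mem _), actH0_one]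
    exact fun x hx => lift01_apply (π := π) 1 ⟨x, hx⟩
  map_mul' g h := by
    rw [actH0_eq_of_eqOn H (lift01_mem (g * h)) (mul_mem (lift01_mem g) (lift01_mem h)), actH0_mul]
    intro x hx
    rw [lift01_apply (g * h) ⟨x, hx⟩, RelIso.mul_apply, lift01_apply h ⟨x, hx⟩, lift01_apply g]
    rfl

lemma repH_eq (H : Admissible 𝓕 e) {h : Nhat01 π e} {s : AutX π} (hs : s ∈ Nhat0 π e)
    (hsh : ∀ x : Xplus F, ((h.1 x : Xplus F) : Vert F) = s x) (hsP : s ∈ PhatPlus π e) :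
    repH H h = actH0 H hsP :=
  actH0_eq_of_eqOn H (lift01_mem h) hs fun x hx => by rw [lift01_apply h ⟨x, hx⟩, hsh ⟨x, hx⟩]

/-- The representation of `N̂_{0,1}^(e)` on `H₀(X₊, F) / F(σ)`. -/
def repQ (H : Admissible 𝓕 e) : Nhat01 π e →* Module.End Λ (H0plus 𝓕 ⧸ imSigma 𝓕) where
  toFun h := actQuot H (Nhat0_inv_mem_PhatPlus H.one_le (lift01_mem h))
  map_one' := Submodule.linearMap_qext _ (LinearMap.ext fun c => by
    rw [LinearMap.comp_apply, actQuot_mkQ H (Nhat0_mem_PhatPlus H.one_le (lift01_mem 1))]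
    exact congrArg _ (LinearMap.congr_fun (map_one (repH H)) c))
  map_mul' g h := Submodule.linearMap_qext _ (LinearMap.ext fun c => by
    rw [LinearMap.comp_apply, LinearMap.comp_apply, Module.End.mul_apply,
      actQuot_mkQ H (Nhat0_mem_PhatPlus H.one_le (lift01_mem (g * h))),
      actQuot_mkQ H (Nhat0_mem_PhatPlus H.one_le (lift01_mem h)),
      actQuot_mkQ H (Nhat0_mem_PhatPlus H.one_le (lift01_mem g))]
    exact congrArg _ (LinearMap.congr_fun (map_mul (repH H) g h) c))

lemma repQ_mkQ (H : Admissible 𝓕 e) (h : Nhat01 π e) (c : H0plus 𝓕) :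
    repQ H h ((imSigma 𝓕).mkQ c) = (imSigma 𝓕).mkQ (repH H h c) :=
  actQuot_mkQ H (Nhat0_mem_PhatPlus H.one_le (lift01_mem h)) _ c

lemma repQ_eq (H : Admissible 𝓕 e) {h : Nhat01 π e} {s : AutX π} (hs : s ∈ Nhat0 π e)
    (hsh : ∀ x : Xplus F, ((h.1 x : Xplus F) : Vert F) = s x) (hsP : s⁻¹ ∈ PhatPlus π e) :
    repQ H h = actQuot H hsP :=
  Submodule.linearMap_qext _ (LinearMap.ext fun c => by
    rw [LinearMap.comp_apply, LinearMap.comp_apply, repQ_mkQ,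
      actQuot_mkQ H (Nhat0_mem_PhatPlus H.one_le hs),
      repH_eq H hs hsh (Nhat0_mem_PhatPlus H.one_le hs)])

/-- An element that fixes all vertices up to level `lvl x + e` fixes `Z₊^(e)(x)` pointwise and hence
acts trivially on `F(x)`. A class involves only finitely many vertices. -/
lemma exists_levelSubgroup_fix (H : Admissible 𝓕 e) (c : H0plus 𝓕) :
    ∃ m : ℕ, ∀ u ∈ levelSubgroup π e m, repH H u c = c := by
  refine CoeffSystem.H0_induction
    (P := fun c => ∃ m : ℕ, ∀ u ∈ levelSubgroup π e m, repH H u c = c) c (fun x hx v => ?_) ?_ ?_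
  · refine ⟨(lvl π x).toNat + e, fun u hu => ?_⟩
    change actH0 H (Nhat0_mem_PhatPlus H.one_le (lift01_mem u)) _ = _
    rw [actH0_cls H _ hx, cls_autAct_of_fix H _ (Nhat0_le_Nhat e (lift01_mem u))]
    intro z hz
    rw [lift01_apply u ⟨z, Zplus_subset_Xplus hx hz⟩,
      mem_levelSubgroup.mp hu ⟨z, Zplus_subset_Xplus hx hz⟩ ?_]
    have := lvl_le_of_mem_Zplus hz
    push_cast
    lia
  · exact ⟨0, fun u _ => map_zero _⟩
  · rintro c d ⟨m, hm⟩ ⟨m', hm'⟩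
    have hle : ∀ {i j : ℕ}, i ≤ j → ∀ u ∈ levelSubgroup π e j, u ∈ levelSubgroup π e i :=
      fun hij u hu x hx => hu x (by lia)
    refine ⟨max m m', fun u hu => ?_⟩
    rw [map_add, hm u (hle (le_max_left _ _) u hu), hm' u (hle (le_max_right _ _) u hu)]

end Representation

section Dual

variable (o L : Type*) [CommRing o] [Field L] [Algebra o L] [Algebra o Λ]

lemma isSmooth_repH (H : Admissible 𝓕 e) : IsSmooth ((PDual.restrictEnd o).comp (repH H)) :=
  fun c => (exists_levelSubgroup_fix H c).elim fun m hm => ⟨levelSubgroup π e m, hm⟩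

lemma isSmooth_repQ (H : Admissible 𝓕 e) : IsSmooth ((PDual.restrictEnd o).comp (repQ H)) := by
  intro c
  obtain ⟨c, rfl⟩ := Submodule.mkQ_surjective _ c
  obtain ⟨m, hm⟩ := exists_levelSubgroup_fix H c
  exact ⟨levelSubgroup π e m, fun u hu => (repQ_mkQ H u c).trans (congrArg _ (hm u hu))⟩

/-- The `o[[N̂_{0,1}^(e)]]`-module structure on `D(F)`. -/
@[reducible] def modD (H : Admissible 𝓕 e) :
    Module (IwasawaAlgebra o (Nhat01 π e)) (DD 𝓕 o L) :=
  smoothModule (isSmooth_repH o H)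

/-- The `o[[N̂_{0,1}^(e)]]`-module structure on `D'(F)`. -/
@[reducible] def modD' (H : Admissible 𝓕 e) :
    Module (IwasawaAlgebra o (Nhat01 π e)) (DD' 𝓕 o L) :=
  smoothModule (isSmooth_repQ o H)

variable {o L}

lemma modD_smul_eval (H : Admissible 𝓕 e) (a : IwasawaAlgebra o (Nhat01 π e)) (f : DD 𝓕 o L)
    (c : H0plus 𝓕) :
    (letI := modD o L H; a • f).eval c = a.integral fun h => f.eval (repH H h⁻¹ c) := rfl

lemma modD'_smul_eval (H : Admissible 𝓕 e) (a : IwasawaAlgebra o (Nhat01 π e)) (f : DD' 𝓕 o L)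
    (c : H0plus 𝓕 ⧸ imSigma 𝓕) :
    (letI := modD' o L H; a • f).eval c = a.integral fun h => f.eval (repQ H h⁻¹ c) := rfl

lemma locConst_repH (H : Admissible 𝓕 e) (f : DD 𝓕 o L) (c : H0plus 𝓕) :
    (fun h => f.eval (repH H h⁻¹ c)) ∈ LocConst o (Nhat01 π e) (FracQuot o L) :=
  (isSmooth_repH o H).locConst f c

lemma locConst_repQ (H : Admissible 𝓕 e) (f : DD' 𝓕 o L) (c : H0plus 𝓕 ⧸ imSigma 𝓕) :
    (fun h => f.eval (repQ H h⁻¹ c)) ∈ LocConst o (Nhat01 π e) (FracQuot o L) :=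
  (isSmooth_repQ o H).locConst f c

lemma modD_dirac_smul_eval (H : Admissible 𝓕 e) (h : Nhat01 π e) (f : DD 𝓕 o L) (c : H0plus 𝓕) :
    (letI := modD o L H; IwasawaAlgebra.dirac o h • f).eval c = f.eval (repH H h⁻¹ c) :=
  IwasawaAlgebra.integral_dirac h (locConst_repH H f c)

lemma modD'_dirac_smul_eval (H : Admissible 𝓕 e) (h : Nhat01 π e) (f : DD' 𝓕 o L)
    (c : H0plus 𝓕 ⧸ imSigma 𝓕) :
    (letI := modD' o L H; IwasawaAlgebra.dirac o h • f).eval c = f.eval (repQ H h⁻¹ c) :=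
  IwasawaAlgebra.integral_dirac h (locConst_repQ H f c)

lemma exists_smul_eval_eq_zero_modD (H : Admissible 𝓕 e) (f : DD 𝓕 o L) (c : H0plus 𝓕) :
    ∃ U : OpenNormalSubgroup (Nhat01 π e), ∀ a : IwasawaAlgebra o (Nhat01 π e), a.proj U = 0 →
      (letI := modD o L H; (a • f : DD 𝓕 o L)).eval c = 0 := by
  obtain ⟨U, hU⟩ := locConst_repH H f c
  exact ⟨U, fun a ha => (modD_smul_eval H a f c).trans (a.integral_eq_zero_of_proj hU ha)⟩

lemma exists_smul_eval_eq_zero_modD' (H : Admissible 𝓕 e) (f : DD' 𝓕 o L)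
    (c : H0plus 𝓕 ⧸ imSigma 𝓕) :
    ∃ U : OpenNormalSubgroup (Nhat01 π e), ∀ a : IwasawaAlgebra o (Nhat01 π e), a.proj U = 0 →
      (letI := modD' o L H; (a • f : DD' 𝓕 o L)).eval c = 0 := by
  obtain ⟨U, hU⟩ := locConst_repQ H f c
  exact ⟨U, fun a ha => (modD'_smul_eval H a f c).trans (a.integral_eq_zero_of_proj hU ha)⟩

variable (o L)

/-- The morphism `∂ : D'(F) → D(F)`. -/
def bdMap (H : Admissible 𝓕 e) :
    letI := modD o L H
    letI := modD' o L H
    DD' 𝓕 o L →ₗ[IwasawaAlgebra o (Nhat01 π e)] DD 𝓕 o L :=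
  letI := modD o L H
  letI := modD' o L H
  { toFun := PDual.comap (imSigma 𝓕).mkQ
    map_add' := map_add _
    map_smul' a f := PDual.ext_eval fun c => by
      change a.integral (fun h => f.eval (repQ H h⁻¹ ((imSigma 𝓕).mkQ c))) =
        a.integral (fun h => f.eval ((imSigma 𝓕).mkQ (repH H h⁻¹ c)))
      simp only [repQ_mkQ] }

lemma bdMap_eval (H : Admissible 𝓕 e) (f : DD' 𝓕 o L) (c : H0plus 𝓕) :
    (bdMap o L H f).eval c = f.eval ((imSigma 𝓕).mkQ c) := rfl

lemma bdMap_injective (H : Admissible 𝓕 e) : Function.Injective (bdMap o L H) := fun f g h =>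
  PDual.ext_eval fun c => by
    obtain ⟨c, rfl⟩ := Submodule.mkQ_surjective _ c
    rw [← bdMap_eval o L H, ← bdMap_eval o L H, h]

lemma inv_mem_PhatPlus (he : 1 ≤ e) (u : ↥((PhatStarExt π e)⁻¹)) :
    (u : AutX π)⁻¹ ∈ PhatPlus π e :=
  PhatStarExt_le_PhatPlus he (Submonoid.mem_inv.mp u.2)

lemma inv_inv_mem_PhatPlus (he : 1 ≤ e) (s : ↥(PhatStarExt π e)) :
    ((s : AutX π)⁻¹)⁻¹ ∈ PhatPlus π e := by
  rw [inv_inv]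
  exact PhatStarExt_le_PhatPlus he s.2

lemma comap_one {M : Type*} [AddCommGroup M] [Module Λ M] :
    (PDual.comap (1 : Module.End Λ M) : Module.End o (PDual o L Λ M)) = 1 := rfl

lemma comap_mul {M : Type*} [AddCommGroup M] [Module Λ M] (φ ψ : Module.End Λ M) :
    (PDual.comap (φ * ψ) : Module.End o (PDual o L Λ M)) = PDual.comap ψ * PDual.comap φ := rfl

lemma actH0_inv_one (H : Admissible 𝓕 e) :
    actH0 H (inv_mem_PhatPlus H.one_le (1 : ↥((PhatStarExt π e)⁻¹))) = 1 := by
  rw [← actH0_one H]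
  exact actH0_congr H inv_one _ _

lemma actH0_inv_mul (H : Admissible 𝓕 e) (u v : ↥((PhatStarExt π e)⁻¹)) :
    actH0 H (inv_mem_PhatPlus H.one_le (u * v)) =
      actH0 H (inv_mem_PhatPlus H.one_le v) * actH0 H (inv_mem_PhatPlus H.one_le u) := by
  rw [← actH0_mul]
  exact actH0_congr H (mul_inv_rev (u : AutX π) v) _ _

lemma actQuot_inv_one (H : Admissible 𝓕 e) :
    actQuot H (inv_inv_mem_PhatPlus H.one_le (1 : ↥(PhatStarExt π e))) = 1 := by
  have h : (1 : AutX π)⁻¹ ∈ PhatPlus π e := by rw [inv_one]; exact one_mem _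
  rw [← actQuot_one H h]
  exact actQuot_congr H inv_one _ _

lemma actQuot_inv_mul (H : Admissible 𝓕 e) (s s' : ↥(PhatStarExt π e)) :
    actQuot H (inv_inv_mem_PhatPlus H.one_le (s * s')) =
      actQuot H (inv_inv_mem_PhatPlus H.one_le s') *
        actQuot H (inv_inv_mem_PhatPlus H.one_le s) := by
  have h : ((s' : AutX π)⁻¹ * (s : AutX π)⁻¹)⁻¹ ∈ PhatPlus π e := by
    rw [← mul_inv_rev]
    exact inv_inv_mem_PhatPlus H.one_le (s * s')
  rw [← actQuot_mul H (inv_inv_mem_PhatPlus H.one_le s') (inv_inv_mem_PhatPlus H.one_le s) h]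
  exact actQuot_congr H (mul_inv_rev (s : AutX π) s') _ _

/-- The action of the inverse monoid of `P̃_⋆^(e)` on `D(F)`. -/
def actOnD (H : Admissible 𝓕 e) : ↥((PhatStarExt π e)⁻¹) →* Module.End o (DD 𝓕 o L) where
  toFun u := PDual.comap (actH0 H (inv_mem_PhatPlus H.one_le u))
  map_one' := by rw [actH0_inv_one, comap_one]
  map_mul' u v := by rw [actH0_inv_mul, comap_mul]

/-- The action of `P̃_⋆^(e)` on `D'(F)`. -/
def actOnD' (H : Admissible 𝓕 e) : ↥(PhatStarExt π e) →* Module.End o (DD' 𝓕 o L) where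
  toFun s := PDual.comap (actQuot H (inv_inv_mem_PhatPlus H.one_le s))
  map_one' := by rw [actQuot_inv_one, comap_one]
  map_mul' s s' := by rw [actQuot_inv_mul, comap_mul]

variable {o L}

lemma actOnD'_eval (H : Admissible 𝓕 e) {s : AutX π} (hs : s ∈ PhatStarExt π e)
    (hs' : s⁻¹⁻¹ ∈ PhatPlus π e) (f : DD' 𝓕 o L) (c : H0plus 𝓕 ⧸ imSigma 𝓕) :
    (actOnD' o L H ⟨s, hs⟩ f).eval c = f.eval (actQuot H hs' c) := rfl

lemma coe_inv_apply {g : AutX π} {h : Nhat01 π e}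
    (hg : ∀ x, ((h.1 x : Xplus F) : Vert F) = g x) (x : Xplus F) :
    (((h⁻¹).1 x : Xplus F) : Vert F) = g⁻¹ x := by
  have := hg ((h⁻¹).1 x)
  rw [Nhat01_apply_inv_self] at this
  rw [this, RelIso.inv_apply_self]

lemma actOnD_eq_dirac (H : Admissible 𝓕 e) (g : AutX π) (hg : g ∈ Nhat0 π e) (h : Nhat01 π e)
    (hh : ∀ x, ((h.1 x : Xplus F) : Vert F) = g x) (d : DD 𝓕 o L) :
    actOnD o L H ⟨g, Nhat0_mem_inv π hg⟩ d =
      (letI := modD o L H; IwasawaAlgebra.dirac o h • d) :=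
  PDual.ext_eval fun c => by
    rw [modD_dirac_smul_eval, repH_eq H (inv_mem hg) (coe_inv_apply hh)
      (Nhat0_inv_mem_PhatPlus H.one_le hg)]
    rfl

lemma actOnD'_eq_dirac (H : Admissible 𝓕 e) (g : AutX π) (hg : g ∈ Nhat0 π e) (h : Nhat01 π e)
    (hh : ∀ x, ((h.1 x : Xplus F) : Vert F) = g x) (d : DD' 𝓕 o L) :
    actOnD' o L H ⟨g, Nhat0_mem π hg⟩ d =
      (letI := modD' o L H; IwasawaAlgebra.dirac o h • d) :=
  PDual.ext_eval fun c => by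
    rw [modD'_dirac_smul_eval, repQ_eq H (inv_mem hg) (coe_inv_apply hh)
      (Nhat0_inv_mem_PhatPlus H.one_le (inv_mem hg))]
    rfl

lemma toAut_inv_mem_PhatPlus (he : 1 ≤ e) (n : N0 π 1) : (toAut π n)⁻¹ ∈ PhatPlus π e := by
  rw [← map_inv]
  exact PhatStarExt_le_PhatPlus he (N0_one_mem π e n⁻¹)

/-- Elements of `N₀^(1)` and their inverses preserve `X₊`, so the two actions are compatible with
the projection. -/
lemma bdMap_actOnD' (H : Admissible 𝓕 e) (n : N0 π 1) (d : DD' 𝓕 o L) :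
    bdMap o L H (actOnD' o L H ⟨toAut π n, N0_one_mem π e n⟩ d) =
      actOnD o L H ⟨toAut π n, N0_one_mem_inv π e n⟩ (bdMap o L H d) :=
  PDual.ext_eval fun c => by
    exact congrArg d.eval (actQuot_mkQ H (toAut_inv_mem_PhatPlus H.one_le n)
      (inv_inv_mem_PhatPlus H.one_le ⟨_, N0_one_mem π e n⟩) c)

/-- `s⁻¹` is a left inverse of `s` on `H₀(X₊, F) / F(σ)`. -/
lemma actQuot_inv_mkQ_actH0 (H : Admissible 𝓕 e) {s : AutX π} (hs : s ∈ PhatPlus π e)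
    (hs' : s⁻¹⁻¹ ∈ PhatPlus π e) (c : H0plus 𝓕) :
    actQuot H hs' ((imSigma 𝓕).mkQ (actH0 H hs c)) = (imSigma 𝓕).mkQ c :=
  LinearMap.congr_fun (CoeffSystem.H0_hom_ext
    (f := actQuot H hs' ∘ₗ (imSigma 𝓕).mkQ ∘ₗ actH0 H hs) (g := (imSigma 𝓕).mkQ)
    fun x hx v => by
      have key : ∀ u : AutX π, u = 1 → 𝓕.cls (Xplus F) (u x) (autAct 𝓕 e u x v) =
          𝓕.cls (Xplus F) x v := by
        rintro _ rfl
        rw [autAct_one H.one_le H.hyp1 H.hyp2 H.hyp3]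
        rfl
      rw [LinearMap.comp_apply, LinearMap.comp_apply, actH0_cls H _ hx, actQuot_cls' H hs',
        ← key (s⁻¹ * s) (inv_mul_cancel s),
        autAct_mul H.one_le H.hyp1 H.hyp2 H.hyp3 (inv_mem hs.1) hs.1]
      rfl) c

lemma t_pow_mem_PhatPlus (he : 1 ≤ e) (m : ℕ) : toAut π (t π) ^ m ∈ PhatPlus π e :=
  PhatStarExt_le_PhatPlus he (t_pow_mem π e m)

lemma actOnD_t_eval (H : Admissible 𝓕 e) (m : ℕ) (f : DD 𝓕 o L) (c : H0plus 𝓕) :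
    (actOnD o L H ⟨(toAut π (t π) ^ m)⁻¹, t_pow_inv_mem π e m⟩ f).eval c =
      f.eval (actH0 H (t_pow_mem_PhatPlus H.one_le m) c) := by
  rw [actH0_congr H (inv_inv _).symm _
    (inv_mem_PhatPlus H.one_le ⟨(toAut π (t π) ^ m)⁻¹, t_pow_inv_mem π e m⟩)]
  rfl

/-- Dual to `actQuot_inv_mkQ_actH0`: on the quotient, `t^(-m)` undoes `t^m`. -/
lemma actOnD_bdMap_actOnD' (H : Admissible 𝓕 e) (m : ℕ) (d : DD' 𝓕 o L) :
    actOnD o L H ⟨(toAut π (t π) ^ m)⁻¹, t_pow_inv_mem π e m⟩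
      (bdMap o L H (actOnD' o L H ⟨toAut π (t π) ^ m, t_pow_mem π e m⟩ d)) = bdMap o L H d :=
  PDual.ext_eval fun c => by
    rw [actOnD_t_eval, bdMap_eval]
    exact congrArg d.eval (actQuot_inv_mkQ_actH0 H (t_pow_mem_PhatPlus H.one_le m)
      (inv_inv_mem_PhatPlus H.one_le ⟨_, t_pow_mem π e m⟩) c)

end Dual

end BTree

end

/-! ### Finiteness and generators -/

noncomputable section

/-- The fibres of multiplication by `a` are empty or translates of its finite kernel. -/
lemma finite_setOf_pow_smul_eq_zero {R M : Type*} [CommRing R] [AddCommGroup M] [Module R M] {a : R}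
    (h : {c : M | a • c = 0}.Finite) (K : ℕ) : {c : M | a ^ K • c = 0}.Finite := by
  induction K with
  | zero => simp
  | succ K ih =>
    have h1 : {c : M | a ^ (K + 1) • c = 0} = (fun c : M => a • c) ⁻¹' {c : M | a ^ K • c = 0} := by
      ext c
      rw [Set.mem_preimage, Set.mem_ofPred_eq, Set.mem_ofPred_eq, smul_smul, pow_succ]
    rw [h1]
    refine ih.preimage' fun b _ => ?_
    by_cases hb : ∃ c : M, a • c = b
    · obtain ⟨c, rfl⟩ := hb
      refine (h.image fun d => c + d).subset fun d hd => ⟨d - c, ?_, add_sub_cancel c d⟩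
      rw [Set.mem_ofPred_eq, smul_sub, sub_eq_zero]
      exact hd
    · refine Set.Finite.subset Set.finite_empty fun c hc => hb ⟨c, hc⟩

section DVR

variable {o : Type*} [CommRing o] [IsDomain o] [IsDiscreteValuationRing o] {ϖ : o}

/-- Linear functionals on a module that separate linear combinations of given vectors killed
by `ϖ`. -/
lemma exists_dual_functionals (L : Type*) [Field L] [Algebra o L] [IsFractionRing o L]
    (hϖ : Irreducible ϖ) {M : Type*} [AddCommGroup M] [Module o M] {n : ℕ} (c : Fin n → M)
    (hc : ∀ r : Fin n → o, ∑ i, r i • c i = 0 → ∀ i, ϖ ∣ r i) :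
    ∃ f : Fin n → (M →ₗ[o] FracQuot o L), ∀ (r : Fin n → o) (i : Fin n),
      f i (∑ j, r j • c j) = 0 → ϖ ∣ r i := by
  let φ : (Fin n → o) →ₗ[o] M := Fintype.linearCombination o c
  have hφ : ∀ r, φ r = ∑ j, r j • c j := fun r => Fintype.linearCombination_apply o c r
  have key : ∀ i, ∃ f : M →ₗ[o] FracQuot o L, ∀ r, f (φ r) = FracQuot.divBy o (L := L) ϖ (r i) := by
    intro i
    -- The functional `r ↦ r i / ϖ` vanishes on the relations between the `c j`, by `hc`. It
    -- descends to their span and extends to `M`, because `L/o` is injective.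
    let g : (Fin n → o) →ₗ[o] FracQuot o L := FracQuot.divBy o (L := L) ϖ ∘ₗ LinearMap.proj i
    have hg : LinearMap.ker φ ≤ LinearMap.ker g := fun r hr => by
      rw [LinearMap.mem_ker, hφ] at hr
      exact (FracQuot.divBy_eq_zero_iff hϖ.ne_zero).mpr (hc r hr i)
    obtain ⟨f, hf⟩ := (FracQuot.baer o L).extension_property ((LinearMap.ker φ).liftQ φ le_rfl)
      (LinearMap.ker_eq_bot.mp (Submodule.ker_liftQ_eq_bot _ _ _ le_rfl))
      ((LinearMap.ker φ).liftQ g hg)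
    exact ⟨f, fun r => LinearMap.congr_fun hf ((LinearMap.ker φ).mkQ r)⟩
  choose f hf using key
  refine ⟨f, fun r i hr => ?_⟩
  rw [← hφ, hf, FracQuot.divBy_eq_zero_iff hϖ.ne_zero] at hr
  exact hr

variable {Λ : Type*} [CommRing Λ] [IsLocalRing Λ] [Algebra o Λ]

lemma not_isUnit_algebraMap_uniformizer (hϖ : Irreducible ϖ)
    (hΛ : Function.Surjective (algebraMap o Λ)) : ¬ IsUnit (algebraMap o Λ ϖ) := by
  intro hu
  obtain ⟨b, hb⟩ := hu.exists_right_inv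
  obtain ⟨b, rfl⟩ := hΛ b
  have h0 : algebraMap o Λ (1 - ϖ * b) = 0 := by rw [map_sub, map_mul, hb, map_one, sub_self]
  by_cases h : IsUnit (1 - ϖ * b)
  · have := h.map (algebraMap o Λ)
    rw [h0] at this
    exact not_isUnit_zero this
  · obtain ⟨d, hd⟩ := Ideal.mem_span_singleton.mp (mem_span_uniformizer_of_not_isUnit hϖ h)
    exact hϖ.not_isUnit (IsUnit.of_mul_eq_one (b + d) (by linear_combination -hd))

lemma dvd_of_algebraMap_mem_span (hϖ : Irreducible ϖ) (hΛ : Function.Surjective (algebraMap o Λ))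
    {r : o} (hr : algebraMap o Λ r ∈ Ideal.span {algebraMap o Λ ϖ}) : ϖ ∣ r := by
  rw [← Ideal.mem_span_singleton]
  refine mem_span_uniformizer_of_not_isUnit hϖ fun h => ?_
  exact not_isUnit_algebraMap_uniformizer hϖ hΛ
    (isUnit_of_dvd_unit (Ideal.mem_span_singleton.mp hr) (h.map (algebraMap o Λ)))

lemma isMaximal_span_algebraMap_uniformizer (hϖ : Irreducible ϖ)
    (hΛ : Function.Surjective (algebraMap o Λ)) :
    (Ideal.span {algebraMap o Λ ϖ}).IsMaximal := by
  refine Ideal.isMaximal_iff.mpr ⟨fun h => ?_, fun J x _ hx hxJ => ?_⟩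
  · exact not_isUnit_algebraMap_uniformizer hϖ hΛ
      (isUnit_of_dvd_one (Ideal.mem_span_singleton.mp h))
  · obtain ⟨r, rfl⟩ := hΛ x
    have hr : IsUnit r := by
      by_contra h
      obtain ⟨d, rfl⟩ := Ideal.mem_span_singleton.mp (mem_span_uniformizer_of_not_isUnit hϖ h)
      exact hx (Ideal.mem_span_singleton.mpr ⟨algebraMap o Λ d, map_mul _ _ _⟩)
    rw [J.eq_top_of_isUnit_mem hxJ (hr.map (algebraMap o Λ))]
    trivial

lemma finite_quotient_span_algebraMap [Finite (o ⧸ Ideal.span {ϖ})]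
    (hΛ : Function.Surjective (algebraMap o Λ)) : Finite (Λ ⧸ Ideal.span {algebraMap o Λ ϖ}) := by
  refine Finite.of_surjective (Ideal.Quotient.lift (Ideal.span {ϖ})
    ((Ideal.Quotient.mk (Ideal.span {algebraMap o Λ ϖ})).comp (algebraMap o Λ)) fun a ha => ?_) ?_
  · obtain ⟨d, rfl⟩ := Ideal.mem_span_singleton.mp ha
    rw [RingHom.comp_apply, Ideal.Quotient.eq_zero_iff_mem, map_mul]
    exact Ideal.mul_mem_right _ _ (Ideal.mem_span_singleton_self _)
  · intro x
    obtain ⟨x, rfl⟩ := Ideal.Quotient.mk_surjective x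
    obtain ⟨r, rfl⟩ := hΛ x
    exact ⟨Ideal.Quotient.mk _ r, rfl⟩

lemma exists_algebraMap_uniformizer_pow_eq_zero [IsArtinianRing Λ] (hϖ : Irreducible ϖ)
    (hΛ : Function.Surjective (algebraMap o Λ)) : ∃ K : ℕ, algebraMap o Λ ϖ ^ K = 0 := by
  obtain ⟨K, hK⟩ := IsArtinianRing.isNilpotent_jacobson_bot (R := Λ)
  refine ⟨K, ?_⟩
  have h : algebraMap o Λ ϖ ∈ Ideal.jacobson (⊥ : Ideal Λ) := by
    rw [IsLocalRing.jacobson_eq_maximalIdeal ⊥ bot_ne_top]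
    exact not_isUnit_algebraMap_uniformizer hϖ hΛ
  have := Ideal.pow_mem_pow h K
  rw [hK] at this
  exact this

end DVR

namespace BTree

variable {F : Type*} [Field F] [ValuativeRel F] [TopologicalSpace F]
  [IsNonarchimedeanLocalField F] {π : Uniformizer F} {e : ℕ}
  {Λ : Type*} [CommRing Λ] {𝓕 : EquivariantCoeffSystem Λ (NT F) (tree π)}

variable (e 𝓕) in
/-- The `N₀^(e)`-invariants in `F(x₊)`. -/
def N0Invariants : Submodule Λ (𝓕.onVert (xPlus F)) where
  carrier := {v | ∀ (g : GL (Fin 2) F) (hg : g ∈ N0 π e)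
    (h : (⟨g, N0_le_NT π e hg⟩ : NT F) • xPlus F = xPlus F),
    𝓕.actVert ⟨g, N0_le_NT π e hg⟩ (xPlus F) (xPlus F) h v = v}
  add_mem' := fun hv hw g hg h => by rw [map_add, hv g hg h, hw g hg h]
  zero_mem' := fun g hg h => map_zero _
  smul_mem' := fun c v hv g hg h => by rw [map_smul, hv g hg h]

/-- Elements of `N₀^(e)` fix all vertices of level at most `e - 1`, hence belong to `N_{x₊}^(e)`. So
(Hyp 3) for the edge `σ` applies. -/
lemma exists_mem_N0Invariants_of_mem_imSigma (H : Admissible 𝓕 e) {c : H0plus 𝓕}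
    (hc : c ∈ imSigma 𝓕) :
    ∃ v ∈ N0Invariants e 𝓕, 𝓕.cls (Xplus F) (xPlus F) v = c := by
  obtain ⟨w, rfl⟩ := mem_imSigma_iff.mp hc
  refine ⟨_, fun g hg h => ?_, rfl⟩
  refine (H.hyp3.mem_range_iff (xPlus F) _).mp ⟨w, rfl⟩ _ ⟨N0_le_N e hg, fun z hz => ?_⟩ h
  refine N0_smul_of_lvl_le hg ?_
  have := lvl_le_of_mem_Zplus hz
  rwa [lvl_xPlus, zero_add] at this

/-- `N₀^(e)` acts trivially on the image of `F(σ)`. -/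
lemma actH0_toAut_of_mem_imSigma (H : Admissible 𝓕 e) {c : H0plus 𝓕} (hc : c ∈ imSigma 𝓕)
    (n : N0 π e) : actH0 H (Nhat0_mem_PhatPlus H.one_le (toAut_mem_Nhat0 π n)) c = c := by
  obtain ⟨v, hv, rfl⟩ := exists_mem_N0Invariants_of_mem_imSigma H hc
  have hn : (⟨n, N0_le_NT π e n.2⟩ : NT F) • xPlus F = xPlus F :=
    N0_smul_of_lvl_le n.2 (by rw [lvl_xPlus]; lia)
  rw [actH0_cls H _ xPlus_mem_Xplus,
    cls_autAct H _ (isLocalRep_toAut_N e (N0_le_N e n.2) _) hn, hv n n.2 hn]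

section

variable {o : Type*} [CommRing o] [Algebra o Λ] (L : Type*) [Field L] [Algebra o L]

lemma _root_.PDual.exists_comap_mkQ {M : Type*} [AddCommGroup M] [Module Λ M] (S : Submodule Λ M)
    (f : PDual o L Λ M) (h : ∀ c ∈ S, f.eval c = 0) :
    ∃ g : PDual o L Λ (M ⧸ S), ∀ c, g.eval (S.mkQ c) = f.eval c := by
  let g : (M ⧸ S) →+ FracQuot o L := QuotientAddGroup.lift S.toAddSubgroup
    { toFun := f.eval
      map_zero' := map_zero f
      map_add' := map_add f } h
  refine ⟨{ toFun := g, map_add' := map_add g, map_smul' := fun r c => ?_ }, fun c => rfl⟩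
  obtain ⟨c, rfl⟩ := S.mkQ_surjective c
  exact f.map_smul r c

lemma exists_bdMap_eq (H : Admissible 𝓕 e) {f : DD 𝓕 o L} (h : ∀ c ∈ imSigma 𝓕, f.eval c = 0) :
    ∃ g, bdMap o L H g = f := by
  obtain ⟨g, hg⟩ := PDual.exists_comap_mkQ L _ f h
  exact ⟨g, PDual.ext_eval hg⟩

end

section

variable {o : Type*} [CommRing o] [IsDomain o] [IsDiscreteValuationRing o] {ϖ : o}
  [IsLocalRing Λ] [Algebra o Λ]

lemma finite_N0Invariants_torsion [Finite (o ⧸ Ideal.span {ϖ})] (hϖ : Irreducible ϖ)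
    (hΛ : Function.Surjective (algebraMap o Λ)) {n : ℕ}
    (hn : Module.rank (Λ ⧸ Ideal.span {algebraMap o Λ ϖ})
      (invTorsion 𝓕 e (algebraMap o Λ ϖ)) = n) :
    {v : N0Invariants e 𝓕 | algebraMap o Λ ϖ • v = 0}.Finite := by
  have := isMaximal_span_algebraMap_uniformizer hϖ hΛ
  let := Ideal.Quotient.field (Ideal.span {algebraMap o Λ ϖ})
  have := finite_quotient_span_algebraMap (ϖ := ϖ) hΛ
  have : Module.Finite (Λ ⧸ Ideal.span {algebraMap o Λ ϖ}) (invTorsion 𝓕 e (algebraMap o Λ ϖ)) :=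
    Module.finite_of_rank_eq_nat hn
  have : Finite (invTorsion 𝓕 e (algebraMap o Λ ϖ)) :=
    Module.finite_of_finite (Λ ⧸ Ideal.span {algebraMap o Λ ϖ})
  let ι : invTorsion 𝓕 e (algebraMap o Λ ϖ) → N0Invariants e 𝓕 := fun v => ⟨v.1.1, v.2⟩
  refine (Set.finite_range ι).subset fun v hv => ?_
  exact ⟨⟨⟨v.1, (Submodule.mem_torsionBy_iff _ _).mpr (congrArg Subtype.val hv)⟩, v.2⟩, rfl⟩

/-- The image of `F(σ)` consists of classes of `N₀^(e)`-invariants in `F(x₊)`. Their `ϖ`-torsion is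
a finite-dimensional space over a finite field, and a power of `ϖ` kills `Λ`, so there are only
finitely many invariants. -/
lemma finite_imSigma [IsArtinianRing Λ] [Finite (o ⧸ Ideal.span {ϖ})] (H : Admissible 𝓕 e)
    (hϖ : Irreducible ϖ) (hΛ : Function.Surjective (algebraMap o Λ)) {n : ℕ}
    (hn : Module.rank (Λ ⧸ Ideal.span {algebraMap o Λ ϖ})
      (invTorsion 𝓕 e (algebraMap o Λ ϖ)) = n) : Finite (imSigma 𝓕) := by
  obtain ⟨K, hK⟩ := exists_algebraMap_uniformizer_pow_eq_zero (Λ := Λ) hϖ hΛ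
  have h1 := finite_setOf_pow_smul_eq_zero (finite_N0Invariants_torsion hϖ hΛ hn) K
  refine Set.Finite.to_subtype (s := (imSigma 𝓕 : Set (H0plus 𝓕)))
    ((h1.image fun v : N0Invariants e 𝓕 => 𝓕.cls (Xplus F) (xPlus F) v).subset fun c hc => ?_)
  obtain ⟨v, hv, rfl⟩ := exists_mem_N0Invariants_of_mem_imSigma H hc
  exact ⟨⟨v, hv⟩, by rw [Set.mem_ofPred_eq, hK, zero_smul], rfl⟩

lemma exists_N0Invariants_generators (hϖ : Irreducible ϖ)
    (hΛ : Function.Surjective (algebraMap o Λ)) {n : ℕ}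
    (hn : Module.rank (Λ ⧸ Ideal.span {algebraMap o Λ ϖ})
      (invTorsion 𝓕 e (algebraMap o Λ ϖ)) = n) :
    ∃ b : Fin n → 𝓕.onVert (xPlus F), (∀ i, algebraMap o Λ ϖ • b i = 0) ∧
      (∀ r : Fin n → o, ∑ i, algebraMap o Λ (r i) • b i = 0 → ∀ i, ϖ ∣ r i) ∧
      ∀ v ∈ N0Invariants e 𝓕, algebraMap o Λ ϖ • v = 0 →
        ∃ r : Fin n → o, v = ∑ i, algebraMap o Λ (r i) • b i := by
  have := isMaximal_span_algebraMap_uniformizer hϖ hΛ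
  let := Ideal.Quotient.field (Ideal.span {algebraMap o Λ ϖ})
  have : Module.Finite (Λ ⧸ Ideal.span {algebraMap o Λ ϖ}) (invTorsion 𝓕 e (algebraMap o Λ ϖ)) :=
    Module.finite_of_rank_eq_nat hn
  let b := Module.finBasisOfFinrankEq (Λ ⧸ Ideal.span {algebraMap o Λ ϖ})
    (invTorsion 𝓕 e (algebraMap o Λ ϖ)) (Module.finrank_eq_of_rank_eq hn)
  let q : o → Λ ⧸ Ideal.span {algebraMap o Λ ϖ} := fun r => Ideal.Quotient.mk _ (algebraMap o Λ r)
  let ι : invTorsion 𝓕 e (algebraMap o Λ ϖ) →+ 𝓕.onVert (xPlus F) :=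
    { toFun v := v.1.1
      map_zero' := rfl
      map_add' _ _ := rfl }
  have hι : Function.Injective ι := fun v w h => Subtype.ext (Subtype.ext h)
  have hsmul : ∀ (r : o) (v : invTorsion 𝓕 e (algebraMap o Λ ϖ)),
      ι (q r • v) = algebraMap o Λ r • ι v := fun _ _ => rfl
  have hsum : ∀ r : Fin n → o,
      ι (∑ i, q (r i) • b i) = ∑ i, algebraMap o Λ (r i) • ι (b i) := fun r => by
    rw [map_sum]
    exact Finset.sum_congr rfl fun i _ => hsmul _ _
  refine ⟨fun i => ι (b i), fun i => ?_, fun r hr i => ?_, fun v hv hv' => ?_⟩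
  · exact (Submodule.mem_torsionBy_iff _ _).mp (b i).1.2
  · have h1 : ∑ i, q (r i) • b i = 0 := hι ((hsum r).trans (hr.trans (map_zero ι).symm))
    have h2 : q (r i) = 0 := Fintype.linearIndependent_iff.mp b.linearIndependent _ h1 i
    exact dvd_of_algebraMap_mem_span hϖ hΛ (Ideal.Quotient.eq_zero_iff_mem.mp h2)
  · let w : invTorsion 𝓕 e (algebraMap o Λ ϖ) :=
      ⟨⟨v, (Submodule.mem_torsionBy_iff _ _).mpr hv'⟩, hv⟩
    have hq : Function.Surjective q := Ideal.Quotient.mk_surjective.comp hΛ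
    choose r hr using fun i => hq (b.repr w i)
    have h1 : ∑ i, q (r i) • b i = w :=
      (Finset.sum_congr rfl fun i _ => congrArg (· • b i) (hr i)).trans (b.sum_repr w)
    exact ⟨r, (congrArg ι h1).symm.trans (hsum r)⟩

lemma exists_Nhat01_of_mem (he : 1 ≤ e) {s : AutX π} (hs : s ∈ Nhat0 π e) :
    ∃ h : Nhat01 π e, ∀ x : Xplus F, ((h.1 x : Xplus F) : Vert F) = s x :=
  ⟨⟨⟨fun x => ⟨s x, Nhat0_apply_mem_Xplus he hs x.2⟩,
      fun x => ⟨s⁻¹ x, Nhat0_apply_mem_Xplus he (inv_mem hs) x.2⟩,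
      fun x => Subtype.ext (RelIso.inv_apply_self s (x : Vert F)),
      fun x => Subtype.ext (RelIso.apply_inv_self s (x : Vert F))⟩, s, hs, fun _ => rfl⟩,
    fun _ => rfl⟩

/-- Generators of `D(F)`. -/
lemma exists_generators [IsArtinianRing Λ] (p : ℕ) [Fact p.Prime] [CharP 𝓀[F] p]
    (L : Type*) [Field L] [Algebra o L] [IsFractionRing o L]
    (hp0 : (p : o) ≠ 0) (hpu : ¬ IsUnit (p : o)) [IsAdicComplete (Ideal.span {(p : o)}) o]
    [Finite (o ⧸ Ideal.span {ϖ})] (H : Admissible 𝓕 e) (hϖ : Irreducible ϖ)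
    (hΛ : Function.Surjective (algebraMap o Λ)) {n : ℕ}
    (hn : Module.rank (Λ ⧸ Ideal.span {algebraMap o Λ ϖ})
      (invTorsion 𝓕 e (algebraMap o Λ ϖ)) = n) :
    letI := modD o L H
    ∃ d : Fin n → DD 𝓕 o L,
      Submodule.span (IwasawaAlgebra o (Nhat01 π e)) (Set.range d) = ⊤ := by
  obtain ⟨b, hb0, hb, hb'⟩ := exists_N0Invariants_generators (𝓕 := 𝓕) (e := e) hϖ hΛ hn
  let c : Fin n → RestrictScalars o Λ (H0plus 𝓕) := fun i => 𝓕.cls (Xplus F) (xPlus F) (b i)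
  let : @Module o (RestrictScalars o Λ (H0plus 𝓕)) _ AddCommGroup.toAddCommMonoid :=
    RestrictScalars.module o Λ (H0plus 𝓕)
  have hsum : ∀ r : Fin n → o, ∑ i, r i • c i =
      𝓕.cls (Xplus F) (xPlus F) (∑ i, algebraMap o Λ (r i) • b i) := fun r => by
    rw [map_sum]
    exact Finset.sum_congr rfl fun i _ => ((𝓕.cls (Xplus F) (xPlus F)).map_smul _ _).symm
  obtain ⟨f, hf⟩ := exists_dual_functionals L hϖ c fun r hr => hb r
    (cls_injective H.hyp1 xPlus_mem_Xplus ((hsum r).symm.trans (hr.trans (map_zero _).symm)))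
  obtain ⟨K, hK⟩ := exists_algebraMap_uniformizer_pow_eq_zero (Λ := Λ) hϖ hΛ
  have htor : ∀ x : RestrictScalars o Λ (H0plus 𝓕), ϖ ^ K • x = 0 := fun x => by
    change algebraMap o Λ (ϖ ^ K) • (show H0plus 𝓕 from x) = 0
    rw [map_pow, hK, zero_smul]
  refine ⟨f, ?_⟩
  let := modD o L H
  refine eq_top_iff.mpr fun g _ => ?_
  -- An invariant class killed by `ϖ` is the class of a combination of the vectors `b i`. The
  -- functionals `f i` detect whether its coefficients are divisible by `ϖ`; if all of them vanish
  -- on the class, the combination is zero because `ϖ` kills the `b i`.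
  obtain ⟨a, ha⟩ := exists_eq_sum_smoothSMul p hp0 hpu hϖ
    (fun U => isPGroup_Nhat01_quotient H.one_le p U) (isSmooth_repH o H)
    (fun x => ⟨K, htor x⟩) f (fun x hx hx0 hfx => by
      obtain ⟨v, rfl, hv⟩ := exists_eq_cls_of_invariant H (c := x) fun s hs => by
        obtain ⟨h, hh⟩ := exists_Nhat01_of_mem H.one_le hs
        rw [← repH_eq H hs hh]
        exact hx h
      have hv0 : algebraMap o Λ ϖ • v = 0 := cls_injective H.hyp1 xPlus_mem_Xplus
        ((map_smul _ _ _).trans (hx0.trans (map_zero _).symm))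
      obtain ⟨r, rfl⟩ := hb' v hv hv0
      have h0 : ∑ i, algebraMap o Λ (r i) • b i = 0 := Finset.sum_eq_zero fun i _ => by
        obtain ⟨d, hd⟩ := hf r i ((congrArg (f i) (hsum r)).trans (hfx i))
        rw [hd, mul_comm, map_mul, mul_smul, hb0, smul_zero]
      exact (congrArg _ h0).trans (map_zero (𝓕.cls (Xplus F) (xPlus F)))) g
  rw [ha]
  exact sum_mem fun i _ => Submodule.smul_mem _ _ (Submodule.subset_span ⟨i, rfl⟩)

/-! #### The cokernel of `∂` -/

section Coker

variable (L : Type*) [Field L] [Algebra o L] [IsFractionRing o L]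

/-- The cokernel of `∂` is finite. -/
lemma finite_coker_bdMap [IsArtinianRing Λ] [Finite (o ⧸ Ideal.span {ϖ})] (H : Admissible 𝓕 e)
    (hϖ : Irreducible ϖ) (hΛ : Function.Surjective (algebraMap o Λ)) [Finite (imSigma 𝓕)] :
    letI := modD o L H
    letI := modD' o L H
    Finite (DD 𝓕 o L ⧸ LinearMap.range (bdMap o L H)) := by
  let := modD o L H
  let := modD' o L H
  obtain ⟨K, hK⟩ := exists_algebraMap_uniformizer_pow_eq_zero (Λ := Λ) hϖ hΛ
  have := finite_quotient_span_pow (ϖ := ϖ) K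
  have hfin : Finite {x : FracQuot o L | ϖ ^ K • x = 0} :=
    FracQuot.finite_torsion (pow_ne_zero K hϖ.ne_zero)
  have hval : ∀ (f : DD 𝓕 o L) (c : H0plus 𝓕), ϖ ^ K • f.eval c = 0 := fun f c => by
    have h1 : ϖ ^ K • f.eval c = f.eval (algebraMap o Λ (ϖ ^ K) • c) := (f.map_smul (ϖ ^ K) c).symm
    rw [h1, map_pow, hK, zero_smul]
    exact map_zero f
  -- Modulo `∂ D'(F)` a functional is determined by its restriction to the finite image of `F(σ)`,
  -- and its values lie in the finite `ϖ^K`-torsion of `L/o`.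
  let j : DD 𝓕 o L ⧸ LinearMap.range (bdMap o L H) →
      (imSigma 𝓕 → {x : FracQuot o L | ϖ ^ K • x = 0}) :=
    fun q c => ⟨q.out.eval c, hval _ _⟩
  refine Finite.of_injective j fun q q' hqq => ?_
  rw [← q.out_eq, ← q'.out_eq]
  refine (Submodule.Quotient.eq _).mpr ?_
  obtain ⟨g, hg⟩ := exists_bdMap_eq L H (f := q.out - q'.out) fun c hc =>
    sub_eq_zero.mpr (congrArg Subtype.val (congrFun hqq ⟨c, hc⟩))
  exact ⟨g, hg⟩

end Coker

end

end BTree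

end

/-! ### The action of `o[[N₀^(e)]]` and its compatibility with the monoid actions -/

noncomputable section

namespace BTree

variable {F : Type*} [Field F] [ValuativeRel F] [TopologicalSpace F]
  [IsNonarchimedeanLocalField F] {π : Uniformizer F} {e : ℕ}
  {Λ : Type*} [CommRing Λ] {𝓕 : EquivariantCoeffSystem Λ (NT F) (tree π)}
  {o : Type*} [CommRing o] {L : Type*} [Field L] [Algebra o L] [Algebra o Λ]

lemma N0_mem_PhatPlus (he : 1 ≤ e) (n : N0 π e) : toAut π n ∈ PhatPlus π e :=
  Nhat0_mem_PhatPlus he (toAut_mem_Nhat0 π n)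

lemma N0_one_mem_PhatPlus (he : 1 ≤ e) (n : N0 π 1) : toAut π n ∈ PhatPlus π e :=
  PhatStarExt_le_PhatPlus he (N0_one_mem π e n)

lemma N0_inv_mem_PhatPlus (he : 1 ≤ e) (n : N0 π e) : (toAut π n)⁻¹ ∈ PhatPlus π e :=
  Nhat0_inv_mem_PhatPlus he (toAut_mem_Nhat0 π n)

lemma repH_N0ToNhat01 (H : Admissible 𝓕 e) (n : N0 π e) :
    repH H (N0ToNhat01 π e n) = actH0 H (N0_mem_PhatPlus H.one_le n) :=
  repH_eq H (toAut_mem_Nhat0 π n) (fun _ => rfl) _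

lemma repQ_N0ToNhat01 (H : Admissible 𝓕 e) (n : N0 π e) :
    repQ H (N0ToNhat01 π e n) = actQuot H (N0_inv_mem_PhatPlus H.one_le n) :=
  repQ_eq H (toAut_mem_Nhat0 π n) (fun _ => rfl) _

lemma locConst_actH0 (H : Admissible 𝓕 e) (f : DD 𝓕 o L) (c : H0plus 𝓕) :
    (fun n : N0 π e => f.eval (actH0 H (N0_mem_PhatPlus H.one_le n⁻¹) c)) ∈
      LocConst o (N0 π e) (FracQuot o L) := by
  have := LocConst.comp_hom (locConst_repH H f c) (N0ToNhat01 π e) (continuous_N0ToNhat01 π e)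
  simp only [Function.comp_def, ← map_inv, repH_N0ToNhat01] at this
  exact this

lemma locConst_actQuot (H : Admissible 𝓕 e) (f : DD' 𝓕 o L) (c : H0plus 𝓕 ⧸ imSigma 𝓕) :
    (fun n : N0 π e => f.eval (actQuot H (N0_inv_mem_PhatPlus H.one_le n⁻¹) c)) ∈
      LocConst o (N0 π e) (FracQuot o L) := by
  have := LocConst.comp_hom (locConst_repQ H f c) (N0ToNhat01 π e) (continuous_N0ToNhat01 π e)
  simp only [Function.comp_def, ← map_inv, repQ_N0ToNhat01] at this
  exact this

lemma iwN0_smul_eval (H : Admissible 𝓕 e) (r : IwasawaAlgebra o (N0 π e)) (f : DD 𝓕 o L)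
    (c : H0plus 𝓕) :
    (letI := modD o L H; iwN0 π e o r • f).eval c =
      r.integral fun n => f.eval (actH0 H (N0_mem_PhatPlus H.one_le n⁻¹) c) := by
  rw [modD_smul_eval]
  refine (IwasawaAlgebra.integral_map _ _ _ (locConst_repH H f c)).trans ?_
  simp only [Function.comp_def, ← map_inv, repH_N0ToNhat01]

lemma iwN0_smul_eval' (H : Admissible 𝓕 e) (r : IwasawaAlgebra o (N0 π e)) (f : DD' 𝓕 o L)
    (c : H0plus 𝓕 ⧸ imSigma 𝓕) :
    (letI := modD' o L H; iwN0 π e o r • f).eval c =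
      r.integral fun n => f.eval (actQuot H (N0_inv_mem_PhatPlus H.one_le n⁻¹) c) := by
  rw [modD'_smul_eval]
  refine (IwasawaAlgebra.integral_map _ _ _ (locConst_repQ H f c)).trans ?_
  simp only [Function.comp_def, ← map_inv, repQ_N0ToNhat01]

lemma toAut_conjN0 (m : ℕ) (n : N0 π e) :
    toAut π (conjN0 π e m n) = toAut π (t π) ^ m * toAut π n * (toAut π (t π) ^ m)⁻¹ := by
  rw [coe_conjN0, map_mul, map_mul, map_inv, map_pow]

lemma actH0_mul_comm_of_eq (H : Admissible 𝓕 e) {s s' u u' : AutX π} (h : s * s' = u * u')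
    (hs : s ∈ PhatPlus π e) (hs' : s' ∈ PhatPlus π e) (hu : u ∈ PhatPlus π e)
    (hu' : u' ∈ PhatPlus π e) (c : H0plus 𝓕) :
    actH0 H hs (actH0 H hs' c) = actH0 H hu (actH0 H hu' c) := by
  rw [← Module.End.mul_apply, ← Module.End.mul_apply, ← actH0_mul, ← actH0_mul]
  exact LinearMap.congr_fun (actH0_congr H h _ _) c

lemma actQuot_mul_comm_of_eq (H : Admissible 𝓕 e) {s s' u u' : AutX π} (h : s * s' = u * u')
    (hs : s⁻¹ ∈ PhatPlus π e) (hs' : s'⁻¹ ∈ PhatPlus π e) (hu : u⁻¹ ∈ PhatPlus π e)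
    (hu' : u'⁻¹ ∈ PhatPlus π e) (c : H0plus 𝓕 ⧸ imSigma 𝓕) :
    actQuot H hs (actQuot H hs' c) = actQuot H hu (actQuot H hu' c) := by
  have h1 : (s * s')⁻¹ ∈ PhatPlus π e := by rw [mul_inv_rev]; exact mul_mem hs' hs
  have h2 : (u * u')⁻¹ ∈ PhatPlus π e := by rw [mul_inv_rev]; exact mul_mem hu' hu
  rw [← Module.End.mul_apply, ← Module.End.mul_apply, ← actQuot_mul H _ _ h1,
    ← actQuot_mul H _ _ h2]
  exact LinearMap.congr_fun (actQuot_congr H h _ _) c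

lemma t_pow_mul_toAut (m : ℕ) (n : N0 π e) :
    toAut π (conjN0 π e m n) * toAut π (t π) ^ m = toAut π (t π) ^ m * toAut π n := by
  rw [toAut_conjN0, inv_mul_cancel_right]

/-- `ψ_{t^m}` is semilinear. -/
lemma actOnD_t_smul (H : Admissible 𝓕 e) (m : ℕ) (r : IwasawaAlgebra o (N0 π e))
    (d : DD 𝓕 o L) :
    letI := modD o L H
    actOnD o L H ⟨(toAut π (t π) ^ m)⁻¹, t_pow_inv_mem π e m⟩ (iwN0 π e o (iwConj π e o m r) • d) =
      iwN0 π e o r • actOnD o L H ⟨(toAut π (t π) ^ m)⁻¹, t_pow_inv_mem π e m⟩ d :=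
  PDual.ext_eval fun c => by
    rw [actOnD_t_eval, iwN0_smul_eval, iwN0_smul_eval]
    refine (IwasawaAlgebra.integral_map _ _ _ (locConst_actH0 H d _)).trans (congrArg r.integral ?_)
    funext n
    rw [Function.comp_apply, actOnD_t_eval]
    refine congrArg d.eval (actH0_mul_comm_of_eq H ?_ _ _ _ _ c)
    rw [← map_inv]
    exact t_pow_mul_toAut m n⁻¹

lemma t_pow_inv_inv_mem_PhatPlus (he : 1 ≤ e) (m : ℕ) :
    (toAut π (t π) ^ m)⁻¹⁻¹ ∈ PhatPlus π e :=
  inv_inv_mem_PhatPlus he ⟨_, t_pow_mem π e m⟩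

/-- `φ_{t^m}` is semilinear. -/
lemma actOnD'_t_smul (H : Admissible 𝓕 e) (m : ℕ) (r : IwasawaAlgebra o (N0 π e))
    (d : DD' 𝓕 o L) :
    letI := modD' o L H
    actOnD' o L H ⟨toAut π (t π) ^ m, t_pow_mem π e m⟩ (iwN0 π e o r • d) =
      iwN0 π e o (iwConj π e o m r) • actOnD' o L H ⟨toAut π (t π) ^ m, t_pow_mem π e m⟩ d :=
  PDual.ext_eval fun c => by
    rw [actOnD'_eval H _ (t_pow_inv_inv_mem_PhatPlus H.one_le m), iwN0_smul_eval', iwN0_smul_eval']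
    refine Eq.trans (congrArg r.integral ?_)
      (IwasawaAlgebra.integral_map _ _ _ (locConst_actQuot H _ c)).symm
    funext n
    rw [Function.comp_apply, actOnD'_eval H _ (t_pow_inv_inv_mem_PhatPlus H.one_le m)]
    refine congrArg d.eval (actQuot_mul_comm_of_eq H ?_ _ _ _ _ c)
    rw [← map_inv, toAut_conjN0]
    group

lemma toAut_N0_mul_comm {e' : ℕ} (n : N0 π e) (n' : N0 π e') :
    toAut π n * toAut π n' = toAut π n' * toAut π n := by
  obtain ⟨_, b, -, rfl⟩ := n
  obtain ⟨_, b', -, rfl⟩ := n'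
  rw [← map_mul, ← map_mul, aff_mul, aff_mul]
  simp only [mul_one, Units.val_one, one_mul, add_comm]

lemma actOnD_N0_eval (H : Admissible 𝓕 e) (n : N0 π 1) (f : DD 𝓕 o L) (c : H0plus 𝓕) :
    (actOnD o L H ⟨toAut π n, N0_one_mem_inv π e n⟩ f).eval c =
      f.eval (actH0 H (N0_one_mem_PhatPlus H.one_le n⁻¹) c) := by
  rw [actH0_congr H (map_inv (toAut π) (n : GL (Fin 2) F)) _
    (inv_mem_PhatPlus H.one_le ⟨toAut π n, N0_one_mem_inv π e n⟩)]
  rfl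

/-- The operators `n ∈ N₀^(1)` on `D(F)` are linear over `o[[N₀^(e)]]`. -/
lemma actOnD_N0_smul (H : Admissible 𝓕 e) (n : N0 π 1) (r : IwasawaAlgebra o (N0 π e))
    (d : DD 𝓕 o L) :
    letI := modD o L H
    actOnD o L H ⟨toAut π n, N0_one_mem_inv π e n⟩ (iwN0 π e o r • d) =
      iwN0 π e o r • actOnD o L H ⟨toAut π n, N0_one_mem_inv π e n⟩ d :=
  PDual.ext_eval fun c => by
    rw [actOnD_N0_eval, iwN0_smul_eval, iwN0_smul_eval]
    refine congrArg r.integral (funext fun n' => ?_)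
    rw [actOnD_N0_eval]
    exact congrArg d.eval (actH0_mul_comm_of_eq H (toAut_N0_mul_comm n'⁻¹ n⁻¹) _ _ _ _ c)

/-! #### An element of `o[[N₀^(e)]]` that maps `D(F)` into `D'(F)` -/

lemma iwN0_dirac_sub_one_smul_eval (H : Admissible 𝓕 e) (h : N0 π e) (d : DD 𝓕 o L)
    (c : H0plus 𝓕) :
    (letI := modD o L H; iwN0 π e o (IwasawaAlgebra.dirac o h - 1) • d).eval c =
      d.eval (actH0 H (N0_mem_PhatPlus H.one_le h⁻¹) c) - d.eval c := by
  let := modD o L H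
  rw [map_sub, map_one, sub_smul, one_smul, eq_sub_iff_add_eq]
  refine (sub_add_cancel (PDual.eval (iwN0 π e o (IwasawaAlgebra.dirac o h) • d) c) _).trans ?_
  rw [iwN0_smul_eval]
  exact IwasawaAlgebra.integral_dirac h (locConst_actH0 H d c)

/-- As `N₀^(e)` acts trivially on the image of `F(σ)`, the functional `([h] - 1) d` vanishes there
and factors through the quotient. So `[h] - 1` can serve as a denominator for the inverse of `∂`. -/
lemma exists_bdMap_eq_smul (H : Admissible 𝓕 e) (h : N0 π e) : ∃ κ : DD 𝓕 o L → DD' 𝓕 o L, ∀ d,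
      bdMap o L H (κ d) =
        (letI := modD o L H; iwN0 π e o (IwasawaAlgebra.dirac o h - 1) • d) := by
  refine Classical.skolem.mp fun d => exists_bdMap_eq L H fun c hc => ?_
  rw [iwN0_dirac_sub_one_smul_eval, sub_eq_zero]
  exact congrArg d.eval (actH0_toAut_of_mem_imSigma H hc h⁻¹)

/-- In `o[N₀^(e)/U]` the element `[h] - 1` has coefficient `1` at the class of `h`, since `h` is not
in `U`. -/
lemma dirac_sub_one_notMem {ϖ : o} (hϖ : ¬ IsUnit ϖ) {h : N0 π e}
    {U : OpenNormalSubgroup (N0 π e)} (hU : h ∉ U) :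
    IwasawaAlgebra.dirac o h - 1 ∉
      Ideal.span {algebraMap o (IwasawaAlgebra o (N0 π e)) ϖ} := by
  intro hmem
  obtain ⟨y, hy⟩ := Ideal.mem_span_singleton.mp hmem
  rw [← Algebra.smul_def] at hy
  have h1 : MonoidAlgebra.single (h : N0 π e ⧸ U.toSubgroup) (1 : o) - 1 = ϖ • y.proj U :=
    congrArg (fun x : IwasawaAlgebra o (N0 π e) => x.proj U) hy
  have h2 := congrArg (fun x => MonoidAlgebra.coeff x (h : N0 π e ⧸ U.toSubgroup)) h1
  have h3 : (1 : N0 π e ⧸ U.toSubgroup) ≠ h := fun h' =>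
    hU ((QuotientGroup.eq_one_iff (N := U.toSubgroup) h).mp h'.symm)
  rw [MonoidAlgebra.one_def, MonoidAlgebra.coeff_sub, Finsupp.sub_apply, MonoidAlgebra.coeff_single,
    MonoidAlgebra.coeff_single, Finsupp.single_eq_same, Finsupp.single_eq_of_ne h3.symm, sub_zero,
    MonoidAlgebra.coeff_smul_apply] at h2
  exact hϖ (IsUnit.of_mul_eq_one _ h2.symm)

lemma _root_.ComplLocalization.isUnit_algebraMap {R : Type*} [CommRing R] (p : ℕ) {a s : R}
    (hs : s ∉ Ideal.span {a}) : IsUnit (algebraMap R (ComplLocalization R p a) s) := by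
  have h1 : IsUnit (algebraMap R (Localization (complSubmonoid R a)) s) :=
    IsLocalization.map_units (Localization (complSubmonoid R a))
      (⟨s, Submonoid.subset_closure hs⟩ : complSubmonoid R a)
  exact h1.map (algebraMap (Localization (complSubmonoid R a))
    (AdicCompletion (Ideal.span {(p : Localization (complSubmonoid R a))})
      (Localization (complSubmonoid R a))))

end BTree

end

/-! ### The relation between `φ_{t^m}` and `ψ_{t^m}` -/

noncomputable section

namespace BTree

variable {F : Type*} [Field F] [ValuativeRel F] [TopologicalSpace F]
  [IsNonarchimedeanLocalField F] {π : Uniformizer F} {e : ℕ}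
  {Λ : Type*} [CommRing Λ] {𝓕 : EquivariantCoeffSystem Λ (NT F) (tree π)}
  {o : Type*} [CommRing o] {L : Type*} [Field L] [Algebra o L] [Algebra o Λ]

lemma inv_t_pow_smul_vtx (m : ℕ) (i : ℤ) (b : F) :
    (t π ^ m)⁻¹ • vtx π i b = vtx π (i - m) (((π.1 : F) ^ m)⁻¹ * b) := by
  rw [inv_smul_eq_iff, vtx, vtx, ← mul_smul, t, aff_pow, aff_mul, add_zero,
    Units.val_pow_eq_pow_val, mul_inv_cancel_left₀ (pow_ne_zero m π.1.ne_zero), ← zpow_natCast,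
    ← zpow_add, add_sub_cancel]

/-- For a vertex `x` of `X₊` of level at least `m`, the elements `n` of `N₀^(1)` with
`t^(-m) n⁻¹ x ∈ X₊` form a coset of `t^m N₀^(1) t^(-m)`. -/
lemma exists_coset (m : ℕ) {x : Vert F} (hx : x ∈ Xplus F) (hm : (m : ℤ) ≤ lvl π x) :
    ∃ q : N0 π 1 ⧸ (conjN0 π 1 m).range, ∀ n : N0 π 1,
      (t π ^ m)⁻¹ • ((n⁻¹ : N0 π 1) : GL (Fin 2) F) • x ∈ Xplus F ↔
        (n : N0 π 1 ⧸ (conjN0 π 1 m).range) = q := by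
  obtain ⟨i, b, rfl⟩ := exists_vtx π x
  rw [lvl_vtx] at hm
  have hb : aff 1 b ∈ N0 π 1 :=
    aff_one_mem_N0_iff.mpr (by simpa using (vtx_mem_Xplus_iff.mp hx).2)
  -- For `x = vtx i b` with `i ≥ m`, the condition on `n = (1, c)` is `b - c ∈ p_F^m 𝒪`. So `n` runs
  -- through the coset of `(1, b)`.
  refine ⟨((⟨aff 1 b, hb⟩ : N0 π 1) : N0 π 1 ⧸ (conjN0 π 1 m).range), fun n => ?_⟩
  obtain ⟨n, hn⟩ := n
  obtain ⟨c, rfl⟩ := N0_le_N 1 hn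
  have h1 : (aff 1 c : GL (Fin 2) F)⁻¹ = aff 1 (-c) := by
    rw [aff_inv, inv_one, Units.val_one, neg_mul, one_mul]
  have h3 : (aff 1 c : GL (Fin 2) F)⁻¹ * aff 1 b = aff 1 (b + -c) := by
    rw [h1, aff_mul, one_mul, Units.val_one, one_mul]
  have h2 : (⟨aff 1 c, hn⟩ : N0 π 1)⁻¹ * ⟨aff 1 b, hb⟩ =
      ⟨aff 1 (b + -c), h3 ▸ mul_mem (inv_mem hn) hb⟩ := Subtype.ext h3
  rw [QuotientGroup.eq, h2, mem_conjN0_range]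
  change (t π ^ m)⁻¹ • (aff 1 c : GL (Fin 2) F)⁻¹ • vtx π i b ∈ Xplus F ↔ _
  rw [h1, aff_one_smul_vtx, inv_t_pow_smul_vtx, vtx_mem_Xplus_iff, mul_comm, Nat.sub_self,
    Nat.cast_zero, add_zero, zpow_neg, zpow_natCast]
  exact and_iff_right (by lia)

lemma lvl_inv_t_pow_smul (m : ℕ) (x : Vert F) : lvl π ((t π ^ m)⁻¹ • x) = lvl π x - m := by
  have := lvl_t_pow_smul (π := π) m ((t π ^ m)⁻¹ • x)
  rw [smul_inv_smul] at this
  lia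

lemma conjN0_mem (he : 1 ≤ e) (m : ℕ) (n : N0 π e) :
    (conjN0 π e m n : GL (Fin 2) F) ∈ N0 π (m + e) := by
  obtain ⟨b, hb⟩ := N0_le_N e (conjN0 π e m n).2
  have h2 : aff 1 b ∈ N0 π e := hb ▸ (conjN0 π e m n).2
  have h1 : (⟨aff 1 b, h2⟩ : N0 π e) ∈ (conjN0 π e m).range := ⟨n, Subtype.ext hb⟩
  rw [mem_conjN0_range] at h1
  rw [hb, aff_one_mem_N0_iff]
  have h3 : ((m + e - 1 : ℕ) : ℤ) = m + (e - 1 : ℕ) := by lia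
  rwa [h3]

lemma cls_autAct_of_eq_one (H : Admissible 𝓕 e) {u : AutX π} (hu : u = 1) (x : Vert F)
    (v : 𝓕.onVert x) : 𝓕.cls (Xplus F) (u x) (autAct 𝓕 e u x v) = 𝓕.cls (Xplus F) x v := by
  subst hu
  rw [autAct_one H.one_le H.hyp1 H.hyp2 H.hyp3]
  rfl

lemma actH0_cls_autAct (H : Admissible 𝓕 e) {s u : AutX π} (hs : s ∈ PhatPlus π e)
    (hu : u ∈ Phat π e) {x : Vert F} (hx : u x ∈ Xplus F) (v : 𝓕.onVert x) :
    actH0 H hs (𝓕.cls (Xplus F) (u x) (autAct 𝓕 e u x v)) =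
      𝓕.cls (Xplus F) ((s * u) x) (autAct 𝓕 e (s * u) x v) := by
  rw [actH0_cls H hs hx, autAct_mul H.one_le H.hyp1 H.hyp2 H.hyp3 hs.1 hu]
  rfl

/-- The classes `t^(-m) n⁻¹ v` in `H₀(X, F) / H₀(X₋, F)`. -/
lemma actQuot_t_actH0_cls (H : Admissible 𝓕 e) (m : ℕ) (n : N0 π 1) {x : Vert F}
    (hx : x ∈ Xplus F) (v : 𝓕.onVert x) :
    actQuot H (t_pow_inv_inv_mem_PhatPlus H.one_le m)
      ((imSigma 𝓕).mkQ (actH0 H (N0_one_mem_PhatPlus H.one_le n⁻¹) (𝓕.cls (Xplus F) x v))) =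
    (imSigma 𝓕).mkQ (𝓕.cls (Xplus F)
      (((toAut π (t π) ^ m)⁻¹ * toAut π (n⁻¹ : N0 π 1)) x)
      (autAct 𝓕 e ((toAut π (t π) ^ m)⁻¹ * toAut π (n⁻¹ : N0 π 1)) x v)) := by
  rw [actH0_cls H _ hx, actQuot_cls', autAct_mul H.one_le H.hyp1 H.hyp2 H.hyp3
    (inv_mem (t_pow_mem_PhatPlus H.one_le m).1) (N0_one_mem_PhatPlus H.one_le n⁻¹).1]
  rfl

lemma iwConj_dirac_sub_one (m : ℕ) (h : N0 π e) :
    iwConj π e o m (IwasawaAlgebra.dirac o h - 1) =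
      IwasawaAlgebra.dirac o (conjN0 π e m h) - 1 := by
  rw [map_sub, map_one]
  congr 1
  refine Subtype.ext (funext fun U => ?_)
  exact MonoidAlgebra.mapDomain_single

/-- Dualizing, `n` and `φ_{t^m}` move the argument `c` to `t^(-m) n⁻¹ c` in the quotient by `F(σ)`.
On a representative `c'` of it, `κ d` takes the same value as `([h] - 1) d`. -/
lemma phi_bd_kappa_psi_eval (H : Admissible 𝓕 e) (m : ℕ) (h : N0 π e)
    {κ : DD 𝓕 o L → DD' 𝓕 o L}
    (hκ : ∀ d, bdMap o L H (κ d) =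
        (letI := modD o L H; iwN0 π e o (IwasawaAlgebra.dirac o h - 1) • d))
    (n : N0 π 1) (d : DD 𝓕 o L) (c : H0plus 𝓕) {c' : H0plus 𝓕}
    (hc' : actQuot H (t_pow_inv_inv_mem_PhatPlus H.one_le m)
      ((imSigma 𝓕).mkQ (actH0 H (N0_one_mem_PhatPlus H.one_le n⁻¹) c)) = (imSigma 𝓕).mkQ c') :
    (actOnD o L H ⟨toAut π n, N0_one_mem_inv π e n⟩
      (bdMap o L H (actOnD' o L H ⟨toAut π (t π) ^ m, t_pow_mem π e m⟩ (κ d)))).eval c =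
      d.eval (actH0 H (N0_mem_PhatPlus H.one_le h⁻¹) c') - d.eval c' := by
  rw [actOnD_N0_eval]
  refine (congrArg (κ d).eval hc').trans ?_
  refine (congrArg (fun f : DD 𝓕 o L => f.eval c') (hκ d)).trans ?_
  exact iwN0_dirac_sub_one_smul_eval H h d c'

lemma psi_eval (H : Admissible 𝓕 e) (m : ℕ) (n : N0 π 1) (d : DD 𝓕 o L) (c : H0plus 𝓕) :
    (actOnD o L H ⟨(toAut π (t π) ^ m)⁻¹, t_pow_inv_mem π e m⟩
      (actOnD o L H ⟨toAut π (n⁻¹ : N0 π 1), N0_one_mem_inv π e n⁻¹⟩ d)).eval c =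
      d.eval (actH0 H (N0_one_mem_PhatPlus H.one_le n⁻¹⁻¹)
        (actH0 H (t_pow_mem_PhatPlus H.one_le m) c)) := by
  rw [actOnD_t_eval, actOnD_N0_eval]

/-- `n t^m` maps the class of `t^(-m) n⁻¹ v` to the class of `v`. -/
lemma actH0_N0_t_cls (H : Admissible 𝓕 e) (m : ℕ) (n : N0 π 1) {u : AutX π}
    (hu : u = (toAut π (t π) ^ m)⁻¹ * toAut π (n⁻¹ : N0 π 1)) {x : Vert F}
    (hx : u x ∈ Xplus F) (v : 𝓕.onVert x) :
    actH0 H (N0_one_mem_PhatPlus H.one_le n⁻¹⁻¹) (actH0 H (t_pow_mem_PhatPlus H.one_le m)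
      (𝓕.cls (Xplus F) (u x) (autAct 𝓕 e u x v))) = 𝓕.cls (Xplus F) x v := by
  have huP : u ∈ Phat π e := hu ▸ mul_mem (inv_mem (t_pow_mem_PhatPlus H.one_le m).1)
    (N0_one_mem_PhatPlus H.one_le n⁻¹).1
  rw [actH0_cls_autAct H _ huP hx, actH0_cls_autAct H _
    (mul_mem (t_pow_mem_PhatPlus H.one_le m).1 huP)
    ((t_pow_mem_PhatPlus H.one_le m).2 _ hx)]
  refine cls_autAct_of_eq_one H ?_ x v
  rw [hu, mul_inv_cancel_left, ← map_mul, ← Subgroup.coe_mul, inv_mul_cancel,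
    Subgroup.coe_one, map_one]

lemma actH0_N0_t_N0 (H : Admissible 𝓕 e) (m : ℕ) (n : N0 π 1) (h : N0 π e) (c : H0plus 𝓕) :
    actH0 H (N0_one_mem_PhatPlus H.one_le n⁻¹⁻¹) (actH0 H (t_pow_mem_PhatPlus H.one_le m)
      (actH0 H (N0_mem_PhatPlus H.one_le h⁻¹) c)) =
    actH0 H (N0_mem_PhatPlus H.one_le (conjN0 π e m h)⁻¹)
      (actH0 H (N0_one_mem_PhatPlus H.one_le n⁻¹⁻¹)
        (actH0 H (t_pow_mem_PhatPlus H.one_le m) c)) := by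
  rw [actH0_mul_comm_of_eq H (t_pow_mul_toAut m h⁻¹).symm _ _
    (N0_mem_PhatPlus H.one_le _) (t_pow_mem_PhatPlus H.one_le m),
    actH0_mul_comm_of_eq H (toAut_N0_mul_comm n⁻¹⁻¹ (conjN0 π e m h⁻¹)) _ _
    (N0_mem_PhatPlus H.one_le _) (N0_one_mem_PhatPlus H.one_le _)]
  simp only [map_inv]

/-- One summand of the relation between `φ_{t^m}` and `ψ_{t^m}`. -/
lemma phi_psi_eval (H : Admissible 𝓕 e) (m : ℕ) (h : N0 π e) {κ : DD 𝓕 o L → DD' 𝓕 o L}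
    (hκ : ∀ d, bdMap o L H (κ d) =
        (letI := modD o L H; iwN0 π e o (IwasawaAlgebra.dirac o h - 1) • d))
    (n : N0 π 1) (d : DD 𝓕 o L) {x : Vert F} (hx : x ∈ Xplus F) (v : 𝓕.onVert x)
    [Decidable ((t π ^ m)⁻¹ • ((n⁻¹ : N0 π 1) : GL (Fin 2) F) • x ∈ Xplus F)] :
    (actOnD o L H ⟨toAut π n, N0_one_mem_inv π e n⟩
      (bdMap o L H (actOnD' o L H ⟨toAut π (t π) ^ m, t_pow_mem π e m⟩
        (κ (actOnD o L H ⟨(toAut π (t π) ^ m)⁻¹, t_pow_inv_mem π e m⟩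
          (actOnD o L H ⟨toAut π (n⁻¹ : N0 π 1), N0_one_mem_inv π e n⁻¹⟩ d)))))).eval
        (𝓕.cls (Xplus F) x v) =
      if (t π ^ m)⁻¹ • ((n⁻¹ : N0 π 1) : GL (Fin 2) F) • x ∈ Xplus F then
        (letI := modD o L H; iwN0 π e o (iwConj π e o m (IwasawaAlgebra.dirac o h - 1)) • d).eval
          (𝓕.cls (Xplus F) x v)
      else 0 := by
  have hux : ((toAut π (t π) ^ m)⁻¹ * toAut π (n⁻¹ : N0 π 1)) x =
      (t π ^ m)⁻¹ • ((n⁻¹ : N0 π 1) : GL (Fin 2) F) • x := by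
    rw [← map_pow, ← map_inv]
    rfl
  rw [phi_bd_kappa_psi_eval H m h hκ n _ _ (actQuot_t_actH0_cls H m n hx v), psi_eval, psi_eval,
    actH0_N0_t_N0, iwConj_dirac_sub_one, iwN0_dirac_sub_one_smul_eval]
  -- If `t^(-m) n⁻¹ x` is in `X₊`, then `n t^m` from `ψ_{t^m}` carries the class back to that of
  -- `v`. Otherwise the class is already zero in `H₀(X, F)/H₀(X₋, F)`.
  split_ifs with hmem
  · rw [actH0_N0_t_cls H m n rfl (hux ▸ hmem)]
  · rw [𝓕.cls_of_notMem _ (hux ▸ hmem)]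
    simp only [map_zero]
    exact sub_self _

/-- The relation `∑ n ∂ φ_{t^m} (s ψ_{t^m} (n⁻¹ d)) = φ(s) d` for `s = [h] - 1`. -/
lemma sum_phi_psi (H : Admissible 𝓕 e) (m : ℕ) (h : N0 π e) {κ : DD 𝓕 o L → DD' 𝓕 o L}
    (hκ : ∀ d, bdMap o L H (κ d) =
        (letI := modD o L H; iwN0 π e o (IwasawaAlgebra.dirac o h - 1) • d))
    [Fintype (N0 π 1 ⧸ (conjN0 π 1 m).range)]
    {rep : (N0 π 1 ⧸ (conjN0 π 1 m).range) → N0 π 1}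
    (hrep : ∀ q, (rep q : N0 π 1 ⧸ (conjN0 π 1 m).range) = q) (d : DD 𝓕 o L) :
    ∑ q, actOnD o L H ⟨toAut π (rep q), N0_one_mem_inv π e (rep q)⟩
      (bdMap o L H (actOnD' o L H ⟨toAut π (t π) ^ m, t_pow_mem π e m⟩
        (κ (actOnD o L H ⟨(toAut π (t π) ^ m)⁻¹, t_pow_inv_mem π e m⟩
          (actOnD o L H ⟨toAut π ((rep q)⁻¹ : N0 π 1), N0_one_mem_inv π e (rep q)⁻¹⟩ d))))) =
      (letI := modD o L H; iwN0 π e o (iwConj π e o m (IwasawaAlgebra.dirac o h - 1)) • d) := by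
  classical
  have hlin : ∀ (f g : DD 𝓕 o L), (∀ x ∈ Xplus F, ∀ v, f.eval (𝓕.cls (Xplus F) x v) =
      g.eval (𝓕.cls (Xplus F) x v)) → f = g := fun f g hfg => PDual.ext_eval fun c =>
    CoeffSystem.H0_induction (P := fun c => f.eval c = g.eval c) c hfg
      ((map_zero f).trans (map_zero g).symm) fun c c' hc hc' =>
      (map_add f c c').trans ((congrArg₂ (· + ·) hc hc').trans (map_add g c c').symm)
  refine hlin _ _ fun x hx v => ?_
  have hev : ∀ (f : (N0 π 1 ⧸ (conjN0 π 1 m).range) → DD 𝓕 o L) (c : H0plus 𝓕),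
      (∑ q, f q).eval c = ∑ q, (f q).eval c := fun f c => LinearMap.sum_apply _ _ _
  rw [hev, Finset.sum_congr rfl fun q _ => phi_psi_eval H m h hκ (rep q) d hx v]
  -- At level at least `m` exactly one coset contributes. At a lower level none does, and the right
  -- hand side vanishes too: `t^m h t^(-m)` lies in `N₀^(m+e)`, which fixes all levels up to `m + e
  -- - 1` and hence `Z₊^(e)(x)`.
  by_cases hm : (m : ℤ) ≤ lvl π x
  · obtain ⟨q₀, hq₀⟩ := exists_coset m hx hm
    rw [Finset.sum_eq_single q₀]
    · rw [if_pos ((hq₀ _).mpr (hrep q₀))]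
    · intro q _ hq
      rw [if_neg fun h' => hq ((hrep q).symm.trans ((hq₀ _).mp h'))]
    · intro h'
      exact absurd (Finset.mem_univ q₀) h'
  · rw [Finset.sum_eq_zero, iwConj_dirac_sub_one, iwN0_dirac_sub_one_smul_eval, eq_comm,
      sub_eq_zero, actH0_cls H _ hx,
      cls_autAct_of_fix H _ (Nhat0_le_Nhat e (toAut_mem_Nhat0 π _))]
    · intro z hz
      rw [← map_inv]
      refine N0_smul_of_lvl_le (conjN0_mem H.one_le m h⁻¹) ?_
      have := lvl_le_of_mem_Zplus hz
      lia
    · intro q _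
      refine if_neg fun h' => hm ?_
      have := lvl_nonneg_of_mem_Xplus π h'
      rw [lvl_inv_t_pow_smul, lvl_N_smul (N0_le_N 1 (rep q)⁻¹.2)] at this
      lia

end BTree

end

/-! ### The étale pair -/

noncomputable section

lemma exists_dvd_uniformizer_pow {o : Type*} [CommRing o] [IsDomain o] [IsDiscreteValuationRing o]
    {ϖ : o} (hϖ : Irreducible ϖ) {x : o} (hx : x ≠ 0) : ∃ E, x ∣ ϖ ^ E :=
  (IsDiscreteValuationRing.associated_pow_irreducible hx hϖ).imp fun _ h => h.dvd

namespace BTree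

section Frobenius

variable {F : Type*} [Field F] [ValuativeRel F] [TopologicalSpace F]
  [IsNonarchimedeanLocalField F] {π : Uniformizer F} {e : ℕ} {o : Type*} [CommRing o]

lemma iwConj_dirac (m : ℕ) (h : N0 π e) :
    iwConj π e o m (IwasawaAlgebra.dirac o h) = IwasawaAlgebra.dirac o (conjN0 π e m h) :=
  Subtype.ext (funext fun _ => MonoidAlgebra.mapDomain_single)

lemma iwConj_algebraMap (m : ℕ) (c : o) :
    iwConj π e o m (algebraMap o _ c) = algebraMap o _ c :=
  AlgHom.commutes (IwasawaAlgebra.map o (conjN0 π e m) (continuous_conjN0 π e m)) c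

lemma dirac_pow (h : N0 π e) (k : ℕ) :
    (IwasawaAlgebra.dirac o h : IwasawaAlgebra o (N0 π e)) ^ k =
      IwasawaAlgebra.dirac o (h ^ k) := by
  induction k with
  | zero => rw [pow_zero, pow_zero]; exact IwasawaAlgebra.dirac_one.symm
  | succ k ih =>
    rw [pow_succ, ih, pow_succ h]
    exact (IwasawaAlgebra.dirac_mul (h ^ k) h).symm

/-- `p^m`-th powers in `o[[N₀^(e)]]` come from `o[[t^m N₀^(e) t^(-m)]]` modulo `ϖ`. -/
lemma pow_eq_iwConj_add (p : ℕ) [Fact p.Prime] [CharP 𝓀[F] p] {ϖ : o} (hp : ϖ ∣ (p : o)) (m : ℕ)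
    {ι : Type*} [Fintype ι] (g : ι → N0 π e) (b : ι → IwasawaAlgebra o (N0 π e)) :
    ∃ c y : IwasawaAlgebra o (N0 π e),
      (∑ i, IwasawaAlgebra.dirac o (g i) * iwConj π e o m (b i)) ^ p ^ m =
        iwConj π e o m c + algebraMap o _ ϖ * y := by
  obtain ⟨w, hw⟩ := hp
  have hpw : (p : IwasawaAlgebra o (N0 π e)) = algebraMap o _ ϖ * algebraMap o _ w := by
    rw [← map_mul, ← hw, map_natCast]
  -- Raising to the power `p ^ m` is additive modulo `p`, hence modulo `ϖ`. On each summand it takes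
  -- the group element into `t^m N₀^(e) t^(-m)`.
  refine Finset.sum_induction _ (fun s => ∃ c y : IwasawaAlgebra o (N0 π e),
      s ^ p ^ m = iwConj π e o m c + algebraMap o _ ϖ * y) ?_ ?_ ?_
  · rintro s s' ⟨c, y, h⟩ ⟨c', y', h'⟩
    obtain ⟨r, hr⟩ := exists_add_pow_prime_pow_eq (Fact.out : p.Prime) s s' m
    refine ⟨c + c', y + y' + algebraMap o _ w * s * s' * r, ?_⟩
    rw [hr, h, h', hpw, map_add]
    ring
  · exact ⟨0, 0, by
      rw [zero_pow (pow_ne_zero m (Fact.out : p.Prime).ne_zero), map_zero, mul_zero, add_zero]⟩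
  · intro i _
    obtain ⟨n', hn'⟩ := pow_mem_conjN0_range (π := π) (e := e) p m (g i)
    refine ⟨IwasawaAlgebra.dirac o n' * b i ^ p ^ m, 0, ?_⟩
    have h1 : IwasawaAlgebra.dirac o (g i) ^ p ^ m = IwasawaAlgebra.dirac o (conjN0 π e m n') :=
      (dirac_pow (g i) (p ^ m)).trans (congrArg _ hn'.symm)
    rw [mul_pow, h1, map_mul, map_pow, iwConj_dirac, mul_zero, add_zero]

/-- Either `O_E = 0`, or conjugation by `t^m` extends to `O_E`, with the representatives of
`N₀^(e) / t^m N₀^(e) t^(-m)` as a basis of `O_E` over itself. -/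
lemma exists_frobenius [IsDomain o] [IsDiscreteValuationRing o] {ϖ : o} (hϖ : Irreducible ϖ)
    (p : ℕ) [Fact p.Prime] [CharP 𝓀[F] p] (hp : ϖ ∣ (p : o)) (hp0 : (p : o) ≠ 0) (m : ℕ)
    [Fintype (N0 π e ⧸ (conjN0 π e m).range)] :
    Subsingleton (OE π e p ϖ) ∨
      ∃ (g : N0 π e ⧸ (conjN0 π e m).range → IwasawaAlgebra o (N0 π e))
        (phiE : OE π e p ϖ →+* OE π e p ϖ),
        (∀ r, ∃ c : N0 π e ⧸ (conjN0 π e m).range → IwasawaAlgebra o (N0 π e),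
          r = ∑ q, g q * iwConj π e o m (c q)) ∧
        (∀ r : IwasawaAlgebra o (N0 π e),
          phiE (algebraMap _ (OE π e p ϖ) r) = algebraMap _ (OE π e p ϖ) (iwConj π e o m r)) ∧
        Function.Bijective fun z : N0 π e ⧸ (conjN0 π e m).range → OE π e p ϖ =>
          ∑ q, algebraMap _ (OE π e p ϖ) (g q) * phiE (z q) := by
  classical
  obtain ⟨c, hc, hc'⟩ := IwasawaAlgebra.exists_coefficients (o := o)
    (N0_comm π e) (continuous_conjN0 π e m) (conjN0_injective m) (isOpenMap_conjN0 m)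
    (rep := Quotient.out) (fun q => Quotient.out_eq' q)
  have : Nonempty (N0 π e ⧸ (conjN0 π e m).range) := ⟨((1 : N0 π e) : N0 π e ⧸ _)⟩
  obtain ⟨E, hE⟩ := exists_dvd_uniformizer_pow hϖ hp0
  have hsum : ∀ r : IwasawaAlgebra o (N0 π e), r = ∑ q : N0 π e ⧸ (conjN0 π e m).range,
      IwasawaAlgebra.dirac o q.out * iwConj π e o m (c q r) := hc
  -- The alternative `O_E = 0` does occur. If `F` has characteristic `p`, then `h ^ p = 1`, so `([h]
  -- - 1) ^ p` is divisible by `p`; inverting `[h] - 1` for a nontrivial `h` inverts `p`.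
  refine (ComplLocalization.exists_semilinear_basis p (algebraMap o _ ϖ) (iwConj π e o m)
    (iwConj_algebraMap m ϖ) E ?_ (pow_ne_zero m (Fact.out : p.Prime).ne_zero) ?_
    (fun q : N0 π e ⧸ (conjN0 π e m).range => IwasawaAlgebra.dirac o q.out)
    (fun q => (c q).toAddMonoidHom)
    hsum ?_ ?_).imp_right ?_
  · simpa using map_dvd (algebraMap o (IwasawaAlgebra o (N0 π e))) hE
  · intro s
    rw [hsum s]
    exact pow_eq_iwConj_add p hp m _ _
  · intro q s
    change c q _ = _
    rw [map_sum, Finset.sum_eq_single q]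
    · exact (hc' q q (s q)).trans (if_pos rfl)
    · intro q' _ hq'
      exact (hc' q q' (s q')).trans (if_neg hq')
    · intro h
      exact absurd (Finset.mem_univ q) h
  · intro q r
    change c q _ = _ * c q r
    rw [← Algebra.smul_def, ← Algebra.smul_def, map_smul]
  · rintro ⟨phiE, h1, h2⟩
    exact ⟨_, phiE, fun r => ⟨_, hsum r⟩, h1, h2⟩

end Frobenius

end BTree

end

/-! ### Assembling the operators over `O_E` -/

noncomputable section

section BaseChange

variable {R A B D D' : Type*} [CommRing R] [Ring A] [CommRing B] [Algebra R B] {ρ : R →+* A}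
  [AddCommGroup D] [Module A D] [AddCommGroup D'] [Module A D']

/-- This isolates the algebra of the étale relation from the tree: it needs a semilinear basis of
`B`, a unit `s` of `B` with `s D ⊆ ∂ D'`, and the relation multiplied by `s` on `D`. For `B = 0` all
tensor products vanish and the claim is empty. -/
lemma BaseChange.exists_etale {Q Q' N : Type*} [Fintype Q] [Finite Q'] [Group N] {φ : R →+* R}
    (hB : Subsingleton B ∨ ∃ (g : Q → R) (phiE : B →+* B),
      (∀ r, ∃ c : Q → R, r = ∑ q, g q * φ (c q)) ∧
      (∀ r : R, phiE (algebraMap R B r) = algebraMap R B (φ r)) ∧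
      Function.Bijective fun z : Q → B => ∑ q, algebraMap R B (g q) * phiE (z q))
    (f : D' →ₗ[A] D) (hbij : Function.Bijective (BaseChange.map B ρ f)) (s : R)
    (hs : IsUnit (algebraMap R B s)) {κ : D → D'} (hκ : ∀ d, f (κ d) = ρ s • d)
    (Φ : D' →+ D') (hΦ : ∀ r d, Φ (ρ r • d) = ρ (φ r) • Φ d)
    (Ψ : D →+ D) (hΨ : ∀ r d, Ψ (ρ (φ r) • d) = ρ r • Ψ d)
    (ν : N → D →+ D) (hν : ∀ n r d, ν n (ρ r • d) = ρ r • ν n d) (P : (Q' → N) → Prop)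
    (hsum : ∀ rep : Q' → N, P rep → ∀ [Fintype Q'] (d : D),
      ∑ q, ν (rep q) (f (Φ (κ (Ψ (ν (rep q)⁻¹ d))))) = ρ (φ s) • d) :
    ∃ (phiE : B →+* B) (phi : BaseChange B ρ D' →+ BaseChange B ρ D')
      (psi : BaseChange B ρ D →+ BaseChange B ρ D)
      (nu : N → BaseChange B ρ D →+ BaseChange B ρ D),
      (∀ r : R, phiE (algebraMap R B r) = algebraMap R B (φ r)) ∧
      (∀ a d, phi (BaseChange.tmul ρ a d) = BaseChange.tmul ρ (phiE a) (Φ d)) ∧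
      (∀ a d, psi (BaseChange.tmul ρ (phiE a) d) = BaseChange.tmul ρ a (Ψ d)) ∧
      (∀ n a d, nu n (BaseChange.tmul ρ a d) = BaseChange.tmul ρ a (ν n d)) ∧
      ∀ rep : Q' → N, P rep → ∀ z, ∑ᶠ q, nu (rep q) (BaseChange.map B ρ f
        (phi ((Equiv.ofBijective _ hbij).symm (psi (nu (rep q)⁻¹ z))))) = z := by
  obtain hB | ⟨g, phiE, hg, hE, hgbij⟩ := hB
  · have h1 : Subsingleton (BaseChange B ρ D) := Module.subsingleton B _
    have h2 : Subsingleton (BaseChange B ρ D') := Module.subsingleton B _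
    exact ⟨RingHom.id _, 0, 0, 0, fun _ => Subsingleton.elim _ _, fun _ _ => Subsingleton.elim _ _,
      fun _ _ => Subsingleton.elim _ _, fun _ _ _ => Subsingleton.elim _ _,
      fun _ _ _ => Subsingleton.elim _ _⟩
  · have := Fintype.ofFinite Q'
    obtain ⟨phi, hphi⟩ := BaseChange.exists_semilinear hE Φ hΦ
    obtain ⟨psi, hpsi⟩ := BaseChange.exists_inverse_semilinear hE hgbij hg Ψ hΨ
    choose nu hnu using fun n => BaseChange.exists_linear (B := B) (ν n) (hν n)
    refine ⟨phiE, phi, psi, nu, hE, hphi, hpsi, hnu, fun rep hrep z => ?_⟩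
    rw [finsum_eq_sum_of_fintype]
    exact BaseChange.sum_phi_psi f _ s hs hκ hE hgbij.2 hphi hpsi (fun q => hnu (rep q))
      (fun q => hnu (rep q)⁻¹) (hsum rep hrep) z

end BaseChange

namespace BTree

section Pair

variable {F : Type*} [Field F] [ValuativeRel F] [TopologicalSpace F]
  [IsNonarchimedeanLocalField F] {π : Uniformizer F} {e : ℕ}
  {Λ : Type*} [CommRing Λ] {𝓕 : EquivariantCoeffSystem Λ (NT F) (tree π)}
  {o : Type*} [CommRing o] (L : Type*) [Field L] [Algebra o L] [Algebra o Λ]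
  (p : ℕ) (ϖ : o)

/-- `∂` becomes an isomorphism over `O_E`. -/
lemma baseChange_bdMap_bijective (H : Admissible 𝓕 e) (hϖ : ¬IsUnit ϖ) :
    letI := modD o L H
    letI := modD' o L H
    Function.Bijective (BaseChange.map (OE π e p ϖ) (iwN0 π e o) (bdMap o L H)) := by
  obtain ⟨h, U, hU⟩ := exists_notMem_openNormal π e
  obtain ⟨κ, hκ⟩ := exists_bdMap_eq_smul (o := o) (L := L) H h
  let := modD o L H
  let := modD' o L H
  exact BaseChange.map_bijective (bdMap o L H) (bdMap_injective o L H) _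
    (ComplLocalization.isUnit_algebraMap p (dirac_sub_one_notMem hϖ hU)) hκ

lemma etale_bdMap [IsDomain o] [IsDiscreteValuationRing o] (hϖ : Irreducible ϖ) [Fact p.Prime]
    [CharP 𝓀[F] p] (hp : ϖ ∣ (p : o)) (hp0 : (p : o) ≠ 0) (H : Admissible 𝓕 e)
    {h : N0 π e} {U : OpenNormalSubgroup (N0 π e)} (hU : h ∉ U) {κ : DD 𝓕 o L → DD' 𝓕 o L}
    (hκ : ∀ d, bdMap o L H (κ d) =
        (letI := modD o L H; iwN0 π e o (IwasawaAlgebra.dirac o h - 1) • d)) (m : ℕ) :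
    letI := modD o L H
    letI := modD' o L H
    ∃ (phiE : OE π e p ϖ →+* OE π e p ϖ)
    (phi : BaseChange (OE π e p ϖ) (iwN0 π e o) (DD' 𝓕 o L) →+
      BaseChange (OE π e p ϖ) (iwN0 π e o) (DD' 𝓕 o L))
    (psi : BaseChange (OE π e p ϖ) (iwN0 π e o) (DD 𝓕 o L) →+
      BaseChange (OE π e p ϖ) (iwN0 π e o) (DD 𝓕 o L))
    (nu : N0 π 1 → BaseChange (OE π e p ϖ) (iwN0 π e o) (DD 𝓕 o L) →+
      BaseChange (OE π e p ϖ) (iwN0 π e o) (DD 𝓕 o L)),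
    (∀ r : IwasawaAlgebra o (N0 π e),
      phiE (algebraMap _ (OE π e p ϖ) r) = algebraMap _ (OE π e p ϖ) (iwConj π e o m r)) ∧
    (∀ a d, phi (BaseChange.tmul _ a d) =
      BaseChange.tmul _ (phiE a) (actOnD' o L H ⟨toAut π (t π) ^ m, t_pow_mem π e m⟩ d)) ∧
    (∀ a d, psi (BaseChange.tmul _ (phiE a) d) =
      BaseChange.tmul _ a (actOnD o L H ⟨(toAut π (t π) ^ m)⁻¹, t_pow_inv_mem π e m⟩ d)) ∧
    (∀ n a d, nu n (BaseChange.tmul _ a d) =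
      BaseChange.tmul _ a (actOnD o L H ⟨toAut π n, N0_one_mem_inv π e n⟩ d)) ∧
    ∀ rep : (N0 π 1 ⧸ (conjN0 π 1 m).range) → N0 π 1,
      (∀ q, (rep q : N0 π 1 ⧸ (conjN0 π 1 m).range) = q) →
      ∀ z, ∑ᶠ q, nu (rep q) (BaseChange.map (OE π e p ϖ) (iwN0 π e o) (bdMap o L H)
        (phi ((Equiv.ofBijective _ (baseChange_bdMap_bijective L p ϖ H hϖ.not_isUnit)).symm
          (psi (nu (rep q)⁻¹ z))))) = z := by
  have := Fintype.ofFinite (N0 π e ⧸ (conjN0 π e m).range)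
  let := modD o L H
  let := modD' o L H
  exact BaseChange.exists_etale (exists_frobenius hϖ p hp hp0 m) (bdMap o L H) _ _
    (ComplLocalization.isUnit_algebraMap p (dirac_sub_one_notMem hϖ.not_isUnit hU)) hκ
    (actOnD' o L H ⟨toAut π (t π) ^ m, t_pow_mem π e m⟩).toAddMonoidHom (actOnD'_t_smul H m)
    (actOnD o L H ⟨(toAut π (t π) ^ m)⁻¹, t_pow_inv_mem π e m⟩).toAddMonoidHom
    (actOnD_t_smul H m)
    (fun n : N0 π 1 => (actOnD o L H ⟨toAut π n, N0_one_mem_inv π e n⟩).toAddMonoidHom)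
    (actOnD_N0_smul H)
    (fun rep : (N0 π 1 ⧸ (conjN0 π 1 m).range) → N0 π 1 =>
      ∀ q, (rep q : N0 π 1 ⧸ (conjN0 π 1 m).range) = q)
    fun rep hrep _ => sum_phi_psi H m h hκ hrep

end Pair

end BTree

end

noncomputable section

namespace BTree

section Pair

variable {F : Type*} [Field F] [ValuativeRel F] [TopologicalSpace F]
  [IsNonarchimedeanLocalField F] {π : Uniformizer F} {e : ℕ}
  {Λ : Type*} [CommRing Λ] {𝓕 : EquivariantCoeffSystem Λ (NT F) (tree π)}
  {o : Type*} [CommRing o] [IsDomain o] [IsDiscreteValuationRing o] {ϖ : o}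
  [IsLocalRing Λ] [IsArtinianRing Λ] [Algebra o Λ]
  (p : ℕ) [Fact p.Prime] [CharP 𝓀[F] p]
  (L : Type*) [Field L] [Algebra o L] [IsFractionRing o L]

/-- The étale pair `D'(F) → D(F)`. -/
def etalePair (H : Admissible 𝓕 e) (hϖ : Irreducible ϖ) (hΛ : Function.Surjective (algebraMap o Λ))
    (hp : ϖ ∣ (p : o)) (hp0 : (p : o) ≠ 0) [Finite (o ⧸ Ideal.span {ϖ})] [Finite (imSigma 𝓕)]
    {h : N0 π e} {U : OpenNormalSubgroup (N0 π e)} (hU : h ∉ U) {κ : DD 𝓕 o L → DD' 𝓕 o L}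
    (hκ : ∀ d, bdMap o L H (κ d) =
        (letI := modD o L H; iwN0 π e o (IwasawaAlgebra.dirac o h - 1) • d)) :
    EtalePair π e p ϖ (DD' 𝓕 o L) (DD 𝓕 o L) where
  modD' := modD' o L H
  modD := modD o L H
  towerD' := smoothModule_tower (isSmooth_repQ o H)
  towerD := smoothModule_tower (isSmooth_repH o H)
  bd := bdMap o L H
  bd_injective := bdMap_injective o L H
  actD := actOnD o L H
  actD' := actOnD' o L H
  actD_eq := actOnD_eq_dirac H
  actD'_eq := actOnD'_eq_dirac H
  bd_act := bdMap_actOnD' H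
  psi_bd_phi := actOnD_bdMap_actOnD' H
  finite_coker := finite_coker_bdMap L H hϖ hΛ
  baseChange_bijective := baseChange_bdMap_bijective L p ϖ H hϖ.not_isUnit
  etale := etale_bdMap L p ϖ hϖ hp hp0 H hU hκ

lemma isNatural_etalePair (H : Admissible 𝓕 e) (hϖ : Irreducible ϖ)
    (hΛ : Function.Surjective (algebraMap o Λ))
    (hp : ϖ ∣ (p : o)) (hp0 : (p : o) ≠ 0) [Finite (o ⧸ Ideal.span {ϖ})] [Finite (imSigma 𝓕)]
    {h : N0 π e} {U : OpenNormalSubgroup (N0 π e)} (hU : h ∉ U) {κ : DD 𝓕 o L → DD' 𝓕 o L}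
    (hκ : ∀ d, bdMap o L H (κ d) =
        (letI := modD o L H; iwN0 π e o (IwasawaAlgebra.dirac o h - 1) • d)) :
    (etalePair p L H hϖ hΛ hp hp0 hU hκ).IsNatural where
  bd_apply := bdMap_eval o L H
  actD_apply s hs f x hx v := by
    have h1 : s ∈ PhatPlus π e := by
      have := inv_inv_mem_PhatPlus H.one_le ⟨s, hs⟩
      rwa [inv_inv] at this
    refine congrArg f.eval (Eq.trans ?_ (actH0_cls H h1 hx v))
    rw [actH0_congr H (inv_inv s).symm h1 (by rwa [inv_inv])]
    rfl
  actD'_apply s hs f x hx v :=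
    congrArg f.eval (actQuot_cls H (inv_inv_mem_PhatPlus H.one_le ⟨s, hs⟩) hx v)
  continuousD := exists_smul_eval_eq_zero_modD H
  continuousD' := exists_smul_eval_eq_zero_modD' H

end Pair

end BTree

end

theorem theorem5p10
    {F : Type*} [Field F] [ValuativeRel F] [TopologicalSpace F] [IsNonarchimedeanLocalField F]
    (p : ℕ) [Fact p.Prime] [CharP 𝓀[F] p]
    (π : BTree.Uniformizer F) (e : ℕ) (he : 1 ≤ e)
    {L : Type*} [Field L] [Algebra ℚ_[p] L] [FiniteDimensional ℚ_[p] L]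
    {o : Type*} [CommRing o] [Algebra ℤ_[p] o] [Algebra o L] [Algebra ℤ_[p] L]
    [IsScalarTower ℤ_[p] ℚ_[p] L] [IsScalarTower ℤ_[p] o L] [IsIntegralClosure o ℤ_[p] L]
    (ϖ : o) (hϖ : Irreducible ϖ)
    {Λ : Type*} [CommRing Λ] [IsLocalRing Λ] [IsArtinianRing Λ] [Algebra o Λ]
    (hΛ : Function.Surjective (algebraMap o Λ))
    (𝓕 : EquivariantCoeffSystem Λ (BTree.NT F) (BTree.tree π))
    (h1 : BTree.Hyp1 𝓕) (h2 : BTree.Hyp2 𝓕) (h3 : BTree.Hyp3 𝓕 e)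
    (n : ℕ)
    (hn : Module.rank (Λ ⧸ Ideal.span {algebraMap o Λ ϖ})
      (BTree.invTorsion 𝓕 e (algebraMap o Λ ϖ)) = n) :
    ∃ E : BTree.EtalePair π e p ϖ (BTree.DD' 𝓕 o L) (BTree.DD 𝓕 o L),
      E.IsNatural ∧
      letI := E.modD
      ∃ d : Fin n → BTree.DD 𝓕 o L,
        Submodule.span (IwasawaAlgebra o (BTree.Nhat01 π e)) (Set.range d) = ⊤ := by
  obtain ⟨_, _, _, _, hp0, hpu, hfin⟩ := discreteValuationRing_integers p L o
  have hp : ϖ ∣ (p : o) :=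
    Ideal.mem_span_singleton.mp (mem_span_uniformizer_of_not_isUnit hϖ hpu)
  have : Finite (o ⧸ Ideal.span {ϖ}) := Finite.of_surjective _ (Ideal.Quotient.factor_surjective
    (Ideal.span_singleton_le_span_singleton.mpr hp))
  have H : BTree.Admissible 𝓕 e := ⟨he, h1, h2, h3⟩
  have := BTree.finite_imSigma H hϖ hΛ hn
  -- Any `h` outside some open normal subgroup will do; it provides the denominator `[h] - 1`.
  obtain ⟨h, U, hU⟩ := BTree.exists_notMem_openNormal π e
  obtain ⟨κ, hκ⟩ := BTree.exists_bdMap_eq_smul (o := o) (L := L) H h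
  exact ⟨BTree.etalePair p L H hϖ hΛ hp hp0 hU hκ,
    BTree.isNatural_etalePair p L H hϖ hΛ hp hp0 hU hκ,
    BTree.exists_generators p L hp0 hpu H hϖ hΛ hn⟩
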